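/- Let $R$ be a commutative ring and let $\mathcal C$ be a dg-category over $R$ (cohomological grading) with a monoidal, not necessarily unital, structure: a dg-functor $\otimes$ in two variables (so $(f'\otimes g')(f\otimes g)=(-1)^{|g'||f|}f'f\otimes g'g$) and natural associativity isomorphisms $a_{X,Y,Z}\colon (X\otimes Y)\otimes Z\to X\otimes(Y\otimes Z)$, closed of degree $0$, such that the pentagon diagram commutes strictly. Write $X_0\otimes\cdots\otimes X_p$ for the tensor product bracketed to the left; morphisms between differently bracketed tensor products are composed by inserting the canonical isomorphisms made of associators. **Cochains.** For $p,q\ge 0$ let $C^{pq}$ be the complex of reduced cochains: the subcomplex of $$\prod_{(X_{ij})}\operatorname{Hom}_R\Bigl(\bigotimes_{0\le i\le p,\;0\le j<q}\operatorname{Hom}(X_{ij},X_{i,j+1}),\ \operatorname{Hom}\bigl(X_{00}\otimes\cdots\otimes X_{p0},\,X_{0q}\otimes\cdots\otimes X_{pq}\bigr)\Bigr)$$ of those $\phi$ which vanish on every rectangle $(f_{ij})$ containing a column of identities ($f_{ij}=\mathrm{Id}$ for some $j$ and all $i$). Let $TC^n=\bigoplus_{p+q+r=n}(C^{pq})^r$.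 **Admissible paths.** A path is a finite totally ordered subset of a poset. Let $I_q=\{0<\dots<q\}$, with the whole of $I_q$ as its only admissible path. Let $A_N$ be the poset of vertices of the $N$-dimensional associahedron: binary trees with $N+2$ leaves, ordered by $(xy)z<x(yz)$. An admissible path in a product $S\times T$ is a full lattice path (each step moves one coordinate to the next vertex, from the first to the last) over an admissible path in $S$ and one in $T$. The codimension one faces of $A_N$ are $F_{k,a}=A_k\times A_{N-1-k}$ with $0\le k\le N-1$ and $0\le a\le k+1$, where a tree of the second factor is grafted on the leaf number $a$ of a tree of the first one. The admissible path in $A_0$ is the point; for $N>0$ an admissible path in $A_N$ is an admissible path in a face $F_{k,a}$ not containing the terminal vertex (that is, $a\le k$), followed by the terminal vertex. Orientation signs $\operatorname{sgn}(P)=\pm1$: $+1$ for $I_q$ and $A_0$; in a product, the product of the two signs times $(-1)^{s}$, where $s$ is the number of pairs consisting of a step in the first factor and an earlier step in the second; and for a path in $A_N$ which extends the path $P'$ in $F_{k,a}$, the sign $(-1)^{N+(N-k)a+k+1}\operatorname{sgn}(P')$. **Differential.** Let $\delta$ be the internal differential of $C^{pq}$. Below, $\pm$ denotes the Koszul sign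 obtained by moving $\phi$ and the $f_{ij}$ from the order $\phi$; last column; …; first column (each column ordered by $i$) to the order in which they occur. Let $\phi\in C^{p'q'}$. * $d_0\phi\in C^{p',q'+1}$ is the Hochschild differential; with $q=q'+1$, $p=p'$, $$d_0\phi(f)=\pm\bigl(\textstyle\bigotimes_i f_{i,q-1}\bigr)\circ\phi(f_{ij},\,j\ne q-1)+\sum_{k=1}^{q-1}\pm(-1)^{k}\phi(\dots,f_{i,q-k}f_{i,q-k-1},\dots)+(-1)^{q}\phi(f_{ij},\,j\ne 0)\circ\bigl(\textstyle\bigotimes_i f_{i0}\bigr).$$ * $d_1\phi\in C^{p'+1,q'}$ is the Davydov–Yetter differential; with $p=p'+1$, $q=q'$, $$d_1\phi(f)=(-1)^{p'+q'}\Bigl[\pm(f_{0,q-1}\cdots f_{00})\otimes\phi(f_{ij},\,i\neq0)+\sum_{i=0}^{p-1}(-1)^{i+1}\phi(\dots,f_{ij}\otimes f_{i+1,j},\dots)\pm(-1)^{p+1}\phi(f_{ij},\,i\ne p)\otimes(f_{p,q-1}\cdots f_{p0})\Bigr].$$ * For $i\ge2$, $d_i\phi\in C^{p'+i,q'-i+1}$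 (zero if $q'-i+1<0$); with $p=p'+i$, $q=q'-i+1$, $$d_i\phi(f)=\sum_{j=0}^{p-i}(-1)^{i(j+p)+q+(i-1)(i-2)/2}\sum_{P}\operatorname{sgn}(P)\,\phi(P(f)),$$ where $P$ runs over the admissible paths in $A_{i-1}\times I_q$ and $P(f)$ is the following rectangle with $p'+1$ rows and $q'$ columns of morphisms, one column for each step of $P$. A step $(t,m)\to(t,m+1)$ gives the column $f_{0m},\dots,f_{j-1,m},\,t(f_{jm},\dots,f_{j+i,m}),\,f_{j+i+1,m},\dots,f_{pm}$; a step $(s,m)\to(t,m)$ gives the column which is the canonical isomorphism $s(X_{jm},\dots,X_{j+i,m})\to t(X_{jm},\dots,X_{j+i,m})$ in row $j$ and identities in the other rows. Here $t(\dots)$ is the tensor product bracketed by the tree $t$. Let $d=\delta+\sum_{i\ge0}d_i$, where, as usual in a total complex, $\delta$ is taken with the sign $(-1)^{p+q}$ on $C^{pq}$. **Claim.** $d$ maps $TC^n$ to $TC^{n+1}$ and $d^2=0$; that is, $(TC^\bullet,d)$ is a complex. -/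

import Mathlib

open CategoryTheory

universe w v u

namespace TensorHochschild

/-! ### Dg-categories and monoidal dg-categories

A dg-category over `R` is presented by its underlying `R`-linear category of all morphisms
(the direct sum of the homogeneous ones), together with the grading and the differential of the
complexes of morphisms.  In Lean `f ≫ g` is the composite `g ∘ f`. -/

/-- A dg-category over the commutative ring `R` (cohomological grading). -/
class DGCategory (R : Type w) [CommRing R] (C : Type u) [Category.{v} C] [Preadditive C]
    [Linear R C] where
  /-- `gr X Y n` is the degree `n` part of the complex of morphisms from `X` to `Y`. -/
  gr (X Y : C) : ℤ → Submodule R (X ⟶ Y)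
  gr_isInternal (X Y : C) : DirectSum.IsInternal (gr X Y)
  /-- The differential of the complex of morphisms. -/
  d (X Y : C) : (X ⟶ Y) →ₗ[R] (X ⟶ Y)
  d_mem {X Y : C} {n : ℤ} {f : X ⟶ Y} (hf : f ∈ gr X Y n) : d X Y f ∈ gr X Y (n + 1)
  d_d {X Y : C} (f : X ⟶ Y) : d X Y (d X Y f) = 0
  id_mem (X : C) : 𝟙 X ∈ gr X X 0
  comp_mem {X Y Z : C} {m n : ℤ} {f : X ⟶ Y} {g : Y ⟶ Z} (hf : f ∈ gr X Y m)
    (hg : g ∈ gr Y Z n) : f ≫ g ∈ gr X Z (m + n)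
  /-- `d (g ∘ f) = d g ∘ f + (-1)^|g| g ∘ d f` -/
  d_comp {X Y Z : C} {n : ℤ} (f : X ⟶ Y) {g : Y ⟶ Z} (hg : g ∈ gr Y Z n) :
    d X Z (f ≫ g) = f ≫ d Y Z g + n.negOnePow • (d X Y f ≫ g)

/-- A monoidal structure (not necessarily unital) on a dg-category: a dg-functor `⊗` in two
variables, with natural associativity isomorphisms which are closed of degree `0` and satisfy the
pentagon identity strictly. -/
class MonoidalDGCategory (R : Type w) [CommRing R] (C : Type u) [Category.{v} C] [Preadditive C]
    [Linear R C] [DGCategory R C] where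
  tensorObj : C → C → C
  tensorHom {X X' Y Y' : C} :
    (X ⟶ X') →ₗ[R] (Y ⟶ Y') →ₗ[R] (tensorObj X Y ⟶ tensorObj X' Y')
  tensorHom_mem {X X' Y Y' : C} {m n : ℤ} {f : X ⟶ X'} {g : Y ⟶ Y'}
    (hf : f ∈ DGCategory.gr (R := R) X X' m) (hg : g ∈ DGCategory.gr (R := R) Y Y' n) :
    tensorHom f g ∈ DGCategory.gr (R := R) (tensorObj X Y) (tensorObj X' Y') (m + n)
  /-- `d (f ⊗ g) = d f ⊗ g + (-1)^|f| f ⊗ d g` -/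
  d_tensorHom {X X' Y Y' : C} {m : ℤ} {f : X ⟶ X'} (g : Y ⟶ Y')
    (hf : f ∈ DGCategory.gr (R := R) X X' m) :
    DGCategory.d (R := R) _ _ (tensorHom f g) =
      tensorHom (DGCategory.d (R := R) _ _ f) g +
        m.negOnePow • tensorHom f (DGCategory.d (R := R) _ _ g)
  tensorHom_id (X Y : C) : tensorHom (𝟙 X) (𝟙 Y) = 𝟙 (tensorObj X Y)
  /-- `(f' ⊗ g') ∘ (f ⊗ g) = (-1)^(|g'||f|) (f' ∘ f) ⊗ (g' ∘ g)` -/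
  tensorHom_comp {X X' X'' Y Y' Y'' : C} {m n : ℤ} {f : X ⟶ X'} (f' : X' ⟶ X'')
    (g : Y ⟶ Y') {g' : Y' ⟶ Y''} (hf : f ∈ DGCategory.gr (R := R) X X' m)
    (hg' : g' ∈ DGCategory.gr (R := R) Y' Y'' n) :
    tensorHom f g ≫ tensorHom f' g' = (n * m).negOnePow • tensorHom (f ≫ f') (g ≫ g')
  assoc (X Y Z : C) :
    tensorObj (tensorObj X Y) Z ≅ tensorObj X (tensorObj Y Z)
  assoc_hom_mem (X Y Z : C) : (assoc X Y Z).hom ∈ DGCategory.gr (R := R) _ _ 0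
  assoc_inv_mem (X Y Z : C) : (assoc X Y Z).inv ∈ DGCategory.gr (R := R) _ _ 0
  d_assoc_hom (X Y Z : C) : DGCategory.d (R := R) _ _ (assoc X Y Z).hom = 0
  assoc_naturality {X X' Y Y' Z Z' : C} (f : X ⟶ X') (g : Y ⟶ Y') (h : Z ⟶ Z') :
    tensorHom (tensorHom f g) h ≫ (assoc X' Y' Z').hom =
      (assoc X Y Z).hom ≫ tensorHom f (tensorHom g h)
  pentagon (X Y Z W : C) :
    tensorHom (assoc X Y Z).hom (𝟙 W) ≫ (assoc X (tensorObj Y Z) W).hom ≫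
        tensorHom (𝟙 X) (assoc Y Z W).hom =
      (assoc (tensorObj X Y) Z W).hom ≫ (assoc X Y (tensorObj Z W)).hom

/-! ### Binary trees -/

/-- Binary trees with leaves labelled by `ι`, i.e. bracketings of nonempty words in `ι`. -/
inductive BTree (ι : Type) : Type
  | leaf (i : ι) : BTree ι
  | node (l r : BTree ι) : BTree ι

namespace BTree

variable {ι κ : Type}

/-- Replace every leaf by a tree. -/
def bind (f : ι → BTree κ) : BTree ι → BTree κ
  | leaf i => f i
  | node l r => node (l.bind f) (r.bind f)

/-- Relabel the leaves. -/
def map (f : ι → κ) (t : BTree ι) : BTree κ := t.bind fun i => leaf (f i)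

/-- The list of leaves of `t`, followed by the list `rest`. -/
def leavesAppend : BTree ι → List ι → List ι
  | leaf i, rest => i :: rest
  | node l r, rest => l.leavesAppend (r.leavesAppend rest)

/-- The first leaf of `t`. -/
def head : BTree ι → ι
  | leaf i => i
  | node l _ => l.head

/-- The list of all leaves of `t` but the first, followed by the list `rest`. -/
def tail : BTree ι → List ι → List ι
  | leaf _, rest => rest
  | node l r, rest => l.tail (r.leavesAppend rest)

/-- The right comb `s (s+1 (s+2 (… (s+k))))`. -/
def rightComb : ℕ → ℕ → BTree ℕ
  | s, 0 => leaf s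
  | s, k + 1 => node (leaf s) (rightComb (s + 1) k)

/-- Graft the tree `u` with `m + 1` leaves `0, …, m` on the leaf `a` of the tree `t`, renumbering
the leaves from left to right. -/
def graft (t : BTree ℕ) (a m : ℕ) (u : BTree ℕ) : BTree ℕ :=
  t.bind fun b => if b < a then leaf b else if b = a then u.map (· + a) else leaf (b + m)

end BTree

/-! ### Admissible paths

A path in a poset is recorded as the list of its vertices in *descending* order (the largest
vertex comes first). -/

/-- The admissible paths in the product of two aposets which run along the admissible path `P` in
the first and along the admissible path `Q` in the second factor, each with its orientation sign:
the sign is `(-1)` to the number of pairs consisting of a step in the first factor and an earlier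
step in the second factor. -/
def shufflePaths {α β : Type} : List α → List β → List (ℤˣ × List (α × β))
  | [], _ => []
  | _ :: _, [] => []
  | [a], [b] => [(1, [(a, b)])]
  | a :: a' :: as, [b] => (shufflePaths (a' :: as) [b]).map fun x => (x.1, (a, b) :: x.2)
  | [a], b :: b' :: bs => (shufflePaths [a] (b' :: bs)).map fun x => (x.1, (a, b) :: x.2)
  | a :: a' :: as, b :: b' :: bs =>
      ((shufflePaths (a' :: as) (b :: b' :: bs)).map fun x =>
        ((-1) ^ (bs.length + 1) * x.1, (a, b) :: x.2)) ++
      ((shufflePaths (a :: a' :: as) (b' :: bs)).map fun x => (x.1, (a, b) :: x.2))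
  termination_by P Q => P.length + Q.length

/-- The admissible paths in the associahedron `A_N`, with their orientation signs.  The vertices of
`A_N` are the binary trees with `N + 2` leaves, labelled `0, …, N + 1` from left to right; the
order is generated by `(x y) z < x (y z)`, and the terminal vertex is the right comb.

For `N > 0` an admissible path is an admissible path in a codimension one face not containing the
terminal vertex, followed by the terminal vertex.  The codimension one faces are the products
`A_k × A_l` with `k + l = N - 1`: for `0 ≤ a ≤ k + 1` one grafts a tree of `A_l` on the leaf `a` of
a tree of `A_k`.  The face contains the terminal vertex if and only if `a = k + 1`. -/
def admissiblePaths : ℕ → List (ℤˣ × List (BTree ℕ))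
  | 0 => [(1, [BTree.node (.leaf 0) (.leaf 1)])]
  | N + 1 =>
    (List.finRange (N + 1)).flatMap fun k =>
      (List.range (k.1 + 1)).flatMap fun a =>
        (admissiblePaths k.1).flatMap fun P =>
          (admissiblePaths (N - k.1)).flatMap fun Q =>
            (shufflePaths P.2 Q.2).map fun S =>
              ((-1) ^ ((N + 1) + (N + 1 - k.1) * a + (k.1 + 1)) * P.1 * Q.1 * S.1,
                BTree.rightComb 0 (N + 2) ::
                  S.2.map fun v => v.1.graft a (N + 1 - k.1) v.2)
  termination_by N => N
  decreasing_by all_goals omega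

/-- The sum of the values of `ψ` over a list of signed elements. -/
def signedSum {A M : Type*} [AddCommGroup M] (l : List (ℤˣ × A)) (ψ : A → M) : M :=
  (l.map fun x => x.1 • ψ x.2).sum

/-! ### Homogeneous morphisms -/

section Homogeneous

variable (R : Type w) [CommRing R] {C : Type u} [Category.{v} C] [Preadditive C] [Linear R C]
  [DGCategory R C]

/-- A homogeneous morphism, together with its degree. -/
structure HomogHom (X Y : C) where
  deg : ℤ
  hom : X ⟶ Y
  mem : hom ∈ DGCategory.gr (R := R) X Y deg

/-- An isomorphism of degree `0`. -/
structure DegZeroIso (X Y : C) extends X ≅ Y where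
  hom_mem : hom ∈ DGCategory.gr (R := R) X Y 0
  inv_mem : inv ∈ DGCategory.gr (R := R) Y X 0

variable {R}

namespace HomogHom

variable (R) in
/-- The identity, in degree `0`. -/
def id (X : C) : HomogHom R X X := ⟨0, 𝟙 X, DGCategory.id_mem X⟩

/-- First `f`, then `g`. -/
def comp {X Y Z : C} (f : HomogHom R X Y) (g : HomogHom R Y Z) : HomogHom R X Z :=
  ⟨f.deg + g.deg, f.hom ≫ g.hom, DGCategory.comp_mem f.mem g.mem⟩

/-- The differential of a homogeneous morphism. -/
def d {X Y : C} (f : HomogHom R X Y) : HomogHom R X Y :=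
  ⟨f.deg + 1, DGCategory.d (R := R) X Y f.hom, DGCategory.d_mem f.mem⟩

/-- The tensor product of homogeneous morphisms. -/
def tensor [MonoidalDGCategory R C] {X X' Y Y' : C} (f : HomogHom R X X') (g : HomogHom R Y Y') :
    HomogHom R (MonoidalDGCategory.tensorObj R X Y) (MonoidalDGCategory.tensorObj R X' Y') :=
  ⟨f.deg + g.deg, MonoidalDGCategory.tensorHom (R := R) f.hom g.hom,
    MonoidalDGCategory.tensorHom_mem f.mem g.mem⟩

end HomogHom

namespace DegZeroIso

variable (R) in
/-- The identity. -/
def refl (X : C) : DegZeroIso R X X where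
  toIso := Iso.refl X
  hom_mem := DGCategory.id_mem X
  inv_mem := DGCategory.id_mem X

variable (R) in
/-- The identity, for equal objects. -/
def ofEq {X Y : C} (h : X = Y) : DegZeroIso R X Y where
  toIso := eqToIso h
  hom_mem := by subst h; exact DGCategory.id_mem X
  inv_mem := by subst h; exact DGCategory.id_mem X

def symm {X Y : C} (e : DegZeroIso R X Y) : DegZeroIso R Y X where
  toIso := e.toIso.symm
  hom_mem := e.inv_mem
  inv_mem := e.hom_mem

def trans {X Y Z : C} (e : DegZeroIso R X Y) (e' : DegZeroIso R Y Z) : DegZeroIso R X Z where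
  toIso := e.toIso ≪≫ e'.toIso
  hom_mem := by simpa using DGCategory.comp_mem e.hom_mem e'.hom_mem
  inv_mem := by simpa using DGCategory.comp_mem e'.inv_mem e.inv_mem

variable [MonoidalDGCategory R C]

variable (R) in
/-- The associator. -/
def assoc (X Y Z : C) :
    DegZeroIso R (MonoidalDGCategory.tensorObj R (MonoidalDGCategory.tensorObj R X Y) Z)
      (MonoidalDGCategory.tensorObj R X (MonoidalDGCategory.tensorObj R Y Z)) where
  toIso := MonoidalDGCategory.assoc X Y Z
  hom_mem := MonoidalDGCategory.assoc_hom_mem X Y Z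
  inv_mem := MonoidalDGCategory.assoc_inv_mem X Y Z

/-- The isomorphism `e ⊗ 1`. -/
def whiskerRight {X Y : C} (e : DegZeroIso R X Y) (Z : C) :
    DegZeroIso R (MonoidalDGCategory.tensorObj R X Z) (MonoidalDGCategory.tensorObj R Y Z) where
  hom := MonoidalDGCategory.tensorHom (R := R) e.hom (𝟙 Z)
  inv := MonoidalDGCategory.tensorHom (R := R) e.inv (𝟙 Z)
  hom_inv_id := by
    rw [MonoidalDGCategory.tensorHom_comp _ _ e.hom_mem (DGCategory.id_mem Z)]
    simp [MonoidalDGCategory.tensorHom_id]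
  inv_hom_id := by
    rw [MonoidalDGCategory.tensorHom_comp _ _ e.inv_mem (DGCategory.id_mem Z)]
    simp [MonoidalDGCategory.tensorHom_id]
  hom_mem := by
    simpa using MonoidalDGCategory.tensorHom_mem e.hom_mem (DGCategory.id_mem Z)
  inv_mem := by
    simpa using MonoidalDGCategory.tensorHom_mem e.inv_mem (DGCategory.id_mem Z)

end DegZeroIso

end Homogeneous

/-! ### Iterated tensor products and canonical isomorphisms between bracketings -/

section Tensor

variable (R : Type w) [CommRing R] {C : Type u} [Category.{v} C] [Preadditive C] [Linear R C]
  [DGCategory R C] [MonoidalDGCategory R C]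

/-- The tensor product `t(X)` of the objects `X i`, bracketed by the tree `t`. -/
def treeObj {ι : Type} (X : ι → C) : BTree ι → C
  | .leaf i => X i
  | .node l r => MonoidalDGCategory.tensorObj R (treeObj X l) (treeObj X r)

variable {R} in
/-- The tensor product `t(f)` of the morphisms `f i`, bracketed by the tree `t`. -/
def treeHom {ι : Type} {X Y : ι → C} (f : ∀ i, HomogHom R (X i) (Y i)) :
    (t : BTree ι) → HomogHom R (treeObj R X t) (treeObj R Y t)
  | .leaf i => f i
  | .node l r => (treeHom f l).tensor (treeHom f r)

/-- The tensor product `((X 0 ⊗ X 1) ⊗ X 2) ⊗ … ⊗ X p`, bracketed to the left. -/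
def rowTensor : (p : ℕ) → (Fin (p + 1) → C) → C
  | 0, X => X 0
  | p + 1, X =>
      MonoidalDGCategory.tensorObj R (rowTensor p fun i => X i.castSucc) (X (Fin.last (p + 1)))

variable {R} in
/-- The tensor product `((f 0 ⊗ f 1) ⊗ f 2) ⊗ … ⊗ f p`. -/
def rowTensorHom : (p : ℕ) → {X Y : Fin (p + 1) → C} → (∀ i, HomogHom R (X i) (Y i)) →
    HomogHom R (rowTensor R p X) (rowTensor R p Y)
  | 0, _, _, f => f 0
  | p + 1, _, _, f => (rowTensorHom p fun i => f i.castSucc).tensor (f (Fin.last (p + 1)))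

/-- The associativity isomorphism `(X 0 ⊗ … ⊗ X p) ⊗ X (p+1) ≅ X 0 ⊗ (X 1 ⊗ … ⊗ X (p+1))`. -/
def splitFirst : (p : ℕ) → (X : Fin (p + 2) → C) →
    DegZeroIso R (rowTensor R (p + 1) X)
      (MonoidalDGCategory.tensorObj R (X 0) (rowTensor R p fun i => X i.succ))
  | 0, _ => .refl R _
  | p + 1, X =>
      ((splitFirst p fun i => X i.castSucc).whiskerRight (X (Fin.last (p + 2)))).trans
        (.assoc R (X 0) (rowTensor R p fun i => X i.castSucc.succ) (X (Fin.last (p + 2))))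

variable {ι : Type}

/-- `((A ⊗ X i₁) ⊗ X i₂) ⊗ …`, bracketed to the left. -/
def stack (X : ι → C) : C → List ι → C
  | A, [] => A
  | A, i :: l => stack X (MonoidalDGCategory.tensorObj R A (X i)) l

variable {R} in
/-- `((e ⊗ 1) ⊗ 1) ⊗ …` -/
def stackIso (X : ι → C) : {A B : C} → DegZeroIso R A B → (l : List ι) →
    DegZeroIso R (stack R X A l) (stack R X B l)
  | _, _, e, [] => e
  | _, _, e, i :: l => stackIso X (e.whiskerRight (X i)) l

/-- Rebracketing `A ⊗ t(X)` to the left, by inverse associators. -/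
def absorb (X : ι → C) : (t : BTree ι) → (A : C) → (rest : List ι) →
    DegZeroIso R (stack R X (MonoidalDGCategory.tensorObj R A (treeObj R X t)) rest)
      (stack R X A (t.leavesAppend rest))
  | .leaf _, _, _ => .refl R _
  | .node l r, A, rest =>
      (stackIso X (DegZeroIso.assoc R A (treeObj R X l) (treeObj R X r)).symm rest).trans
        ((absorb X r (MonoidalDGCategory.tensorObj R A (treeObj R X l)) rest).trans
          (absorb X l A (r.leavesAppend rest)))

/-- Rebracketing `t(X)` to the left, by inverse associators. -/
def rebracketTree (X : ι → C) : (t : BTree ι) → (rest : List ι) →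
    DegZeroIso R (stack R X (treeObj R X t) rest) (stack R X (X t.head) (t.tail rest))
  | .leaf _, _ => .refl R _
  | .node l r, rest =>
      (absorb R X r (treeObj R X l) rest).trans (rebracketTree X l (r.leavesAppend rest))

/-- The first leaf of a forest. -/
def forestHead : (p : ℕ) → (Fin (p + 1) → BTree ι) → ι
  | 0, F => (F 0).head
  | p + 1, F => forestHead p fun k => F k.castSucc

/-- The leaves of a forest but the first, followed by `rest`. -/
def forestTail : (p : ℕ) → (Fin (p + 1) → BTree ι) → List ι → List ι
  | 0, F, rest => (F 0).tail rest
  | p + 1, F, rest =>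
      forestTail p (fun k => F k.castSucc) ((F (Fin.last (p + 1))).leavesAppend rest)

/-- The word (nonempty list, as head and tail) of leaves of a forest, from left to right. -/
def forestWord {p : ℕ} (F : Fin (p + 1) → BTree ι) : ι × List ι :=
  (forestHead p F, forestTail p F [])

/-- Rebracketing the tensor product of the `(F k)(X)` to the left, by inverse associators. -/
def rebracketForest (X : ι → C) : (p : ℕ) → (F : Fin (p + 1) → BTree ι) → (rest : List ι) →
    DegZeroIso R (stack R X (rowTensor R p fun k => treeObj R X (F k)) rest)
      (stack R X (X (forestHead p F)) (forestTail p F rest))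
  | 0, F, rest => rebracketTree R X (F 0) rest
  | p + 1, F, rest =>
      (absorb R X (F (Fin.last (p + 1))) (rowTensor R p fun k => treeObj R X (F k.castSucc))
        rest).trans
        (rebracketForest X p (fun k => F k.castSucc)
          ((F (Fin.last (p + 1))).leavesAppend rest))

/-- The canonical isomorphism, composed of associators and their inverses, between the tensor
products of the `(F k)(X)` and of the `(G k)(X)`, for forests with the same word of leaves: both
sides are rebracketed to the left.  (By the pentagon identity every composite of associators and
their inverses with this source and target is equal to it.) -/
def canonicalIso (X : ι → C) {p p' : ℕ} (F : Fin (p + 1) → BTree ι) (G : Fin (p' + 1) → BTree ι)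
    (h : forestWord F = forestWord G) :
    DegZeroIso R (rowTensor R p fun k => treeObj R X (F k))
      (rowTensor R p' fun k => treeObj R X (G k)) :=
  (rebracketForest R X p F []).trans
    ((DegZeroIso.ofEq R (congrArg (fun x : ι × List ι => stack R X (X x.1) x.2) h)).trans
      (rebracketForest R X p' G []).symm)

open Classical in
/-- The canonical isomorphism as a homogeneous morphism of degree `0`.  (The words of leaves are
the same wherever it is used below; the value `0` is never taken.) -/
noncomputable def canonicalHom (X : ι → C) {p p' : ℕ} (F : Fin (p + 1) → BTree ι)
    (G : Fin (p' + 1) → BTree ι) :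
    HomogHom R (rowTensor R p fun k => treeObj R X (F k))
      (rowTensor R p' fun k => treeObj R X (G k)) :=
  if h : forestWord F = forestWord G then
    ⟨0, (canonicalIso R X F G h).hom, (canonicalIso R X F G h).hom_mem⟩
  else ⟨0, 0, Submodule.zero_mem _⟩

end Tensor

/-! ### Rectangles of composable morphisms -/

section Rectangles

/-- A column of `p + 1` objects. -/
def Row (_R : Type w) (C : Type u) (p : ℕ) : Type u := Fin (p + 1) → C

variable {R : Type w} [CommRing R] {C : Type u} [Category.{v} C] [Preadditive C] [Linear R C]
  [DGCategory R C]

/-- An arrow from the column `X` to the column `Y` is a column of homogeneous morphisms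
`f i : X i ⟶ Y i`.  Thus a path of length `q` in this quiver is a rectangle of homogeneous
morphisms `f i j : X i j ⟶ X i (j+1)`, `0 ≤ i ≤ p`, `0 ≤ j < q`. -/
instance Row.instQuiver (p : ℕ) : Quiver.{v} (Row R C p) where
  Hom X Y := ∀ i : Fin (p + 1), HomogHom R (X i) (Y i)

variable {p : ℕ}

/-- The column of identities. -/
def idColumn (X : Row R C p) : X ⟶ X := fun i => HomogHom.id R (X i)

/-- The total degree of a column. -/
def columnDeg {X Y : Row R C p} (f : X ⟶ Y) : ℤ := ∑ i, (f i).deg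

/-- The total degree of a rectangle. -/
def totalDeg {X : Row R C p} : {Y : Row R C p} → Quiver.Path X Y → ℤ
  | _, .nil => 0
  | _, .cons γ f => totalDeg γ + columnDeg f

/-- The composite `f i (q-1) ∘ … ∘ f i 0` of the row `i`. -/
def rowComp (i : Fin (p + 1)) {X : Row R C p} :
    {Y : Row R C p} → Quiver.Path X Y → HomogHom R (X i) (Y i)
  | _, .nil => HomogHom.id R (X i)
  | _, .cons γ f => (rowComp i γ).comp (f i)

/-- Split off the first column of morphisms of a rectangle. -/
def uncons {X : Row R C p} : {Y : Row R C p} → Quiver.Path X Y →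
    Option (Σ Z : Row R C p, (X ⟶ Z) × Quiver.Path Z Y)
  | _, .nil => none
  | _, .cons .nil f => some ⟨_, f, .nil⟩
  | _, .cons (.cons γ e) f => (uncons (.cons γ e)).map fun x => ⟨x.1, x.2.1, x.2.2.cons f⟩

/-- The Koszul sign relating `f₀ … f_p e₀ … e_p` and `f₀ e₀ f₁ e₁ … f_p e_p`. -/
def mergeSign {X Y Z : Row R C p} (e : X ⟶ Y) (f : Y ⟶ Z) : ℤˣ :=
  (∑ i, ∑ k, if k < i then (f i).deg * (e k).deg else 0).negOnePow

/-- The rectangles obtained by composing two consecutive columns of morphisms.  The one where the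
`k`-th and the `(k+1)`-st column, counted from the last one, are composed, `k ≥ 1`, appears with
the sign `(-1)^k` times the Koszul sign. -/
def merges {X : Row R C p} : {Y : Row R C p} → Quiver.Path X Y → List (ℤˣ × Quiver.Path X Y)
  | _, .nil => []
  | _, .cons .nil _ => []
  | _, .cons (.cons γ e) f =>
      (-mergeSign e f, γ.cons fun i => (e i).comp (f i)) ::
        (merges (.cons γ e)).map fun x => (-x.1, x.2.cons f)

/-- The rectangles obtained by applying the differential to one of the morphisms, with the Koszul
sign for moving the differential past the preceding morphisms, where the morphisms are ordered from
the last to the first column and downwards in each column. -/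
def diffs {X : Row R C p} : {Y : Row R C p} → Quiver.Path X Y → List (ℤˣ × Quiver.Path X Y)
  | _, .nil => []
  | _, .cons γ f =>
      ((List.finRange (p + 1)).map fun i =>
        ((∑ k, if k < i then (f k).deg else 0).negOnePow,
          γ.cons (Function.update f i (f i).d))) ++
      (diffs γ).map fun x => ((columnDeg f).negOnePow * x.1, x.2.cons f)

/-- A column of objects without the object in the row `0`. -/
def Row.dropFirst (X : Row R C (p + 1)) : Row R C p := fun i => X i.succ

/-- A column of objects without the object in the last row. -/
def Row.dropLast (X : Row R C (p + 1)) : Row R C p := fun i => X i.castSucc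

/-- Remove the row `0`. -/
def dropFirstRow {X : Row R C (p + 1)} : {Y : Row R C (p + 1)} → Quiver.Path X Y →
    Quiver.Path X.dropFirst Y.dropFirst
  | _, .nil => .nil
  | _, .cons γ f => (dropFirstRow γ).cons fun i => f i.succ

/-- Remove the last row. -/
def dropLastRow {X : Row R C (p + 1)} : {Y : Row R C (p + 1)} → Quiver.Path X Y →
    Quiver.Path X.dropLast Y.dropLast
  | _, .nil => .nil
  | _, .cons γ f => (dropLastRow γ).cons fun i => f i.castSucc

/-- The exponent of the Koszul sign for moving the row `0` to the front. -/
def firstRowExponent {X : Row R C (p + 1)} : {Y : Row R C (p + 1)} → Quiver.Path X Y → ℤ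
  | _, .nil => 0
  | _, .cons γ f => firstRowExponent γ + (rowComp 0 γ).deg * ∑ i : Fin (p + 1), (f i.succ).deg

/-- The exponent of the Koszul sign for moving the last row to the end. -/
def lastRowExponent {X : Row R C (p + 1)} : {Y : Row R C (p + 1)} → Quiver.Path X Y → ℤ
  | _, .nil => 0
  | _, .cons γ f =>
      lastRowExponent γ +
        (f (Fin.last (p + 1))).deg * ∑ i : Fin (p + 1), (rowComp i.castSucc γ).deg

variable [MonoidalDGCategory R C]

/-- The tensor product `((X 0 ⊗ X 1) ⊗ X 2) ⊗ … ⊗ X p` of a column of objects. -/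
def Row.tensor (X : Row R C p) : C := rowTensor R p X

/-- The tensor product `((f 0 ⊗ f 1) ⊗ f 2) ⊗ … ⊗ f p` of a column of morphisms. -/
def columnTensor {X Y : Row R C p} (f : X ⟶ Y) : X.tensor ⟶ Y.tensor := (rowTensorHom p f).hom

/-- A forest: trees `F 0, …, F p'` whose leaves are labelled by the rows `0, …, p`. -/
abbrev Forest (p p' : ℕ) : Type := Fin (p' + 1) → BTree (Fin (p + 1))

/-- The column of objects `(F k)(X)`. -/
def forestObj {p' : ℕ} (F : Forest p p') (X : Row R C p) : Row R C p' :=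
  fun k => treeObj R X (F k)

/-- The column of morphisms `(F k)(f)`. -/
def forestHom {p' : ℕ} (F : Forest p p') {X Y : Row R C p} (f : X ⟶ Y) :
    forestObj F X ⟶ forestObj F Y :=
  fun k => treeHom f (F k)

/-- The column of canonical isomorphisms `(F k)(X) ⟶ (G k)(X)`. -/
noncomputable def forestArrow {p' : ℕ} (F G : Forest p p') (X : Row R C p) :
    forestObj F X ⟶ forestObj G X :=
  fun k => canonicalHom R X (p := 0) (p' := 0) (fun _ => F k) (fun _ => G k)

/-- Apply a forest to every column of a rectangle. -/
def forestPath {p' : ℕ} (F : Forest p p') {X : Row R C p} :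
    {Y : Row R C p} → Quiver.Path X Y → Quiver.Path (forestObj F X) (forestObj F Y)
  | _, .nil => .nil
  | _, .cons γ f => (forestPath F γ).cons (forestHom F f)

/-- The last element of the nonempty list `F :: Q`. -/
def bottom {α : Type*} : α → List α → α
  | F, [] => F
  | _, F' :: Q => bottom F' Q

/-- The inductive step of `latticePaths`, by recursion on the rectangle.  A path ending in the
vertex `(F, q)` ends with the horizontal step from `(F', q)` or with a vertical step from
`(F, q - 1)`. -/
noncomputable def latticeStep {p' : ℕ} {X : Row R C p} (F F' B : Forest p p')
    (ih : {Y : Row R C p} → Quiver.Path X Y →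
      List (ℤˣ × Quiver.Path (forestObj B X) (forestObj F' Y))) :
    {Y : Row R C p} → Quiver.Path X Y →
      List (ℤˣ × Quiver.Path (forestObj B X) (forestObj F Y))
  | _, .nil => (ih .nil).map fun x => (x.1, x.2.cons (forestArrow F' F X))
  | Y, .cons γ f =>
      ((ih (.cons γ f)).map fun x =>
        ((-1) ^ (γ.length + 1) * x.1, x.2.cons (forestArrow F' F Y))) ++
      (latticeStep F F' B ih γ).map fun x => (x.1, x.2.cons (forestHom F f))

/-- Let `F :: Q` be a path of forests in descending order, and let `γ` be a rectangle with `q`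
columns of morphisms.  This is the list of the rectangles `P(f)` for the admissible paths `P` in
the product with `I_q` which run along the path `F :: Q` in the first factor, with the orientation
signs of the product (as in `shufflePaths`): a horizontal step of `P` gives a column of canonical
isomorphisms and a vertical step gives a column of tensor products of the given morphisms. -/
noncomputable def latticePaths {p' : ℕ} {X : Row R C p} : (F : Forest p p') →
    (Q : List (Forest p p')) → {Y : Row R C p} → Quiver.Path X Y →
      List (ℤˣ × Quiver.Path (forestObj (bottom F Q) X) (forestObj F Y))
  | F, [], _, γ => [(1, forestPath F γ)]
  | F, F' :: Q, _, γ => latticeStep F F' (bottom F' Q) (latticePaths F' Q) γ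

/-- The forest with the trees `0, …, j - 1, t, j + i + 1, …, p`, for a tree `t` with leaves
`0, …, i` which is placed on the rows `j, …, j + i`. -/
def blockForest (p i j : ℕ) (t : BTree ℕ) : Forest p (p - i) := fun k =>
  if k.1 < j then .leaf (Fin.ofNat (p + 1) k.1)
  else if k.1 = j then t.map fun a => Fin.ofNat (p + 1) (j + a)
  else .leaf (Fin.ofNat (p + 1) (k.1 + i))

end Rectangles

/-! ### The complex -/

section Complex

variable (R : Type w) [CommRing R] (C : Type u) [Category.{v} C] [Preadditive C] [Linear R C]
  [DGCategory R C] [MonoidalDGCategory R C]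

/-- Functions which send rectangles of size `(p, q)` to morphisms from the tensor product of the
first column to the tensor product of the last column of objects. -/
abbrev RawCochain (p q : ℕ) : Type _ :=
  ∀ (X Y : Row R C p), {γ : Quiver.Path X Y // γ.length = q} → (X.tensor ⟶ Y.tensor)

/-- The reduced `⊗`-Hochschild cochains `(C^{pq})^r` of internal degree `r`: functions which are
multilinear, are homogeneous of degree `r`, and vanish on rectangles containing a column of
identities. -/
def cochains (p q : ℕ) (r : ℤ) : Submodule R (RawCochain R C p q) where
  carrier := {φ |
    (∀ (X X' Y' Y : Row R C p) (α : Quiver.Path X X') (f : X' ⟶ Y') (β : Quiver.Path Y' Y)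
      (i : Fin (p + 1)) (m : ℤ)
      (h : ∀ x : HomogHom R (X' i) (Y' i),
        ((α.cons (Function.update f i x)).comp β).length = q),
      IsLinearMap R fun x : DGCategory.gr (R := R) (X' i) (Y' i) m =>
        φ X Y ⟨(α.cons (Function.update f i ⟨m, x.1, x.2⟩)).comp β, h _⟩) ∧
    (∀ (X Y : Row R C p) (γ : {γ : Quiver.Path X Y // γ.length = q}),
      φ X Y γ ∈ DGCategory.gr (R := R) _ _ (totalDeg γ.1 + r)) ∧
    (∀ (X Z Y : Row R C p) (α : Quiver.Path X Z) (β : Quiver.Path Z Y)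
      (h : ((α.cons (idColumn Z)).comp β).length = q),
      φ X Y ⟨(α.cons (idColumn Z)).comp β, h⟩ = 0)}
  zero_mem' := by
    refine ⟨fun _ _ _ _ _ _ _ _ _ _ => ⟨?_, ?_⟩, fun _ _ _ => Submodule.zero_mem _,
      fun _ _ _ _ _ _ => rfl⟩ <;> intros <;> simp
  add_mem' := by
    rintro φ ψ ⟨h1, h2, h3⟩ ⟨k1, k2, k3⟩
    refine ⟨fun X X' Y' Y α f β i m h => ⟨fun x y => ?_, fun c x => ?_⟩,
      fun X Y γ => Submodule.add_mem _ (h2 X Y γ) (k2 X Y γ), fun X Z Y α β h => ?_⟩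
    · have a := (h1 X X' Y' Y α f β i m h).map_add x y
      have b := (k1 X X' Y' Y α f β i m h).map_add x y
      simp only [Pi.add_apply, a, b]
      abel
    · have a := (h1 X X' Y' Y α f β i m h).map_smul c x
      have b := (k1 X X' Y' Y α f β i m h).map_smul c x
      simp only [Pi.add_apply, a, b, smul_add]
    · simp only [Pi.add_apply, h3 X Z Y α β h, k3 X Z Y α β h, add_zero]
  smul_mem' := by
    rintro s φ ⟨h1, h2, h3⟩
    refine ⟨fun X X' Y' Y α f β i m h => ⟨fun x y => ?_, fun c x => ?_⟩,
      fun X Y γ => Submodule.smul_mem _ s (h2 X Y γ), fun X Z Y α β h => ?_⟩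
    · have a := (h1 X X' Y' Y α f β i m h).map_add x y
      simp only [Pi.smul_apply, a, smul_add]
    · have a := (h1 X X' Y' Y α f β i m h).map_smul c x
      simp only [Pi.smul_apply, a, smul_comm s c]
    · simp only [Pi.smul_apply, h3 X Z Y α β h, smul_zero]

/-- Families of functions as in `RawCochain`, for all `p, q ≥ 0`. -/
abbrev TotalCochain : Type _ :=
  ∀ (p : ℕ) (X Y : Row R C p), Quiver.Path X Y → (X.tensor ⟶ Y.tensor)

/-- The component of bidegree `(p, q)`. -/
def component (p q : ℕ) : TotalCochain R C →ₗ[R] RawCochain R C p q where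
  toFun Φ X Y γ := Φ p X Y γ.1
  map_add' _ _ := rfl
  map_smul' _ _ := rfl

/-- The degree `n` part `TC^n = ⨁_{p + q + r = n} (C^{pq})^r` of the total space: the families with
component of bidegree `(p, q)` in `(C^{pq})^{n - p - q}`, only finitely many of them nonzero. -/
def TC (n : ℤ) : Submodule R (TotalCochain R C) where
  carrier := {Φ | (∀ p q : ℕ, component R C p q Φ ∈ cochains R C p q (n - p - q)) ∧
    {x : ℕ × ℕ | component R C x.1 x.2 Φ ≠ 0}.Finite}
  zero_mem' := ⟨fun p q => by simp, by simp⟩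
  add_mem' := by
    rintro Φ Ψ ⟨h1, h2⟩ ⟨k1, k2⟩
    refine ⟨fun p q => by rw [map_add]; exact Submodule.add_mem _ (h1 p q) (k1 p q),
      (h2.union k2).subset fun x hx => ?_⟩
    by_contra hc
    simp only [Set.mem_union, Set.mem_ofPred_eq, not_or, not_not] at hc
    exact hx (by rw [map_add, hc.1, hc.2, add_zero])
  smul_mem' := by
    rintro c Φ ⟨h1, h2⟩
    refine ⟨fun p q => by rw [map_smul]; exact Submodule.smul_mem _ c (h1 p q),
      h2.subset fun x hx hc => hx (by rw [map_smul, hc, smul_zero])⟩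

variable {R C}

/-- The internal differential: `(δφ)(f) = d(φ(f)) - (-1)^r ∑ ± φ(…, d f i j, …)` for `φ` in
`(C^{pq})^r`, `r = n - p - q`. -/
def internalDiff (n : ℤ) (Φ : TotalCochain R C) : TotalCochain R C := fun p X Y γ =>
  DGCategory.d (R := R) _ _ (Φ p X Y γ) -
    (n - p - γ.length).negOnePow • signedSum (diffs γ) (Φ p X Y)

/-- The Hochschild differential `d₀ : C^{pq} → C^{p,q+1}`, for `φ` of internal degree
`r = n - p - q`:
`(d₀φ)(f) = ± (⨂ f i q) ∘ φ(f i j, j ≠ q) + ∑_{k=1}^{q} ± (-1)^k φ(…, f i (q+1-k) ∘ f i (q-k), …)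
  + (-1)^(q+1) φ(f i j, j ≠ 0) ∘ (⨂ f i 0)`, where the signs `±` are the Koszul signs. -/
def hochschildDiff (n : ℤ) (Φ : TotalCochain R C) : TotalCochain R C := fun p X Y γ =>
  (match Y, γ with
    | _, .nil => 0
    | _, .cons γ' f =>
        ((n - p - γ'.length) * columnDeg f).negOnePow •
          (Φ p _ _ γ' ≫ columnTensor f)) +
  signedSum (merges γ) (Φ p X Y) +
  (match uncons γ with
    | none => 0
    | some x => (-1 : ℤˣ) ^ γ.length • (columnTensor x.2.1 ≫ Φ p _ _ x.2.2))

/-- `g ⊗ h : X 0 ⊗ (X 1 ⊗ … ⊗ X (p+1)) ⟶ Y 0 ⊗ (Y 1 ⊗ … ⊗ Y (p+1))`, considered as a morphism between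
the tensor products bracketed to the left. -/
def tensorFirst {p : ℕ} {X Y : Row R C (p + 1)} (g : X 0 ⟶ Y 0)
    (h : X.dropFirst.tensor ⟶ Y.dropFirst.tensor) : X.tensor ⟶ Y.tensor :=
  (splitFirst R p X).hom ≫ MonoidalDGCategory.tensorHom (R := R) g h ≫ (splitFirst R p Y).inv

/-- `h ⊗ g : (X 0 ⊗ … ⊗ X p) ⊗ X (p+1) ⟶ (Y 0 ⊗ … ⊗ Y p) ⊗ Y (p+1)`. -/
def tensorLast {p : ℕ} {X Y : Row R C (p + 1)}
    (h : X.dropLast.tensor ⟶ Y.dropLast.tensor)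
    (g : X (Fin.last (p + 1)) ⟶ Y (Fin.last (p + 1))) : X.tensor ⟶ Y.tensor :=
  MonoidalDGCategory.tensorHom (R := R) h g

/-- The first and the last term
`± (f 0 (q-1) ∘ … ∘ f 0 0) ⊗ φ(f i j, i ≠ 0)` and
`± (-1)^(p+2) φ(f i j, i ≠ p + 1) ⊗ (f (p+1) (q-1) ∘ … ∘ f (p+1) 0)`
of the Davydov–Yetter differential of a cochain `φ` in `C^{pq}`, where the signs `±` are the Koszul
signs; with the total sign `(-1)^(p+q)`. -/
def davydovYetterOuter (n : ℤ) (Φ : TotalCochain R C) : TotalCochain R C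
  | 0, _, _, _ => 0
  | p + 1, _, _, γ =>
      (-1 : ℤˣ) ^ (p + γ.length) •
        (((n - p - γ.length) * (rowComp 0 γ).deg + firstRowExponent γ).negOnePow •
            tensorFirst (rowComp 0 γ).hom (Φ p _ _ (dropFirstRow γ)) +
          ((-1 : ℤˣ) ^ (p + 2) * (lastRowExponent γ).negOnePow) •
            tensorLast (Φ p _ _ (dropLastRow γ)) (rowComp (Fin.last (p + 1)) γ).hom)

/-- The canonical isomorphism from `(X 0 ⊗ X 1) ⊗ … ⊗ X p` to the tensor product of the
`(F k)(X)`. -/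
noncomputable def toForest {p p' : ℕ} (F : Forest p p') (X : Row R C p) :
    X.tensor ⟶ (forestObj F X).tensor :=
  (canonicalHom R X (p := p) (p' := p') (fun k => .leaf k) F).hom

/-- The canonical isomorphism from the tensor product of the `(F k)(X)` to
`(X 0 ⊗ X 1) ⊗ … ⊗ X p`. -/
noncomputable def ofForest {p p' : ℕ} (F : Forest p p') (X : Row R C p) :
    (forestObj F X).tensor ⟶ X.tensor :=
  (canonicalHom R X (p := p') (p' := p) F (fun k => .leaf k)).hom

/-- The value `φ(P(f))` for a rectangle `P(f)` between forests `F` and `G`, considered as a morphism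
between the tensor products bracketed to the left, by means of the canonical isomorphisms. -/
noncomputable def evalForest {p p' : ℕ} (Φ : TotalCochain R C) (F G : Forest p p')
    {X Y : Row R C p} (P : Quiver.Path (forestObj F X) (forestObj G Y)) :
    X.tensor ⟶ Y.tensor :=
  toForest F X ≫ Φ p' _ _ P ≫ ofForest G Y

/-- The sum `∑_j ∑_P ± φ(P(f))` over `0 ≤ j ≤ p - i` and the admissible paths `P` in
`A_{i-1} × I_q`, for a rectangle `f` of size `(p, q)`; here `1 ≤ i ≤ p`.  The sign is the
orientation sign of `P` times `(-1)^(i(j+p) + q + (i-1)(i-2)/2)`. -/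
noncomputable def blockSum (i : ℕ) (Φ : TotalCochain R C) : TotalCochain R C := fun p _ _ γ =>
  ∑ j ∈ Finset.range (p - i + 1),
    (-1 : ℤˣ) ^ (i * (j + p) + γ.length + (i - 1).choose 2) •
      signedSum (admissiblePaths (i - 1)) fun S =>
        match S.map (blockForest p i j) with
        | [] => 0
        | F :: Q => signedSum (latticePaths F Q γ) fun P => evalForest Φ (bottom F Q) F P

/-- The component `d_i : C^{pq} → C^{p+i,q-i+1}` of the differential on cochains of total
degree `n`.  For `i = 1` the terms `(-1)^(j+1) φ(…, f j k ⊗ f (j+1) k, …)` of the Davydov–Yetter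
differential are those of `blockSum`, as `A_0` is a point. -/
noncomputable def diffComponent (n : ℤ) (i : ℕ) (Φ : TotalCochain R C) : TotalCochain R C :=
  fun p X Y γ =>
    match i with
    | 0 => hochschildDiff n Φ p X Y γ
    | 1 => davydovYetterOuter n Φ p X Y γ + if 1 ≤ p then blockSum 1 Φ p X Y γ else 0
    | i + 2 => if i + 2 ≤ p then blockSum (i + 2) Φ p X Y γ else 0

section Linearity

variable (n : ℤ) (c : R) (Φ Ψ : TotalCochain R C)

theorem signedSum_add {A M : Type*} [AddCommGroup M] (l : List (ℤˣ × A)) (ψ χ : A → M) :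
    signedSum l (fun a => ψ a + χ a) = signedSum l ψ + signedSum l χ := by
  simp only [signedSum, smul_add, List.sum_map_add]

theorem signedSum_smul {A M : Type*} [AddCommGroup M] [Module R M] (l : List (ℤˣ × A))
    (ψ : A → M) : signedSum l (fun a => c • ψ a) = c • signedSum l ψ := by
  simp only [signedSum, List.smul_sum, List.map_map, Function.comp_def, smul_comm c]

theorem tensorFirst_add {p : ℕ} {X Y : Row R C (p + 1)} (g : X 0 ⟶ Y 0)
    (h h' : X.dropFirst.tensor ⟶ Y.dropFirst.tensor) :
    tensorFirst (X := X) (Y := Y) g (h + h') = tensorFirst g h + tensorFirst g h' := by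
  unfold tensorFirst
  erw [map_add, Preadditive.add_comp, Preadditive.comp_add]

theorem tensorFirst_smul {p : ℕ} {X Y : Row R C (p + 1)} (g : X 0 ⟶ Y 0)
    (h : X.dropFirst.tensor ⟶ Y.dropFirst.tensor) :
    tensorFirst (X := X) (Y := Y) g (c • h) = c • tensorFirst g h := by
  unfold tensorFirst
  erw [map_smul, Linear.smul_comp, Linear.comp_smul]

theorem tensorLast_add {p : ℕ} {X Y : Row R C (p + 1)}
    (h h' : X.dropLast.tensor ⟶ Y.dropLast.tensor)
    (g : X (Fin.last (p + 1)) ⟶ Y (Fin.last (p + 1))) :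
    tensorLast (X := X) (Y := Y) (h + h') g = tensorLast h g + tensorLast h' g :=
  LinearMap.map_add₂ (MonoidalDGCategory.tensorHom (R := R)) h h' g

theorem tensorLast_smul {p : ℕ} {X Y : Row R C (p + 1)}
    (h : X.dropLast.tensor ⟶ Y.dropLast.tensor)
    (g : X (Fin.last (p + 1)) ⟶ Y (Fin.last (p + 1))) :
    tensorLast (X := X) (Y := Y) (c • h) g = c • tensorLast h g :=
  LinearMap.map_smul₂ (MonoidalDGCategory.tensorHom (R := R)) c h g

theorem internalDiff_add :
    internalDiff n (Φ + Ψ) = internalDiff n Φ + internalDiff n Ψ := by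
  funext p X Y γ
  simp only [internalDiff, Pi.add_apply, map_add]
  have := signedSum_add (diffs γ) (Φ p X Y) (Ψ p X Y)
  rw [show (Φ p X Y + Ψ p X Y) = fun a => Φ p X Y a + Ψ p X Y a from rfl, this, smul_add]
  abel

theorem internalDiff_smul : internalDiff n (c • Φ) = c • internalDiff n Φ := by
  funext p X Y γ
  simp only [internalDiff, Pi.smul_apply, map_smul]
  have := signedSum_smul c (diffs γ) (Φ p X Y)
  rw [show (c • Φ p X Y) = fun a => c • Φ p X Y a from rfl, this, smul_comm _ c, smul_sub]

theorem hochschildDiff_add :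
    hochschildDiff n (Φ + Ψ) = hochschildDiff n Φ + hochschildDiff n Ψ := by
  funext p X Y γ
  simp only [hochschildDiff, Pi.add_apply]
  have := signedSum_add (merges γ) (Φ p X Y) (Ψ p X Y)
  rw [show (Φ p X Y + Ψ p X Y) = fun a => Φ p X Y a + Ψ p X Y a from rfl, this]
  have key {M : Type _} [AddCommGroup M] (a a' b b' c c' : M) :
      (a + a') + (b + b') + (c + c') = (a + b + c) + (a' + b' + c') := by abel
  rw [← key]
  congr 2
  · cases γ with
    | nil => simp
    | cons γ' f => simp only [Preadditive.add_comp, smul_add]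
  · cases uncons γ with
    | none => simp
    | some x => simp only [Preadditive.comp_add, smul_add]

theorem hochschildDiff_smul : hochschildDiff n (c • Φ) = c • hochschildDiff n Φ := by
  funext p X Y γ
  simp only [hochschildDiff, Pi.smul_apply, smul_add]
  have := signedSum_smul c (merges γ) (Φ p X Y)
  rw [show (c • Φ p X Y) = fun a => c • Φ p X Y a from rfl, this]
  congr 2
  · cases γ with
    | nil => simp
    | cons γ' f => simp only [Linear.smul_comp, smul_comm c]
  · cases uncons γ with
    | none => simp
    | some x => simp only [Linear.comp_smul, smul_comm c]

theorem davydovYetterOuter_add :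
    davydovYetterOuter n (Φ + Ψ) = davydovYetterOuter n Φ + davydovYetterOuter n Ψ := by
  funext p X Y γ
  cases p with
  | zero => simp [davydovYetterOuter]
  | succ p =>
    simp only [davydovYetterOuter, Pi.add_apply, tensorFirst_add, tensorLast_add, smul_add]
    abel

theorem davydovYetterOuter_smul :
    davydovYetterOuter n (c • Φ) = c • davydovYetterOuter n Φ := by
  funext p X Y γ
  cases p with
  | zero => simp [davydovYetterOuter]
  | succ p =>
    simp only [davydovYetterOuter, Pi.smul_apply, tensorFirst_smul, tensorLast_smul, smul_add,
      smul_comm _ c]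

theorem evalForest_add {p p' : ℕ} (F G : Forest p p') {X Y : Row R C p}
    (P : Quiver.Path (forestObj F X) (forestObj G Y)) :
    evalForest (Φ + Ψ) F G P = evalForest Φ F G P + evalForest Ψ F G P := by
  simp only [evalForest, Pi.add_apply, Preadditive.add_comp, Preadditive.comp_add]

theorem evalForest_smul {p p' : ℕ} (F G : Forest p p') {X Y : Row R C p}
    (P : Quiver.Path (forestObj F X) (forestObj G Y)) :
    evalForest (c • Φ) F G P = c • evalForest Φ F G P := by
  simp only [evalForest, Pi.smul_apply, Linear.smul_comp, Linear.comp_smul]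

theorem blockSum_add (i : ℕ) : blockSum i (Φ + Ψ) = blockSum i Φ + blockSum i Ψ := by
  funext p X Y γ
  simp only [blockSum, Pi.add_apply, ← Finset.sum_add_distrib, ← smul_add, ← signedSum_add]
  refine Finset.sum_congr rfl fun j _ => ?_
  congr 2
  funext S
  cases S.map (blockForest p i j) with
  | nil => simp
  | cons F Q => simp only [evalForest_add, signedSum_add]

theorem blockSum_smul (i : ℕ) : blockSum i (c • Φ) = c • blockSum i Φ := by
  funext p X Y γ
  simp only [blockSum, Pi.smul_apply, Finset.smul_sum, smul_comm c, ← signedSum_smul]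
  refine Finset.sum_congr rfl fun j _ => ?_
  congr 2
  funext S
  cases S.map (blockForest p i j) with
  | nil => simp
  | cons F Q => simp only [evalForest_smul, signedSum_smul]

theorem diffComponent_add (i : ℕ) :
    diffComponent n i (Φ + Ψ) = diffComponent n i Φ + diffComponent n i Ψ := by
  funext p X Y γ
  match i with
  | 0 => simp [diffComponent, hochschildDiff_add]
  | 1 =>
    simp only [diffComponent, davydovYetterOuter_add, blockSum_add, Pi.add_apply]
    split_ifs <;> abel
  | i + 2 =>
    simp only [diffComponent, blockSum_add, Pi.add_apply]
    split_ifs <;> abel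

theorem diffComponent_smul (i : ℕ) :
    diffComponent n i (c • Φ) = c • diffComponent n i Φ := by
  funext p X Y γ
  match i with
  | 0 => simp [diffComponent, hochschildDiff_smul]
  | 1 =>
    simp only [diffComponent, davydovYetterOuter_smul, blockSum_smul, Pi.smul_apply]
    split_ifs <;> simp
  | i + 2 =>
    simp only [diffComponent, blockSum_smul, Pi.smul_apply]
    split_ifs <;> simp

end Linearity

variable (R C)

/-- The differential `d = δ + ∑_i d_i` on cochains of total degree `n`, where as usual in a total
complex the internal differential `δ` is taken with the sign `(-1)^(p+q)` on `C^{pq}`.  (On a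
rectangle with `p + 1` rows the `d_i` with `i > p` vanish.) -/
noncomputable def differential (n : ℤ) : TotalCochain R C →ₗ[R] TotalCochain R C where
  toFun Φ p X Y γ :=
    (-1 : ℤˣ) ^ (p + γ.length) • internalDiff n Φ p X Y γ +
      ∑ i ∈ Finset.range (p + 1), diffComponent n i Φ p X Y γ
  map_add' Φ Ψ := by
    funext p X Y γ
    simp only [internalDiff_add, diffComponent_add, Pi.add_apply, smul_add,
      Finset.sum_add_distrib]
    abel
  map_smul' c Φ := by
    funext p X Y γ
    simp only [internalDiff_smul, diffComponent_smul, Pi.smul_apply, smul_add,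
      Finset.smul_sum, smul_comm c, RingHom.id_apply]

end Complex

end TensorHochschild

namespace TensorHochschild

set_option linter.unusedSectionVars false

open Quiver renaming Path → Rect
open Function (update update_of_ne update_self update_idem update_comm)
open Category (assoc id_comp comp_id)
open MonoidalDGCategory (tensorObj tensorHom tensorHom_id tensorHom_comp assoc_hom_mem
  assoc_inv_mem assoc_naturality d_assoc_hom d_tensorHom tensorHom_mem)
open DGCategory (gr id_mem comp_mem d_comp)
open Finset (mem_range sum_congr sum_add_distrib sum_eq_zero smul_sum mul_sum sum_range_succ
  sum_range_succ' sum_range_add sum_sigma' sum_const_zero)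
open Int (negOnePow_add negOnePow_succ)
open Finset.HasAntidiagonal renaming mem_antidiagonal → mem_ad

theorem units_smul_comp' {C : Type u} [Category.{v} C] [Preadditive C] {X Y Z : C} (s : ℤˣ)
    (f : X ⟶ Y) (g : Y ⟶ Z) : (s • f) ≫ g = s • (f ≫ g) := by
  obtain rfl | rfl := Int.units_eq_one_or s <;> simp

theorem comp_units_smul' {C : Type u} [Category.{v} C] [Preadditive C] {X Y Z : C} (s : ℤˣ)
    (f : X ⟶ Y) (g : Y ⟶ Z) : f ≫ (s • g) = s • (f ≫ g) := by
  obtain rfl | rfl := Int.units_eq_one_or s <;> simp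

theorem map_usmul {M N F : Type*} [AddCommGroup M] [AddCommGroup N] [FunLike F M N]
    [AddMonoidHomClass F M N] (φ : F) (s : ℤˣ) (x : M) : φ (s • x) = s • φ x := by
  obtain rfl | rfl := Int.units_eq_one_or s <;> simp

theorem negOnePow_congr {a b : ℤ} (h : Even (a - b)) : a.negOnePow = b.negOnePow :=
  (Int.negOnePow_eq_iff a b).2 h

theorem add_congr {M : Type*} [Add M] {a b c d : M} (h : a = b) (h' : c = d) : a + c = b + d :=
  h ▸ h' ▸ rfl

theorem units_mem_smul {R M : Type*} [Ring R] [AddCommGroup M] [Module R M] (S : Submodule R M)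
    (s : ℤˣ) {x : M} (hx : x ∈ S) : s • x ∈ S := by
  obtain rfl | rfl := Int.units_eq_one_or s
  · simpa
  · simpa using S.neg_mem hx

section SignedSum

variable {A B M : Type*} [AddCommGroup M]

@[simp] theorem signedSum_nil (ψ : A → M) : signedSum [] ψ = 0 := rfl

@[simp] theorem signedSum_cons (x : ℤˣ × A) (l : List (ℤˣ × A)) (ψ : A → M) :
    signedSum (x :: l) ψ = x.1 • ψ x.2 + signedSum l ψ := by
  simp [signedSum]

@[simp] theorem signedSum_append (l l' : List (ℤˣ × A)) (ψ : A → M) :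
    signedSum (l ++ l') ψ = signedSum l ψ + signedSum l' ψ := by
  simp [signedSum]

theorem signedSum_map (l : List (ℤˣ × A)) (s : ℤˣ) (f : A → B) (ψ : B → M) :
    signedSum (l.map fun x => (s * x.1, f x.2)) ψ = s • signedSum l fun a => ψ (f a) := by
  induction l with
  | nil => simp
  | cons x l ih => simp only [List.map_cons, signedSum_cons, ih, smul_add, mul_smul]

theorem signedSum_map_one (l : List (ℤˣ × A)) (f : A → B) (ψ : B → M) :
    signedSum (l.map fun x => (x.1, f x.2)) ψ = signedSum l fun a => ψ (f a) := by
  simpa using signedSum_map l 1 f ψ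

theorem signedSum_map_neg (l : List (ℤˣ × A)) (f : A → B) (ψ : B → M) :
    signedSum (l.map fun x => (-x.1, f x.2)) ψ = -signedSum l fun a => ψ (f a) := by
  simpa using signedSum_map l (-1) f ψ

theorem signedSum_flatMap {I : Type*} (L : List I) (f : I → List (ℤˣ × A)) (ψ : A → M) :
    signedSum (L.flatMap f) ψ = (L.map fun i => signedSum (f i) ψ).sum := by
  induction L with
  | nil => simp
  | cons i L ih => simp [ih]

theorem signedSum_congr {l : List (ℤˣ × A)} {ψ χ : A → M} (h : ∀ x ∈ l, ψ x.2 = χ x.2) :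
    signedSum l ψ = signedSum l χ := by
  induction l with
  | nil => rfl
  | cons x l ih =>
    rw [signedSum_cons, signedSum_cons, h x (by simp), ih fun y hy => h y (by simp [hy])]

theorem signedSum_hom {N F : Type*} [AddCommGroup N] [FunLike F M N] [AddMonoidHomClass F M N]
    (φ : F) (l : List (ℤˣ × A)) (ψ : A → M) :
    φ (signedSum l ψ) = signedSum l fun a => φ (ψ a) := by
  induction l with
  | nil => simp
  | cons x l ih => rw [signedSum_cons, signedSum_cons, map_add, ih, map_usmul]

@[simp] theorem signedSum_zero (l : List (ℤˣ × A)) : signedSum l (fun _ => (0 : M)) = 0 := by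
  induction l with
  | nil => rfl
  | cons x l ih => simp [ih]

theorem signedSum_units_smul (s : ℤˣ) (l : List (ℤˣ × A)) (ψ : A → M) :
    signedSum l (fun a => s • ψ a) = s • signedSum l ψ := by
  induction l with
  | nil => simp
  | cons x l ih => simp only [signedSum_cons, ih, smul_add, smul_comm s]

theorem signedSum_neg (l : List (ℤˣ × A)) (ψ : A → M) :
    signedSum l (fun a => -ψ a) = -signedSum l ψ := by
  simpa using signedSum_units_smul (-1) l ψ

theorem signedSum_sub (l : List (ℤˣ × A)) (ψ χ : A → M) :
    signedSum l (fun a => ψ a - χ a) = signedSum l ψ - signedSum l χ := by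
  simp only [sub_eq_add_neg, signedSum_add, signedSum_neg]

theorem signedSum_sum {I : Type*} (s : Finset I) (l : List (ℤˣ × A)) (ψ : I → A → M) :
    signedSum l (fun a => ∑ i ∈ s, ψ i a) = ∑ i ∈ s, signedSum l (ψ i) := by
  classical
  induction s using Finset.induction_on with
  | empty => simp
  | insert i s hi ih => simp only [Finset.sum_insert hi, signedSum_add, ih]

theorem signedSum_comm (l : List (ℤˣ × A)) (l' : List (ℤˣ × B)) (ψ : A → B → M) :
    signedSum l (fun a => signedSum l' (ψ a)) =
      signedSum l' fun b => signedSum l fun a => ψ a b := by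
  induction l with
  | nil => simp
  | cons x l ih => simp only [signedSum_cons, ih, signedSum_add, signedSum_units_smul]

end SignedSum

/-! ### Columns of homogeneous morphisms -/

section Columns

variable {R : Type w} [CommRing R] {C : Type u} [Category.{v} C] [Preadditive C] [Linear R C]
  [DGCategory R C]

theorem HomogHom.ext' {X Y : C} {f g : HomogHom R X Y} (h : f.deg = g.deg) (h' : f.hom = g.hom) :
    f = g := by
  cases f; cases g; cases h; cases h'; rfl

theorem HomogHom.comp_assoc {X Y Z W : C} (f : HomogHom R X Y) (g : HomogHom R Y Z)
    (h : HomogHom R Z W) : (f.comp g).comp h = f.comp (g.comp h) :=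
  HomogHom.ext' (add_assoc _ _ _) (assoc _ _ _)

theorem HomogHom.id_comp {X Y : C} (f : HomogHom R X Y) : (HomogHom.id R X).comp f = f :=
  HomogHom.ext' (zero_add _) (Category.id_comp _)

theorem HomogHom.comp_id {X Y : C} (f : HomogHom R X Y) : f.comp (HomogHom.id R Y) = f :=
  HomogHom.ext' (add_zero _) (Category.comp_id _)

/-- `f` times a sign. -/
def HomogHom.signSmul {X Y : C} (s : ℤˣ) (f : HomogHom R X Y) : HomogHom R X Y :=
  ⟨f.deg, s • f.hom, units_mem_smul _ s f.mem⟩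

theorem d_id (X : C) : DGCategory.d (R := R) X X (𝟙 X) = 0 := by
  have := d_comp (R := R) (𝟙 X) (id_mem X)
  simpa using this

variable {p : ℕ} {X Y Z W : Row R C p}

/-- The composite of two columns. -/
def colComp {X Y Z : Row R C p} (e : X ⟶ Y) (f : Y ⟶ Z) : X ⟶ Z := fun i => (e i).comp (f i)

theorem colComp_assoc (e : X ⟶ Y) (f : Y ⟶ Z) (g : Z ⟶ W) :
    colComp (colComp e f) g = colComp e (colComp f g) :=
  funext fun _ => HomogHom.comp_assoc _ _ _

theorem idColumn_colComp (f : X ⟶ Y) : colComp (idColumn X) f = f :=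
  funext fun _ => HomogHom.id_comp _

theorem colComp_idColumn (f : X ⟶ Y) : colComp f (idColumn Y) = f :=
  funext fun _ => HomogHom.comp_id _

theorem columnDeg_colComp (e : X ⟶ Y) (f : Y ⟶ Z) :
    columnDeg (colComp e f) = columnDeg e + columnDeg f := sum_add_distrib

@[simp] theorem columnDeg_idColumn (X : Row R C p) : columnDeg (idColumn X) = 0 :=
  sum_const_zero

theorem columnDeg_update (f : X ⟶ Y) (i : Fin (p + 1)) (x : HomogHom R (X i) (Y i)) :
    columnDeg (update f i x : X ⟶ Y) = columnDeg f + (x.deg - (f i).deg) := by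
  have : ∀ k, (update f i x k).deg = (f k).deg + if k = i then x.deg - (f i).deg else 0 := by
    intro k
    by_cases h : k = i
    · subst h; simp
    · simp [h]
  simp only [columnDeg, this, sum_add_distrib]
  simp

/-- The exponent of `mergeSign`. -/
def mergeExp {X Y Z : Row R C p} (e : X ⟶ Y) (f : Y ⟶ Z) : ℤ :=
  ∑ i, ∑ k, if k < i then (f i).deg * (e k).deg else 0

theorem mergeSign_eq (e : X ⟶ Y) (f : Y ⟶ Z) : mergeSign e f = (mergeExp e f).negOnePow := rfl

theorem mergeSign_assoc (e : X ⟶ Y) (f : Y ⟶ Z) (g : Z ⟶ W) :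
    mergeSign f g * mergeSign e (colComp f g) = mergeSign e f * mergeSign (colComp e f) g := by
  simp only [mergeSign_eq, mergeExp, ← negOnePow_add, ← sum_add_distrib]
  congr 1
  refine sum_congr rfl fun i _ => sum_congr rfl fun k _ => ?_
  split_ifs
  · simp only [colComp, HomogHom.comp]; ring
  · simp

theorem mergeExp_update_left (e : X ⟶ Y) (f : Y ⟶ Z) (i : Fin (p + 1))
    (x : HomogHom R (X i) (Y i)) :
    mergeExp (update e i x : X ⟶ Y) f =
      mergeExp e f + (x.deg - (e i).deg) * ∑ k, if i < k then (f k).deg else 0 := by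
  have : ∀ k, (update e i x k).deg = (e k).deg + if k = i then x.deg - (e i).deg else 0 := by
    intro k
    by_cases h : k = i
    · subst h; simp
    · simp [h]
  simp only [mergeExp, this, mul_sum, ← sum_add_distrib]
  refine sum_congr rfl fun j _ => ?_
  rw [sum_congr rfl (g := fun k => (if k < j then (f j).deg * (e k).deg else 0) +
    if k = i then (if i < j then (x.deg - (e i).deg) * (f j).deg else 0) else 0)]
  · simp [sum_add_distrib]
  · intro k _
    by_cases hk : k = i
    · subst hk; simp; split_ifs <;> ring
    · simp [hk]

theorem mergeExp_update_right (e : X ⟶ Y) (f : Y ⟶ Z) (i : Fin (p + 1))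
    (x : HomogHom R (Y i) (Z i)) :
    mergeExp e (update f i x : Y ⟶ Z) =
      mergeExp e f + (x.deg - (f i).deg) * ∑ k, if k < i then (e k).deg else 0 := by
  have : ∀ k, (update f i x k).deg = (f k).deg + if k = i then x.deg - (f i).deg else 0 := by
    intro k
    by_cases h : k = i
    · subst h; simp
    · simp [h]
  simp only [mergeExp, this]
  rw [sum_congr rfl (g := fun j => (∑ k, if k < j then (f j).deg * (e k).deg else 0) +
    if j = i then (x.deg - (f i).deg) * (∑ k, if k < i then (e k).deg else 0) else 0)]
  · simp [sum_add_distrib]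
  · intro j _
    by_cases hj : j = i
    · subst hj
      simp only [if_true, mul_sum, ← sum_add_distrib]
      refine sum_congr rfl fun k _ => ?_
      split_ifs <;> ring
    · simp [hj]

@[simp] theorem mergeSign_idColumn_left (f : X ⟶ Y) : mergeSign (idColumn X) f = 1 := by
  simp [mergeSign, idColumn, HomogHom.id]

@[simp] theorem mergeSign_idColumn_right (f : X ⟶ Y) : mergeSign f (idColumn Y) = 1 := by
  simp [mergeSign, idColumn, HomogHom.id]

theorem update_colComp_left (e : X ⟶ Y) (f : Y ⟶ Z) (i : Fin (p + 1)) (x : HomogHom R (X i) (Y i)) :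
    colComp (update e i x : X ⟶ Y) f = (update (colComp e f) i (x.comp (f i)) : X ⟶ Z) := by
  funext k
  by_cases h : k = i
  · subst h; simp [colComp]
  · simp [colComp, h]

theorem update_colComp_right (e : X ⟶ Y) (f : Y ⟶ Z) (i : Fin (p + 1))
    (x : HomogHom R (Y i) (Z i)) :
    colComp e (update f i x : Y ⟶ Z) = (update (colComp e f) i ((e i).comp x) : X ⟶ Z) := by
  funext k
  by_cases h : k = i
  · subst h; simp [colComp]
  · simp [colComp, h]

/-! ### Multilinear functions of a column -/

section ColMl

variable {M N : Type*} [AddCommGroup M] [Module R M] [AddCommGroup N] [Module R N]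

/-- `G` is linear in every entry of a column. -/
structure ColMl {X Y : Row R C p} (G : (X ⟶ Y) → M) : Prop where
  map_add : ∀ (f : X ⟶ Y) (i : Fin (p + 1)) (x y z : HomogHom R (X i) (Y i)), x.deg = z.deg →
    y.deg = z.deg → z.hom = x.hom + y.hom →
    G (update f i z : X ⟶ Y) = G (update f i x : X ⟶ Y) + G (update f i y : X ⟶ Y)
  map_smul : ∀ (f : X ⟶ Y) (i : Fin (p + 1)) (c : R) (x z : HomogHom R (X i) (Y i)),
    x.deg = z.deg → z.hom = c • x.hom →
    G (update f i z : X ⟶ Y) = c • G (update f i x : X ⟶ Y)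

variable {X Y Z : Row R C p}

theorem ColMl.zero : ColMl (fun _ : X ⟶ Y => (0 : M)) :=
  ⟨fun _ _ _ _ _ _ _ _ => by simp, fun _ _ _ _ _ _ _ => by simp⟩

theorem ColMl.add {G H : (X ⟶ Y) → M} (hG : ColMl G) (hH : ColMl H) : ColMl fun f => G f + H f :=
  ⟨fun f i x y z h1 h2 h3 => by
    rw [hG.map_add f i x y z h1 h2 h3, hH.map_add f i x y z h1 h2 h3]; abel,
   fun f i c x z h1 h2 => by
    rw [hG.map_smul f i c x z h1 h2, hH.map_smul f i c x z h1 h2, smul_add]⟩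

theorem ColMl.comp_linear {G : (X ⟶ Y) → M} (hG : ColMl G) (φ : M →ₗ[R] N) :
    ColMl fun f => φ (G f) :=
  ⟨fun f i x y z h1 h2 h3 => by
    rw [hG.map_add f i x y z h1 h2 h3, _root_.map_add],
   fun f i c x z h1 h2 => by
    rw [hG.map_smul f i c x z h1 h2, _root_.map_smul]⟩

theorem update_deg (f : X ⟶ Y) (i : Fin (p + 1)) (x : HomogHom R (X i) (Y i)) :
    (fun k => (update f i x k).deg) = update (fun k => (f k).deg) i x.deg := by
  funext k
  by_cases h : k = i
  · subst h; simp
  · simp [h]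

/-- Multilinearity is preserved by signs depending only on the degrees of the entries. -/
theorem ColMl.sign {G : (X ⟶ Y) → M} (hG : ColMl G) (s : (Fin (p + 1) → ℤ) → ℤˣ) :
    ColMl fun f => s (fun i => (f i).deg) • G f := by
  refine ⟨fun f i x y z h1 h2 h3 => ?_, fun f i c x z h1 h2 => ?_⟩
  · rw [hG.map_add f i x y z h1 h2 h3, update_deg, update_deg, update_deg, h1, h2, smul_add]
  · rw [hG.map_smul f i c x z h1 h2, update_deg, update_deg, h1, smul_comm]

theorem ColMl.neg {G : (X ⟶ Y) → M} (hG : ColMl G) : ColMl fun f => -G f := by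
  simpa using hG.sign fun _ => -1

theorem ColMl.sum {I : Type*} (s : Finset I) {G : I → (X ⟶ Y) → M} (hG : ∀ i, ColMl (G i)) :
    ColMl fun f => ∑ i ∈ s, G i f :=
  ⟨fun f i x y z h1 h2 h3 => by
    rw [← sum_add_distrib]
    exact sum_congr rfl fun j _ => (hG j).map_add f i x y z h1 h2 h3,
   fun f i c x z h1 h2 => by
    rw [smul_sum]
    exact sum_congr rfl fun j _ => (hG j).map_smul f i c x z h1 h2⟩

theorem ColMl.update_zero {G : (X ⟶ Y) → M} (hG : ColMl G) (f : X ⟶ Y) (i : Fin (p + 1))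
    (x : HomogHom R (X i) (Y i)) (hx : x.hom = 0) : G (update f i x : X ⟶ Y) = 0 := by
  rw [hG.map_smul f i 0 x x rfl (by simp [hx]), zero_smul]

theorem ColMl.update_signSmul {G : (X ⟶ Y) → M} (hG : ColMl G) (f : X ⟶ Y) (i : Fin (p + 1))
    (s : ℤˣ) (x : HomogHom R (X i) (Y i)) :
    G (update f i (x.signSmul s) : X ⟶ Y) = s • G (update f i x : X ⟶ Y) := by
  obtain rfl | rfl := Int.units_eq_one_or s
  · rw [hG.map_smul f i 1 x (x.signSmul 1) rfl (by simp [HomogHom.signSmul]), one_smul, one_smul]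
  · rw [hG.map_smul f i (-1) x (x.signSmul (-1)) rfl (by simp [HomogHom.signSmul])]
    simp

theorem ColMl.map_signSmul {G : (X ⟶ Y) → M} (hG : ColMl G) (f : X ⟶ Y) (s : Fin (p + 1) → ℤˣ) :
    G (fun i => (f i).signSmul (s i)) = (∏ i, s i) • G f := by
  classical
  have key : ∀ S : Finset (Fin (p + 1)),
      G (fun i => if i ∈ S then (f i).signSmul (s i) else f i) = (∏ i ∈ S, s i) • G f := by
    intro S
    induction S using Finset.induction_on with
    | empty => simp
    | insert i S hi ih =>
      rw [Finset.prod_insert hi, mul_smul, ← ih]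
      convert hG.update_signSmul (fun k => if k ∈ S then (f k).signSmul (s k) else f k) i (s i)
        (f i) using 2
      · funext k
        by_cases h : k = i
        · subst h; simp
        · simp [h]
      · congr 1
        funext k
        by_cases h : k = i
        · subst h; simp [hi]
        · simp [h]
  simpa using key Finset.univ

theorem ColMl.colComp_left {G : (X ⟶ Z) → M} (hG : ColMl G) (f : Y ⟶ Z) :
    ColMl fun e : X ⟶ Y => G (colComp e f) := by
  refine ⟨fun e i x y z h1 h2 h3 => ?_, fun e i c x z h1 h2 => ?_⟩
  · simp only [update_colComp_left]
    exact hG.map_add _ _ _ _ _ (by simp [HomogHom.comp, h1]) (by simp [HomogHom.comp, h2])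
      (by simp [HomogHom.comp, h3])
  · simp only [update_colComp_left]
    exact hG.map_smul _ _ _ _ _ (by simp [HomogHom.comp, h1]) (by simp [HomogHom.comp, h2])

theorem ColMl.colComp_right {G : (X ⟶ Z) → M} (hG : ColMl G) (e : X ⟶ Y) :
    ColMl fun f : Y ⟶ Z => G (colComp e f) := by
  refine ⟨fun f i x y z h1 h2 h3 => ?_, fun f i c x z h1 h2 => ?_⟩
  · simp only [update_colComp_right]
    exact hG.map_add _ _ _ _ _ (by simp [HomogHom.comp, h1]) (by simp [HomogHom.comp, h2])
      (by simp [HomogHom.comp, h3])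
  · simp only [update_colComp_right]
    exact hG.map_smul _ _ _ _ _ (by simp [HomogHom.comp, h1]) (by simp [HomogHom.comp, h2])

/-- The sign for moving the differential to the entry `i` of a column. -/
def colSign (f : X ⟶ Y) (i : Fin (p + 1)) : ℤˣ :=
  (∑ k, if k < i then (f k).deg else 0).negOnePow

/-- The sum of the values of `G` on the columns obtained by applying the differential to an entry
of `f`, with Koszul signs. -/
def colD (G : (X ⟶ Y) → M) (f : X ⟶ Y) : M :=
  ∑ i, colSign f i • G (update f i (f i).d : X ⟶ Y)

theorem colD_add (G H : (X ⟶ Y) → M) (f : X ⟶ Y) :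
    colD (fun g => G g + H g) f = colD G f + colD H f := by
  simp only [colD, smul_add, sum_add_distrib]

theorem colD_hom {F : Type*} [FunLike F M N] [AddMonoidHomClass F M N] (φ : F) (G : (X ⟶ Y) → M)
    (f : X ⟶ Y) : φ (colD G f) = colD (fun g => φ (G g)) f := by
  simp only [colD, map_sum, map_usmul]

theorem colD_units_smul (s : ℤˣ) (G : (X ⟶ Y) → M) (f : X ⟶ Y) :
    colD (fun g => s • G g) f = s • colD G f := by
  simp only [colD, smul_sum, smul_comm s]

theorem colD_neg (G : (X ⟶ Y) → M) (f : X ⟶ Y) : colD (fun g => -G g) f = -colD G f := by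
  simpa using colD_units_smul (-1) G f

theorem sum_lt_update {f : X ⟶ Y} (i j : Fin (p + 1)) (x : HomogHom R (X i) (Y i)) :
    (∑ k, if k < j then (update f i x k).deg else 0) =
      (∑ k, if k < j then (f k).deg else 0) + if i < j then x.deg - (f i).deg else 0 := by
  rw [sum_congr rfl (g := fun k => (if k < j then (f k).deg else 0) +
    if k = i then (if i < j then x.deg - (f i).deg else 0) else 0)]
  · simp [sum_add_distrib]
  · intro k _
    by_cases h : k = i
    · subst h; simp; split_ifs <;> ring
    · simp [h]

theorem colSign_update_d (f : X ⟶ Y) (i j : Fin (p + 1)) : colSign (update f i (f i).d : X ⟶ Y) j =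
      colSign f j * if i < j then -1 else 1 := by
  rw [colSign, sum_lt_update, negOnePow_add, colSign]
  congr 1
  split_ifs
  · simp [HomogHom.d]
  · simp

theorem colD_colD {G : (X ⟶ Y) → M} (hG : ColMl G) (f : X ⟶ Y) : colD (colD G) f = 0 := by
  have h : ∀ i j : Fin (p + 1), colSign f i • (colSign (update f i (f i).d : X ⟶ Y) j •
      G (update (update f i (f i).d : X ⟶ Y) j ((update f i (f i).d : X ⟶ Y) j).d : X ⟶ Y)) =
      (if i < j then -((colSign f i * colSign f j) •
        G (update (update f i (f i).d : X ⟶ Y) j (f j).d : X ⟶ Y)) else 0) +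
      (if j < i then ((colSign f j * colSign f i) •
        G (update (update f j (f j).d : X ⟶ Y) i (f i).d : X ⟶ Y)) else 0) := by
    intro i j
    rw [colSign_update_d]
    rcases lt_trichotomy i j with hij | rfl | hij
    · rw [if_pos hij, if_pos hij, if_neg hij.asymm, update_of_ne hij.ne', mul_neg_one,
        Units.neg_smul, smul_neg, mul_smul, add_zero]
    · rw [hG.update_zero]
      · simp
      · simp [HomogHom.d, DGCategory.d_d]
    · rw [if_neg hij.asymm, if_neg hij.asymm, if_pos hij, update_of_ne hij.ne, mul_one,
        update_comm hij.ne, zero_add, mul_comm, mul_smul]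
  simp only [colD, smul_sum, h, sum_add_distrib]
  rw [Finset.sum_comm, ← sum_add_distrib]
  refine sum_eq_zero fun j _ => ?_
  rw [← sum_add_distrib]
  refine sum_eq_zero fun i _ => ?_
  split_ifs <;> simp

protected theorem ColMl.colD {G : (X ⟶ Y) → M} (hG : ColMl G) : ColMl (colD G) := by
  refine ColMl.sum _ fun i => ?_
  have : ColMl fun f : X ⟶ Y => G (update f i (f i).d : X ⟶ Y) := by
    refine ⟨fun f j x y z h1 h2 h3 => ?_, fun f j c x z h1 h2 => ?_⟩
    all_goals
      by_cases h : j = i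
      · subst h
        simp only [update_self, update_idem]
        first
        | exact hG.map_add _ _ _ _ _ (by simp [HomogHom.d, h1]) (by simp [HomogHom.d, h2])
            (by simp [HomogHom.d, h3])
        | exact hG.map_smul _ _ _ _ _ (by simp [HomogHom.d, h1]) (by simp [HomogHom.d, h2])
      · simp only [update_of_ne (Ne.symm h), update_comm h]
        first
        | exact hG.map_add _ _ _ _ _ h1 h2 h3
        | exact hG.map_smul _ _ _ _ _ h1 h2
  exact this.sign fun a => (∑ k, if k < i then a k else 0).negOnePow

/-- The Leibniz rule for the composite of two columns. -/
theorem colD_colComp {G : (X ⟶ Z) → M} (hG : ColMl G) (e : X ⟶ Y) (f : Y ⟶ Z) :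
    mergeSign e f • colD G (colComp e f) = colD (fun f' => mergeSign e f' • G (colComp e f')) f +
        (columnDeg f).negOnePow • colD (fun e' => mergeSign e' f • G (colComp e' f)) e := by
  simp only [colD, smul_sum, ← sum_add_distrib]
  refine sum_congr rfl fun i _ => ?_
  rw [update_colComp_left, update_colComp_right]
  have h : G (update (colComp e f) i (colComp e f i).d : X ⟶ Z) =
      G (update (colComp e f) i ((e i).comp (f i).d) : X ⟶ Z) + (f i).deg.negOnePow •
        G (update (colComp e f) i ((e i).d.comp (f i)) : X ⟶ Z) := by
    rw [← hG.update_signSmul]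
    refine hG.map_add _ _ _ _ _ (add_assoc _ _ _).symm ?_ (d_comp _ (f i).mem)
    simp [colComp, HomogHom.comp, HomogHom.signSmul, HomogHom.d]; ring
  rw [h, smul_add, smul_add]
  simp only [← mul_smul]
  have hs : ∑ k, (f k).deg = (∑ k, if k < i then (f k).deg else 0) + (f i).deg +
      ∑ k, if i < k then (f k).deg else 0 := by
    have : ∀ k, (f k).deg = (if k < i then (f k).deg else 0) + (if k = i then (f i).deg else 0) +
      if i < k then (f k).deg else 0 := by
      intro k
      rcases lt_trichotomy k i with h | rfl | h
      · simp [h, h.ne, h.asymm]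
      · simp
      · simp [h, h.ne', h.asymm]
    rw [sum_congr rfl fun k _ => this k]
    simp [sum_add_distrib]
  have hc : (∑ k, if k < i then (colComp e f k).deg else 0) =
      (∑ k, if k < i then (e k).deg else 0) + ∑ k, if k < i then (f k).deg else 0 := by
    rw [← sum_add_distrib]
    refine sum_congr rfl fun k _ => ?_
    split_ifs <;> simp [colComp, HomogHom.comp]
  congr 2
  · simp only [mergeSign_eq, colSign, ← negOnePow_add, mergeExp_update_right, hc]
    congr 1
    simp [HomogHom.d]; ring
  · simp only [mergeSign_eq, colSign, ← negOnePow_add, mergeExp_update_left, hc, columnDeg]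
    refine negOnePow_congr ?_
    rw [hs]
    simp only [HomogHom.d]
    generalize (∑ k, if i < k then (f k).deg else 0) = A
    exact ⟨-A, by ring⟩

end ColMl

end Columns

variable {R : Type w} [CommRing R] {C : Type u} [Category.{v} C] [Preadditive C] [Linear R C]
  [DGCategory R C] [MonoidalDGCategory R C]

local notation "tHom" => tensorHom (R := R)
local notation "dC" => DGCategory.d (R := R)
local notation "αC" => MonoidalDGCategory.assoc (R := R)

section ColumnTensor

theorem tensorHom_signs {X X' Y Y' : C} (s : ℤˣ) (f : X ⟶ X') (g : Y ⟶ Y') : tHom (s • f) g =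
      s • tHom f g := by
  obtain rfl | rfl := Int.units_eq_one_or s <;> simp

theorem tensorHom_comp_left {X X' X'' Y Y' Y'' : C} {f : X ⟶ X'} (f' : X' ⟶ X'')
    (g : Y ⟶ Y') (g' : Y' ⟶ Y'') (hf : f ∈ gr (R := R) X X' 0) :
    tHom f g ≫ tHom f' g' = tHom (f ≫ f') (g ≫ g') := by
  classical
  have key : ∀ g' : Y' ⟶ Y'', g' ∈ ⨆ n, gr (R := R) Y' Y'' n → tHom f g ≫ tHom f' g' =
      tHom (f ≫ f') (g ≫ g') := by
    intro g' hg'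
    refine Submodule.iSup_induction _ (motive := fun g' =>
      tHom f g ≫ tHom f' g' =
      tHom (f ≫ f') (g ≫ g')) hg' ?_ ?_ ?_
    · intro n x hx
      rw [tensorHom_comp f' g hf hx]
      simp
    · simp
    · intro x y hx hy
      simp only [map_add, Preadditive.comp_add, hx, hy]
  exact key g' (by
    rw [(DGCategory.gr_isInternal (R := R) Y' Y'').submodule_iSup_eq_top]; trivial)

theorem tensorHom_comp_right {X X' X'' Y Y' Y'' : C} (f : X ⟶ X') (f' : X' ⟶ X'')
    (g : Y ⟶ Y') {g' : Y' ⟶ Y''} (hg' : g' ∈ gr (R := R) Y' Y'' 0) :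
    tHom f g ≫ tHom f' g' = tHom (f ≫ f') (g ≫ g') := by
  classical
  have key : ∀ f : X ⟶ X', f ∈ ⨆ n, gr (R := R) X X' n → tHom f g ≫ tHom f' g' =
      tHom (f ≫ f') (g ≫ g') := by
    intro f hf
    refine Submodule.iSup_induction _ (motive := fun f =>
      tHom f g ≫ tHom f' g' =
      tHom (f ≫ f') (g ≫ g')) hf ?_ ?_ ?_
    · intro n x hx
      rw [tensorHom_comp f' g hx hg']
      simp
    · simp
    · intro x y hx hy
      simp only [map_add, LinearMap.add_apply, Preadditive.add_comp, hx, hy]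
  exact key f (by
    rw [(DGCategory.gr_isInternal (R := R) X X').submodule_iSup_eq_top]; trivial)

theorem rowTensorHom_deg : ∀ (p : ℕ) {X Y : Fin (p + 1) → C} (f : ∀ i, HomogHom R (X i) (Y i)),
    (rowTensorHom p f).deg = ∑ i, (f i).deg
  | 0, _, _, f => by simp [rowTensorHom]
  | p + 1, _, _, f => by
    rw [Fin.sum_univ_castSucc, ← rowTensorHom_deg p]
    rfl

theorem rowTensorHom_comp : ∀ (p : ℕ) {X Y Z : Fin (p + 1) → C}
    (e : ∀ i, HomogHom R (X i) (Y i)) (f : ∀ i, HomogHom R (Y i) (Z i)),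
    (rowTensorHom p e).hom ≫ (rowTensorHom p f).hom =
      (∑ i, ∑ k, if k < i then (f i).deg * (e k).deg else 0).negOnePow •
        (rowTensorHom p fun i => (e i).comp (f i)).hom
  | 0, _, _, _, e, f => by
    have : (∑ i : Fin (0 + 1), ∑ k : Fin (0 + 1),
        if k < i then (f i).deg * (e k).deg else 0) = 0 := by simp
    rw [this, Int.negOnePow_zero]
    exact (one_smul _ _).symm
  | p + 1, _, _, _, e, f => by
    rw [Fin.sum_univ_castSucc]
    have h1 : ∀ i : Fin (p + 1), (∑ k : Fin (p + 2), if k < i.castSucc then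
        (f i.castSucc).deg * (e k).deg else 0) =
        ∑ k : Fin (p + 1), if k < i then (f i.castSucc).deg * (e k.castSucc).deg else 0 := by
      intro i
      rw [Fin.sum_univ_castSucc]
      simp [not_lt.2 (Fin.le_last _)]
    have h2 : (∑ k : Fin (p + 2), if k < Fin.last (p + 1) then
        (f (Fin.last (p + 1))).deg * (e k).deg else 0) =
        (f (Fin.last (p + 1))).deg * (rowTensorHom p fun i => e i.castSucc).deg := by
      rw [Fin.sum_univ_castSucc, rowTensorHom_deg, mul_sum]
      simp [Fin.castSucc_lt_last]
    rw [h2, sum_congr rfl fun i _ => h1 i, negOnePow_add]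
    have h3 := tensorHom_comp (rowTensorHom p fun i => f i.castSucc).hom
      (e (Fin.last (p + 1))).hom (rowTensorHom p fun i => e i.castSucc).mem
      (f (Fin.last (p + 1))).mem
    rw [rowTensorHom_comp p, tensorHom_signs] at h3
    refine h3.trans ?_
    rw [mul_smul, smul_comm]
    rfl

theorem rowTensorHom_id : ∀ (p : ℕ) (X : Fin (p + 1) → C),
    (rowTensorHom p fun i => HomogHom.id R (X i)).hom = 𝟙 _
  | 0, _ => rfl
  | p + 1, X => by
    refine Eq.trans ?_ (tensorHom_id (R := R) _ _)
    simp only [rowTensorHom, HomogHom.tensor, rowTensorHom_id p]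
    rfl

theorem update_castSucc_castSucc {p : ℕ} {β : Fin (p + 2) → Type*} (f : ∀ i, β i)
    (j : Fin (p + 1)) (x : β j.castSucc) :
    (fun i : Fin (p + 1) => update f j.castSucc x i.castSucc) =
      update (fun i : Fin (p + 1) => f i.castSucc) j x := by
  funext i
  by_cases h : i = j
  · subst h; simp
  · rw [update_of_ne h, update_of_ne (by simpa using h)]

theorem update_last_castSucc {p : ℕ} {β : Fin (p + 2) → Type*} (f : ∀ i, β i)
    (x : β (Fin.last (p + 1))) :
    (fun i : Fin (p + 1) => update f (Fin.last (p + 1)) x i.castSucc) =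
      fun i : Fin (p + 1) => f i.castSucc := by
  funext i
  rw [update_of_ne (Fin.castSucc_lt_last i).ne]

theorem tensor_hom_add_right {X X' Y Y' : C} (f : HomogHom R X X') {x y z : HomogHom R Y Y'}
    (h : z.hom = x.hom + y.hom) : (f.tensor z).hom = (f.tensor x).hom + (f.tensor y).hom := by
  simp [HomogHom.tensor, h]

theorem tensor_hom_add_left {X X' Y Y' : C} (f : HomogHom R Y Y') {x y z : HomogHom R X X'}
    (h : z.hom = x.hom + y.hom) : (z.tensor f).hom = (x.tensor f).hom + (y.tensor f).hom := by
  simp [HomogHom.tensor, h]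

theorem tensor_hom_smul_right {X X' Y Y' : C} (f : HomogHom R X X') {c : R}
    {x z : HomogHom R Y Y'} (h : z.hom = c • x.hom) :
    (f.tensor z).hom = c • (f.tensor x).hom := by
  simp [HomogHom.tensor, h]

theorem tensor_hom_smul_left {X X' Y Y' : C} (f : HomogHom R Y Y') {c : R}
    {x z : HomogHom R X X'} (h : z.hom = c • x.hom) :
    (z.tensor f).hom = c • (x.tensor f).hom := by
  simp [HomogHom.tensor, h]

theorem rowTensorHom_update_last (p : ℕ) {X Y : Fin (p + 2) → C} (f : ∀ i, HomogHom R (X i) (Y i))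
    (x : HomogHom R (X (Fin.last (p + 1))) (Y (Fin.last (p + 1)))) :
    rowTensorHom (p + 1) (update f (Fin.last (p + 1)) x) =
      (rowTensorHom p fun i => f i.castSucc).tensor x := by
  rw [rowTensorHom, update_last_castSucc, update_self]

theorem rowTensorHom_update_castSucc (p : ℕ) {X Y : Fin (p + 2) → C}
    (f : ∀ i, HomogHom R (X i) (Y i)) (i : Fin (p + 1))
    (x : HomogHom R (X i.castSucc) (Y i.castSucc)) :
    rowTensorHom (p + 1) (update f i.castSucc x) =
      (rowTensorHom p (update (fun i => f i.castSucc) i x)).tensor (f (Fin.last (p + 1))) := by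
  rw [rowTensorHom, update_castSucc_castSucc, update_of_ne (Fin.castSucc_lt_last i).ne']

theorem rowTensorHom_add : ∀ (p : ℕ) {X Y : Fin (p + 1) → C} (f : ∀ i, HomogHom R (X i) (Y i))
    (i : Fin (p + 1)) (x y z : HomogHom R (X i) (Y i)), z.hom = x.hom + y.hom →
    (rowTensorHom p (update f i z)).hom =
      (rowTensorHom p (update f i x)).hom + (rowTensorHom p (update f i y)).hom
  | 0, _, _, f, i, x, y, z, h => by
    obtain rfl : i = 0 := Fin.ext (by omega)
    simp only [rowTensorHom, update_self]
    exact h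
  | p + 1, _, _, f, i, x, y, z, h => by
    cases i using Fin.lastCases with
    | last =>
      rw [rowTensorHom_update_last, rowTensorHom_update_last, rowTensorHom_update_last]
      exact tensor_hom_add_right _ h
    | cast i =>
      rw [rowTensorHom_update_castSucc, rowTensorHom_update_castSucc, rowTensorHom_update_castSucc]
      exact tensor_hom_add_left _ (rowTensorHom_add p (fun i => f i.castSucc) i x y z h)

theorem rowTensorHom_smul : ∀ (p : ℕ) {X Y : Fin (p + 1) → C} (f : ∀ i, HomogHom R (X i) (Y i))
    (i : Fin (p + 1)) (c : R) (x z : HomogHom R (X i) (Y i)), z.hom = c • x.hom →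
    (rowTensorHom p (update f i z)).hom = c • (rowTensorHom p (update f i x)).hom
  | 0, _, _, f, i, c, x, z, h => by
    obtain rfl : i = 0 := Fin.ext (by omega)
    simp only [rowTensorHom, update_self]
    exact h
  | p + 1, _, _, f, i, c, x, z, h => by
    cases i using Fin.lastCases with
    | last =>
      rw [rowTensorHom_update_last, rowTensorHom_update_last]
      exact tensor_hom_smul_right _ h
    | cast i =>
      rw [rowTensorHom_update_castSucc, rowTensorHom_update_castSucc]
      exact tensor_hom_smul_left _ (rowTensorHom_smul p (fun i => f i.castSucc) i c x z h)

theorem d_rowTensorHom : ∀ (p : ℕ) {X Y : Fin (p + 1) → C} (f : ∀ i, HomogHom R (X i) (Y i)),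
    dC _ _ (rowTensorHom p f).hom = ∑ i, (∑ k, if k < i then (f k).deg else 0).negOnePow •
        (rowTensorHom p (update f i (f i).d)).hom
  | 0, _, _, f => by
    rw [Finset.sum_eq_single_of_mem (0 : Fin (0 + 1)) (Finset.mem_univ _)
      fun i _ hi => absurd (Fin.ext (by omega)) hi]
    have : (∑ k : Fin (0 + 1), if k < 0 then (f k).deg else 0) = 0 := by simp
    rw [this, Int.negOnePow_zero]
    simp only [rowTensorHom, update_self]
    exact (one_smul _ _).symm
  | p + 1, _, _, f => by
    rw [Fin.sum_univ_castSucc]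
    have h1 : ∀ i : Fin (p + 1), (∑ k : Fin (p + 2), if k < i.castSucc then (f k).deg else 0) =
        ∑ k : Fin (p + 1), if k < i then (f k.castSucc).deg else 0 := by
      intro i
      rw [Fin.sum_univ_castSucc]
      simp [not_lt.2 (Fin.le_last _)]
    have h2 : (∑ k : Fin (p + 2), if k < Fin.last (p + 1) then (f k).deg else 0) =
        (rowTensorHom p fun i => f i.castSucc).deg := by
      rw [Fin.sum_univ_castSucc, rowTensorHom_deg]
      simp [Fin.castSucc_lt_last]
    rw [h2]
    have h3 := d_tensorHom (R := R) (f (Fin.last (p + 1))).hom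
      (rowTensorHom p fun i => f i.castSucc).mem
    refine h3.trans ?_
    rw [d_rowTensorHom p]
    congr 1
    · rw [map_sum, LinearMap.sum_apply]
      refine sum_congr rfl fun i _ => ?_
      rw [tensorHom_signs, h1, rowTensorHom_update_castSucc]
      rfl
    · rw [rowTensorHom_update_last]
      rfl

variable {p : ℕ} {X Y Z : Row R C p}

theorem columnTensor_mem (f : X ⟶ Y) :
    columnTensor f ∈ gr (R := R) X.tensor Y.tensor (columnDeg f) := by
  have h : columnDeg f = (rowTensorHom p f).deg := (rowTensorHom_deg p f).symm
  rw [h]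
  exact (rowTensorHom p f).mem

theorem columnTensor_comp (e : X ⟶ Y) (f : Y ⟶ Z) :
    columnTensor e ≫ columnTensor f = mergeSign e f • columnTensor (colComp e f) :=
  rowTensorHom_comp p e f

@[simp] theorem columnTensor_idColumn (X : Row R C p) : columnTensor (idColumn X) = 𝟙 X.tensor :=
  rowTensorHom_id p X

theorem columnTensor_colMl : ColMl (columnTensor : (X ⟶ Y) → (X.tensor ⟶ Y.tensor)) :=
  ⟨fun f i x y z _ _ h => rowTensorHom_add p f i x y z h,
    fun f i c x z _ h => rowTensorHom_smul p f i c x z h⟩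

theorem d_columnTensor (f : X ⟶ Y) : dC _ _ (columnTensor f) = colD columnTensor f :=
  d_rowTensorHom p f

end ColumnTensor

/-! ### Families of functions of a rectangle with fixed last column of objects -/

section Families

/-- Functions of the rectangles ending in the column of objects `Z`, with values in morphisms
to `T`. -/
abbrev Fam {p : ℕ} (Z : Row R C p) (T : C) : Type _ :=
  ∀ X : Row R C p, Rect X Z → (X.tensor ⟶ T)

variable {p : ℕ} {T T' : C} {X Y Z W : Row R C p}

/-- Evaluation at a rectangle. -/
def evalFam {X Z : Row R C p} (γ : Rect X Z) : Fam Z T →ₗ[R] (X.tensor ⟶ T) where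
  toFun Ψ := Ψ X γ
  map_add' _ _ := rfl
  map_smul' _ _ := rfl

/-- Insert `f` as the last column of morphisms. -/
def push {Y Z : Row R C p} (f : Y ⟶ Z) : Fam Z T →ₗ[R] Fam Y T where
  toFun Ψ X γ := Ψ X (γ.cons f)
  map_add' _ _ := rfl
  map_smul' _ _ := rfl

theorem push_apply (f : Y ⟶ Z) (Ψ : Fam Z T) (γ : Rect X Y) : push f Ψ X γ = Ψ X (γ.cons f) := rfl

/-- The value on the rectangle obtained by composing the last column with `f`. -/
def actFun {X Z : Row R C p} (Ψ : Fam Z T) : {Y : Row R C p} → (f : Y ⟶ Z) →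
    Rect X Y → (X.tensor ⟶ T)
  | _, f, .nil => columnTensor f ≫ Ψ _ .nil
  | _, f, .cons γ e => mergeSign e f • Ψ X (γ.cons (colComp e f))

/-- Compose the last column with `f`, for the empty rectangle compose with `⊗ f`. -/
def act {Y Z : Row R C p} (f : Y ⟶ Z) : Fam Z T →ₗ[R] Fam Y T where
  toFun Ψ _ γ := actFun Ψ f γ
  map_add' Ψ Ψ' := by
    funext X γ
    cases γ with
    | nil => exact Preadditive.comp_add _ _ _ _ _ _
    | cons γ e => exact smul_add _ _ _
  map_smul' c Ψ := by
    funext X γ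
    cases γ with
    | nil => exact Linear.comp_smul _ _ _ _ _ _
    | cons γ e => exact smul_comm _ _ _

theorem act_nil (f : Y ⟶ Z) (Ψ : Fam Z T) : act f Ψ Y .nil = columnTensor f ≫ Ψ Z .nil := rfl

theorem act_cons (f : Y ⟶ Z) (Ψ : Fam Z T) (γ : Rect X W)
    (e : W ⟶ Y) : act f Ψ X (γ.cons e) = mergeSign e f • Ψ X (γ.cons (colComp e f)) := rfl

theorem push_act (e : Y ⟶ Z) (f : Z ⟶ W) (Ψ : Fam W T) :
    push e (act f Ψ) = mergeSign e f • push (colComp e f) Ψ := rfl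

theorem act_act (e : Y ⟶ Z) (f : Z ⟶ W) (Ψ : Fam W T) :
    act e (act f Ψ) = mergeSign e f • act (colComp e f) Ψ := by
  funext X γ
  cases γ with
  | nil =>
    change columnTensor e ≫ columnTensor f ≫ Ψ W .nil =
      mergeSign e f • (columnTensor (colComp e f) ≫ Ψ W .nil)
    rw [← assoc, columnTensor_comp, units_smul_comp']
  | cons γ g =>
    change mergeSign g e • mergeSign (colComp g e) f • Ψ X (γ.cons (colComp (colComp g e) f)) =
      mergeSign e f • mergeSign g (colComp e f) • Ψ X (γ.cons (colComp g (colComp e f)))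
    rw [← mul_smul, ← mul_smul, mergeSign_assoc, colComp_assoc]

theorem act_idColumn (Ψ : Fam Z T) : act (idColumn Z) Ψ = Ψ := by
  funext X γ
  cases γ with
  | nil => rw [act_nil, columnTensor_idColumn, id_comp]
  | cons γ e => rw [act_cons, mergeSign_idColumn_right, one_smul, colComp_idColumn]

/-- The sum of the inner terms and of the first term of the Hochschild differential. -/
def barAux {X : Row R C p} : {Z : Row R C p} → Rect X Z → (Fam Z T →ₗ[R] (X.tensor ⟶ T))
  | _, .nil => 0
  | _, .cons γ f => -((evalFam γ).comp (act f)) - (barAux γ).comp (push f)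

/-- The sum of the inner terms and of the first term of the Hochschild differential. -/
def bar {Z : Row R C p} : Fam Z T →ₗ[R] Fam Z T where
  toFun Ψ _ γ := barAux γ Ψ
  map_add' _ _ := by funext X γ; exact map_add _ _ _
  map_smul' _ _ := by funext X γ; exact map_smul _ _ _

theorem bar_nil (Ψ : Fam Z T) : bar Ψ Z .nil = 0 := rfl

theorem push_bar (f : Y ⟶ Z) (Ψ : Fam Z T) : push f (bar Ψ) = -act f Ψ - bar (push f Ψ) := rfl

theorem bar_cons (γ : Rect X Y) (f : Y ⟶ Z) (Ψ : Fam Z T) :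
    bar Ψ X (γ.cons f) = -act f Ψ X γ - bar (push f Ψ) X γ := rfl

theorem act_bar (f : Y ⟶ Z) (Ψ : Fam Z T) : act f (bar Ψ) = bar (act f Ψ) := by
  funext X γ
  cases γ with
  | nil => rw [act_nil, bar_nil, bar_nil, Limits.comp_zero]
  | cons γ e =>
    rw [act_cons, bar_cons, bar_cons, act_act, push_act, map_usmul, smul_sub, smul_neg]
    rfl

theorem bar_bar (Ψ : Fam Z T) : bar (bar Ψ) = 0 := by
  funext X γ
  induction γ with
  | nil => rfl
  | cons γ f ih =>
    rw [bar_cons, push_bar, act_bar, map_sub, map_neg]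
    have := ih (push f Ψ)
    simp only [Pi.sub_apply, Pi.neg_apply, this]
    simp

/-- Compose the values with `g`. -/
def post {Z : Row R C p} (g : T ⟶ T') : Fam Z T →ₗ[R] Fam Z T' where
  toFun Ψ X γ := Ψ X γ ≫ g
  map_add' _ _ := by funext X γ; exact Preadditive.add_comp _ _ _ _ _ _
  map_smul' _ _ := by funext X γ; exact Linear.smul_comp _ _ _ _ _ _

theorem push_post (f : Y ⟶ Z) (g : T ⟶ T') (Ψ : Fam Z T) :
    push f (post g Ψ) = post g (push f Ψ) := rfl

theorem act_post (f : Y ⟶ Z) (g : T ⟶ T') (Ψ : Fam Z T) : act f (post g Ψ) = post g (act f Ψ) := by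
  funext X γ
  cases γ with
  | nil => exact (assoc _ _ _).symm
  | cons γ e => exact (units_smul_comp' _ _ _).symm

theorem bar_post (g : T ⟶ T') (Ψ : Fam Z T) : bar (post g Ψ) = post g (bar Ψ) := by
  funext X γ
  induction γ with
  | nil => exact (Limits.zero_comp (f := g)).symm
  | cons γ f ih =>
    rw [bar_cons, act_post, push_post, ih]
    change -(act f Ψ _ γ ≫ g) - bar (push f Ψ) _ γ ≫ g = (-act f Ψ _ γ - bar (push f Ψ) _ γ) ≫ g
    rw [Preadditive.sub_comp, Preadditive.neg_comp]

/-- The sum over the rectangles obtained by applying the differential to an entry. -/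
def diffSum {Z : Row R C p} : Fam Z T →ₗ[R] Fam Z T where
  toFun Ψ X γ := signedSum (diffs γ) (Ψ X)
  map_add' _ _ := by funext X γ; exact signedSum_add _ _ _
  map_smul' _ _ := by funext X γ; exact signedSum_smul _ _ _

theorem diffSum_nil (Ψ : Fam Z T) : diffSum Ψ Z .nil = 0 := rfl

theorem diffSum_cons (γ : Rect X Y) (f : Y ⟶ Z) (Ψ : Fam Z T) :
    diffSum Ψ X (γ.cons f) = colD (fun f' => Ψ X (γ.cons f')) f +
      (columnDeg f).negOnePow • diffSum (push f Ψ) X γ := by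
  change signedSum (_ ++ _) _ = _
  rw [signedSum_append]
  congr 1
  · simp only [signedSum, List.map_map, colD, colSign, Fin.sum_univ_def]
    rfl
  · exact signedSum_map (diffs γ) (columnDeg f).negOnePow (fun x => x.cons f) (Ψ X)

theorem push_diffSum (f : Y ⟶ Z) (Ψ : Fam Z T) : push f (diffSum Ψ) = colD (fun f' => push f' Ψ) f +
      (columnDeg f).negOnePow • diffSum (push f Ψ) := by
  funext X γ
  rw [push_apply, diffSum_cons]
  have := colD_hom (evalFam γ) (fun f' : Y ⟶ Z => push f' Ψ) f
  exact congrArg (· + _) this.symm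

theorem diffSum_congr (γ : Rect X Z) (Ψ Ψ' : Fam Z T)
    (h : ∀ (X' : Row R C p) (γ' : Rect X' Z), γ'.length = γ.length →
      Ψ X' γ' = Ψ' X' γ') : diffSum Ψ X γ = diffSum Ψ' X γ := by
  induction γ with
  | nil => rfl
  | cons γ f ih =>
    rw [diffSum_cons, diffSum_cons,
      ih (push f Ψ) (push f Ψ') fun X' γ' h' => h X' _ (by simpa using h')]
    congr 2
    funext f'
    exact h _ _ rfl

/-- The differential of the values. -/
def dVal {Z : Row R C p} : Fam Z T →ₗ[R] Fam Z T where
  toFun Ψ _ γ := dC _ _ (Ψ _ γ)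
  map_add' _ _ := by funext X γ; exact map_add _ _ _
  map_smul' _ _ := by funext X γ; exact map_smul _ _ _

theorem diffSum_dVal (Ψ : Fam Z T) : diffSum (dVal Ψ) = dVal (diffSum Ψ) := by
  funext X γ
  exact (signedSum_hom (dC X.tensor T) (diffs γ) (Ψ X)).symm

/-! #### Multilinear families -/

/-- `Ψ` is linear in every entry of the rectangle. -/
structure Ml {Z : Row R C p} (Ψ : Fam Z T) : Prop where
  ml : ∀ {Y' Y : Row R C p} (β : Rect Y Z), ColMl (M := Fam Y' T)
    fun (f : Y' ⟶ Y) X α => Ψ X ((α.cons f).comp β)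

variable {Y Z : Row R C p} {Ψ Ψ' : Fam Z T}

protected theorem Ml.push (h : Ml Ψ) (f : Y ⟶ Z) : Ml (push f Ψ) := ⟨fun β => h.ml (β.cons f)⟩

theorem Ml.col (h : Ml Ψ) : ColMl fun f : Y ⟶ Z => push f Ψ := h.ml .nil

/-- A coinduction principle for multilinearity. -/
theorem Ml.coinduct (P : ∀ {Z : Row R C p}, Fam Z T → Prop)
    (h1 : ∀ {Y Z : Row R C p} {Ψ : Fam Z T}, P Ψ → ColMl fun f : Y ⟶ Z => push f Ψ)
    (h2 : ∀ {Y Z : Row R C p} {Ψ : Fam Z T}, P Ψ → ∀ f : Y ⟶ Z, P (push f Ψ))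
    {Ψ : Fam Z T} (h : P Ψ) : Ml Ψ := by
  refine ⟨fun β => ?_⟩
  induction β with
  | nil => exact h1 h
  | cons β f ih => exact ih (h2 h f)

theorem Ml.zero : Ml (0 : Fam Z T) := ⟨fun _ => ColMl.zero⟩

theorem Ml.add (h : Ml Ψ) (h' : Ml Ψ') : Ml (Ψ + Ψ') := ⟨fun β => (h.ml β).add (h'.ml β)⟩

theorem Ml.smul (h : Ml Ψ) (c : R) : Ml (c • Ψ) :=
  ⟨fun β => (h.ml β).comp_linear (LinearMap.lsmul R _ c)⟩

theorem Ml.units_smul (h : Ml Ψ) (s : ℤˣ) : Ml (s • Ψ) := by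
  obtain rfl | rfl := Int.units_eq_one_or s
  · simpa using h
  · simpa using h.smul (-1)

theorem Ml.neg (h : Ml Ψ) : Ml (-Ψ) := by simpa using h.units_smul (-1)

theorem Ml.sub (h : Ml Ψ) (h' : Ml Ψ') : Ml (Ψ - Ψ') := by
  simpa [sub_eq_add_neg] using h.add h'.neg

theorem Ml.sum {I : Type*} (s : Finset I) {Ψ : I → Fam Z T} (h : ∀ i ∈ s, Ml (Ψ i)) :
    Ml (∑ i ∈ s, Ψ i) := by
  classical
  induction s using Finset.induction_on with
  | empty => simpa using Ml.zero
  | insert i s hi ih =>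
    rw [Finset.sum_insert hi]
    exact (h i (by simp)).add (ih fun j hj => h j (by simp [hj]))

theorem Ml.of_push (h1 : ∀ {Y : Row R C p}, ColMl fun f : Y ⟶ Z => push f Ψ)
    (h2 : ∀ {Y : Row R C p} (f : Y ⟶ Z), Ml (push f Ψ)) : Ml Ψ := by
  refine ⟨fun β => ?_⟩
  cases β with
  | nil => exact h1
  | cons β f => exact (h2 f).ml β

protected theorem Ml.post (h : Ml Ψ) (g : T ⟶ T') : Ml (post g Ψ) := by
  refine Ml.coinduct (fun {Z} Ψ => ∃ Ψ' : Fam Z _, Ml Ψ' ∧ Ψ = post g Ψ') ?_ ?_ ⟨Ψ, h, rfl⟩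
  · rintro Y Z _ ⟨Ψ, h, rfl⟩
    exact h.col.comp_linear (post g)
  · rintro Y Z _ ⟨Ψ, h, rfl⟩ f
    exact ⟨_, h.push f, rfl⟩

theorem ColMl.mergeSign_left {M : Type*} [AddCommGroup M] [Module R M]
    {G : (X ⟶ Y) → M} (hG : ColMl G) (f : Y ⟶ Z) : ColMl fun e => mergeSign e f • G e :=
  hG.sign fun a => (∑ i, ∑ k, if k < i then (f i).deg * a k else 0).negOnePow

theorem ColMl.mergeSign_right {M : Type*} [AddCommGroup M] [Module R M]
    {G : (Y ⟶ Z) → M} (hG : ColMl G) (e : X ⟶ Y) : ColMl fun f => mergeSign e f • G f :=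
  hG.sign fun a => (∑ i, ∑ k, if k < i then a i * (e k).deg else 0).negOnePow

protected theorem ColMl.columnDeg {M : Type*} [AddCommGroup M] [Module R M]
    {G : (X ⟶ Y) → M} (hG : ColMl G) (s : ℤ → ℤˣ) :
    ColMl fun f => s (columnDeg f) • G f :=
  hG.sign fun a => s (∑ i, a i)

protected theorem Ml.act (h : Ml Ψ) (f : Y ⟶ Z) : Ml (act f Ψ) :=
  Ml.of_push ((h.col.colComp_left f).mergeSign_left f) fun e =>
    (h.push (colComp e f)).units_smul _

theorem colMl_pi {G : (X ⟶ Y) → Fam W T}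
    (hG : ∀ (V : Row R C p) (γ : Rect V W), ColMl fun f => G f V γ) : ColMl G :=
  ⟨fun f i x y z h1 h2 h3 => funext fun V => funext fun γ =>
      (hG V γ).map_add f i x y z h1 h2 h3,
    fun f i c x z h1 h2 => funext fun V => funext fun γ => (hG V γ).map_smul f i c x z h1 h2⟩

/-- Precomposition, as a linear map. -/
def precomp {X Y : C} (T : C) (g : X ⟶ Y) : (Y ⟶ T) →ₗ[R] (X ⟶ T) where
  toFun h := g ≫ h
  map_add' _ _ := Preadditive.comp_add _ _ _ _ _ _
  map_smul' _ _ := Linear.comp_smul _ _ _ _ _ _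

/-- Postcomposition, as a linear map. -/
def postcomp {X Y : C} (T : C) (g : X ⟶ Y) : (T ⟶ X) →ₗ[R] (T ⟶ Y) where
  toFun h := h ≫ g
  map_add' _ _ := Preadditive.add_comp _ _ _ _ _ _
  map_smul' _ _ := Linear.smul_comp _ _ _ _ _ _

theorem Ml.colMl_act (h : Ml Ψ) : ColMl fun f : Y ⟶ Z => act f Ψ := by
  refine colMl_pi fun V γ => ?_
  cases γ with
  | nil => exact columnTensor_colMl.comp_linear (postcomp Y.tensor (Ψ Z .nil))
  | cons γ e =>
    exact (((h.col.comp_linear (evalFam γ)).colComp_right e).mergeSign_right e)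

protected theorem Ml.bar (h : Ml Ψ) : Ml (bar Ψ) := by
  refine Ml.coinduct (fun {Z} Ψ => ∃ Ψ₁ Ψ₂ : Fam Z T, Ml Ψ₁ ∧ Ml Ψ₂ ∧ Ψ = Ψ₁ + bar Ψ₂) ?_ ?_
    ⟨0, Ψ, Ml.zero, h, (zero_add _).symm⟩
  · rintro Y Z _ ⟨Ψ₁, Ψ₂, h₁, h₂, rfl⟩
    simp only [map_add, push_bar, sub_eq_add_neg]
    exact h₁.col.add (h₂.colMl_act.neg.add (h₂.col.comp_linear bar).neg)
  · rintro Y Z _ ⟨Ψ₁, Ψ₂, h₁, h₂, rfl⟩ f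
    refine ⟨_, _, (h₁.push f).sub (h₂.act f), (h₂.push f).neg, ?_⟩
    rw [map_add, push_bar, map_neg]
    abel

theorem Ml.colD_push (h : Ml Ψ) (f : Y ⟶ Z) : Ml (colD (fun f' => push f' Ψ) f) :=
  Ml.sum _ fun _ _ => (h.push _).units_smul _

protected theorem Ml.diffSum (h : Ml Ψ) : Ml (diffSum Ψ) := by
  refine Ml.coinduct (fun {Z} Ψ => ∃ Ψ₁ Ψ₂ : Fam Z T, Ml Ψ₁ ∧ Ml Ψ₂ ∧ Ψ = Ψ₁ + diffSum Ψ₂)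
    ?_ ?_ ⟨0, Ψ, Ml.zero, h, (zero_add _).symm⟩
  · rintro Y Z _ ⟨Ψ₁, Ψ₂, h₁, h₂, rfl⟩
    simp only [map_add, push_diffSum]
    exact h₁.col.add (h₂.col.colD.add ((h₂.col.comp_linear diffSum).columnDeg Int.negOnePow))
  · rintro Y Z _ ⟨Ψ₁, Ψ₂, h₁, h₂, rfl⟩ f
    refine ⟨_, (columnDeg f).negOnePow • push f Ψ₂,
      (h₁.push f).add (h₂.colD_push f), (h₂.push f).units_smul _, ?_⟩
    rw [map_add, push_diffSum, map_usmul, add_assoc]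

protected theorem Ml.dVal (h : Ml Ψ) : Ml (dVal Ψ) := by
  refine Ml.coinduct (fun {Z} Ψ => ∃ Ψ' : Fam Z _, Ml Ψ' ∧ Ψ = dVal Ψ') ?_ ?_ ⟨Ψ, h, rfl⟩
  · rintro Y Z _ ⟨Ψ, h, rfl⟩
    exact h.col.comp_linear dVal
  · rintro Y Z _ ⟨Ψ, h, rfl⟩ f
    exact ⟨_, h.push f, rfl⟩

theorem diffSum_diffSum (h : Ml Ψ) : diffSum (diffSum Ψ) = 0 := by
  funext X γ
  induction γ with
  | nil => rfl
  | cons γ f ih =>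
    have h1 : push f (diffSum (diffSum Ψ)) = (columnDeg f).negOnePow •
        (columnDeg f).negOnePow • diffSum (diffSum (push f Ψ)) := by
      rw [push_diffSum]
      simp only [push_diffSum, colD_add, map_add]
      rw [colD_colD h.col, zero_add, colD_hom, map_usmul, smul_add, ← add_assoc]
      convert zero_add _ using 2
      simp only [colD, smul_sum, ← sum_add_distrib]
      refine sum_eq_zero fun i _ => ?_
      rw [columnDeg_update]
      simp [HomogHom.d, negOnePow_add, smul_comm (colSign f i)]
    have := congrFun (congrFun h1 X) γ
    refine this.trans ?_
    change (columnDeg f).negOnePow • (columnDeg f).negOnePow • diffSum (diffSum (push f Ψ)) _ γ = 0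
    rw [ih (h.push f)]
    simp

/-! #### Homogeneous families -/

/-- The values of `Ψ` are homogeneous of degree `r`. -/
def Hg (r : ℤ) (Ψ : Fam Z T) : Prop :=
  ∀ (X : Row R C p) (γ : Rect X Z), Ψ X γ ∈ gr (R := R) _ _ (totalDeg γ + r)

variable {r : ℤ}

protected theorem Hg.push (h : Hg r Ψ) (f : Y ⟶ Z) : Hg (columnDeg f + r) (push f Ψ) := fun X γ => by
  have := h X (γ.cons f)
  rwa [totalDeg, add_assoc] at this

theorem Hg.of_push (h0 : Ψ Z .nil ∈ gr (R := R) Z.tensor T r)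
    (h : ∀ {Y : Row R C p} (f : Y ⟶ Z), Hg (columnDeg f + r) (push f Ψ)) :
    Hg r Ψ := by
  intro X γ
  cases γ with
  | nil => simpa [totalDeg] using h0
  | cons γ f =>
    have := h f X γ
    rwa [← add_assoc] at this

theorem Hg.nil (h : Hg r Ψ) : Ψ Z .nil ∈ gr (R := R) Z.tensor T r := by
  simpa [totalDeg] using h Z .nil

theorem Hg.zero : Hg r (0 : Fam Z T) := fun _ _ => Submodule.zero_mem _

theorem Hg.add (h : Hg r Ψ) (h' : Hg r Ψ') : Hg r (Ψ + Ψ') := fun X γ =>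
  Submodule.add_mem _ (h X γ) (h' X γ)

theorem Hg.units_smul (h : Hg r Ψ) (s : ℤˣ) : Hg r (s • Ψ) := fun X γ =>
  units_mem_smul _ s (h X γ)

theorem Hg.neg (h : Hg r Ψ) : Hg r (-Ψ) := by simpa using h.units_smul (-1)

theorem Hg.sub (h : Hg r Ψ) (h' : Hg r Ψ') : Hg r (Ψ - Ψ') := by
  simpa [sub_eq_add_neg] using h.add h'.neg

protected theorem Hg.act (h : Hg r Ψ) (f : Y ⟶ Z) : Hg (columnDeg f + r) (act f Ψ) := by
  refine Hg.of_push (comp_mem (columnTensor_mem f) h.nil) fun e => ?_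
  have := (h.push (colComp e f)).units_smul (mergeSign e f)
  rwa [columnDeg_colComp, add_assoc] at this

protected theorem Hg.bar (h : Hg r Ψ) : Hg r (bar Ψ) := by
  intro X γ
  induction γ generalizing r with
  | nil => exact Submodule.zero_mem _
  | cons γ f ih =>
    rw [bar_cons, totalDeg, add_assoc]
    exact Submodule.sub_mem _ (Submodule.neg_mem _ (h.act f X γ)) (ih (h.push f))

protected theorem Hg.dVal (h : Hg r Ψ) : Hg (r + 1) (dVal Ψ) := fun X γ => by
  rw [← add_assoc]
  exact DGCategory.d_mem (h X γ)

protected theorem Hg.diffSum (h : Hg r Ψ) : Hg (r + 1) (diffSum Ψ) := by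
  intro X γ
  induction γ generalizing r with
  | nil => exact Submodule.zero_mem _
  | cons γ f ih =>
    rw [diffSum_cons]
    refine Submodule.add_mem _ (Submodule.sum_mem _ fun i _ => units_mem_smul _ _ ?_)
      (units_mem_smul _ _ ?_)
    · have := h X (γ.cons (update f i (f i).d))
      rw [totalDeg, columnDeg_update] at this
      convert this using 2
      simp [totalDeg, HomogHom.d]; ring
    · have := ih (h.push f)
      convert this using 2
      simp [totalDeg]; ring

/-! #### Reduced families -/

/-- `Ψ` vanishes on rectangles with a column of identities. -/
structure Red (Ψ : Fam Z T) : Prop where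
  vanish : ∀ {X Y : Row R C p} (α : Rect X Y) (β : Rect Y Z), Ψ X ((α.cons (idColumn Y)).comp β) = 0

protected theorem Red.push (h : Red Ψ) (f : Y ⟶ Z) : Red (push f Ψ) :=
  ⟨fun α β => h.vanish α (β.cons f)⟩

theorem Red.push_id (h : Red Ψ) : push (idColumn Z) Ψ = 0 := by
  funext X α
  exact h.vanish α .nil

theorem Red.coinduct (P : ∀ {Z : Row R C p}, Fam Z T → Prop)
    (h1 : ∀ {Z : Row R C p} {Ψ : Fam Z T}, P Ψ → push (idColumn Z) Ψ = 0)
    (h2 : ∀ {Y Z : Row R C p} {Ψ : Fam Z T}, P Ψ → ∀ f : Y ⟶ Z, P (push f Ψ))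
    {Ψ : Fam Z T} (h : P Ψ) : Red Ψ := by
  refine ⟨fun α β => ?_⟩
  induction β with
  | nil => exact congrFun (congrFun (h1 h) _) α
  | cons β f ih => exact ih (h2 h f)

theorem Red.zero : Red (0 : Fam Z T) := ⟨fun _ _ => rfl⟩

theorem Red.add (h : Red Ψ) (h' : Red Ψ') : Red (Ψ + Ψ') := ⟨fun α β => by
  rw [Pi.add_apply, Pi.add_apply, h.vanish, h'.vanish, add_zero]⟩

theorem Red.units_smul (h : Red Ψ) (s : ℤˣ) : Red (s • Ψ) := ⟨fun α β => by
  change s • Ψ _ _ = 0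
  rw [h.vanish, smul_zero]⟩

theorem Red.neg (h : Red Ψ) : Red (-Ψ) := by simpa using h.units_smul (-1)

theorem Red.sub (h : Red Ψ) (h' : Red Ψ') : Red (Ψ - Ψ') := by
  simpa [sub_eq_add_neg] using h.add h'.neg

theorem Red.sum {I : Type*} (s : Finset I) {Ψ : I → Fam Z T} (h : ∀ i ∈ s, Red (Ψ i)) :
    Red (∑ i ∈ s, Ψ i) := by
  classical
  induction s using Finset.induction_on with
  | empty => simpa using Red.zero
  | insert i s hi ih =>
    rw [Finset.sum_insert hi]
    exact (h i (by simp)).add (ih fun j hj => h j (by simp [hj]))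

protected theorem Red.post (h : Red Ψ) (g : T ⟶ T') : Red (post g Ψ) := ⟨fun α β => by
  change Ψ _ _ ≫ g = 0
  rw [h.vanish, Limits.zero_comp]⟩

protected theorem Red.dVal (h : Red Ψ) : Red (dVal Ψ) := ⟨fun α β => by
  change dC _ _ (Ψ _ _) = 0
  rw [h.vanish, map_zero]⟩

protected theorem Red.diffSum (h : Red Ψ) (h' : Ml Ψ) : Red (diffSum Ψ) := by
  refine Red.coinduct (fun {Z} Ψ => ∃ Ψ₁ Ψ₂ : Fam Z T, Red Ψ₁ ∧ Red Ψ₂ ∧ Ml Ψ₂ ∧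
    Ψ = Ψ₁ + diffSum Ψ₂) ?_ ?_ ⟨0, Ψ, Red.zero, h, h', (zero_add _).symm⟩
  · rintro Z _ ⟨Ψ₁, Ψ₂, h₁, h₂, h₃, rfl⟩
    rw [map_add, push_diffSum, h₁.push_id, h₂.push_id, map_zero, smul_zero, add_zero, zero_add]
    refine sum_eq_zero fun i _ => ?_
    exact (congrArg _ (h₃.col.update_zero _ _ _ (d_id _))).trans (smul_zero _)
  · rintro Y Z _ ⟨Ψ₁, Ψ₂, h₁, h₂, h₃, rfl⟩ f
    refine ⟨push f Ψ₁ + colD (fun f' => push f' Ψ₂) f, (columnDeg f).negOnePow • push f Ψ₂,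
      (h₁.push f).add (Red.sum _ fun i _ => (h₂.push _).units_smul _),
      (h₂.push f).units_smul _, (h₃.push f).units_smul _, ?_⟩
    rw [map_add, push_diffSum, map_usmul, add_assoc]

theorem Red.add_bar {Ψ₁ : Fam Z T} (h : Red Ψ) (h₁ : push (idColumn Z) Ψ₁ = Ψ)
    (h₂ : ∀ {Y : Row R C p} (f : Y ⟶ Z), Red (push f Ψ₁)) :
    Red (Ψ₁ + bar Ψ) := by
  refine Red.coinduct (fun {Z} Ψ => ∃ Ψ₁ Ψ₂ : Fam Z T, Red Ψ₂ ∧ push (idColumn Z) Ψ₁ = Ψ₂ ∧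
    (∀ {Y : Row R C p} (f : Y ⟶ Z), Red (push f Ψ₁)) ∧
    Ψ = Ψ₁ + bar Ψ₂) ?_ ?_ ⟨Ψ₁, Ψ, h, h₁, h₂, rfl⟩
  · rintro Z _ ⟨Ψ₁, Ψ₂, h₁, h₂, h₃, rfl⟩
    rw [map_add, push_bar, h₁.push_id, map_zero, h₂, act_idColumn]
    abel
  · rintro Y Z _ ⟨Ψ₁, Ψ₂, h₁, h₂, h₃, rfl⟩ f
    refine ⟨push f Ψ₁ - act f Ψ₂, -push f Ψ₂, (h₁.push f).neg, ?_, ?_, ?_⟩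
    · rw [map_sub, (h₃ f).push_id, push_act, mergeSign_idColumn_left, one_smul, idColumn_colComp,
        zero_sub]
    · intro W g
      rw [map_sub, push_act]
      exact ((h₃ f).push g).sub ((h₁.push _).units_smul _)
    · rw [map_add, push_bar, map_neg]
      abel

/-! #### The internal differential and the bar differential -/

theorem act_diffSum (h : Ml Ψ) (hr : Hg r Ψ) (f : Y ⟶ Z) (X : Row R C p) (γ : Rect X Y) :
    colD (fun f' => act f' Ψ X γ) f + (columnDeg f).negOnePow • diffSum (act f Ψ) X γ -
      act f (diffSum Ψ) X γ =
    r.negOnePow • (dVal (act f Ψ) X γ - act f (dVal Ψ) X γ) := by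
  cases γ with
  | nil =>
    simp only [act_nil, diffSum_nil, Limits.comp_zero, smul_zero, add_zero, sub_zero]
    have h1 : dVal (act f Ψ) Y .nil = _ :=
      d_comp (R := R) (columnTensor f) hr.nil
    rw [h1, d_columnTensor]
    change _ = _ • (_ + _ - columnTensor f ≫ dC _ _ (Ψ Z .nil))
    rw [add_sub_cancel_left, ← mul_smul, Int.units_mul_self, one_smul]
    exact (colD_hom (postcomp (R := R) Y.tensor (Ψ Z .nil)) _ _).symm
  | cons γ e =>
    have h1 : dVal (act f Ψ) X (γ.cons e) = act f (dVal Ψ) X (γ.cons e) :=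
      map_usmul (dC X.tensor T) _ _
    have h2 := colD_colComp (G := fun g => Ψ X (γ.cons g)) (h.col.comp_linear (evalFam γ)) e f
    rw [h1, sub_self, smul_zero, diffSum_cons, act_cons, diffSum_cons, push_act, smul_add (mergeSign e f),
      h2, map_usmul, columnDeg_colComp]
    simp only [smul_add, negOnePow_add, mul_smul]
    rw [show (mergeSign e f • diffSum (push (colComp e f) Ψ)) X γ
      = mergeSign e f • diffSum (push (colComp e f) Ψ) X γ
      from rfl, smul_comm (mergeSign e f), smul_comm (mergeSign e f),
      smul_comm (columnDeg e).negOnePow, sub_eq_zero, add_assoc,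
      smul_comm (mergeSign e f) (columnDeg e).negOnePow,
      smul_comm (columnDeg f).negOnePow (columnDeg e).negOnePow]
    rfl

theorem bar_diffSum (h : Ml Ψ) (hr : Hg r Ψ) (X : Row R C p) (γ : Rect X Z) : bar (diffSum Ψ) X γ -
        diffSum (bar Ψ) X γ =
      r.negOnePow • (bar (dVal Ψ) X γ - dVal (bar Ψ) X γ) := by
  induction γ generalizing r with
  | nil =>
    rw [bar_nil, diffSum_nil, bar_nil]
    change (0 : _ ⟶ _) - 0 = _ • (0 - dC _ _ 0)
    rw [map_zero, sub_zero, smul_zero]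
  | cons γ f ih =>
    have h1 := act_diffSum h hr f X γ
    have h2 := ih (h.push f) (hr.push f)
    have h3 : bar (push f (diffSum Ψ)) X γ = colD (fun f' => bar (push f' Ψ) X γ) f +
        (columnDeg f).negOnePow • bar (diffSum (push f Ψ)) X γ := by
      rw [push_diffSum, map_add, map_usmul]
      have h8 := colD_hom ((evalFam γ).comp bar) (fun f' => push f' Ψ) f
      rw [← show _ = colD (fun f' => bar (push f' Ψ) X γ) f from h8]
      rfl
    have h4 : diffSum (bar Ψ) X (γ.cons f) = -colD (fun f' => act f' Ψ X γ) f
        - colD (fun f' => bar (push f' Ψ) X γ) f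
        - (columnDeg f).negOnePow • diffSum (act f Ψ) X γ
        - (columnDeg f).negOnePow • diffSum
            (bar (push f Ψ)) X γ := by
      rw [diffSum_cons, push_bar]
      simp only [bar_cons, sub_eq_add_neg, colD_add, colD_neg, map_add, map_neg]
      simp only [Pi.add_apply, Pi.neg_apply, smul_add, smul_neg]
      abel
    have h5 : dVal (bar Ψ) X (γ.cons f) = -dVal (act f Ψ) X γ - dVal (bar (push f Ψ)) X γ := by
      change dC X.tensor T (-act f Ψ X γ - bar (push f Ψ) X γ) = _
      rw [map_sub, map_neg]
      rfl
    have h6 : push f (dVal Ψ) = dVal (push f Ψ) := rfl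
    rw [bar_cons, h3, h4, bar_cons, h5, h6]
    rw [negOnePow_add, mul_smul] at h2
    have h7 : (columnDeg f).negOnePow • (bar (diffSum (push f Ψ)) X γ - diffSum (bar
        (push f Ψ)) X γ) = r.negOnePow • (bar
        (dVal (push f Ψ)) X γ - dVal
        (bar (push f Ψ)) X γ) := by
      rw [h2, ← mul_smul, Int.units_mul_self, one_smul]
    have h8 := congrArg₂ (· - ·) h1 h7
    simp only [smul_sub, smul_neg] at h8 ⊢
    rw [← sub_eq_zero] at h8 ⊢
    rw [← h8]
    abel

end Families

/-! ### Coherence -/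

section Coherence

variable {ι κ : Type}

local notation f " ⊗' " g => tHom f g

theorem tensorHom_assoc_inv {X X' Y Y' Z Z' : C} (f : X ⟶ X') (g : Y ⟶ Y') (h : Z ⟶ Z') :
    (f ⊗' (g ⊗' h)) ≫ (αC X' Y' Z').inv = (αC X Y Z).inv ≫ ((f ⊗' g) ⊗' h) := by
  rw [Iso.eq_inv_comp, ← assoc, ← assoc_naturality, assoc, Iso.hom_inv_id, comp_id]

theorem d_inv_eq_zero {X Y : C} (e : X ≅ Y) (he' : e.inv ∈ gr (R := R) Y X 0)
    (h : dC X Y e.hom = 0) : dC Y X e.inv = 0 := by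
  have h1 := d_comp (R := R) e.hom he'
  rw [e.hom_inv_id, h, Limits.zero_comp, smul_zero, add_zero] at h1
  rw [d_id] at h1
  rw [← id_comp (dC Y X e.inv), ← e.inv_hom_id, assoc, ← h1, Limits.comp_zero]

variable (R) in
/-- Canonical morphisms between tensor products bracketed by trees. -/
inductive Coh (X : ι → C) : ∀ s t : BTree ι, (treeObj R X s ⟶ treeObj R X t) → Prop
  | id (t) : Coh X t t (𝟙 _)
  | comp {s t u} {f : treeObj R X s ⟶ treeObj R X t} {g : treeObj R X t ⟶ treeObj R X u} :
      Coh X s t f → Coh X t u g → Coh X s u (f ≫ g)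
  | tensor {s t s' t'} {f : treeObj R X s ⟶ treeObj R X t} {g : treeObj R X s' ⟶ treeObj R X t'} :
      Coh X s t f → Coh X s' t' g → Coh X (.node s s') (.node t t') (tHom f g)
  | assoc (s t u) : Coh X (.node (.node s t) u) (.node s (.node t u))
      (αC _ _ _).hom
  | assocInv (s t u) : Coh X (.node s (.node t u)) (.node (.node s t) u)
      (αC _ _ _).inv

namespace Coh

variable {X Y : ι → C} {s t u : BTree ι}

theorem mem {f : treeObj R X s ⟶ treeObj R X t} (h : Coh R X s t f) : f ∈ gr (R := R) _ _ 0 := by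
  induction h with
  | id t => exact id_mem _
  | comp _ _ h h' => simpa using comp_mem h h'
  | tensor _ _ h h' =>
    have := tensorHom_mem h h'
    rw [add_zero] at this
    exact this
  | assoc s t u => exact assoc_hom_mem _ _ _
  | assocInv s t u => exact assoc_inv_mem _ _ _

theorem d_eq_zero {f : treeObj R X s ⟶ treeObj R X t} (h : Coh R X s t f) : dC _ _ f = 0 := by
  induction h with
  | id t => exact d_id _
  | comp _ h₂ h h' =>
    rw [d_comp _ h₂.mem, h, h']; simp
  | tensor h₁ _ h h' =>
    refine (d_tensorHom (R := R) _ h₁.mem).trans ?_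
    rw [h, h', map_zero, LinearMap.zero_apply, map_zero, smul_zero]
    exact add_zero _
  | assoc s t u => exact d_assoc_hom _ _ _
  | assocInv s t u =>
    exact d_inv_eq_zero (αC _ _ _) (assoc_inv_mem _ _ _) (d_assoc_hom _ _ _)

theorem exists_inv {f : treeObj R X s ⟶ treeObj R X t} (h : Coh R X s t f) :
    ∃ g, Coh R X t s g ∧ f ≫ g = 𝟙 _ ∧ g ≫ f = 𝟙 _ := by
  induction h with
  | id t => exact ⟨_, .id t, by simp, by simp⟩
  | comp _ _ h h' =>
    obtain ⟨f', hf, h1, h2⟩ := h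
    obtain ⟨g', hg, h3, h4⟩ := h'
    refine ⟨_, hg.comp hf, ?_, ?_⟩
    · rw [Category.assoc, reassoc_of% h3, h1]
    · rw [Category.assoc, reassoc_of% h2, h4]
  | tensor h h' ih ih' =>
    obtain ⟨f', hf, h1, h2⟩ := ih
    obtain ⟨g', hg, h3, h4⟩ := ih'
    refine ⟨_, hf.tensor hg, ?_, ?_⟩
    · refine (tensorHom_comp_left _ _ _ h.mem).trans ?_
      rw [h1, h3]
      exact tensorHom_id _ _
    · refine (tensorHom_comp_left _ _ _ hf.mem).trans ?_
      rw [h2, h4]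
      exact tensorHom_id _ _
  | assoc s t u => exact ⟨_, .assocInv s t u, Iso.hom_inv_id _, Iso.inv_hom_id _⟩
  | assocInv s t u => exact ⟨_, .assoc s t u, Iso.inv_hom_id _, Iso.hom_inv_id _⟩

theorem natural {f : treeObj R X s ⟶ treeObj R X t} (h : Coh R X s t f) (Y : ι → C) :
    ∃ g, Coh R Y s t g ∧ ∀ e : ∀ i, HomogHom R (X i) (Y i),
      (treeHom e s).hom ≫ g = f ≫ (treeHom e t).hom := by
  induction h with
  | id t => exact ⟨_, .id t, by simp⟩
  | comp _ _ h h' =>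
    obtain ⟨f', hf, h1⟩ := h
    obtain ⟨g', hg, h3⟩ := h'
    refine ⟨_, hf.comp hg, fun e => ?_⟩
    rw [← Category.assoc, h1, Category.assoc, h3, Category.assoc]
  | tensor h h' ih ih' =>
    obtain ⟨f', hf, h1⟩ := ih
    obtain ⟨g', hg, h3⟩ := ih'
    refine ⟨_, hf.tensor hg, fun e => ?_⟩
    refine (tensorHom_comp_right _ _ _ hg.mem).trans ?_
    rw [h1, h3]
    exact (tensorHom_comp_left _ _ _ h.mem).symm
  | assoc s t u =>
    exact ⟨_, .assoc s t u, fun e => assoc_naturality _ _ _⟩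
  | assocInv s t u =>
    exact ⟨_, .assocInv s t u, fun e => tensorHom_assoc_inv _ _ _⟩

end Coh

/-! #### Uniqueness of canonical morphisms -/

variable (R) in
/-- `((A ⊗ X i₀) ⊗ X i₁) ⊗ …`, for the leaves `i₀, i₁, …` of a tree. -/
def normObj (X : ι → C) : C → BTree ι → C
  | A, .leaf i => tensorObj R A (X i)
  | A, .node l r => normObj X (normObj X A l) r

variable (R) in
/-- `(X i₀ ⊗ X i₁) ⊗ …`, for the leaves `i₀, i₁, …` of a tree. -/
def normalForm (X : ι → C) : BTree ι → C
  | .leaf i => X i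
  | .node l r => normObj R X (normalForm X l) r

variable (R) in
/-- Rebracketing `A ⊗ t(X)` to the left. -/
def normIso (X : ι → C) : (A : C) → (t : BTree ι) →
    DegZeroIso R (tensorObj R A (treeObj R X t)) (normObj R X A t)
  | _, .leaf _ => .refl R _
  | A, .node l r => (DegZeroIso.assoc R A (treeObj R X l) (treeObj R X r)).symm.trans
      (((normIso X A l).whiskerRight (treeObj R X r)).trans (normIso X (normObj R X A l) r))

variable (R) in
/-- Rebracketing `t(X)` to the left. -/
def normalFormIso (X : ι → C) : (t : BTree ι) → DegZeroIso R (treeObj R X t) (normalForm R X t)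
  | .leaf _ => .refl R _
  | .node l r =>
      ((normalFormIso X l).whiskerRight (treeObj R X r)).trans (normIso R X (normalForm R X l) r)

theorem normIso_node (X : ι → C) (A : C) (l r : BTree ι) : (normIso R X A (.node l r)).hom =
      (αC A (treeObj R X l) (treeObj R X r)).inv ≫
        ((normIso R X A l).hom ⊗' 𝟙 (treeObj R X r)) ≫ (normIso R X (normObj R X A l) r).hom := rfl

theorem normalFormIso_node (X : ι → C) (l r : BTree ι) : (normalFormIso R X (.node l r)).hom =
        ((normalFormIso R X l).hom ⊗' 𝟙 (treeObj R X r)) ≫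
          (normIso R X (normalForm R X l) r).hom := rfl

theorem id_tensorHom_comp (A : C) {X Y Z : C} (f : X ⟶ Y) (g : Y ⟶ Z) :
    (𝟙 A ⊗' (f ≫ g)) = (𝟙 A ⊗' f) ≫ (𝟙 A ⊗' g) := by
  rw [tensorHom_comp_left _ _ _ (id_mem A), comp_id]

theorem comp_tensorHom_id (A : C) {X Y Z : C} (f : X ⟶ Y) (g : Y ⟶ Z) :
    ((f ≫ g) ⊗' 𝟙 A) = (f ⊗' 𝟙 A) ≫ (g ⊗' 𝟙 A) := by
  rw [tensorHom_comp_right _ _ _ (id_mem A), comp_id]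

theorem pentagon_inv (X Y Z W : C) : (𝟙 X ⊗' (αC Y Z W).hom) ≫ (αC X Y (tensorObj R Z W)).inv ≫
        (αC (tensorObj R X Y) Z W).inv =
    (αC X (tensorObj R Y Z) W).inv ≫ ((αC X Y Z).inv ⊗' 𝟙 W) := by
  have h := MonoidalDGCategory.pentagon (R := R) X Y Z W
  have h1 : ((αC X Y Z).inv ⊗' 𝟙 W) ≫ ((αC X Y Z).hom ⊗' 𝟙 W) = 𝟙 _ := by
    rw [tensorHom_comp_left _ _ _ (assoc_inv_mem _ _ _), Iso.inv_hom_id, id_comp, tensorHom_id]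
  rw [← assoc, Iso.comp_inv_eq, Iso.comp_inv_eq, assoc, assoc, ← h,
    reassoc_of% h1, Iso.inv_hom_id_assoc]

theorem tensorHom_normIso_aux {X : ι → C} {A A' B B' : C} {s t : BTree ι} {f : A ⟶ A'}
    {a : A ⟶ B} {a' : A' ⟶ B'} (ha : a ∈ gr (R := R) A B 0) (e : B = B')
    (hf : f ≫ a' = a ≫ eqToHom e) {g : treeObj R X s ⟶ treeObj R X t}
    {e' : normObj R X B' s = normObj R X B' t}
    (hg : (𝟙 B' ⊗' g) ≫ (normIso R X B' t).hom = (normIso R X B' s).hom ≫ eqToHom e') :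
    ∃ h : normObj R X B s = normObj R X B' t, (f ⊗' g) ≫ (a' ⊗' 𝟙 _) ≫ (normIso R X B' t).hom =
        (a ⊗' 𝟙 _) ≫ (normIso R X B s).hom ≫ eqToHom h := by
  subst e
  refine ⟨e', ?_⟩
  rw [eqToHom_refl, comp_id] at hf
  rw [← assoc, tensorHom_comp_right _ _ _ (id_mem _), hf, comp_id,
    ← hg, ← assoc, tensorHom_comp_left _ _ _ ha, comp_id, id_comp]

theorem rebracket_assoc {A B D E S T U : C} (a : tensorObj R A S ⟶ B) (b : tensorObj R B T ⟶ D)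
    (c : tensorObj R D U ⟶ E) :
    (𝟙 A ⊗' (αC S T U).hom) ≫ (αC A S (tensorObj R T U)).inv ≫
        (a ⊗' 𝟙 (tensorObj R T U)) ≫ (αC B T U).inv ≫ (b ⊗' 𝟙 U) ≫ c =
    (αC A (tensorObj R S T) U).inv ≫ (((αC A S T).inv ≫ (a ⊗' 𝟙 T) ≫ b) ⊗' 𝟙 U) ≫ c := by
  have h2 := pentagon_inv (R := R) A S T U
  have h3 := tensorHom_assoc_inv (R := R) a (𝟙 T) (𝟙 U)
  rw [comp_tensorHom_id, comp_tensorHom_id, ← tensorHom_id, reassoc_of% h3,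
    reassoc_of% h2, assoc, assoc]

theorem rebracket_assoc' {B D E S T U : C} (a : S ⟶ B) (b : tensorObj R B T ⟶ D)
    (c : tensorObj R D U ⟶ E) :
    (αC S T U).hom ≫ (a ⊗' 𝟙 (tensorObj R T U)) ≫ (αC B T U).inv ≫ (b ⊗' 𝟙 U) ≫ c =
      (((a ⊗' 𝟙 T) ≫ b) ⊗' 𝟙 U) ≫ c := by
  have h3 := tensorHom_assoc_inv (R := R) a (𝟙 T) (𝟙 U)
  rw [comp_tensorHom_id, ← tensorHom_id, reassoc_of% h3, Iso.hom_inv_id_assoc, assoc]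

theorem normIso_assoc (X : ι → C) (A : C) (s t u : BTree ι) :
    (𝟙 A ⊗' (αC (treeObj R X s) (treeObj R X t)
      (treeObj R X u)).hom) ≫ (normIso R X A (.node s (.node t u))).hom =
    (normIso R X A (.node (.node s t) u)).hom :=
  rebracket_assoc (R := R) _ _ _

theorem normalFormIso_assoc (X : ι → C) (s t u : BTree ι) : (αC (treeObj R X s) (treeObj R X t)
      (treeObj R X u)).hom ≫ (normalFormIso R X (.node s (.node t u))).hom =
    (normalFormIso R X (.node (.node s t) u)).hom :=
  rebracket_assoc' (R := R) _ _ _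

namespace Coh

variable {X : ι → C} {s t : BTree ι}

theorem tensorHom_normIso {f : treeObj R X s ⟶ treeObj R X t} (h : Coh R X s t f) :
    ∀ A : C, ∃ h : normObj R X A s = normObj R X A t,
      (𝟙 A ⊗' f) ≫ (normIso R X A t).hom = (normIso R X A s).hom ≫ eqToHom h := by
  induction h with
  | id t =>
    intro A
    refine ⟨rfl, ?_⟩
    rw [tensorHom_id, eqToHom_refl, id_comp, comp_id]
  | comp _ _ h h' =>
    intro A
    obtain ⟨e, h⟩ := h A
    obtain ⟨e', h'⟩ := h' A
    refine ⟨e.trans e', ?_⟩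
    rw [id_tensorHom_comp, Category.assoc, h', reassoc_of% h, eqToHom_trans]
  | tensor h h' ih ih' =>
    rename_i s t s' t' f g
    intro A
    obtain ⟨e, he⟩ := ih A
    obtain ⟨e', he'⟩ := ih' (normObj R X A t)
    obtain ⟨e'', he''⟩ := tensorHom_normIso_aux (normIso R X A s).hom_mem e he he'
    refine ⟨e'', ?_⟩
    refine (congrArg (_ ≫ ·) (normIso_node X A t t')).trans ?_
    have h2 := tensorHom_assoc_inv (R := R) (𝟙 A) f g
    refine ((reassoc_of% h2) _).trans ((congrArg (_ ≫ ·) he'').trans ?_)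
    exact ((Category.assoc _ _ _).trans (congrArg (_ ≫ ·) (Category.assoc _ _ _))).symm
  | assoc s t u =>
    intro A
    exact ⟨rfl, (normIso_assoc X A s t u).trans (comp_id _).symm⟩
  | assocInv s t u =>
    intro A
    refine ⟨rfl, Eq.trans ?_ (comp_id _).symm⟩
    refine (congrArg (_ ≫ ·) (normIso_assoc X A s t u).symm).trans ?_
    refine (Category.assoc _ _ _).symm.trans ?_
    refine (congrArg (· ≫ _) (id_tensorHom_comp A _ _).symm).trans ?_
    refine (congrArg (fun x => (𝟙 A ⊗' x) ≫ _) (Iso.inv_hom_id _)).trans ?_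
    exact (congrArg (· ≫ _) (tensorHom_id _ _)).trans (id_comp _)

theorem comp_normalFormIso {f : treeObj R X s ⟶ treeObj R X t} (h : Coh R X s t f) :
    ∃ h : normalForm R X s = normalForm R X t,
      f ≫ (normalFormIso R X t).hom = (normalFormIso R X s).hom ≫ eqToHom h := by
  induction h with
  | id t => exact ⟨rfl, by rw [eqToHom_refl, id_comp, comp_id]⟩
  | comp _ _ h h' =>
    obtain ⟨e, h⟩ := h
    obtain ⟨e', h'⟩ := h'
    refine ⟨e.trans e', ?_⟩
    rw [Category.assoc, h', reassoc_of% h, eqToHom_trans]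
  | tensor h h' ih ih' =>
    rename_i s t s' t' f g
    obtain ⟨e, he⟩ := ih
    obtain ⟨e', he'⟩ := h'.tensorHom_normIso (normalForm R X t)
    obtain ⟨e'', he''⟩ := tensorHom_normIso_aux (normalFormIso R X s).hom_mem e he he'
    refine ⟨e'', ?_⟩
    refine (congrArg (_ ≫ ·) (normalFormIso_node X t t')).trans (he''.trans ?_)
    exact (Category.assoc _ _ _).symm
  | assoc s t u =>
    exact ⟨rfl, (normalFormIso_assoc X s t u).trans (comp_id _).symm⟩
  | assocInv s t u =>
    refine ⟨rfl, Eq.trans ?_ (comp_id _).symm⟩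
    exact (Iso.inv_comp_eq _).2 (normalFormIso_assoc X s t u).symm

theorem unique {f g : treeObj R X s ⟶ treeObj R X t} (hf : Coh R X s t f) (hg : Coh R X s t g) :
    f = g := by
  obtain ⟨h, hf⟩ := hf.comp_normalFormIso
  obtain ⟨_, hg⟩ := hg.comp_normalFormIso
  exact (cancel_mono (normalFormIso R X t).toIso.hom).1 (hf.trans hg.symm)

end Coh

/-! #### Canonical morphisms up to equality of objects -/

variable (R) in
/-- Canonical morphisms between objects which are equal to tensor products bracketed by the trees
`s` and `t`. -/
def IsCan (X : ι → C) (s t : BTree ι) {A B : C} (f : A ⟶ B) : Prop :=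
  ∃ (hA : A = treeObj R X s) (hB : B = treeObj R X t),
    Coh R X s t (eqToHom hA.symm ≫ f ≫ eqToHom hB)

variable (R) in
/-- `e` is a tensor product of the `f i`, bracketed by `t`, up to equality of objects. -/
def IsTreeHom {X Y : ι → C} (f : ∀ i, HomogHom R (X i) (Y i)) (t : BTree ι) {A B : C}
    (e : A ⟶ B) : Prop :=
  ∃ (hA : A = treeObj R X t) (hB : B = treeObj R Y t),
    e = eqToHom hA ≫ (treeHom f t).hom ≫ eqToHom hB.symm

theorem Coh.isCanonical {X : ι → C} {s t : BTree ι} {f : treeObj R X s ⟶ treeObj R X t}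
    (h : Coh R X s t f) : IsCan R X s t f :=
  ⟨rfl, rfl, by simpa using h⟩

namespace IsCan

variable {X Y : ι → C} {s t u s' t' : BTree ι} {A B D A' B' : C}

theorem comp {f : A ⟶ B} {g : B ⟶ D} (hf : IsCan R X s t f) (hg : IsCan R X t u g) :
    IsCan R X s u (f ≫ g) := by
  obtain ⟨rfl, rfl, hf⟩ := hf
  obtain ⟨_, rfl, hg⟩ := hg
  simp only [eqToHom_refl, comp_id, id_comp] at hf hg
  exact (hf.comp hg).isCanonical

theorem tensor {f : A ⟶ B} {g : A' ⟶ B'} (hf : IsCan R X s t f) (hg : IsCan R X s' t' g) :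
    IsCan R X (.node s s') (.node t t') (tHom f g) := by
  obtain ⟨rfl, rfl, hf⟩ := hf
  obtain ⟨rfl, rfl, hg⟩ := hg
  simp only [eqToHom_refl, comp_id, id_comp] at hf hg
  exact (hf.tensor hg).isCanonical

theorem eqToHom (h : A = B) (hA : A = treeObj R X s) : IsCan R X s s (eqToHom h) := by
  subst h hA
  exact (Coh.id s).isCanonical

theorem id (hA : A = treeObj R X s) : IsCan R X s s (𝟙 A) := by
  subst hA
  exact (Coh.id s).isCanonical

theorem assoc (hA : A = treeObj R X s) (hB : B = treeObj R X t) (hD : D = treeObj R X u) :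
    IsCan R X (.node (.node s t) u) (.node s (.node t u)) (αC A B D).hom := by
  subst hA hB hD
  exact (Coh.assoc s t u).isCanonical

theorem inv {e : A ≅ B} (h : IsCan R X s t e.hom) : IsCan R X t s e.inv := by
  obtain ⟨rfl, rfl, h⟩ := h
  simp only [eqToHom_refl, comp_id, id_comp] at h
  obtain ⟨g, hg, h1, -⟩ := h.exists_inv
  rw [← Iso.eq_inv_comp, comp_id] at h1
  rw [← h1]
  exact hg.isCanonical

theorem unique {f g : A ⟶ B} (hf : IsCan R X s t f) (hg : IsCan R X s t g) : f = g := by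
  obtain ⟨rfl, rfl, hf⟩ := hf
  obtain ⟨_, _, hg⟩ := hg
  simp only [eqToHom_refl, comp_id, id_comp] at hf hg
  exact hf.unique hg

theorem congr {f : A ⟶ B} (hf : IsCan R X s t f) (hs : s = s') (ht : t = t') :
    IsCan R X s' t' f := hs ▸ ht ▸ hf

theorem source_eq {f : A ⟶ B} (hf : IsCan R X s t f) : A = treeObj R X s := hf.1

theorem target_eq {f : A ⟶ B} (hf : IsCan R X s t f) : B = treeObj R X t := hf.2.1

theorem heq {f : A ⟶ B} {g : A' ⟶ B'} (hf : IsCan R X s t f) (hg : IsCan R X s t g) : HEq f g := by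
  obtain rfl := hf.source_eq.trans hg.source_eq.symm
  obtain rfl := hf.target_eq.trans hg.target_eq.symm
  exact heq_of_eq (hf.unique hg)

theorem mem {f : A ⟶ B} (hf : IsCan R X s t f) : f ∈ gr (R := R) A B 0 := by
  obtain ⟨rfl, rfl, hf⟩ := hf
  simpa using hf.mem

theorem d_eq_zero {f : A ⟶ B} (hf : IsCan R X s t f) : dC A B f = 0 := by
  obtain ⟨rfl, rfl, hf⟩ := hf
  simpa using hf.d_eq_zero

theorem natural {f : A ⟶ B} {f' : A' ⟶ B'} (hf : IsCan R X s t f)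
    (hf' : IsCan R Y s t f') {e : ∀ i, HomogHom R (X i) (Y i)} {a : A ⟶ A'} {b : B ⟶ B'}
    (ha : IsTreeHom R e s a) (hb : IsTreeHom R e t b) : a ≫ f' = f ≫ b := by
  obtain ⟨rfl, rfl, hf⟩ := hf
  obtain ⟨rfl, rfl, hf'⟩ := hf'
  obtain ⟨_, _, rfl⟩ := ha
  obtain ⟨_, _, rfl⟩ := hb
  simp only [eqToHom_refl, comp_id, id_comp] at hf hf' ⊢
  obtain ⟨g, hg, h⟩ := hf.natural Y
  rw [hf'.unique hg, h]

end IsCan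

namespace IsTreeHom

variable {X Y : ι → C} {s t : BTree ι} {A B A' B' : C} {f : ∀ i, HomogHom R (X i) (Y i)}

theorem treeHom (f : ∀ i, HomogHom R (X i) (Y i)) (t : BTree ι) :
    IsTreeHom R f t (treeHom f t).hom := ⟨rfl, rfl, by simp⟩

theorem tensor {a : A ⟶ B} {b : A' ⟶ B'} (ha : IsTreeHom R f s a) (hb : IsTreeHom R f t b) :
    IsTreeHom R f (.node s t) (tHom a b) := by
  obtain ⟨rfl, rfl, rfl⟩ := ha
  obtain ⟨rfl, rfl, rfl⟩ := hb
  simp only [eqToHom_refl, comp_id, id_comp]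
  exact IsTreeHom.treeHom f (.node s t)

theorem unique {a b : A ⟶ B} (ha : IsTreeHom R f t a) (hb : IsTreeHom R f t b) : a = b := by
  obtain ⟨rfl, rfl, rfl⟩ := ha
  obtain ⟨_, _, rfl⟩ := hb
  rfl

theorem source_eq {a : A ⟶ B} (hf : IsTreeHom R f t a) : A = treeObj R X t := hf.1

theorem target_eq {a : A ⟶ B} (hf : IsTreeHom R f t a) : B = treeObj R Y t := hf.2.1

theorem heq {a : A ⟶ B} {b : A' ⟶ B'} (ha : IsTreeHom R f t a) (hb : IsTreeHom R f t b) :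
    HEq a b := by
  obtain rfl := ha.source_eq.trans hb.source_eq.symm
  obtain rfl := ha.target_eq.trans hb.target_eq.symm
  exact heq_of_eq (ha.unique hb)

end IsTreeHom

theorem HomogHom.heq {A B A' B' : C} (hA : A = A') (hB : B = B') {f : HomogHom R A B}
    {g : HomogHom R A' B'} (hd : f.deg = g.deg) (hh : HEq f.hom g.hom) : HEq f g := by
  subst hA hB
  exact heq_of_eq (HomogHom.ext' hd (eq_of_heq hh))

theorem treeObj_bind (X : κ → C) (F : ι → BTree κ) : ∀ t : BTree ι,
    treeObj R (fun i => treeObj R X (F i)) t = treeObj R X (t.bind F)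
  | .leaf _ => rfl
  | .node l r => congrArg₂ (tensorObj R) (treeObj_bind X F l) (treeObj_bind X F r)

theorem treeHom_bind {X Y : κ → C} (f : ∀ i, HomogHom R (X i) (Y i)) (F : ι → BTree κ) :
    ∀ t : BTree ι, IsTreeHom R f (t.bind F) (treeHom (fun i => treeHom f (F i)) t).hom
  | .leaf _ => IsTreeHom.treeHom _ _
  | .node l r => (treeHom_bind f F l).tensor (treeHom_bind f F r)

theorem treeHom_deg {X Y : ι → C} (f : ∀ i, HomogHom R (X i) (Y i)) :
    ∀ t : BTree ι, ∀ rest : List ι, (treeHom f t).deg + (rest.map fun i => (f i).deg).sum =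
      ((t.leavesAppend rest).map fun i => (f i).deg).sum
  | .leaf i, rest => by simp [BTree.leavesAppend, treeHom]
  | .node l r, rest => by
    rw [BTree.leavesAppend, ← treeHom_deg f l, ← treeHom_deg f r, ← add_assoc]
    rfl

/-- The tree `((F 0) (F 1)) … (F p)`. -/
def rowTree : (p : ℕ) → (Fin (p + 1) → BTree ι) → BTree ι
  | 0, F => F 0
  | p + 1, F => .node (rowTree p fun k => F k.castSucc) (F (Fin.last (p + 1)))

/-- The tree `(t i₀) i₁ …`. -/
def stackTree : BTree ι → List ι → BTree ι
  | t, [] => t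
  | t, i :: l => stackTree (.node t (.leaf i)) l

theorem rowTensor_eq (X : ι → C) : ∀ (p : ℕ) (F : Fin (p + 1) → BTree ι),
    rowTensor R p (fun k => treeObj R X (F k)) = treeObj R X (rowTree p F)
  | 0, _ => rfl
  | p + 1, F => congrArg (tensorObj R · (treeObj R X (F (Fin.last (p + 1)))))
      (rowTensor_eq X p fun k => F k.castSucc)

theorem rowTensorHom_isTreeHom {X Y : ι → C} (f : ∀ i, HomogHom R (X i) (Y i)) :
    ∀ (p : ℕ) (F : Fin (p + 1) → BTree ι), IsTreeHom R f (rowTree p F)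
      (rowTensorHom p fun k => treeHom f (F k)).hom
  | 0, _ => IsTreeHom.treeHom _ _
  | p + 1, F => (rowTensorHom_isTreeHom f p fun k => F k.castSucc).tensor (IsTreeHom.treeHom f _)

theorem rowTensorHom_isCanonical {X : ι → C} : ∀ (p : ℕ) {A B : Fin (p + 1) → C}
    (F G : Fin (p + 1) → BTree ι) (c : ∀ k, HomogHom R (A k) (B k)),
    (∀ k, IsCan R X (F k) (G k) (c k).hom) →
    IsCan R X (rowTree p F) (rowTree p G) (rowTensorHom p c).hom
  | 0, _, _, _, _, _, h => h 0
  | p + 1, _, _, F, G, c, h =>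
    (rowTensorHom_isCanonical p (fun k => F k.castSucc) (fun k => G k.castSucc) _
      fun k => h k.castSucc).tensor (h (Fin.last (p + 1)))

theorem treeHom_isCanonical {X : κ → C} {A B : ι → C} (F G : ι → BTree κ)
    (c : ∀ i, HomogHom R (A i) (B i)) (h : ∀ i, IsCan R X (F i) (G i) (c i).hom) :
    ∀ t : BTree ι, IsCan R X (t.bind F) (t.bind G) (treeHom c t).hom
  | .leaf i => h i
  | .node l r => (treeHom_isCanonical F G c h l).tensor (treeHom_isCanonical F G c h r)

theorem Coh.bind {X : κ → C} {F : ι → BTree κ} {s t : BTree ι}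
    {f : treeObj R (fun i => treeObj R X (F i)) s ⟶ treeObj R (fun i => treeObj R X (F i)) t}
    (h : Coh R (fun i => treeObj R X (F i)) s t f) :
    IsCan R X (s.bind F) (t.bind F) f := by
  induction h with
  | id t => exact .id (treeObj_bind X F t)
  | comp _ _ h h' => exact h.comp h'
  | tensor _ _ h h' => exact h.tensor h'
  | assoc s t u => exact .assoc (treeObj_bind X F s) (treeObj_bind X F t) (treeObj_bind X F u)
  | assocInv s t u =>
    exact (IsCan.assoc (treeObj_bind X F s) (treeObj_bind X F t) (treeObj_bind X F u)).inv

theorem IsCan.bind {X : κ → C} {F : ι → BTree κ} {s t : BTree ι} {A B : C} {f : A ⟶ B}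
    (h : IsCan R (fun i => treeObj R X (F i)) s t f) :
    IsCan R X (s.bind F) (t.bind F) f := by
  obtain ⟨rfl, rfl, h⟩ := h
  simp only [eqToHom_refl, comp_id, id_comp] at h
  exact h.bind

theorem stack_eq (X : ι → C) : ∀ (l : List ι) {A : C} {t : BTree ι}, A = treeObj R X t →
    stack R X A l = treeObj R X (stackTree t l)
  | [], _, _, h => h
  | i :: l, _, t, h => stack_eq X l (t := .node t (.leaf i)) (congrArg (tensorObj R · (X i)) h)

theorem stackIso_isCanonical {X : ι → C} : ∀ (l : List ι) {A B : C} {s t : BTree ι}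
    {e : DegZeroIso R A B}, IsCan R X s t e.hom →
    IsCan R X (stackTree s l) (stackTree t l) (stackIso X e l).hom
  | [], _, _, _, _, _, h => h
  | i :: l, _, _, s, t, e, h =>
    stackIso_isCanonical l (s := .node s (.leaf i)) (t := .node t (.leaf i))
      (e := e.whiskerRight (X i)) (h.tensor (.id rfl))

theorem absorb_isCanonical {X : ι → C} : ∀ (t : BTree ι) {A : C} {s : BTree ι} (rest : List ι),
    A = treeObj R X s → IsCan R X (stackTree (.node s t) rest)
      (stackTree s (t.leavesAppend rest)) (absorb R X t A rest).hom
  | .leaf i, _, s, rest, h =>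
    .id (stack_eq X rest (t := .node s (.leaf i)) (congrArg (tensorObj R · (X i)) h))
  | .node l r, _, s, rest, h => by
    refine (stackIso_isCanonical rest (e := (DegZeroIso.assoc R _ _ _).symm)
      (IsCan.inv (IsCan.assoc h rfl rfl))).comp
      ((absorb_isCanonical r (s := .node s l) rest (congrArg (tensorObj R · _) h)).comp
        (absorb_isCanonical l (r.leavesAppend rest) h))

theorem rebracketTree_isCanonical {X : ι → C} : ∀ (t : BTree ι) (rest : List ι),
    IsCan R X (stackTree t rest) (stackTree (.leaf t.head) (t.tail rest))
      (rebracketTree R X t rest).hom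
  | .leaf i, rest => .id (stack_eq X rest (t := .leaf i) rfl)
  | .node l r, rest => (absorb_isCanonical r rest rfl).comp
      (rebracketTree_isCanonical l (r.leavesAppend rest))

theorem rebracketForest_isCanonical {X : ι → C} : ∀ (p : ℕ) (F : Fin (p + 1) → BTree ι)
    (rest : List ι), IsCan R X (stackTree (rowTree p F) rest)
      (stackTree (.leaf (forestHead p F)) (forestTail p F rest)) (rebracketForest R X p F rest).hom
  | 0, F, rest => rebracketTree_isCanonical (F 0) rest
  | p + 1, F, rest => (absorb_isCanonical _ rest (rowTensor_eq X p _)).comp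
      (rebracketForest_isCanonical p (fun k => F k.castSucc) _)

theorem canonicalHom_isCanonical (X : ι → C) {p p' : ℕ} {F : Fin (p + 1) → BTree ι}
    {G : Fin (p' + 1) → BTree ι} (h : forestWord F = forestWord G) :
    IsCan R X (rowTree p F) (rowTree p' G) (canonicalHom R X F G).hom := by
  rw [canonicalHom, dif_pos h]
  refine (rebracketForest_isCanonical p F []).comp (.comp (t := stackTree (.leaf (forestHead p' G))
    (forestTail p' G [])) ?_ (rebracketForest_isCanonical p' G []).inv)
  exact (IsCan.eqToHom (congrArg (fun x : ι × List ι => stack R X (X x.1) x.2) h)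
    (stack_eq X _ rfl)).congr rfl
    (congrArg (fun x : ι × List ι => stackTree (.leaf x.1) x.2) h)

theorem canonicalHom_deg (X : ι → C) {p p' : ℕ} (F : Fin (p + 1) → BTree ι)
    (G : Fin (p' + 1) → BTree ι) : (canonicalHom R X F G).deg = 0 := by
  rw [canonicalHom]
  split_ifs <;> rfl

theorem splitFirst_isCanonical {X : ι → C} : ∀ (p : ℕ) {A : Fin (p + 2) → C}
    (F : Fin (p + 2) → BTree ι) (_ : ∀ k, A k = treeObj R X (F k)),
    IsCan R X (rowTree (p + 1) F) (.node (F 0) (rowTree p fun k => F k.succ)) (splitFirst R p A).hom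
  | 0, _, F, h => .id (congrArg₂ (tensorObj R) (h 0) (h 1))
  | p + 1, A, F, h => by
    have hr : (rowTensor R p fun i => A i.castSucc.succ) =
        treeObj R X (rowTree p fun k => F k.castSucc.succ) := by
      rw [← rowTensor_eq]
      exact congrArg _ (funext fun i => h _)
    exact ((splitFirst_isCanonical p (fun k => F k.castSucc) fun k => h _).tensor
      (.id (h (Fin.last (p + 2))))).comp (.assoc (h 0) hr (h (Fin.last (p + 2))))

end Coherence

/-! ### The boundary and the shuffle product of chains -/

section Chains

variable {A B M : Type*} [AddCommGroup M]

/-- The alternating sum of the values on the lists with one element removed. -/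
def bdry : (List A → M) → List A → M
  | _, [] => 0
  | ψ, v :: Q => ψ Q - bdry (fun S => ψ (v :: S)) Q

@[simp] theorem bdry_nil (ψ : List A → M) : bdry ψ [] = 0 := rfl

theorem bdry_cons (ψ : List A → M) (v : A) (Q : List A) :
    bdry ψ (v :: Q) = ψ Q - bdry (fun S => ψ (v :: S)) Q := rfl

theorem bdry_add (ψ χ : List A → M) (Q : List A) :
    bdry (fun S => ψ S + χ S) Q = bdry ψ Q + bdry χ Q := by
  induction Q generalizing ψ χ with
  | nil => simp
  | cons v Q ih => rw [bdry_cons, bdry_cons, bdry_cons, ih]; abel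

theorem bdry_units_smul (s : ℤˣ) (ψ : List A → M) (Q : List A) :
    bdry (fun S => s • ψ S) Q = s • bdry ψ Q := by
  induction Q generalizing ψ with
  | nil => simp
  | cons v Q ih => rw [bdry_cons, bdry_cons, ih, smul_sub]

theorem bdry_map (f : B → A) (ψ : List A → M) (Q : List B) :
    bdry (fun S => ψ (S.map f)) Q = bdry ψ (Q.map f) := by
  induction Q generalizing ψ with
  | nil => rfl
  | cons v Q ih =>
    rw [List.map_cons, bdry_cons, bdry_cons]
    exact congrArg (_ - ·) (ih fun S => ψ (f v :: S))

/-- The signed sum of the values on the shuffles of `a :: P` and `b :: Q`, without their common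
first element `(a, b)`. -/
def shuffleTail {M : Type*} [AddCommGroup M] : A → List A → B → List B → (List (A × B) → M) → M
  | _, [], _, [], ψ => ψ []
  | _, a' :: P, b, [], ψ => shuffleTail a' P b [] fun S => ψ ((a', b) :: S)
  | a, [], _, b' :: Q, ψ => shuffleTail a [] b' Q fun S => ψ ((a, b') :: S)
  | a, a' :: P, b, b' :: Q, ψ =>
    (-1 : ℤˣ) ^ (Q.length + 1) • shuffleTail a' P b (b' :: Q) (fun S => ψ ((a', b) :: S)) +
      shuffleTail a (a' :: P) b' Q fun S => ψ ((a, b') :: S)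
  termination_by _ P _ Q => P.length + Q.length

theorem signedSum_shufflePaths {A B : Type} (a : A) (P : List A) (b : B) (Q : List B)
    (ψ : List (A × B) → M) : signedSum (shufflePaths (a :: P) (b :: Q)) ψ =
      shuffleTail a P b Q fun S => ψ ((a, b) :: S) := by
  match P, Q with
  | [], [] => rw [shufflePaths, shuffleTail]; simp
  | a' :: P, [] =>
    rw [shufflePaths, shuffleTail, ← signedSum_shufflePaths a' P b [] fun S => ψ ((a, b) :: S)]
    exact signedSum_map_one _ _ _
  | [], b' :: Q =>
    rw [shufflePaths, shuffleTail, ← signedSum_shufflePaths a [] b' Q fun S => ψ ((a, b) :: S)]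
    exact signedSum_map_one _ _ _
  | a' :: P, b' :: Q =>
    rw [shufflePaths, shuffleTail, ← signedSum_shufflePaths a' P b (b' :: Q) (fun S => ψ ((a, b) :: S)),
      ← signedSum_shufflePaths a (a' :: P) b' Q (fun S => ψ ((a, b) :: S)), signedSum_append]
    congr 1
    · exact signedSum_map _ _ _ _
    · exact signedSum_map_one _ _ _
  termination_by P.length + Q.length

end Chains

section Realizations

theorem mergeSign_of_deg_left {p : ℕ} {X Y Z : Row R C p} {e : X ⟶ Y} (f : Y ⟶ Z)
    (h : ∀ i, (e i).deg = 0) : mergeSign e f = 1 := by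
  simp [mergeSign, h]

theorem mergeSign_of_deg_right {p : ℕ} {X Y Z : Row R C p} (e : X ⟶ Y) {f : Y ⟶ Z}
    (h : ∀ i, (f i).deg = 0) : mergeSign e f = 1 := by
  simp [mergeSign, h]

theorem neg_one_pow_smul_smul {M : Type*} [AddCommGroup M] (n : ℕ) (x : M) :
    (-1 : ℤˣ) ^ n • (-1 : ℤˣ) ^ n • x = x := by
  rw [← mul_smul, Int.units_mul_self, one_smul]

theorem homogeneous_induction {X Y : C} {P : (X ⟶ Y) → Prop}
    (h : ∀ (n : ℤ) (f : X ⟶ Y), f ∈ gr (R := R) X Y n → P f) (h0 : P 0)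
    (hadd : ∀ f g, P f → P g → P (f + g)) (f : X ⟶ Y) : P f := by
  classical
  have hf : f ∈ ⨆ n, gr (R := R) X Y n := by
    rw [(DGCategory.gr_isInternal (R := R) X Y).submodule_iSup_eq_top]; trivial
  exact Submodule.iSup_induction _ (motive := P) hf h h0 hadd

theorem d_comp_of_closed {X Y Z : C} {f : X ⟶ Y} (hf : dC X Y f = 0)
    (g : Y ⟶ Z) : dC X Z (f ≫ g) = f ≫ dC Y Z g := by
  refine homogeneous_induction (R := R) (P := fun g =>
    dC X Z (f ≫ g) = f ≫ dC Y Z g) ?_ ?_ ?_ g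
  · intro n g hg
    rw [d_comp f hg, hf, Limits.zero_comp, smul_zero, add_zero]
  · simp
  · intro g g' h h'
    rw [Preadditive.comp_add, map_add, h, h', map_add, Preadditive.comp_add]

/-- Functorial operations on columns, parametrized by `V`, with natural arrows between them. -/
structure Realization (R : Type w) [CommRing R] (C : Type u) [Category.{v} C] [Preadditive C]
    [Linear R C] [DGCategory R C] [MonoidalDGCategory R C] (V : Type) (p p' : ℕ) where
  obj : V → Row R C p → Row R C p'
  map : ∀ (x : V) {X Y : Row R C p}, (X ⟶ Y) → (obj x X ⟶ obj x Y)
  arr : ∀ (x y : V) (X : Row R C p), obj x X ⟶ obj y X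
  frm : ∀ (x : V) (X : Row R C p), X.tensor ⟶ (obj x X).tensor
  bck : ∀ (x : V) (X : Row R C p), (obj x X).tensor ⟶ X.tensor

namespace Realization

variable {V V' : Type} {p p' p'' : ℕ} {X Y Z : Row R C p}

/-- The laws of a realization. -/
structure Lawful (ρ : Realization R C V p p') : Prop where
  map_id : ∀ x (X : Row R C p), ρ.map x (idColumn X) = idColumn _
  arr_self : ∀ x (X : Row R C p), ρ.arr x x X = idColumn _
  arr_comp : ∀ x y z (X : Row R C p), colComp (ρ.arr x y X) (ρ.arr y z X) = ρ.arr x z X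
  arr_nat : ∀ x y {X Y : Row R C p} (f : X ⟶ Y),
    colComp (ρ.map x f) (ρ.arr x y Y) = colComp (ρ.arr x y X) (ρ.map y f)
  arr_deg : ∀ x y (X : Row R C p) i, (ρ.arr x y X i).deg = 0
  arr_d : ∀ x y (X : Row R C p) i, (ρ.arr x y X i).d.hom = 0
  frm_arr : ∀ x y (X : Row R C p), ρ.frm x X ≫ columnTensor (ρ.arr x y X) = ρ.frm y X
  arr_bck : ∀ x y (X : Row R C p), columnTensor (ρ.arr x y X) ≫ ρ.bck y X = ρ.bck x X
  frm_nat : ∀ x {X Y : Row R C p} (f : X ⟶ Y),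
    columnTensor f ≫ ρ.frm x Y = ρ.frm x X ≫ columnTensor (ρ.map x f)
  bck_nat : ∀ x {X Y : Row R C p} (f : X ⟶ Y),
    columnTensor (ρ.map x f) ≫ ρ.bck x Y = ρ.bck x X ≫ columnTensor f
  frm_mem : ∀ x (X : Row R C p), ρ.frm x X ∈ gr (R := R) _ _ 0
  bck_mem : ∀ x (X : Row R C p), ρ.bck x X ∈ gr (R := R) _ _ 0
  d_frm : ∀ x (X : Row R C p), dC _ _ (ρ.frm x X) = 0
  d_bck : ∀ x (X : Row R C p), dC _ _ (ρ.bck x X) = 0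
  map_deg : ∀ x {X Y : Row R C p} (f : X ⟶ Y), columnDeg (ρ.map x f) = columnDeg f
  map_colMl : ∀ x {X Y : Row R C p} {M : Type v} [AddCommGroup M] [Module R M]
    {G : (ρ.obj x X ⟶ ρ.obj x Y) → M}, ColMl G → ColMl fun f => G (ρ.map x f)
  map_comp : ∀ x {X Y Z : Row R C p} (e : X ⟶ Y) (f : Y ⟶ Z) {M : Type v} [AddCommGroup M]
    [Module R M] {G : (ρ.obj x X ⟶ ρ.obj x Z) → M}, ColMl G →
    mergeSign (ρ.map x e) (ρ.map x f) • G (colComp (ρ.map x e) (ρ.map x f)) =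
      mergeSign e f • G (ρ.map x (colComp e f))
  map_colD : ∀ x {X Y : Row R C p} (f : X ⟶ Y) {M : Type v} [AddCommGroup M] [Module R M]
    {G : (ρ.obj x X ⟶ ρ.obj x Y) → M}, ColMl G →
    colD G (ρ.map x f) = colD (fun f => G (ρ.map x f)) f

variable (ρ : Realization R C V p p') {T T' : C}

/-- The value on the image of a rectangle. -/
def latBase (x : V) {X : Row R C p} : {Y : Row R C p} → Rect X Y →
    (Fam (ρ.obj x Y) T →ₗ[R] (X.tensor ⟶ T))
  | _, .nil => (precomp T (ρ.frm x X)).comp (evalFam .nil)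
  | _, .cons γ f => (latBase x γ).comp (push (ρ.map x f))

/-- The inductive step of `lat`. -/
def latStep (x y : V) {X : Row R C p}
    (ih : {Y : Row R C p} → Rect X Y → (Fam (ρ.obj y Y) T →ₗ[R] (X.tensor ⟶ T))) :
    {Y : Row R C p} → Rect X Y → (Fam (ρ.obj x Y) T →ₗ[R] (X.tensor ⟶ T))
  | _, .nil => (ih .nil).comp (push (ρ.arr y x X))
  | Y, .cons γ f => (-1 : ℤˣ) ^ (γ.length + 1) • (ih (.cons γ f)).comp (push (ρ.arr y x Y)) +
      (latStep x y ih γ).comp (push (ρ.map x f))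

/-- The signed sum of the values on the lattice paths running along `x :: Q`. -/
def lat : (x : V) → (Q : List V) → {X Y : Row R C p} → Rect X Y →
    (Fam (ρ.obj x Y) T →ₗ[R] (X.tensor ⟶ T))
  | x, [], _, _, γ => ρ.latBase x γ
  | x, y :: Q, _, _, γ => ρ.latStep x y (fun γ => lat y Q γ) γ

/-- `lat` as an operation on families. -/
def latFam (x : V) (Q : List V) {Y : Row R C p} : Fam (ρ.obj x Y) T →ₗ[R] Fam Y T where
  toFun Ψ _ γ := ρ.lat x Q γ Ψ
  map_add' _ _ := by funext X γ; exact map_add _ _ _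
  map_smul' _ _ := by funext X γ; exact map_smul _ _ _

theorem latFam_apply (x : V) (Q : List V) (γ : Rect X Y)
    (Ψ : Fam (ρ.obj x Y) T) : ρ.latFam x Q Ψ X γ = ρ.lat x Q γ Ψ := rfl

theorem lat_nil_nil (x : V) (X : Row R C p) (Ψ : Fam (ρ.obj x X) T) :
    ρ.lat x [] (.nil : Rect X X) Ψ = ρ.frm x X ≫ Ψ _ .nil := rfl

theorem lat_nil_cons (x : V) (γ : Rect X Y) (f : Y ⟶ Z) (Ψ : Fam (ρ.obj x Z) T) :
    ρ.lat x [] (γ.cons f) Ψ = ρ.lat x [] γ (push (ρ.map x f) Ψ) := rfl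

theorem lat_cons_nil (x y : V) (Q : List V) (X : Row R C p) (Ψ : Fam (ρ.obj x X) T) :
    ρ.lat x (y :: Q) (.nil : Rect X X) Ψ = ρ.lat y Q .nil (push (ρ.arr y x X) Ψ) := rfl

theorem lat_cons_cons (x y : V) (Q : List V) (γ : Rect X Y) (f : Y ⟶ Z) (Ψ : Fam (ρ.obj x Z) T) :
    ρ.lat x (y :: Q) (γ.cons f) Ψ =
      (-1 : ℤˣ) ^ (γ.length + 1) • ρ.lat y Q (γ.cons f) (push (ρ.arr y x Z) Ψ) +
        ρ.lat x (y :: Q) γ (push (ρ.map x f) Ψ) := rfl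

theorem lat_post (g : T ⟶ T') (x : V) (Q : List V) (γ : Rect X Y)
    (Ψ : Fam (ρ.obj x Y) T) : ρ.lat x Q γ (post g Ψ) = ρ.lat x Q γ Ψ ≫ g := by
  induction Q generalizing x Y with
  | nil =>
    induction γ with
    | nil => exact (assoc _ _ _).symm
    | cons γ f ih => exact ih _
  | cons y Q ihQ =>
    induction γ with
    | nil => exact ihQ _ _ _
    | cons γ f ih =>
      rw [lat_cons_cons, lat_cons_cons, push_post, push_post, ihQ, ih, Preadditive.add_comp,
        units_smul_comp']

/-- Multiply by `(-1)` to the length of the rectangle. -/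
def twist {Z : Row R C p} : Fam Z T →ₗ[R] Fam Z T where
  toFun Ψ X γ := (-1 : ℤˣ) ^ γ.length • Ψ X γ
  map_add' _ _ := by funext X γ; exact smul_add _ _ _
  map_smul' _ _ := by funext X γ; exact smul_comm _ _ _

theorem twist_apply (Ψ : Fam Z T) (γ : Rect X Z) : twist Ψ X γ = (-1 : ℤˣ) ^ γ.length • Ψ X γ := rfl

theorem push_twist (f : Y ⟶ Z) (Ψ : Fam Z T) : push f (twist Ψ) = -twist (push f Ψ) := by
  funext X γ
  change (-1 : ℤˣ) ^ (γ.length + 1) • Ψ X _ = -((-1 : ℤˣ) ^ γ.length • Ψ X _)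
  rw [pow_succ, mul_smul, Units.neg_smul, one_smul, smul_neg]

theorem lat_twist (x : V) (Q : List V) (γ : Rect X Y) (Ψ : Fam (ρ.obj x Y) T) :
    ρ.lat x Q γ (twist Ψ) = (-1 : ℤˣ) ^ (γ.length + Q.length) • ρ.lat x Q γ Ψ := by
  induction Q generalizing x Y with
  | nil =>
    induction γ with
    | nil =>
      rw [lat_nil_nil, lat_nil_nil]
      simp [twist_apply]
    | cons γ f ih =>
      rw [lat_nil_cons, lat_nil_cons, push_twist, map_neg, ih, Quiver.Path.length_cons,
        add_right_comm, pow_succ, mul_smul, Units.neg_smul, one_smul, smul_neg]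
  | cons y Q ihQ =>
    induction γ with
    | nil =>
      rw [lat_cons_nil, lat_cons_nil, push_twist, map_neg, ihQ, List.length_cons, ← add_assoc,
        pow_succ, mul_smul, Units.neg_smul, one_smul, smul_neg]
    | cons γ f ih =>
      rw [lat_cons_cons, lat_cons_cons, push_twist, push_twist, map_neg, map_neg, ihQ, ih, smul_add,
        smul_neg, smul_comm ((-1 : ℤˣ) ^ (γ.length + 1))]
      congr 1
      · rw [List.length_cons, ← add_assoc, pow_succ _ (_ + Q.length), mul_smul, Units.neg_smul,
          one_smul, smul_neg]
      · rw [Quiver.Path.length_cons, add_right_comm, pow_succ, mul_smul, Units.neg_smul, one_smul,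
          smul_neg]

theorem bar_twist (Ψ : Fam Z T) (γ : Rect X Z) :
    bar (twist Ψ) X γ = -((-1 : ℤˣ) ^ γ.length • bar Ψ X γ) := by
  induction γ with
  | nil => rw [bar_nil, bar_nil, smul_zero, neg_zero]
  | cons γ f ih =>
    have h : act f (twist Ψ) = twist (act f Ψ) := by
      funext X γ
      cases γ with
      | nil =>
        simp only [act_nil, twist_apply, comp_units_smul']
        rfl
      | cons γ e =>
        simp only [act_cons, twist_apply]
        rw [smul_comm]
        rfl
    rw [bar_cons, bar_cons, h, push_twist, map_neg, Pi.neg_apply, Pi.neg_apply, ih, twist_apply,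
      Quiver.Path.length_cons, pow_succ, mul_smul, Units.neg_smul, one_smul, smul_neg, smul_sub,
      smul_neg]
    abel

theorem push_latFam_nil (x : V) (f : Y ⟶ Z) (Ψ : Fam (ρ.obj x Z) T) :
    push f (ρ.latFam x [] Ψ) = ρ.latFam x [] (push (ρ.map x f) Ψ) := rfl

theorem push_latFam_cons (x y : V) (Q : List V) (f : Y ⟶ Z)
    (Ψ : Fam (ρ.obj x Z) T) : push f (ρ.latFam x (y :: Q) Ψ) =
      -twist (push f (ρ.latFam y Q (push (ρ.arr y x Z) Ψ))) +
        ρ.latFam x (y :: Q) (push (ρ.map x f) Ψ) := by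
  funext X γ
  refine (ρ.lat_cons_cons x y Q γ f Ψ).trans ?_
  refine congrArg (· + _) ?_
  change _ = -((-1 : ℤˣ) ^ γ.length • ρ.lat y Q (γ.cons f) _)
  rw [pow_succ, mul_smul, Units.neg_smul, one_smul, smul_neg]

theorem _root_.TensorHochschild.Ml.twist {Ψ : Fam Z T} (h : Ml Ψ) : Ml (twist Ψ) := by
  refine Ml.coinduct (fun {Z} Ψ => ∃ (s : ℤˣ) (Ψ' : Fam Z T), Ml Ψ' ∧ Ψ = s • Realization.twist Ψ')
    ?_ ?_ ⟨1, Ψ, h, (one_smul _ _).symm⟩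
  · rintro Y Z _ ⟨s, Ψ, h, rfl⟩
    simp only [map_usmul, push_twist]
    exact ((h.col.comp_linear Realization.twist).neg).sign fun _ => s
  · rintro Y Z _ ⟨s, Ψ, h, rfl⟩ f
    refine ⟨-s, _, h.push f, ?_⟩
    rw [map_usmul, push_twist, smul_neg, Units.neg_smul]

theorem _root_.TensorHochschild.Red.twist {Ψ : Fam Z T} (h : Red Ψ) :
    Red (twist Ψ) := ⟨fun α β => by rw [twist_apply, h.vanish, smul_zero]⟩

theorem lat_eq_zero_of_length {q : ℕ} (x : V) (Q : List V) (γ : Rect X Z) {Ψ : Fam (ρ.obj x Z) T}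
    (h : ∀ X' (γ' : Rect X' _), γ'.length ≠ q → Ψ X' γ' = 0)
    (hq : γ.length + Q.length ≠ q) : ρ.lat x Q γ Ψ = 0 := by
  induction Q generalizing x Z q with
  | nil =>
    induction γ generalizing q with
    | nil => rw [lat_nil_nil, h _ _ hq, Limits.comp_zero]
    | cons γ f ih =>
      rw [lat_nil_cons]
      cases q with
      | zero =>
        rw [show push (ρ.map x f) Ψ = 0 from funext fun X' => funext fun γ' =>
          h X' _ (Nat.succ_ne_zero _), map_zero]
      | succ q =>
        exact ih (q := q) (fun X' γ' h' => h X' _ (by simpa using h')) (by simp at hq ⊢; omega)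
  | cons y Q ihQ =>
    have harr : ∀ {Z : Row R C p} (γ : Rect X Z) {q : ℕ} {Ψ : Fam (ρ.obj x Z) T},
        (∀ X' (γ' : Rect X' _), γ'.length ≠ q → Ψ X' γ' = 0) →
        γ.length + Q.length + 1 ≠ q → ρ.lat y Q γ (push (ρ.arr y x Z) Ψ) = 0 := by
      intro Z γ q Ψ h hq
      cases q with
      | zero =>
        rw [show push (ρ.arr y x Z) Ψ = 0 from funext fun X' => funext fun γ' =>
          h X' _ (Nat.succ_ne_zero _), map_zero]
      | succ q => exact ihQ y (q := q) γ (fun X' γ' h' => h X' _ (by simpa using h')) (by omega)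
    induction γ generalizing q with
    | nil => exact harr _ h (by simpa using hq)
    | cons γ f ih =>
      rw [lat_cons_cons, harr _ h (by simp at hq ⊢; omega), smul_zero, zero_add]
      cases q with
      | zero =>
        rw [show push (ρ.map x f) Ψ = 0 from funext fun X' => funext fun γ' =>
          h X' _ (Nat.succ_ne_zero _), map_zero]
      | succ q =>
        exact ih (q := q) (fun X' γ' h' => h X' _ (by simpa using h')) (by simp at hq ⊢; omega)

variable {ρ}

namespace Lawful

theorem push_act_arr (hρ : ρ.Lawful) (x y z : V) (Ψ : Fam (ρ.obj z Z) T) :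
    push (ρ.arr x y Z) (act (ρ.arr y z Z) Ψ) = push (ρ.arr x z Z) Ψ := by
  rw [push_act, mergeSign_of_deg_left _ (hρ.arr_deg _ _ _), one_smul, hρ.arr_comp]

theorem push_map_act_arr (hρ : ρ.Lawful) (y z : V) (f : Y ⟶ Z) (Ψ : Fam (ρ.obj z Z) T) :
    push (ρ.map y f) (act (ρ.arr y z Z) Ψ) = push (colComp (ρ.arr y z Y) (ρ.map z f)) Ψ := by
  rw [push_act, mergeSign_of_deg_right _ (hρ.arr_deg _ _ _), one_smul, hρ.arr_nat]

theorem lat_act_arr_nil (hρ : ρ.Lawful) (x y : V) (Q : List V) (Ψ : Fam (ρ.obj x X) T) :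
    ρ.lat y Q (.nil : Rect X X) (act (ρ.arr y x X) Ψ) = ρ.lat x Q .nil Ψ := by
  cases Q with
  | nil => rw [lat_nil_nil, lat_nil_nil, act_nil, ← assoc, hρ.frm_arr]
  | cons z Q => rw [lat_cons_nil, lat_cons_nil, hρ.push_act_arr]

theorem lat_act_arr_cons (hρ : ρ.Lawful) (x y : V) (Q : List V)
    (γ : Rect X Y) (f : Y ⟶ Z) (Ψ : Fam (ρ.obj x Z) T) :
    ρ.lat y Q (γ.cons f) (act (ρ.arr y x Z) Ψ) =
      ρ.lat x Q (γ.cons f) Ψ - ρ.lat x Q γ (push (ρ.map x f) Ψ) +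
        ρ.lat y Q γ (push (colComp (ρ.arr y x Y) (ρ.map x f)) Ψ) := by
  cases Q with
  | nil => rw [lat_nil_cons, lat_nil_cons, hρ.push_map_act_arr, sub_self, zero_add]
  | cons z Q =>
    rw [lat_cons_cons, lat_cons_cons, hρ.push_act_arr, hρ.push_map_act_arr]
    abel

theorem lat_act_map_nil (hρ : ρ.Lawful) (x : V) (γ : Rect X Y)
    (f : Y ⟶ Z) {Ψ : Fam (ρ.obj x Z) T} (h : Ml Ψ) :
    ρ.lat x [] γ (act (ρ.map x f) Ψ) = act f (ρ.latFam x [] Ψ) X γ := by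
  cases γ with
  | nil =>
    rw [lat_nil_nil, act_nil, act_nil, ← assoc, ← hρ.frm_nat, assoc]
    rfl
  | cons γ e =>
    rw [lat_nil_cons, push_act, act_cons, map_usmul]
    exact hρ.map_comp x e f (h.col.comp_linear (ρ.lat x [] γ))

theorem lat_act_map_cons (hρ : ρ.Lawful) (x y : V) (Q : List V)
    (γ : Rect X Y) (f : Y ⟶ Z) {Ψ : Fam (ρ.obj x Z) T} (h : Ml Ψ) :
    ρ.lat x (y :: Q) γ (act (ρ.map x f) Ψ) = act f (ρ.latFam x (y :: Q) Ψ) X γ +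
      (-1 : ℤˣ) ^ γ.length • (ρ.lat y Q γ (push (colComp (ρ.arr y x Y) (ρ.map x f)) Ψ) -
        act f (ρ.latFam y Q (push (ρ.arr y x Z) Ψ)) X γ) := by
  cases γ with
  | nil =>
    rw [lat_cons_nil, act_nil, act_nil, push_act, mergeSign_of_deg_left _ (hρ.arr_deg _ _ _),
      one_smul, Quiver.Path.length_nil, pow_zero, one_smul]
    exact (add_sub_cancel _ _).symm
  | cons γ e =>
    rw [lat_cons_cons, act_cons, act_cons, push_act, push_act,
      mergeSign_of_deg_left _ (hρ.arr_deg _ _ _), one_smul, map_usmul,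
      hρ.map_comp x e f (h.col.comp_linear (ρ.lat x (y :: Q) γ)), latFam_apply, latFam_apply,
      lat_cons_cons, smul_add, smul_sub, smul_comm (mergeSign e f)]
    simp only [Quiver.Path.length_cons]
    abel

theorem lat_bar (hρ : ρ.Lawful) (x : V) (Q : List V) (γ : Rect X Y)
    {Ψ : Fam (ρ.obj x Y) T} (h : Ml Ψ) :
    ρ.lat x Q γ (bar Ψ) = bar (ρ.latFam x Q Ψ) X γ -
      (-1 : ℤˣ) ^ γ.length • bdry (fun Q' => ρ.lat x Q' γ Ψ) Q := by
  induction Q generalizing x Y with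
  | nil =>
    rw [bdry_nil, smul_zero, sub_zero]
    induction γ with
    | nil => rw [lat_nil_nil, bar_nil, bar_nil, Limits.comp_zero]
    | cons γ f ih =>
      rw [lat_nil_cons, push_bar, map_sub, map_neg, hρ.lat_act_map_nil _ _ _ h, ih (h.push _),
        bar_cons, push_latFam_nil]
  | cons y Q ihQ =>
    induction γ with
    | nil =>
      rw [lat_cons_nil, push_bar, map_sub, map_neg, hρ.lat_act_arr_nil, ihQ _ _ (h.push _), bar_nil,
        bar_nil, bdry_cons, Quiver.Path.length_nil, pow_zero, one_smul, one_smul]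
      simp only [lat_cons_nil]
      abel
    | cons γ f ih =>
      rw [lat_cons_cons, push_bar, push_bar, map_sub, map_sub, map_neg, map_neg,
        hρ.lat_act_arr_cons, hρ.lat_act_map_cons _ _ _ _ _ h, ihQ _ _ (h.push _), ih (h.push _),
        bar_cons, bar_cons, push_latFam_cons, map_add, map_neg, Pi.add_apply, Pi.add_apply,
        Pi.neg_apply, Pi.neg_apply, bar_twist, bdry_cons, bdry_cons]
      simp only [lat_cons_cons, bdry_add, bdry_units_smul, Quiver.Path.length_cons, smul_add,
        smul_sub, smul_neg, neg_one_pow_smul_smul]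
      simp only [pow_succ, mul_smul, Units.neg_smul, one_smul, smul_neg]
      abel

theorem lat_diffSum (hρ : ρ.Lawful) (x : V) (Q : List V)
    (γ : Rect X Y) {Ψ : Fam (ρ.obj x Y) T} (h : Ml Ψ) :
    ρ.lat x Q γ (diffSum Ψ) = diffSum (ρ.latFam x Q Ψ) X γ := by
  have harr : ∀ (x y : V) {Y : Row R C p} {Ψ : Fam (ρ.obj x Y) T}, Ml Ψ →
      push (ρ.arr y x Y) (diffSum Ψ) = diffSum (push (ρ.arr y x Y) Ψ) := by
    intro x y Y Ψ h
    have h1 : columnDeg (ρ.arr y x Y) = 0 :=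
      sum_eq_zero fun i _ => hρ.arr_deg y x Y i
    rw [push_diffSum, h1, Int.negOnePow_zero, one_smul]
    convert zero_add _
    refine sum_eq_zero fun i _ => ?_
    exact (congrArg _ (h.col.update_zero _ _ _ (hρ.arr_d _ _ _ _))).trans (smul_zero _)
  have hmap : ∀ (x : V) (Q : List V) {X Y Z : Row R C p} (γ : Rect X Y) (f : Y ⟶ Z)
      {Ψ : Fam (ρ.obj x Z) T}, Ml Ψ → ρ.lat x Q γ (push (ρ.map x f) (diffSum Ψ)) =
        colD (fun f' => ρ.lat x Q γ (push (ρ.map x f') Ψ)) f +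
          (columnDeg f).negOnePow • ρ.lat x Q γ (diffSum (push (ρ.map x f) Ψ)) := by
    intro x Q X Y Z γ f Ψ h
    rw [push_diffSum, map_add, map_usmul, hρ.map_deg, colD_hom,
      hρ.map_colD x f (h.col.comp_linear (ρ.lat x Q γ))]
  induction Q generalizing x Y with
  | nil =>
    induction γ with
    | nil => rw [lat_nil_nil, diffSum_nil, diffSum_nil, Limits.comp_zero]
    | cons γ f ih => rw [lat_nil_cons, hmap _ _ _ _ h, ih (h.push _), diffSum_cons]; rfl
  | cons y Q ihQ =>
    induction γ with
    | nil => rw [lat_cons_nil, harr _ _ h, ihQ _ _ (h.push _), diffSum_nil, diffSum_nil]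
    | cons γ f ih =>
      rw [lat_cons_cons, harr _ _ h, ihQ _ _ (h.push _), hmap _ _ _ _ h, ih (h.push _),
        diffSum_cons, diffSum_cons, smul_add, push_latFam_cons]
      simp only [latFam_apply, lat_cons_cons, map_add, map_neg, Pi.add_apply, Pi.neg_apply,
        smul_add, smul_neg, colD_add, colD_units_smul]
      have h2 : diffSum (twist (push f (ρ.latFam y Q (push (ρ.arr y x _) Ψ)))) _ γ =
          (-1 : ℤˣ) ^ γ.length • diffSum (push f (ρ.latFam y Q (push (ρ.arr y x _) Ψ))) _ γ := by
        refine (diffSum_congr γ _ ((-1 : ℤˣ) ^ γ.length •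
          push f (ρ.latFam y Q (push (ρ.arr y x _) Ψ))) fun X' γ' h' => ?_).trans ?_
        · rw [twist_apply, h']; rfl
        · rw [map_usmul]; rfl
      rw [h2, smul_comm (columnDeg f).negOnePow ((-1 : ℤˣ) ^ γ.length)]
      simp only [pow_succ, mul_smul, Units.neg_smul, one_smul, smul_neg]
      abel

theorem lat_dVal (hρ : ρ.Lawful) (x : V) (Q : List V) (γ : Rect X Y) (Ψ : Fam (ρ.obj x Y) T) :
    ρ.lat x Q γ (dVal Ψ) = dVal (ρ.latFam x Q Ψ) X γ := by
  induction Q generalizing x Y with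
  | nil =>
    induction γ with
    | nil => exact (d_comp_of_closed (hρ.d_frm _ _) _).symm
    | cons γ f ih => exact ih _
  | cons y Q ihQ =>
    induction γ with
    | nil => exact ihQ _ _ _
    | cons γ f ih =>
      refine (lat_cons_cons _ _ _ _ _ _ _).trans ?_
      refine (add_congr (congrArg _ (ihQ _ _ _)) (ih _)).trans ?_
      refine Eq.trans ?_ (congrArg (dC _ _) (lat_cons_cons ρ x y Q γ f Ψ)).symm
      rw [map_add, map_usmul]
      rfl

theorem latFam_ml (hρ : ρ.Lawful) (x : V) (Q : List V)
    {Ψ : Fam (ρ.obj x Z) T} (h : Ml Ψ) : Ml (ρ.latFam x Q Ψ) := by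
  have hmap : ∀ (x : V) (Q : List V) {Y Z : Row R C p} {Ψ : Fam (ρ.obj x Z) T}, Ml Ψ →
      ColMl fun f : Y ⟶ Z => ρ.latFam x Q (push (ρ.map x f) Ψ) := by
    intro x Q Y Z Ψ h
    refine colMl_pi fun X γ => ?_
    exact hρ.map_colMl x (h.col.comp_linear (ρ.lat x Q γ))
  induction Q generalizing x Z with
  | nil =>
    refine Ml.coinduct (fun {Z} Φ => ∃ Ψ : Fam (ρ.obj x Z) T, Ml Ψ ∧ Φ = ρ.latFam x [] Ψ)
      ?_ ?_ ⟨Ψ, h, rfl⟩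
    · rintro Y Z _ ⟨Ψ, h, rfl⟩
      exact hmap x [] h
    · rintro Y Z _ ⟨Ψ, h, rfl⟩ f
      exact ⟨_, h.push _, rfl⟩
  | cons y Q ih =>
    refine Ml.coinduct (fun {Z} Φ => ∃ (Φ₁ : Fam Z T) (Ψ : Fam (ρ.obj x Z) T), Ml Φ₁ ∧ Ml Ψ ∧
      Φ = Φ₁ + ρ.latFam x (y :: Q) Ψ) ?_ ?_ ⟨0, Ψ, Ml.zero, h, (zero_add _).symm⟩
    · rintro Y Z _ ⟨Φ₁, Ψ, h₁, h, rfl⟩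
      simp only [map_add, push_latFam_cons]
      exact h₁.col.add (((ih y (h.push _)).col.comp_linear twist).neg.add (hmap x _ h))
    · rintro Y Z _ ⟨Φ₁, Ψ, h₁, h, rfl⟩ f
      refine ⟨push f Φ₁ - twist (push f (ρ.latFam y Q (push (ρ.arr y x Z) Ψ))), _,
        (h₁.push f).sub ((ih y (h.push _)).push f).twist, h.push (ρ.map x f), ?_⟩
      rw [map_add, push_latFam_cons, sub_eq_add_neg, add_assoc]

theorem latFam_red (hρ : ρ.Lawful) (x : V) (Q : List V)
    {Ψ : Fam (ρ.obj x Z) T} (h : Red Ψ) : Red (ρ.latFam x Q Ψ) := by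
  induction Q generalizing x Z with
  | nil =>
    refine Red.coinduct (fun {Z} Φ => ∃ Ψ : Fam (ρ.obj x Z) T, Red Ψ ∧ Φ = ρ.latFam x [] Ψ)
      ?_ ?_ ⟨Ψ, h, rfl⟩
    · rintro Z _ ⟨Ψ, h, rfl⟩
      rw [push_latFam_nil, hρ.map_id, h.push_id, map_zero]
    · rintro Y Z _ ⟨Ψ, h, rfl⟩ f
      exact ⟨_, h.push _, rfl⟩
  | cons y Q ih =>
    refine Red.coinduct (fun {Z} Φ => ∃ (Φ₁ : Fam Z T) (Ψ : Fam (ρ.obj x Z) T), Red Φ₁ ∧ Red Ψ ∧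
      Φ = Φ₁ + ρ.latFam x (y :: Q) Ψ) ?_ ?_ ⟨0, Ψ, Red.zero, h, (zero_add _).symm⟩
    · rintro Z _ ⟨Φ₁, Ψ, h₁, h, rfl⟩
      rw [map_add, push_latFam_cons, (ih y (h.push _)).push_id, hρ.map_id, h.push_id, map_zero,
        map_zero, h₁.push_id]
      simp
    · rintro Y Z _ ⟨Φ₁, Ψ, h₁, h, rfl⟩ f
      refine ⟨push f Φ₁ - twist (push f (ρ.latFam y Q (push (ρ.arr y x Z) Ψ))), _,
        (h₁.push f).sub ((ih y (h.push _)).push f).twist, h.push (ρ.map x f), ?_⟩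
      rw [map_add, push_latFam_cons, sub_eq_add_neg, add_assoc]

theorem latFam_hg (hρ : ρ.Lawful) (x : V) (Q : List V) {r : ℤ}
    {Ψ : Fam (ρ.obj x Z) T} (h : Hg r Ψ) : Hg r (ρ.latFam x Q Ψ) := by
  intro X γ
  change ρ.lat x Q γ Ψ ∈ _
  have harr : ∀ {x y : V} {Z : Row R C p} {r : ℤ} {Ψ : Fam (ρ.obj x Z) T}, Hg r Ψ →
      Hg r (push (ρ.arr y x Z) Ψ) := by
    intro x y Z r Ψ h
    have h1 : columnDeg (ρ.arr y x Z) = 0 := sum_eq_zero fun i _ => hρ.arr_deg y x Z i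
    simpa [h1] using h.push (ρ.arr y x Z)
  induction Q generalizing x Z r with
  | nil =>
    induction γ generalizing r with
    | nil => exact comp_mem (hρ.frm_mem _ _) h.nil
    | cons γ f ih =>
      rw [lat_nil_cons, totalDeg, add_assoc]
      have := ih (h.push (ρ.map x f))
      rwa [hρ.map_deg] at this
  | cons y Q ihQ =>
    induction γ generalizing r with
    | nil => exact ihQ _ (harr h) _
    | cons γ f ih =>
      rw [lat_cons_cons]
      refine Submodule.add_mem _ (units_mem_smul _ _ (ihQ _ (harr h) _)) ?_
      rw [totalDeg, add_assoc]
      have := ih (h.push (ρ.map x f))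
      rwa [hρ.map_deg] at this

theorem lat_eq_zero_of_repeat (hρ : ρ.Lawful) (x : V) (Q : List V)
    (γ : Rect X Z) {Ψ : Fam (ρ.obj x Z) T} (h : Red Ψ)
    (hQ : ¬ (x :: Q).IsChain (· ≠ ·)) : ρ.lat x Q γ Ψ = 0 := by
  induction Q generalizing x Z with
  | nil => exact absurd (List.isChain_singleton x) hQ
  | cons y Q ihQ =>
    have harr : ∀ {Z : Row R C p} (γ : Rect X Z) {Ψ : Fam (ρ.obj x Z) T}, Red Ψ →
        ρ.lat y Q γ (push (ρ.arr y x Z) Ψ) = 0 := by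
      intro Z γ Ψ h
      by_cases hxy : x = y
      · subst hxy
        rw [hρ.arr_self, h.push_id, map_zero]
      · exact ihQ y γ (h.push _) fun h' => hQ (List.isChain_cons_cons.2 ⟨hxy, h'⟩)
    induction γ with
    | nil => exact harr _ h
    | cons γ f ih => rw [lat_cons_cons, harr _ h, ih (h.push _), smul_zero, add_zero]

end Lawful

end Realization

end Realizations

/-! ### Cochains with a fixed number of rows -/

section Cochains

variable (R C) in
/-- Functions of the rectangles with `p + 1` rows. -/
abbrev Cochain (p : ℕ) : Type _ :=
  ∀ X Y : Row R C p, Rect X Y → (X.tensor ⟶ Y.tensor)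

variable {p p' p'' : ℕ} {X Y Z : Row R C p}

/-- The values of a cochain on the rectangles with a fixed last column of objects. -/
def fam (Z : Row R C p) : Cochain R C p →ₗ[R] Fam Z Z.tensor where
  toFun Φ X γ := Φ X Z γ
  map_add' _ _ := rfl
  map_smul' _ _ := rfl

/-- The last term of the Hochschild differential. -/
def outer (r : ℤ) : Cochain R C p →ₗ[R] Cochain R C p where
  toFun Φ X _
    | .nil => 0
    | .cons γ f => (r * columnDeg f).negOnePow • (Φ X _ γ ≫ columnTensor f)
  map_add' Φ Ψ := by
    funext X Y γ
    cases γ with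
    | nil => exact (add_zero _).symm
    | cons γ f =>
      change (r * columnDeg f).negOnePow • ((Φ X _ γ + Ψ X _ γ) ≫ columnTensor f) =
        (r * columnDeg f).negOnePow • (Φ X _ γ ≫ columnTensor f) +
          (r * columnDeg f).negOnePow • (Ψ X _ γ ≫ columnTensor f)
      rw [Preadditive.add_comp, smul_add]
  map_smul' c Φ := by
    funext X Y γ
    cases γ with
    | nil => exact (smul_zero c).symm
    | cons γ f =>
      change (r * columnDeg f).negOnePow • ((c • Φ X _ γ) ≫ columnTensor f) =
        c • (r * columnDeg f).negOnePow • (Φ X _ γ ≫ columnTensor f)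
      rw [Linear.smul_comp, smul_comm]

theorem outer_nil (r : ℤ) (Φ : Cochain R C p) (X : Row R C p) : outer r Φ X X .nil = 0 := rfl

theorem outer_cons (r : ℤ) (Φ : Cochain R C p) (γ : Rect X Y)
    (f : Y ⟶ Z) : outer r Φ X Z (γ.cons f) =
      (r * columnDeg f).negOnePow • (Φ X Y γ ≫ columnTensor f) := rfl

theorem push_fam_outer (r : ℤ) (Φ : Cochain R C p) (f : Y ⟶ Z) : push f (fam Z (outer r Φ)) =
      (r * columnDeg f).negOnePow • post (columnTensor f) (fam Y Φ) := rfl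

/-- The Hochschild differential of cochains of internal degree `r`. -/
def hoch (r : ℤ) : Cochain R C p →ₗ[R] Cochain R C p where
  toFun Φ X Y γ := outer r Φ X Y γ + bar (fam Y Φ) X γ
  map_add' Φ Ψ := by
    funext X Y γ
    simp only [map_add, Pi.add_apply]
    abel
  map_smul' c Φ := by
    funext X Y γ
    simp only [map_smul, Pi.smul_apply, smul_add, RingHom.id_apply]

theorem fam_hoch (r : ℤ) (Φ : Cochain R C p) (Z : Row R C p) :
    fam Z (hoch r Φ) = fam Z (outer r Φ) + bar (fam Z Φ) := rfl

/-- The internal differential of cochains of internal degree `r`. -/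
def intern (r : ℤ) : Cochain R C p →ₗ[R] Cochain R C p where
  toFun Φ X Y γ := dVal (fam Y Φ) X γ - r.negOnePow • diffSum (fam Y Φ) X γ
  map_add' Φ Ψ := by
    funext X Y γ
    simp only [map_add, Pi.add_apply, smul_add]
    abel
  map_smul' c Φ := by
    funext X Y γ
    simp only [map_smul, Pi.smul_apply, smul_sub, RingHom.id_apply, smul_comm c]

theorem fam_intern (r : ℤ) (Φ : Cochain R C p) (Z : Row R C p) :
    fam Z (intern r Φ) = dVal (fam Z Φ) - r.negOnePow • diffSum (fam Z Φ) := rfl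

/-- The first term of the Hochschild differential. -/
def firstTerm {Z : Row R C p} {T : C} (Ψ : Fam Z T) {X : Row R C p} (s : ℤˣ) :
    Option (Σ Y : Row R C p, (X ⟶ Y) × Rect Y Z) → (X.tensor ⟶ T)
  | none => 0
  | some x => s • (columnTensor x.2.1 ≫ Ψ _ x.2.2)

theorem signedSum_merges {T : C} (γ : Rect X Z)
    (Ψ : Fam Z T) : signedSum (merges γ) (Ψ X) + firstTerm Ψ ((-1 : ℤˣ) ^ γ.length) (uncons γ) =
      bar Ψ X γ := by
  induction γ with
  | nil => rw [bar_nil]; exact add_zero _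
  | cons γ f ih =>
    cases γ with
    | nil =>
      change 0 + (-1 : ℤˣ) ^ 1 • (columnTensor f ≫ Ψ _ .nil) = -(columnTensor f ≫ Ψ _ .nil) - 0
      simp
    | cons γ e =>
      rw [bar_cons, ← ih, act_cons]
      have h1 : signedSum (merges ((γ.cons e).cons f)) (Ψ X) =
          -(mergeSign e f • Ψ X (γ.cons (colComp e f))) -
            signedSum (merges (γ.cons e)) (push f Ψ X) := by
        refine (signedSum_cons _ _ _).trans ?_
        rw [sub_eq_add_neg]
        refine add_congr (Units.neg_smul _ _) ?_
        exact signedSum_map_neg (merges (γ.cons e)) (fun x => x.cons f) (Ψ X)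
      have h2 : firstTerm Ψ ((-1 : ℤˣ) ^ ((γ.cons e).cons f).length) (uncons ((γ.cons e).cons f)) =
          -firstTerm (push f Ψ) ((-1 : ℤˣ) ^ (γ.cons e).length) (uncons (γ.cons e)) := by
        rw [uncons]
        cases uncons (γ.cons e) with
        | none => exact neg_zero.symm
        | some x =>
          change (-1 : ℤˣ) ^ ((γ.cons e).length + 1) • (columnTensor x.2.1 ≫ Ψ _ _) =
            -((-1 : ℤˣ) ^ (γ.cons e).length • (columnTensor x.2.1 ≫ Ψ _ _))
          rw [pow_succ, mul_smul, Units.neg_smul, one_smul, smul_neg]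
      rw [h1, h2]
      abel

theorem hochschildDiff_eq (n : ℤ) (Φ : TotalCochain R C) (p : ℕ) {X Y : Row R C p}
    (γ : Rect X Y) {r : ℤ} (h : ∀ {Z : Row R C p} (γ' : Rect X Z),
      γ'.length + 1 = γ.length → n - p - γ'.length = r ∨ Φ p X Z γ' = 0) :
    hochschildDiff n Φ p X Y γ = hoch r (Φ p) X Y γ := by
  refine (add_assoc _ _ _).trans ?_
  refine add_congr ?_ (Eq.trans (congrArg (_ + ·) ?_) (signedSum_merges γ (fam Y (Φ p))))
  swap
  · cases uncons γ <;> rfl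
  cases γ with
  | nil => rfl
  | cons γ f =>
    rw [outer_cons]
    obtain h | h := h γ rfl
    · rw [← h]
    · simp [h]

theorem act_fam_outer (r : ℤ) (Φ : Cochain R C p) (f : Y ⟶ Z) (γ : Rect X Y) :
    act f (fam Z (outer r Φ)) X γ =
      (r * columnDeg f).negOnePow • (outer r Φ X Y γ ≫ columnTensor f) := by
  cases γ with
  | nil =>
    rw [act_nil, outer_nil, Limits.zero_comp, smul_zero]
    exact Limits.comp_zero
  | cons γ e =>
    rw [act_cons, outer_cons]
    change mergeSign e f • (r * columnDeg (colComp e f)).negOnePow •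
      (Φ X _ γ ≫ columnTensor (colComp e f)) = _
    rw [smul_comm (mergeSign e f), ← comp_units_smul' (mergeSign e f), ← columnTensor_comp,
      units_smul_comp', assoc, ← mul_smul, ← negOnePow_add, columnDeg_colComp]
    ring_nf

theorem bar_outer_cons (r : ℤ) (Φ : Cochain R C p) (γ : Rect X Y) (f : Y ⟶ Z) :
    bar (fam Z (outer r Φ)) X (γ.cons f) =
      -((r * columnDeg f).negOnePow • (hoch r Φ X Y γ ≫ columnTensor f)) := by
  rw [bar_cons, act_fam_outer, push_fam_outer, map_usmul, bar_post]
  change _ - (r * columnDeg f).negOnePow • (bar (fam Y Φ) X γ ≫ columnTensor f) =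
    -((r * columnDeg f).negOnePow • ((outer r Φ X Y γ + bar (fam Y Φ) X γ) ≫ columnTensor f))
  rw [Preadditive.add_comp, smul_add]
  abel

theorem hoch_hoch (r : ℤ) (Φ : Cochain R C p) : hoch r (hoch r Φ) = 0 := by
  funext X Y γ
  change outer r (hoch r Φ) X Y γ + bar (fam Y (hoch r Φ)) X γ = 0
  rw [fam_hoch, map_add, bar_bar, add_zero]
  cases γ with
  | nil => exact add_zero _
  | cons γ f => rw [outer_cons, bar_outer_cons, add_neg_cancel]

/-- `Φ` is multilinear. -/
def MlCochain (Φ : Cochain R C p) : Prop := ∀ Z, Ml (fam Z Φ)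

/-- `Φ` is homogeneous of degree `r`. -/
def HgCochain (r : ℤ) (Φ : Cochain R C p) : Prop := ∀ Z, Hg r (fam Z Φ)

/-- `Φ` is reduced. -/
def RedCochain (Φ : Cochain R C p) : Prop := ∀ Z, Red (fam Z Φ)

variable {Φ : Cochain R C p} {r : ℤ}

theorem intern_intern (h : MlCochain Φ) : intern (r + 1) (intern r Φ) = 0 := by
  funext X Y γ
  change dVal (fam Y (intern r Φ)) X γ - (r + 1).negOnePow • diffSum (fam Y (intern r Φ)) X γ = 0
  rw [fam_intern, map_sub, map_sub, map_usmul, map_usmul, diffSum_diffSum (h Y),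
    diffSum_dVal, smul_zero, sub_zero]
  have h1 : dVal (dVal (fam Y Φ)) = 0 := by
    funext X γ
    exact DGCategory.d_d _
  rw [h1, zero_sub, negOnePow_succ, Units.neg_smul, sub_neg_eq_add]
  exact neg_add_cancel _

theorem intern_outer (r : ℤ) (Φ : Cochain R C p) (γ : Rect X Z) :
    intern r (outer r Φ) X Z γ = outer (r + 1) (intern r Φ) X Z γ := by
  cases γ with
  | nil =>
    change dC X.tensor X.tensor 0 - r.negOnePow • 0 = 0
    rw [map_zero, smul_zero, sub_zero]
  | cons γ f =>
    rename_i Y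
    change dC _ _ (outer r Φ X Z (γ.cons f)) -
      r.negOnePow • diffSum (fam Z (outer r Φ)) X (γ.cons f) = _
    rw [outer_cons, outer_cons, map_usmul, d_comp _ (columnTensor_mem f),
      d_columnTensor, diffSum_cons, push_fam_outer, map_usmul]
    have h1 : diffSum (post (columnTensor f) (fam Y Φ)) X γ =
        diffSum (fam Y Φ) X γ ≫ columnTensor f :=
      (signedSum_hom (postcomp (R := R) X.tensor (columnTensor f)) (diffs γ) (Φ X Y)).symm
    have h2 : colD (fun f' => fam Z (outer r Φ) X (γ.cons f')) f =
        (r * (columnDeg f + 1)).negOnePow • (Φ X Y γ ≫ colD columnTensor f) := by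
      rw [show (Φ X Y γ ≫ colD columnTensor f) = colD (fun f' => Φ X Y γ ≫ columnTensor f') f from
        colD_hom (precomp (R := R) Z.tensor (Φ X Y γ)) columnTensor f, ← colD_units_smul]
      refine sum_congr rfl fun i _ => ?_
      refine congrArg (colSign f i • ·) ?_
      have h5 : columnDeg (update f i (f i).d) = columnDeg f + 1 := by
        rw [columnDeg_update]
        simp [HomogHom.d]
      exact congrArg (fun n => (r * n).negOnePow • (Φ X Y γ ≫ columnTensor (update f i (f i).d))) h5
    have h3 : ((r * columnDeg f).negOnePow • diffSum (post (columnTensor f) (fam Y Φ))) X γ =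
      (r * columnDeg f).negOnePow • (diffSum (fam Y Φ) X γ ≫ columnTensor f) := by
      rw [← h1]; rfl
    have h4 : intern r Φ X Y γ = dC _ _ (Φ X Y γ) - r.negOnePow • diffSum (fam Y Φ) X γ := rfl
    rw [h2, h3, h4, Preadditive.sub_comp, units_smul_comp', smul_add, smul_add, smul_sub, ← mul_smul,
      ← mul_smul, ← mul_smul, ← mul_smul, ← mul_smul]
    simp only [← negOnePow_add]
    rw [negOnePow_congr (a := r + r * (columnDeg f + 1)) (b := r * columnDeg f) ⟨r, by ring⟩,
      negOnePow_congr (a := r * columnDeg f + columnDeg f) (b := (r + 1) * columnDeg f)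
        ⟨0, by ring⟩,
      negOnePow_congr (a := r + columnDeg f + r * columnDeg f)
        (b := (r + 1) * columnDeg f + r) ⟨0, by ring⟩]
    abel

theorem intern_hoch (h : MlCochain Φ) (hr : HgCochain r Φ) :
    intern r (hoch r Φ) = hoch (r + 1) (intern r Φ) := by
  funext X Y γ
  have h1 := bar_diffSum (h Y) (hr Y) X γ
  have h2 := intern_outer r Φ γ
  have h3 : intern r (hoch r Φ) X Y γ = intern r (outer r Φ) X Y γ +
      (dVal (bar (fam Y Φ)) X γ - r.negOnePow • diffSum (bar (fam Y Φ)) X γ) := by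
    change (dVal (fam Y (hoch r Φ)) - r.negOnePow • diffSum (fam Y (hoch r Φ))) X γ =
      (dVal (fam Y (outer r Φ)) - r.negOnePow • diffSum (fam Y (outer r Φ)) +
        (dVal (bar (fam Y Φ)) - r.negOnePow • diffSum (bar (fam Y Φ)))) X γ
    rw [fam_hoch, map_add, map_add, smul_add, add_sub_add_comm]
  have h4 : hoch (r + 1) (intern r Φ) X Y γ = outer (r + 1) (intern r Φ) X Y γ +
      (bar (dVal (fam Y Φ)) X γ - r.negOnePow • bar (diffSum (fam Y Φ)) X γ) := by
    change outer (r + 1) (intern r Φ) X Y γ + bar (fam Y (intern r Φ)) X γ = _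
    rw [fam_intern, map_sub, map_usmul]
    rfl
  rw [h3, h4, h2]
  refine congrArg (_ + ·) ?_
  have h5 := congrArg (r.negOnePow • ·) h1
  simp only [smul_sub, ← mul_smul, Int.units_mul_self, one_smul] at h5
  rw [sub_eq_sub_iff_add_eq_add] at h5 ⊢
  rw [add_comm, ← h5, add_comm]

/-! #### Closure properties -/

theorem hoch_mlCochain (h : MlCochain Φ) : MlCochain (hoch r Φ) := fun Z => by
  rw [fam_hoch]
  refine Ml.add (Ml.of_push ?_ ?_) (h Z).bar
  · intro Y
    simp only [push_fam_outer]
    refine colMl_pi fun X γ => ?_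
    exact (columnTensor_colMl.comp_linear (precomp (R := R) Z.tensor (Φ X Y γ))).columnDeg
      fun n => (r * n).negOnePow
  · intro Y f
    rw [push_fam_outer]
    exact ((h Y).post _).units_smul _

theorem hoch_redCochain (h : RedCochain Φ) : RedCochain (hoch r Φ) := fun Z => by
  rw [fam_hoch]
  refine Red.add_bar (h Z) ?_ fun f => ?_
  · rw [push_fam_outer, columnDeg_idColumn, mul_zero, Int.negOnePow_zero, one_smul,
      columnTensor_idColumn]
    funext X γ
    exact comp_id _
  · rw [push_fam_outer]
    exact ((h _).post _).units_smul _

theorem hoch_hgCochain (h : HgCochain r Φ) : HgCochain r (hoch r Φ) := fun Z => by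
  rw [fam_hoch]
  refine Hg.add (fun X γ => ?_) (h Z).bar
  cases γ with
  | nil => exact Submodule.zero_mem _
  | cons γ f =>
    change (outer r Φ) X Z (γ.cons f) ∈ _
    rw [outer_cons, totalDeg, add_right_comm]
    exact units_mem_smul _ _ (comp_mem (h _ X γ) (columnTensor_mem f))

theorem intern_mlCochain (h : MlCochain Φ) : MlCochain (intern r Φ) := fun Z => by
  rw [fam_intern]
  exact (h Z).dVal.sub ((h Z).diffSum.units_smul _)

theorem intern_redCochain (h : RedCochain Φ) (h' : MlCochain Φ) : RedCochain (intern r Φ) :=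
  fun Z => by
  rw [fam_intern]
  exact (h Z).dVal.sub (((h Z).diffSum (h' Z)).units_smul _)

theorem intern_hgCochain (h : HgCochain r Φ) : HgCochain (r + 1) (intern r Φ) := fun Z => by
  rw [fam_intern]
  exact (h Z).dVal.sub ((h Z).diffSum.units_smul _)

/-! #### Evaluation of cochains along chains of a realization -/

namespace Realization

variable {V V' : Type}

/-- The value on the chain `S` of a realization. -/
def eval (ρ : Realization R C V p p') (S : List V) : Cochain R C p' →ₗ[R] Cochain R C p :=
  match S with
  | [] => 0
  | x :: Q =>
    { toFun := fun Φ X Y γ => ρ.lat x Q γ (post (ρ.bck x Y) (fam (ρ.obj x Y) Φ))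
      map_add' := fun Φ Ψ => by
        funext X Y γ
        simp only [map_add]
        rfl
      map_smul' := fun c Φ => by
        funext X Y γ
        simp only [map_smul]
        rfl }

variable (ρ : Realization R C V p p')

@[simp] theorem eval_nil (Φ : Cochain R C p') : ρ.eval [] Φ = 0 := rfl

theorem eval_cons (x : V) (Q : List V) (Φ : Cochain R C p') (γ : Rect X Y) :
    ρ.eval (x :: Q) Φ X Y γ = ρ.lat x Q γ (post (ρ.bck x Y) (fam (ρ.obj x Y) Φ)) := rfl

theorem fam_eval_cons (x : V) (Q : List V) (Φ : Cochain R C p') (Y : Row R C p) :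
    fam Y (ρ.eval (x :: Q) Φ) = ρ.latFam x Q (post (ρ.bck x Y) (fam (ρ.obj x Y) Φ)) := rfl

variable {ρ}

theorem Lawful.lat_outer (hρ : ρ.Lawful) (r : ℤ) (Φ : Cochain R C p') (x : V) (Q : List V)
    (γ : Rect X Y) :
    ρ.lat x Q γ (post (ρ.bck x Y) (fam (ρ.obj x Y) (outer r Φ))) =
      outer r (ρ.eval (x :: Q) Φ) X Y γ + (-1 : ℤˣ) ^ γ.length • ρ.eval Q Φ X Y γ := by
  have harr : ∀ (y : V) (Y : Row R C p),
      push (ρ.arr y x Y) (post (ρ.bck x Y) (fam (ρ.obj x Y) (outer r Φ))) =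
        post (ρ.bck y Y) (fam (ρ.obj y Y) Φ) := by
    intro y Y
    have h1 : columnDeg (ρ.arr y x Y) = 0 := sum_eq_zero fun i _ => hρ.arr_deg y x Y i
    rw [push_post, push_fam_outer, h1, mul_zero, Int.negOnePow_zero, one_smul]
    funext X γ
    refine (assoc _ _ _).trans ?_
    rw [hρ.arr_bck]
    rfl
  have hmap : ∀ {Y Z : Row R C p} (f : Y ⟶ Z),
      push (ρ.map x f) (post (ρ.bck x Z) (fam (ρ.obj x Z) (outer r Φ))) =
        (r * columnDeg f).negOnePow •
          post (columnTensor f) (post (ρ.bck x Y) (fam (ρ.obj x Y) Φ)) := by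
    intro Y Z f
    rw [push_post, push_fam_outer, hρ.map_deg, map_usmul]
    congr 1
    funext X γ
    refine (assoc _ _ _).trans ?_
    rw [hρ.bck_nat]
    exact (assoc _ _ _).symm
  cases Q with
  | nil =>
    rw [eval_nil, Pi.zero_apply, Pi.zero_apply, Pi.zero_apply, smul_zero, add_zero]
    cases γ with
    | nil =>
      rw [lat_nil_nil, outer_nil]
      change _ ≫ (0 ≫ _) = 0
      rw [Limits.zero_comp, Limits.comp_zero]
    | cons γ f => rw [lat_nil_cons, hmap, map_usmul, lat_post, outer_cons, eval_cons]
  | cons y Q =>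
    cases γ with
    | nil =>
      rw [lat_cons_nil, harr, outer_nil, zero_add, Quiver.Path.length_nil, pow_zero, one_smul,
        eval_cons]
    | cons γ f =>
      rw [lat_cons_cons, harr, hmap, map_usmul, ρ.lat_post (columnTensor f), outer_cons,
        eval_cons, eval_cons, add_comm]
      rfl

theorem Lawful.eval_hoch (hρ : ρ.Lawful) (r : ℤ) {Φ : Cochain R C p'} (h : MlCochain Φ)
    (S : List V) (γ : Rect X Y) :
    ρ.eval S (hoch r Φ) X Y γ = hoch r (ρ.eval S Φ) X Y γ +
      (-1 : ℤˣ) ^ γ.length • bdry (fun S => ρ.eval S Φ X Y γ) S := by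
  cases S with
  | nil =>
    simp only [eval_nil, map_zero, bdry_nil, smul_zero]
    exact (add_zero _).symm
  | cons x Q =>
    rw [eval_cons, fam_hoch, map_add, map_add, hρ.lat_outer, ← bar_post,
      hρ.lat_bar x Q γ ((h _).post _), ← fam_eval_cons, bdry_cons, smul_sub]
    change _ = outer r _ X Y γ + _ + _
    simp only [eval_cons]
    abel

theorem Lawful.eval_intern (hρ : ρ.Lawful) (r : ℤ) {Φ : Cochain R C p'} (h : MlCochain Φ)
    (S : List V) : ρ.eval S (intern r Φ) = intern r (ρ.eval S Φ) := by
  cases S with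
  | nil => simp only [eval_nil, map_zero]
  | cons x Q =>
    funext X Y γ
    have h1 : post (ρ.bck x Y) (dVal (fam (ρ.obj x Y) Φ)) =
        dVal (post (ρ.bck x Y) (fam (ρ.obj x Y) Φ)) := by
      funext X' γ'
      have := d_comp (R := R) (Φ X' _ γ') (hρ.bck_mem x Y)
      rw [hρ.d_bck, Limits.comp_zero, zero_add, Int.negOnePow_zero, one_smul] at this
      exact this.symm
    have h2 : post (ρ.bck x Y) (diffSum (fam (ρ.obj x Y) Φ)) =
        diffSum (post (ρ.bck x Y) (fam (ρ.obj x Y) Φ)) := by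
      funext X' γ'
      exact signedSum_hom (postcomp (R := R) X'.tensor (ρ.bck x Y)) (diffs γ') (Φ X' _)
    rw [eval_cons, fam_intern, map_sub, map_sub, map_usmul, map_usmul, h1, h2,
      hρ.lat_dVal, hρ.lat_diffSum _ _ _ ((h _).post _)]
    rfl

theorem Lawful.eval_mlCochain (hρ : ρ.Lawful) {Φ : Cochain R C p'} (h : MlCochain Φ)
    (S : List V) : MlCochain (ρ.eval S Φ) := fun Z => by
  cases S with
  | nil => exact Ml.zero
  | cons x Q => exact hρ.latFam_ml x Q ((h _).post _)

theorem Lawful.eval_redCochain (hρ : ρ.Lawful) {Φ : Cochain R C p'} (h : RedCochain Φ)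
    (S : List V) : RedCochain (ρ.eval S Φ) := fun Z => by
  cases S with
  | nil => exact Red.zero
  | cons x Q => exact hρ.latFam_red x Q ((h _).post _)

theorem Lawful.eval_hgCochain (hρ : ρ.Lawful) {Φ : Cochain R C p'} (h : HgCochain r Φ)
    (S : List V) : HgCochain r (ρ.eval S Φ) := fun Z => by
  cases S with
  | nil => exact Hg.zero
  | cons x Q =>
    refine hρ.latFam_hg x Q fun X γ => ?_
    have := comp_mem (h _ X γ) (hρ.bck_mem x Z)
    rwa [add_zero] at this

theorem Lawful.eval_eq_zero_of_repeat (hρ : ρ.Lawful) {Φ : Cochain R C p'} (h : RedCochain Φ)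
    {S : List V} (hS : ¬ S.IsChain (· ≠ ·)) : ρ.eval S Φ = 0 := by
  cases S with
  | nil => rfl
  | cons x Q =>
    funext X Y γ
    exact hρ.lat_eq_zero_of_repeat x Q γ ((h _).post _) hS

theorem eval_eq_zero_of_length (ρ : Realization R C V p p') {Φ : Cochain R C p'} {q : ℕ}
    (h : ∀ X Y (γ : Rect X Y), γ.length ≠ q → Φ X Y γ = 0) (S : List V)
    (γ : Rect X Y) (hq : γ.length + S.length ≠ q + 1) :
    ρ.eval S Φ X Y γ = 0 := by
  cases S with
  | nil => rfl
  | cons x Q =>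
    refine ρ.lat_eq_zero_of_length (q := q) x Q γ (fun X' γ' h' => ?_) (by simp at hq; omega)
    change Φ _ _ γ' ≫ _ = 0
    rw [h _ _ _ h', Limits.zero_comp]

/-- Change of the parameters. -/
def pull (β : V' → V) (ρ : Realization R C V p p') : Realization R C V' p p' where
  obj x := ρ.obj (β x)
  map x := ρ.map (β x)
  arr x y := ρ.arr (β x) (β y)
  frm x := ρ.frm (β x)
  bck x := ρ.bck (β x)

theorem lat_pull (β : V' → V) (ρ : Realization R C V p p') {T : C} (x : V') (Q : List V')
    (γ : Rect X Y) (Ψ : Fam (ρ.obj (β x) Y) T) :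
    (ρ.pull β).lat x Q γ Ψ = ρ.lat (β x) (Q.map β) γ Ψ := by
  induction Q generalizing x Y with
  | nil =>
    induction γ with
    | nil => rfl
    | cons γ f ih => exact ih _
  | cons y Q ihQ =>
    induction γ with
    | nil => exact ihQ y _ _
    | cons γ f ih =>
      exact add_congr (congrArg ((-1 : ℤˣ) ^ (γ.length + 1) • ·) (ihQ y _ _)) (ih _)

theorem eval_pull (β : V' → V) (ρ : Realization R C V p p') (S : List V')
    (Φ : Cochain R C p') : (ρ.pull β).eval S Φ = ρ.eval (S.map β) Φ := by
  cases S with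
  | nil => rfl
  | cons x Q =>
    funext X Y γ
    exact lat_pull β ρ x Q γ _

/-- First apply `ρ`, then `ρ'`. -/
def compose (ρ : Realization R C V p p') (ρ' : Realization R C V' p' p'') :
    Realization R C (V' × V) p p'' where
  obj x X := ρ'.obj x.1 (ρ.obj x.2 X)
  map x _ _ f := ρ'.map x.1 (ρ.map x.2 f)
  arr x y X := colComp (ρ'.map x.1 (ρ.arr x.2 y.2 X)) (ρ'.arr x.1 y.1 (ρ.obj y.2 X))
  frm x X := ρ.frm x.2 X ≫ ρ'.frm x.1 (ρ.obj x.2 X)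
  bck x X := ρ'.bck x.1 (ρ.obj x.2 X) ≫ ρ.bck x.2 X

theorem compose_arr_left {ρ' : Realization R C V' p' p''} (hρ : ρ.Lawful) (hρ' : ρ'.Lawful)
    (a b : V') (x : V) (X : Row R C p) :
    (ρ.compose ρ').arr (a, x) (b, x) X = ρ'.arr a b (ρ.obj x X) := by
  change colComp (ρ'.map a (ρ.arr x x X)) (ρ'.arr a b (ρ.obj x X)) = _
  rw [hρ.arr_self, hρ'.map_id, idColumn_colComp]

theorem compose_arr_right {ρ' : Realization R C V' p' p''} (hρ' : ρ'.Lawful)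
    (a : V') (x y : V) (X : Row R C p) :
    (ρ.compose ρ').arr (a, x) (a, y) X = ρ'.map a (ρ.arr x y X) := by
  change colComp (ρ'.map a (ρ.arr x y X)) (ρ'.arr a a (ρ.obj y X)) = _
  rw [hρ'.arr_self, colComp_idColumn]

theorem _root_.TensorHochschild.shuffleTail_add {A B M : Type*} [AddCommGroup M] (a : A)
    (P : List A) (b : B) (Q : List B) (ψ χ : List (A × B) → M) :
    shuffleTail a P b Q (fun S => ψ S + χ S) = shuffleTail a P b Q ψ + shuffleTail a P b Q χ := by
  match P, Q with
  | [], [] => simp only [shuffleTail]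
  | a' :: P, [] => simp only [shuffleTail, shuffleTail_add a' P b []]
  | [], b' :: Q => simp only [shuffleTail, shuffleTail_add a [] b' Q]
  | a' :: P, b' :: Q =>
    simp only [shuffleTail, shuffleTail_add a' P b (b' :: Q), shuffleTail_add a (a' :: P) b' Q,
      smul_add]
    abel
  termination_by P.length + Q.length

theorem _root_.TensorHochschild.shuffleTail_units_smul {A B M : Type*} [AddCommGroup M] (a : A)
    (P : List A) (b : B) (Q : List B) (s : ℤˣ) (ψ : List (A × B) → M) :
    shuffleTail a P b Q (fun S => s • ψ S) = s • shuffleTail a P b Q ψ := by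
  match P, Q with
  | [], [] => simp only [shuffleTail]
  | a' :: P, [] => simp only [shuffleTail, shuffleTail_units_smul a' P b []]
  | [], b' :: Q => simp only [shuffleTail, shuffleTail_units_smul a [] b' Q]
  | a' :: P, b' :: Q =>
    simp only [shuffleTail, shuffleTail_units_smul a' P b (b' :: Q),
      shuffleTail_units_smul a (a' :: P) b' Q, smul_add]
    rw [smul_comm]
  termination_by P.length + Q.length

/-- `lat` for a composite realization. -/
def latCompose (ρ : Realization R C V p p') (ρ' : Realization R C V' p' p'') {T : C} (a : V')
    (x : V) (S : List (V' × V)) {X Y : Row R C p} (γ : Rect X Y) :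
    Fam (ρ'.obj a (ρ.obj x Y)) T →ₗ[R] (X.tensor ⟶ T) :=
  (ρ.compose ρ').lat (a, x) S γ

section

variable {ρ' : Realization R C V' p' p''} {T : C} (hρ : ρ.Lawful) (hρ' : ρ'.Lawful)
  {X Y Z : Row R C p} (γ : Rect X Y) (f : Y ⟶ Z) (a b : V') (x y : V) (S : List (V' × V))

include hρ hρ' in
theorem latCompose_left_nil (Ψ : Fam (ρ'.obj a (ρ.obj x X)) T) :
    latCompose ρ ρ' a x ((b, x) :: S) .nil Ψ =
      latCompose ρ ρ' b x S .nil (push (ρ'.arr b a (ρ.obj x X)) Ψ) :=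
  congrArg (fun e => (ρ.compose ρ').lat (b, x) S .nil (push e Ψ)) (compose_arr_left hρ hρ' b a x X)

include hρ hρ' in
theorem latCompose_left_cons (Ψ : Fam (ρ'.obj a (ρ.obj x Z)) T) :
    latCompose ρ ρ' a x ((b, x) :: S) (γ.cons f) Ψ = (-1 : ℤˣ) ^ (γ.length + 1) •
        latCompose ρ ρ' b x S (γ.cons f) (push (ρ'.arr b a (ρ.obj x Z)) Ψ) +
      latCompose ρ ρ' a x ((b, x) :: S) γ (push (ρ'.map a (ρ.map x f)) Ψ) :=
  congrArg (fun e => (-1 : ℤˣ) ^ (γ.length + 1) •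
      (ρ.compose ρ').lat (b, x) S (γ.cons f) (push e Ψ) +
        latCompose ρ ρ' a x ((b, x) :: S) γ (push (ρ'.map a (ρ.map x f)) Ψ))
    (compose_arr_left hρ hρ' b a x Z)

include hρ' in
theorem latCompose_right_nil (Ψ : Fam (ρ'.obj a (ρ.obj x X)) T) :
    latCompose ρ ρ' a x ((a, y) :: S) .nil Ψ =
      latCompose ρ ρ' a y S .nil (push (ρ'.map a (ρ.arr y x X)) Ψ) :=
  congrArg (fun e => (ρ.compose ρ').lat (a, y) S .nil (push e Ψ)) (compose_arr_right hρ' a y x X)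

include hρ' in
theorem latCompose_right_cons (Ψ : Fam (ρ'.obj a (ρ.obj x Z)) T) :
    latCompose ρ ρ' a x ((a, y) :: S) (γ.cons f) Ψ = (-1 : ℤˣ) ^ (γ.length + 1) •
        latCompose ρ ρ' a y S (γ.cons f) (push (ρ'.map a (ρ.arr y x Z)) Ψ) +
      latCompose ρ ρ' a x ((a, y) :: S) γ (push (ρ'.map a (ρ.map x f)) Ψ) :=
  congrArg (fun e => (-1 : ℤˣ) ^ (γ.length + 1) •
      (ρ.compose ρ').lat (a, y) S (γ.cons f) (push e Ψ) +
        latCompose ρ ρ' a x ((a, y) :: S) γ (push (ρ'.map a (ρ.map x f)) Ψ))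
    (compose_arr_right hρ' a y x Z)

end

theorem lat_latFam_signs {M : Type*} [AddCommGroup M] (g q : ℕ) (A B s₁ s₂ s₃ : M) :
    (-1 : ℤˣ) ^ (g + 1) • (-((-1 : ℤˣ) ^ (g + 1 + q) • A) + s₁) +
        (-((-1 : ℤˣ) ^ (g + (q + 1)) • B) + ((-1 : ℤˣ) ^ (q + 1) • s₂ + s₃)) =
      (-1 : ℤˣ) ^ (q + 1) • ((-1 : ℤˣ) ^ (g + 1) • ((-1 : ℤˣ) ^ (g + 1) • A + B) + s₂) +
        ((-1 : ℤˣ) ^ (g + 1) • s₁ + s₃) := by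
  rcases neg_one_pow_eq_or ℤˣ g with h | h <;>
    rcases neg_one_pow_eq_or ℤˣ q with h' | h' <;>
    simp [pow_succ, pow_add, h, h'] <;> abel

theorem lat_latFam {ρ' : Realization R C V' p' p''} (hρ : ρ.Lawful) (hρ' : ρ'.Lawful) {T : C}
    (a : V') (P : List V') (x : V) (Q : List V) (γ : Rect X Y)
    (Ψ : Fam (ρ'.obj a (ρ.obj x Y)) T) :
    ρ.lat x Q γ (ρ'.latFam a P Ψ) = shuffleTail a P x Q fun S => latCompose ρ ρ' a x S γ Ψ := by
  induction P generalizing a x Q Y with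
  | nil =>
    induction Q generalizing x Y with
    | nil =>
      rw [shuffleTail]
      induction γ with
      | nil => exact (assoc _ _ _).symm
      | cons γ f ih => exact ih _
    | cons y Q ihQ =>
      rw [shuffleTail]
      induction γ with
      | nil =>
        rw [lat_cons_nil, push_latFam_nil, ihQ]
        simp only [latCompose_right_nil hρ']
      | cons γ f ih =>
        rw [lat_cons_cons, push_latFam_nil, push_latFam_nil, ihQ, ih]
        simp only [latCompose_right_cons hρ', shuffleTail_add, shuffleTail_units_smul]
  | cons b P ihP =>
    induction Q generalizing x Y with
    | nil =>
      rw [shuffleTail]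
      induction γ with
      | nil =>
        rw [lat_nil_nil, latFam_apply, lat_cons_nil]
        simp only [latCompose_left_nil hρ hρ']
        exact ihP b x [] .nil _
      | cons γ f ih =>
        rw [lat_nil_cons, push_latFam_cons, map_add, map_neg, lat_twist, ih, ← lat_nil_cons, ihP]
        simp only [latCompose_left_cons hρ hρ', shuffleTail_add, shuffleTail_units_smul]
        simp [pow_succ]
    | cons y Q ihQ =>
      rw [shuffleTail]
      induction γ with
      | nil =>
        rw [lat_cons_nil, push_latFam_cons, map_add, map_neg, lat_twist, ihQ, ← lat_cons_nil, ihP]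
        simp only [latCompose_left_nil hρ hρ', latCompose_right_nil hρ']
        simp [pow_succ]
      | cons γ f ih =>
        rw [lat_cons_cons, push_latFam_cons, push_latFam_cons, map_add, map_neg, map_add, map_neg,
          lat_twist, lat_twist, ihQ, ih]
        simp only [latCompose_left_cons hρ hρ', latCompose_right_cons hρ', shuffleTail_add,
          shuffleTail_units_smul]
        rw [← ihP, lat_cons_cons]
        simp only [Quiver.Path.length_cons, List.length_cons]
        exact lat_latFam_signs _ _ _ _ _ _ _

theorem eval_eval {ρ' : Realization R C V' p' p''} (hρ : ρ.Lawful) (hρ' : ρ'.Lawful)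
    (a : V') (P : List V') (x : V) (Q : List V) (Φ : Cochain R C p'')
    (γ : Rect X Y) :
    ρ.eval (x :: Q) (ρ'.eval (a :: P) Φ) X Y γ =
      shuffleTail a P x Q fun S => (ρ.compose ρ').eval ((a, x) :: S) Φ X Y γ := by
  rw [eval_cons, fam_eval_cons]
  have h : post (ρ.bck x Y) (ρ'.latFam a P (post (ρ'.bck a (ρ.obj x Y))
      (fam (ρ'.obj a (ρ.obj x Y)) Φ))) = ρ'.latFam a P (post ((ρ.compose ρ').bck (a, x) Y)
        (fam (ρ'.obj a (ρ.obj x Y)) Φ)) := by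
    funext X' γ'
    refine (ρ'.lat_post _ _ _ _ _).symm.trans (congrArg (ρ'.lat a P γ') ?_)
    funext X'' γ''
    exact assoc _ _ _
  rw [h]
  exact lat_latFam hρ hρ' a P x Q γ _

end Realization

end Cochains

/-! ### Words of leaves -/

namespace BTree

variable {ι κ : Type}

/-- The list of leaves. -/
def leaves (t : BTree ι) : List ι := t.leavesAppend []

theorem leavesAppend_eq : ∀ (t : BTree ι) (rest : List ι), t.leavesAppend rest = t.leaves ++ rest
  | leaf _, _ => rfl
  | node l r, rest => by
    rw [leaves, leavesAppend, leavesAppend, leavesAppend_eq l, leavesAppend_eq r,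
      leavesAppend_eq l (r.leavesAppend []), leavesAppend_eq r [], List.append_nil,
      List.append_assoc]

@[simp] theorem leaves_leaf (i : ι) : (leaf i).leaves = [i] := rfl

@[simp] theorem leaves_node (l r : BTree ι) : (node l r).leaves = l.leaves ++ r.leaves := by
  rw [leaves, leavesAppend, leavesAppend_eq, leaves, leavesAppend_eq, List.append_nil]
  rfl

theorem leaves_bind (F : ι → BTree κ) : ∀ t : BTree ι,
    (t.bind F).leaves = t.leaves.flatMap fun i => (F i).leaves
  | leaf i => by simp [bind]
  | node l r => by simp [bind, leaves_bind F l, leaves_bind F r]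

theorem leaves_map (g : ι → κ) (t : BTree ι) : (t.map g).leaves = t.leaves.map g := by
  rw [map, leaves_bind]
  exact List.map_eq_flatMap.symm

theorem head_cons_tail : ∀ (t : BTree ι) (rest : List ι), t.head :: t.tail rest = t.leaves ++ rest
  | leaf _, _ => rfl
  | node l r, rest => by
    rw [head, tail, head_cons_tail l, leavesAppend_eq, leaves_node, List.append_assoc]

end BTree

section Words

variable {ι κ : Type} {M : Type*} [AddCommGroup M]

/-- The concatenation of words. -/
def rowWord : (p : ℕ) → (Fin (p + 1) → List ι) → List ι
  | 0, L => L 0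
  | p + 1, L => rowWord p (fun k => L k.castSucc) ++ L (Fin.last (p + 1))

theorem forestHead_cons_forestTail : ∀ (p : ℕ) (F : Fin (p + 1) → BTree ι) (rest : List ι),
    forestHead p F :: forestTail p F rest = rowWord p (fun k => (F k).leaves) ++ rest
  | 0, F, rest => (F 0).head_cons_tail rest
  | p + 1, F, rest => by
    rw [forestHead, forestTail, forestHead_cons_forestTail p, rowWord, BTree.leavesAppend_eq,
      List.append_assoc]

theorem forestWord_congr {p p' : ℕ} {F : Fin (p + 1) → BTree ι} {G : Fin (p' + 1) → BTree ι}
    (h : rowWord p (fun k => (F k).leaves) = rowWord p' fun k => (G k).leaves) :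
    forestWord F = forestWord G := by
  have h1 := (forestHead_cons_forestTail p F []).trans
    ((congrArg (· ++ []) h).trans (forestHead_cons_forestTail p' G []).symm)
  rw [forestWord, forestWord, (List.cons.inj h1).1, (List.cons.inj h1).2]

theorem rowWord_map (g : ι → κ) : ∀ (p : ℕ) (L : Fin (p + 1) → List ι),
    (rowWord p L).map g = rowWord p fun k => (L k).map g
  | 0, _ => rfl
  | p + 1, L => by rw [rowWord, rowWord, List.map_append, rowWord_map g p]

theorem rowWord_flatMap (g : ι → List κ) : ∀ (p : ℕ) (L : Fin (p + 1) → List ι),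
    (rowWord p L).flatMap g = rowWord p fun k => (L k).flatMap g
  | 0, _ => rfl
  | p + 1, L => by rw [rowWord, rowWord, List.flatMap_append, rowWord_flatMap g p]

theorem mem_rowWord {i : ι} : ∀ {p : ℕ} {L : Fin (p + 1) → List ι}, i ∈ rowWord p L ↔ ∃ k, i ∈ L k
  | 0, L => ⟨fun h => ⟨0, h⟩, fun ⟨k, h⟩ => by obtain rfl : k = 0 := Fin.ext (by omega); exact h⟩
  | p + 1, L => by
    rw [rowWord, List.mem_append, mem_rowWord]
    refine ⟨fun h => h.elim (fun ⟨k, h⟩ => ⟨_, h⟩) fun h => ⟨_, h⟩, fun ⟨k, h⟩ => ?_⟩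
    induction k using Fin.lastCases with
    | last => exact .inr h
    | cast k => exact .inl ⟨k, h⟩

theorem nodup_of_rowWord : ∀ {p : ℕ} {L : Fin (p + 1) → List ι}, (rowWord p L).Nodup →
    (∀ k, (L k).Nodup) ∧ ∀ i k k', i ∈ L k → i ∈ L k' → k = k'
  | 0, L, h => ⟨fun k => by obtain rfl : k = 0 := Fin.ext (by omega); exact h,
      fun _ k k' _ _ => Fin.ext (by omega)⟩
  | p + 1, L, h => by
    obtain ⟨h1, h2, h3⟩ := List.nodup_append'.1 h
    obtain ⟨h4, h5⟩ := nodup_of_rowWord h1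
    refine ⟨fun k => ?_, fun i k k' hk hk' => ?_⟩
    · induction k using Fin.lastCases with
      | last => exact h2
      | cast k => exact h4 k
    · induction k using Fin.lastCases with
      | last =>
        induction k' using Fin.lastCases with
        | last => rfl
        | cast k' => exact (h3 (mem_rowWord.2 ⟨k', hk'⟩) hk).elim
      | cast k =>
        induction k' using Fin.lastCases with
        | last => exact (h3 (mem_rowWord.2 ⟨k, hk⟩) hk').elim
        | cast k' => exact congrArg Fin.castSucc (h5 i k k' hk hk')

theorem rowWord_singleton_nat : ∀ p : ℕ,
    rowWord p (fun k : Fin (p + 1) => [(k : ℕ)]) = List.range (p + 1)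
  | 0 => rfl
  | p + 1 => by
    rw [rowWord, List.range_succ]
    exact congrArg (· ++ [p + 1]) (rowWord_singleton_nat p)

theorem rowWord_singleton_nodup (p : ℕ) : (rowWord p fun k : Fin (p + 1) => [k]).Nodup := by
  refine List.Nodup.of_map Fin.val ?_
  rw [rowWord_map]
  exact (rowWord_singleton_nat p).symm ▸ List.nodup_range

/-! #### Sums and signs over words -/

theorem sum_rowWord (a : ι → ℤ) : ∀ (p : ℕ) (L : Fin (p + 1) → List ι),
    ((rowWord p L).map a).sum = ∑ k, ((L k).map a).sum
  | 0, L => by simp [rowWord]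
  | p + 1, L => by
    rw [rowWord, List.map_append, List.sum_append, sum_rowWord a p]
    exact (Fin.sum_univ_castSucc fun k => ((L k).map a).sum).symm

/-- The Koszul exponent relating `f₀ f₁ … e₀ e₁ …` and `f₀ e₀ f₁ e₁ …`. -/
def pairExp (e f : ι → ℤ) : List ι → ℤ
  | [] => 0
  | i :: l => e i * (l.map f).sum + pairExp e f l

theorem pairExp_append (e f : ι → ℤ) : ∀ l l' : List ι, pairExp e f (l ++ l') =
      pairExp e f l + pairExp e f l' + (l.map e).sum * (l'.map f).sum
  | [], _ => by simp [pairExp]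
  | i :: l, l' => by
    simp only [List.cons_append, pairExp, pairExp_append e f l, List.map_append, List.map_cons,
      List.sum_append, List.sum_cons]
    ring

theorem pairExp_rowWord (e f : ι → ℤ) : ∀ (p : ℕ) (L : Fin (p + 1) → List ι),
    pairExp e f (rowWord p L) = ∑ k, pairExp e f (L k) +
      ∑ i, ∑ k, if k < i then ((L i).map f).sum * ((L k).map e).sum else 0
  | 0, L => by simp [rowWord]
  | p + 1, L => by
    rw [rowWord, pairExp_append, pairExp_rowWord e f p, sum_rowWord]
    simp only [Fin.sum_univ_castSucc (n := p + 1), Fin.castSucc_lt_castSucc_iff,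
      (Fin.castSucc_lt_last _).not_gt, Fin.castSucc_lt_last, if_true, if_false, lt_irrefl, add_zero,
      ← mul_sum]
    ring

/-- The sum over a word with the Koszul signs for moving an operator of degree `1` past the
preceding letters. -/
def dSum (a : ι → ℤ) (H : ι → M) : ℤ → List ι → M
  | _, [] => 0
  | c, i :: l => c.negOnePow • H i + dSum a H (c + a i) l

theorem dSum_append (a : ι → ℤ) (H : ι → M) : ∀ (c : ℤ) (l l' : List ι),
    dSum a H c (l ++ l') = dSum a H c l + dSum a H (c + (l.map a).sum) l'
  | c, [], l' => by simp [dSum]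
  | c, i :: l, l' => by
    simp only [List.cons_append, dSum, dSum_append a H _ l, List.map_cons, List.sum_cons, add_assoc]

theorem dSum_shift (a : ι → ℤ) (H : ι → M) : ∀ (c c' : ℤ) (l : List ι),
    dSum a H (c + c') l = c.negOnePow • dSum a H c' l
  | c, c', [] => by simp [dSum]
  | c, c', i :: l => by
    simp only [dSum, smul_add, add_assoc c, dSum_shift a H c _ l, negOnePow_add, mul_smul]

theorem dSum_hom {N F : Type*} [AddCommGroup N] [FunLike F M N] [AddMonoidHomClass F M N] (φ : F)
    (a : ι → ℤ) (H : ι → M) : ∀ (c : ℤ) (l : List ι),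
    φ (dSum a H c l) = dSum a (fun i => φ (H i)) c l
  | c, [] => map_zero φ
  | c, i :: l => by simp only [dSum, map_add, map_usmul, dSum_hom φ a H _ l]

theorem dSum_congr (a : ι → ℤ) {H H' : ι → M} : ∀ (c : ℤ) {l : List ι},
    (∀ i ∈ l, H i = H' i) → dSum a H c l = dSum a H' c l
  | c, [], _ => rfl
  | c, i :: l, h => by
    rw [dSum, dSum, h i List.mem_cons_self,
      dSum_congr a _ fun k hk => h k (List.mem_cons_of_mem _ hk)]

theorem dSum_rowWord (a : ι → ℤ) (H : ι → M) : ∀ (p : ℕ) (L : Fin (p + 1) → List ι),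
    dSum a H 0 (rowWord p L) = ∑ k, (∑ k', if k' < k then ((L k').map a).sum else 0).negOnePow •
      dSum a H 0 (L k)
  | 0, L => by simp [rowWord]
  | p + 1, L => by
    have h := dSum_shift a H (∑ k : Fin (p + 1), ((L k.castSucc).map a).sum) 0 (L (Fin.last (p + 1)))
    rw [add_zero] at h
    rw [rowWord, dSum_append, dSum_rowWord a H p, sum_rowWord, zero_add, h]
    simp only [Fin.sum_univ_castSucc (n := p + 1), Fin.castSucc_lt_castSucc_iff,
      (Fin.castSucc_lt_last _).not_gt, Fin.castSucc_lt_last, if_true, if_false, lt_irrefl, add_zero]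

end Words

/-! ### Tensor products of morphisms bracketed by a tree -/

section TreeHom

variable {ι κ : Type}

theorem treeHom_deg_eq {X Y : ι → C} (f : ∀ i, HomogHom R (X i) (Y i)) (t : BTree ι) :
    (treeHom f t).deg = (t.leaves.map fun i => (f i).deg).sum :=
  (add_zero _).symm.trans (treeHom_deg f t [])

theorem treeHom_deg_congr {X Y : ι → C} (f : ∀ i, HomogHom R (X i) (Y i)) {s t : BTree ι}
    (h : s.leaves = t.leaves) : (treeHom f s).deg = (treeHom f t).deg := by
  rw [treeHom_deg_eq, treeHom_deg_eq, h]

theorem treeHom_id (X : ι → C) : ∀ t : BTree ι,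
    treeHom (fun i => HomogHom.id R (X i)) t = HomogHom.id R (treeObj R X t)
  | .leaf _ => rfl
  | .node l r => by
    rw [treeHom, treeHom_id X l, treeHom_id X r]
    exact HomogHom.ext' (add_zero _) (tensorHom_id _ _)

theorem treeHom_comp {X Y Z : ι → C} (e : ∀ i, HomogHom R (X i) (Y i))
    (f : ∀ i, HomogHom R (Y i) (Z i)) : ∀ t : BTree ι,
    (treeHom e t).hom ≫ (treeHom f t).hom =
      (pairExp (fun i => (e i).deg) (fun i => (f i).deg) t.leaves).negOnePow •
        (treeHom (fun i => (e i).comp (f i)) t).hom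
  | .leaf i => by
    have h : pairExp (fun i => (e i).deg) (fun i => (f i).deg) (BTree.leaf i).leaves = 0 := by
      simp [pairExp]
    rw [h, Int.negOnePow_zero]
    exact (one_smul _ _).symm
  | .node l r => by
    have h := tensorHom_comp (R := R) (treeHom f l).hom (treeHom e r).hom
      (treeHom e l).mem (treeHom f r).mem
    rw [treeHom_comp e f l, treeHom_comp e f r, tensorHom_signs, map_usmul,
      treeHom_deg_eq f r, treeHom_deg_eq e l, ← mul_smul, ← mul_smul, ← negOnePow_add,
      ← negOnePow_add] at h
    refine h.trans ?_
    rw [BTree.leaves_node, pairExp_append]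
    refine congrArg (fun n : ℤ => n.negOnePow • _) ?_
    ring

theorem treeHom_comp_treeHom {X Y Z : ι → C} (e : ∀ i, HomogHom R (X i) (Y i))
    (f : ∀ i, HomogHom R (Y i) (Z i)) (t : BTree ι) :
    (treeHom e t).comp (treeHom f t) = (treeHom (fun i => (e i).comp (f i)) t).signSmul
      (pairExp (fun i => (e i).deg) (fun i => (f i).deg) t.leaves).negOnePow := by
  refine HomogHom.ext' ?_ (treeHom_comp e f t)
  change (treeHom e t).deg + (treeHom f t).deg = (treeHom (fun i => (e i).comp (f i)) t).deg
  rw [treeHom_deg_eq, treeHom_deg_eq, treeHom_deg_eq, ← List.sum_map_add]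
  rfl

variable [DecidableEq ι]

theorem treeHom_update_of_notMem {X Y : ι → C} (f : ∀ i, HomogHom R (X i) (Y i)) {i : ι}
    (v : HomogHom R (X i) (Y i)) : ∀ {t : BTree ι}, i ∉ t.leaves →
    treeHom (update f i v) t = treeHom f t
  | .leaf k, h => update_of_ne (fun h' => h (by simp [h'])) _ _
  | .node l r, h => by
    rw [BTree.leaves_node, List.mem_append, not_or] at h
    rw [treeHom, treeHom, treeHom_update_of_notMem f v h.1, treeHom_update_of_notMem f v h.2]

theorem treeHom_update {X Y : ι → C} (f : ∀ i, HomogHom R (X i) (Y i)) {i : ι} :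
    ∀ {t : BTree ι}, i ∈ t.leaves → t.leaves.Nodup →
    ∃ (c : ℤ) (φ : (X i ⟶ Y i) →ₗ[R] (treeObj R X t ⟶ treeObj R Y t)),
      ∀ v : HomogHom R (X i) (Y i), (treeHom (update f i v) t).deg = v.deg + c ∧
        (treeHom (update f i v) t).hom = φ v.hom
  | .leaf k, h, _ => by
    obtain rfl : i = k := by simpa using h
    refine ⟨0, LinearMap.id, fun v => ?_⟩
    rw [treeHom, update_self]
    exact ⟨(add_zero _).symm, rfl⟩
  | .node l r, h, h' => by
    rw [BTree.leaves_node] at h h'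
    obtain ⟨h1, h2, h3⟩ := List.nodup_append'.1 h'
    rcases List.mem_append.1 h with h | h
    · obtain ⟨c, φ, hφ⟩ := treeHom_update f h h1
      refine ⟨c + (treeHom f r).deg, ((tHom).flip (treeHom f r).hom).comp φ, fun v => ?_⟩
      rw [treeHom, treeHom_update_of_notMem f v (h3 h)]
      refine ⟨?_, congrArg (fun x => tHom x _) (hφ v).2⟩
      rw [← add_assoc, ← (hφ v).1]
      rfl
    · obtain ⟨c, φ, hφ⟩ := treeHom_update f h h2
      refine ⟨(treeHom f l).deg + c, (tHom (treeHom f l).hom).comp φ, fun v => ?_⟩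
      rw [treeHom, treeHom_update_of_notMem f v fun h' => h3 h' h]
      refine ⟨?_, congrArg (fun x => tHom _ x) (hφ v).2⟩
      rw [add_left_comm, ← (hφ v).1]
      rfl

theorem d_treeHom {X Y : ι → C} (f : ∀ i, HomogHom R (X i) (Y i)) :
    ∀ {t : BTree ι}, t.leaves.Nodup →
    dC _ _ (treeHom f t).hom = dSum (fun i => (f i).deg)
      (fun i => (treeHom (update f i (f i).d) t).hom) 0 t.leaves
  | .leaf i, _ => by
    simp only [BTree.leaves_leaf, dSum, Int.negOnePow_zero, one_smul, add_zero, treeHom,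
      update_self]
    rfl
  | .node l r, h => by
    rw [BTree.leaves_node] at h ⊢
    obtain ⟨h1, h2, h3⟩ := List.nodup_append'.1 h
    have hd := d_tensorHom (R := R) (treeHom f r).hom (treeHom f l).mem
    rw [d_treeHom f h1, d_treeHom f h2, treeHom_deg_eq] at hd
    refine hd.trans ?_
    have hs := dSum_shift (fun i => (f i).deg)
      (fun i => (treeHom (update f i (f i).d) (.node l r)).hom)
      (l.leaves.map fun i => (f i).deg).sum 0 r.leaves
    rw [add_zero] at hs
    rw [dSum_append, zero_add, hs]
    refine add_congr ?_ (congrArg ((Int.negOnePow _) • ·) ?_)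
    · refine (dSum_hom ((tHom).flip (treeHom f r).hom) _ _ _ _).trans
        (dSum_congr _ _ fun i hi => ?_)
      rw [treeHom, treeHom_update_of_notMem f _ (h3 hi)]
      rfl
    · refine (dSum_hom (tHom (treeHom f l).hom) _ _ _ _).trans (dSum_congr _ _ fun i hi => ?_)
      rw [treeHom, treeHom_update_of_notMem f _ fun h => h3 h hi]
      rfl

end TreeHom

/-! ### Realizations by forests -/

section Forests

variable {p p' p'' : ℕ}

theorem ColMl.update_dSum {X Y : Row R C p} {M : Type*} [AddCommGroup M] [Module R M]
    {G : (X ⟶ Y) → M} (hG : ColMl G) {ι : Type} (f : X ⟶ Y) (k : Fin (p + 1)) (a : ι → ℤ)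
    (x : ι → HomogHom R (X k) (Y k)) : ∀ (c : ℤ) (l : List ι) (z : HomogHom R (X k) (Y k)),
    (∀ i ∈ l, (x i).deg = z.deg) → z.hom = dSum a (fun i => (x i).hom) c l →
    G (update f k z : X ⟶ Y) = dSum a (fun i => G (update f k (x i) : X ⟶ Y)) c l
  | c, [], z, _, h => hG.update_zero f k z h
  | c, i :: l, z, hd, h => by
    have hi := hd i List.mem_cons_self
    have hz : z.hom - c.negOnePow • (x i).hom ∈ gr (R := R) (X k) (Y k) z.deg :=
      Submodule.sub_mem _ z.mem (units_mem_smul _ _ (hi ▸ (x i).mem))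
    rw [hG.map_add f k ((x i).signSmul c.negOnePow) ⟨z.deg, _, hz⟩ z hi rfl
      (add_sub_cancel _ _).symm, hG.update_signSmul, dSum,
      hG.update_dSum f k a x (c + a i) l ⟨z.deg, _, hz⟩
        (fun k hk => hd k (List.mem_cons_of_mem _ hk))]
    exact sub_eq_of_eq_add' h

/-- All the forests have the same words of leaves, and these make up the word `0, …, p`. -/
def Covers {V : Type} (F : V → Forest p p') : Prop :=
  ∃ L : Fin (p' + 1) → List (Fin (p + 1)), (∀ x k, (F x k).leaves = L k) ∧
    rowWord p' L = rowWord p fun k => [k]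

variable (R C) in
/-- The realization given by forests. -/
noncomputable def forestReal {V : Type} (F : V → Forest p p') : Realization R C V p p' where
  obj x X := forestObj (F x) X
  map x _ _ f := forestHom (F x) f
  arr x y X := forestArrow (F x) (F y) X
  frm x X := toForest (F x) X
  bck x X := ofForest (F x) X

namespace Covers

variable {V : Type} {F : V → Forest p p'} (hF : Covers F)

include hF

theorem leaves_eq (x y : V) (k : Fin (p' + 1)) : (F x k).leaves = (F y k).leaves := by
  obtain ⟨L, h, -⟩ := hF
  rw [h, h]

theorem word_eq (x : V) : rowWord p' (fun k => (F x k).leaves) = rowWord p fun k => [k] := by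
  obtain ⟨L, h, h'⟩ := hF
  simp only [h, h']

theorem nodup (x : V) (k : Fin (p' + 1)) : (F x k).leaves.Nodup :=
  (nodup_of_rowWord (hF.word_eq x ▸ rowWord_singleton_nodup p)).1 k

theorem exists_mem (x : V) (i : Fin (p + 1)) : ∃ k, i ∈ (F x k).leaves := by
  rw [← mem_rowWord (L := fun k => (F x k).leaves), hF.word_eq]
  exact mem_rowWord.2 ⟨i, List.mem_singleton_self i⟩

theorem forestHom_update (x : V) {X Y : Row R C p} (f : X ⟶ Y) (i : Fin (p + 1))
    (y : HomogHom R (X i) (Y i)) {k : Fin (p' + 1)} (hk : i ∈ (F x k).leaves) :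
    forestHom (F x) (update f i y : X ⟶ Y) =
      (update (forestHom (F x) f) k (treeHom (update f i y) (F x k)) :
        forestObj (F x) X ⟶ forestObj (F x) Y) := by
  exact Function.eq_update_iff.2 ⟨rfl, fun k' h => treeHom_update_of_notMem f y fun h' => h
    ((nodup_of_rowWord (hF.word_eq x ▸ rowWord_singleton_nodup p)).2 i _ _ h' hk)⟩

theorem arrow_isCanonical (x y : V) (X : Row R C p) (k : Fin (p' + 1)) :
    IsCan R X (F x k) (F y k) (forestArrow (F x) (F y) X k).hom :=
  canonicalHom_isCanonical X (forestWord_congr (p := 0) (p' := 0)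
    (F := fun _ => F x k) (G := fun _ => F y k) (hF.leaves_eq x y k))

theorem toForest_isCanonical (x : V) (X : Row R C p) :
    IsCan R X (rowTree p .leaf) (rowTree p' (F x)) (toForest (F x) X) :=
  canonicalHom_isCanonical X (forestWord_congr (hF.word_eq x).symm)

theorem ofForest_isCanonical (x : V) (X : Row R C p) :
    IsCan R X (rowTree p' (F x)) (rowTree p .leaf) (ofForest (F x) X) :=
  canonicalHom_isCanonical X (forestWord_congr (hF.word_eq x))

theorem columnTensor_arrow (x y : V) (X : Row R C p) :
    IsCan R X (rowTree p' (F x)) (rowTree p' (F y)) (columnTensor (forestArrow (F x) (F y) X)) :=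
  rowTensorHom_isCanonical p' _ _ _ (hF.arrow_isCanonical x y X)

theorem lawful : (forestReal R C F).Lawful where
  map_id x X := funext fun k => treeHom_id X (F x k)
  arr_self x X := funext fun k => HomogHom.ext' (canonicalHom_deg _ _ _)
    ((hF.arrow_isCanonical x x X k).unique (.id rfl))
  arr_comp x y z X := funext fun k => HomogHom.ext'
    ((add_congr (canonicalHom_deg _ _ _) (canonicalHom_deg _ _ _)).trans
      ((add_zero 0).trans (canonicalHom_deg _ _ _).symm))
    (((hF.arrow_isCanonical x y X k).comp (hF.arrow_isCanonical y z X k)).unique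
      (hF.arrow_isCanonical x z X k))
  arr_nat x y X Y f := funext fun k => HomogHom.ext'
    ((add_congr (treeHom_deg_congr f (hF.leaves_eq x y k)) (canonicalHom_deg _ _ _)).trans
      ((add_comm _ _).trans (congrArg (· + _) (canonicalHom_deg _ _ _).symm)))
    ((hF.arrow_isCanonical x y X k).natural (hF.arrow_isCanonical x y Y k) (.treeHom f _)
      (.treeHom f _))
  arr_deg x y X k := canonicalHom_deg _ _ _
  arr_d x y X k := (hF.arrow_isCanonical x y X k).d_eq_zero
  frm_arr x y X := ((hF.toForest_isCanonical x X).comp (hF.columnTensor_arrow x y X)).unique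
    (hF.toForest_isCanonical y X)
  arr_bck x y X := ((hF.columnTensor_arrow x y X).comp (hF.ofForest_isCanonical y X)).unique
    (hF.ofForest_isCanonical x X)
  frm_nat x X Y f := (hF.toForest_isCanonical x X).natural (hF.toForest_isCanonical x Y)
    (rowTensorHom_isTreeHom f p .leaf) (rowTensorHom_isTreeHom f p' (F x))
  bck_nat x X Y f := (hF.ofForest_isCanonical x X).natural (hF.ofForest_isCanonical x Y)
    (rowTensorHom_isTreeHom f p' (F x)) (rowTensorHom_isTreeHom f p .leaf)
  frm_mem x X := (hF.toForest_isCanonical x X).mem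
  bck_mem x X := (hF.ofForest_isCanonical x X).mem
  d_frm x X := (hF.toForest_isCanonical x X).d_eq_zero
  d_bck x X := (hF.ofForest_isCanonical x X).d_eq_zero
  map_deg x X Y f := by
    have h := sum_rowWord (fun i => (f i).deg) p' fun k => (F x k).leaves
    rw [hF.word_eq, sum_rowWord] at h
    simp only [List.map_cons, List.map_nil, List.sum_singleton] at h
    exact (sum_congr rfl fun k _ => treeHom_deg_eq f (F x k)).trans h.symm
  map_colMl x X Y M _ _ G hG := by
    refine ⟨fun f i y z z' h1 h2 h3 => ?_, fun f i c y z h1 h2 => ?_⟩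
    all_goals
      obtain ⟨k, hk⟩ := hF.exists_mem x i
      obtain ⟨c, φ, hφ⟩ := treeHom_update f hk (hF.nodup x k)
      have h := fun y => congrArg G (hF.forestHom_update x f i y hk)
    · refine (h z').trans (Eq.trans ?_ (add_congr (h y) (h z)).symm)
      refine hG.map_add _ k _ _ _ ?_ ?_ ?_
      · rw [(hφ _).1, (hφ _).1, h1]
      · rw [(hφ _).1, (hφ _).1, h2]
      · exact (hφ _).2.trans ((congrArg φ h3).trans ((map_add φ _ _).trans
          (add_congr (hφ _).2.symm (hφ _).2.symm)))
    · refine (h z).trans (Eq.trans ?_ (congrArg (_ • ·) (h y)).symm)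
      refine hG.map_smul _ k _ _ _ ?_ ?_
      · rw [(hφ _).1, (hφ _).1, h1]
      · exact (hφ _).2.trans ((congrArg φ h2).trans ((map_smul φ _ _).trans
          (congrArg (_ • ·) (hφ _).2.symm)))
  map_comp x X Y Z e f M _ _ G hG := by
    have h1 : colComp (forestHom (F x) e) (forestHom (F x) f) = fun k =>
        (forestHom (F x) (colComp e f) k).signSmul
          (pairExp (fun i => (e i).deg) (fun i => (f i).deg) (F x k).leaves).negOnePow :=
      funext fun k => treeHom_comp_treeHom e f (F x k)
    have h5 : ∀ k, ((F x k).leaves.map fun i => (f i).deg).sum = (forestHom (F x) f k).deg :=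
      fun k => (treeHom_deg_eq f _).symm
    have h6 : ∀ k, ((F x k).leaves.map fun i => (e i).deg).sum = (forestHom (F x) e k).deg :=
      fun k => (treeHom_deg_eq e _).symm
    have h2 := pairExp_rowWord (fun i => (e i).deg) (fun i => (f i).deg) p' fun k =>
      (F x k).leaves
    rw [hF.word_eq, pairExp_rowWord] at h2
    simp only [List.map_cons, List.map_nil, List.sum_singleton, pairExp, List.sum_nil, mul_zero,
      add_zero, sum_const_zero, zero_add, h5, h6] at h2
    have h3 : mergeSign e f = (∏ k, (pairExp (fun i => (e i).deg) (fun i => (f i).deg)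
        (F x k).leaves).negOnePow) * mergeSign (forestHom (F x) e) (forestHom (F x) f) := by
      have h4 : ∀ (s : Finset (Fin (p' + 1))) (b : Fin (p' + 1) → ℤ),
          (∑ k ∈ s, b k).negOnePow = ∏ k ∈ s, (b k).negOnePow := fun s b => by
        induction s using Finset.induction_on with
        | empty => rfl
        | insert i s hi ih => rw [Finset.sum_insert hi, Finset.prod_insert hi, negOnePow_add, ih]
      rw [← h4, mergeSign_eq, mergeSign_eq, ← negOnePow_add]
      exact congrArg Int.negOnePow h2
    refine (congrArg (fun y => mergeSign (forestHom (F x) e) (forestHom (F x) f) • G y) h1).trans ?_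
    refine (congrArg (_ • ·) (hG.map_signSmul _ _)).trans ?_
    exact (mul_smul _ _ _).symm.trans (congrArg (· • _) ((mul_comm _ _).trans h3.symm))
  map_colD x X Y f M _ _ G hG := by
    have h1 := dSum_rowWord (fun i => (f i).deg)
      (fun i => G (forestHom (F x) (update f i (f i).d : X ⟶ Y))) p' fun k =>
        (F x k).leaves
    rw [hF.word_eq, dSum_rowWord] at h1
    simp only [List.map_cons, List.map_nil, List.sum_singleton, dSum, Int.negOnePow_zero, one_smul,
      add_zero] at h1
    refine Eq.trans (sum_congr rfl fun k _ => ?_) h1.symm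
    refine congrArg₂ (fun (s : ℤ) y => s.negOnePow • y) (sum_congr rfl fun k' _ =>
        congrArg (fun n : ℤ => if k' < k then n else 0) (treeHom_deg_eq f (F x k'))) ?_
    refine (hG.update_dSum (forestHom (F x) f) k (fun i => (f i).deg)
      (fun i => treeHom (update f i (f i).d) (F x k)) 0 (F x k).leaves _
      (fun i hi => ?_) (d_treeHom f (hF.nodup x k))).trans
      (dSum_congr _ _ fun i hi => congrArg G (hF.forestHom_update x f i _ hi).symm)
    obtain ⟨c, φ, hφ⟩ := treeHom_update f hi (hF.nodup x k)
    have h3 := (hφ (f i)).1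
    rw [Function.update_eq_self] at h3
    change _ = (treeHom f (F x k)).deg + 1
    rw [(hφ _).1, h3]
    change (f i).deg + 1 + c = _
    ring

end Covers

end Forests

/-! ### Grafting -/

namespace BTree

variable {ι κ μ : Type}

theorem bind_bind (F : ι → BTree κ) (G : κ → BTree μ) : ∀ t : BTree ι,
    (t.bind F).bind G = t.bind fun i => (F i).bind G
  | leaf _ => rfl
  | node l r => congrArg₂ node (bind_bind F G l) (bind_bind F G r)

theorem bind_congr {F G : ι → BTree κ} : ∀ {t : BTree ι}, (∀ i ∈ t.leaves, F i = G i) →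
    t.bind F = t.bind G
  | leaf i, h => h i (by simp)
  | node l r, h => congrArg₂ node (bind_congr fun i hi => h i (by simp [hi]))
      (bind_congr fun i hi => h i (by simp [hi]))

theorem leaves_rightComb : ∀ s k : ℕ, (rightComb s k).leaves = List.range' s (k + 1)
  | s, 0 => rfl
  | s, k + 1 => by
    rw [rightComb, leaves_node, leaves_rightComb, leaves_leaf]
    rfl

theorem leaves_rightComb_zero (k : ℕ) : (rightComb 0 k).leaves = List.range (k + 1) := by
  rw [leaves_rightComb, List.range_eq_range']

theorem flatMap_range_graft {α : Type} (F : ℕ → List α) (g : ℕ → α) {a k m : ℕ} (h : a ≤ k)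
    (h1 : ∀ b < a, F b = [g b]) (h2 : F a = (List.range (m + 1)).map fun b => g (b + a))
    (h3 : ∀ b, a < b → F b = [g (b + m)]) :
    (List.range (k + 1)).flatMap F = (List.range (k + m + 1)).map g := by
  induction k, h using Nat.le_induction with
  | base =>
    have : ∀ n ≤ a, (List.range n).flatMap F = (List.range n).map g := by
      intro n hn
      induction n with
      | zero => rfl
      | succ n ih =>
        rw [List.range_succ, List.flatMap_append, ih (by omega), List.map_append,
          List.flatMap_cons, h1 n (by omega)]
        rfl
    rw [List.range_succ, List.flatMap_append, this a le_rfl, List.flatMap_cons, h2, add_assoc,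
      List.range_add (n := a), List.map_append, List.map_map]
    simp [Function.comp_def, add_comm]
  | succ k hk ih =>
    rw [List.range_succ, List.flatMap_append, ih, add_right_comm k 1 m, List.range_succ (n := k + m + 1),
      List.map_append, List.flatMap_cons, h3 _ (by omega), add_right_comm k 1 m]
    rfl

theorem leaves_graft {t u : BTree ℕ} {k a m : ℕ} (ht : t.leaves = List.range (k + 1)) (ha : a ≤ k)
    (hu : u.leaves = List.range (m + 1)) : (t.graft a m u).leaves = List.range (k + m + 1) := by
  rw [graft, leaves_bind, ht, flatMap_range_graft (m := m) _ id ha (fun b hb => by simp [hb])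
      (by simp only [lt_irrefl, if_false, if_true, leaves_map, hu]; rfl)
      (fun b hb => by simp [hb.ne', hb.not_gt]), List.map_id]

/-- `t` if its leaves are `0, …, n`, otherwise a tree with leaves `0, …, n`. -/
def retract (n : ℕ) (t : BTree ℕ) : BTree ℕ :=
  if t.leaves = List.range (n + 1) then t else rightComb 0 n

theorem retract_of_leaves {n : ℕ} {t : BTree ℕ} (h : t.leaves = List.range (n + 1)) :
    t.retract n = t := if_pos h

theorem leaves_retract (n : ℕ) (t : BTree ℕ) : (t.retract n).leaves = List.range (n + 1) := by
  rw [retract]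
  split_ifs with h
  · exact h
  · exact leaves_rightComb_zero n

end BTree

/-! ### The vertices of admissible paths -/

theorem mem_shufflePaths {α β : Type} : ∀ {P : List α} {Q : List β} {x : ℤˣ × List (α × β)},
    x ∈ shufflePaths P Q → ∀ y ∈ x.2, y.1 ∈ P ∧ y.2 ∈ Q
  | [], _, _, h => by simp [shufflePaths] at h
  | _ :: _, [], _, h => by simp [shufflePaths] at h
  | [a], [b], x, h => by
    intro y hy
    rw [shufflePaths, List.mem_singleton] at h
    subst h
    simp at hy
    simp [hy]
  | a :: a' :: as, [b], x, h => by
    intro y hy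
    rw [shufflePaths, List.mem_map] at h
    obtain ⟨x, h, rfl⟩ := h
    rcases List.mem_cons.1 hy with rfl | hy
    · simp
    · exact ⟨List.mem_cons_of_mem _ (mem_shufflePaths h y hy).1, (mem_shufflePaths h y hy).2⟩
  | [a], b :: b' :: bs, x, h => by
    intro y hy
    rw [shufflePaths, List.mem_map] at h
    obtain ⟨x, h, rfl⟩ := h
    rcases List.mem_cons.1 hy with rfl | hy
    · simp
    · exact ⟨(mem_shufflePaths h y hy).1, List.mem_cons_of_mem _ (mem_shufflePaths h y hy).2⟩
  | a :: a' :: as, b :: b' :: bs, x, h => by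
    intro y hy
    rw [shufflePaths, List.mem_append, List.mem_map, List.mem_map] at h
    rcases h with ⟨x, h, rfl⟩ | ⟨x, h, rfl⟩ <;> rcases List.mem_cons.1 hy with rfl | hy
    · simp
    · exact ⟨List.mem_cons_of_mem _ (mem_shufflePaths h y hy).1, (mem_shufflePaths h y hy).2⟩
    · simp
    · exact ⟨(mem_shufflePaths h y hy).1, List.mem_cons_of_mem _ (mem_shufflePaths h y hy).2⟩
  termination_by P Q => P.length + Q.length

theorem leaves_of_mem_admissiblePaths {N : ℕ} {x : ℤˣ × List (BTree ℕ)}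
    (hx : x ∈ admissiblePaths N) : ∀ t ∈ x.2, t.leaves = List.range (N + 2) := by
  induction N using Nat.strong_induction_on generalizing x with
  | h N ih =>
    intro t ht
    cases N with
    | zero =>
      rw [admissiblePaths, List.mem_singleton] at hx
      subst hx
      obtain rfl : t = _ := by simpa using ht
      rfl
    | succ N =>
      rw [admissiblePaths] at hx
      simp only [List.mem_flatMap, List.mem_map, List.mem_range] at hx
      obtain ⟨k, -, a, ha, P, hP, Q, hQ, S, hS, rfl⟩ := hx
      rcases List.mem_cons.1 ht with rfl | ht
      · exact BTree.leaves_rightComb_zero _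
      · obtain ⟨y, hy, rfl⟩ := List.mem_map.1 ht
        obtain ⟨h1, h2⟩ := mem_shufflePaths hS y hy
        have hk := k.2
        have h3 := BTree.leaves_graft (ih k.1 (by omega) hP _ h1) (a := a) (by omega)
          (m := N + 1 - k.1) (by rw [ih (N - k.1) (by omega) hQ _ h2]; congr 1; omega)
        rw [h3]
        congr 1
        omega

theorem map_retract_of_mem_admissiblePaths {N : ℕ} {x : ℤˣ × List (BTree ℕ)}
    (hx : x ∈ admissiblePaths N) : x.2.map (BTree.retract (N + 1)) = x.2 :=
  (List.map_congr_left fun t ht =>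
    BTree.retract_of_leaves (leaves_of_mem_admissiblePaths hx t ht)).trans (List.map_id _)

/-! ### Blocks -/

section Blocks

variable {p p' p'' : ℕ}

theorem Realization.ext_heq {V : Type} {ρ σ : Realization R C V p p'}
    (hobj : ∀ x (X : Row R C p) k, ρ.obj x X k = σ.obj x X k)
    (hmap : ∀ x {X Y : Row R C p} (f : X ⟶ Y) k, HEq (ρ.map x f k) (σ.map x f k))
    (harr : ∀ x y (X : Row R C p) k, HEq (ρ.arr x y X k) (σ.arr x y X k))
    (hfrm : ∀ x (X : Row R C p), HEq (ρ.frm x X) (σ.frm x X))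
    (hbck : ∀ x (X : Row R C p), HEq (ρ.bck x X) (σ.bck x X)) : ρ = σ := by
  obtain ⟨obj, map, arr, frm, bck⟩ := ρ
  obtain ⟨obj', map', arr', frm', bck'⟩ := σ
  obtain rfl : obj = obj' := by
    funext x X
    exact funext fun k => hobj x X k
  obtain rfl : @map = @map' := by
    funext x X Y f
    exact funext fun k => eq_of_heq (hmap x f k)
  obtain rfl : arr = arr' := by
    funext x y X
    exact funext fun k => eq_of_heq (harr x y X k)
  obtain rfl : frm = frm' := by
    funext x X
    exact eq_of_heq (hfrm x X)
  obtain rfl : bck = bck' := by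
    funext x X
    exact eq_of_heq (hbck x X)
  rfl

theorem rowTree_bind {ι κ : Type} (F : ι → BTree κ) : ∀ (p : ℕ) (G : Fin (p + 1) → BTree ι),
    (rowTree p G).bind F = rowTree p fun k => (G k).bind F
  | 0, _ => rfl
  | p + 1, G => congrArg₂ BTree.node (rowTree_bind F p fun k => G k.castSucc) rfl

theorem treeHom_bind_deg {ι κ : Type} {X Y : κ → C} (f : ∀ i, HomogHom R (X i) (Y i))
    (F : ι → BTree κ) : ∀ t : BTree ι,
    (treeHom (fun i => treeHom f (F i)) t).deg = (treeHom f (t.bind F)).deg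
  | .leaf _ => rfl
  | .node l r => add_congr (treeHom_bind_deg f F l) (treeHom_bind_deg f F r)

/-- Substitution of forests. -/
def bindForests {V V' : Type} (F : V → Forest p p') (G : V' → Forest p' p'') :
    V' × V → Forest p p'' := fun x k => (G x.1 k).bind (F x.2)

namespace Covers

variable {V V' : Type} {F : V → Forest p p'} {G : V' → Forest p' p''}

protected theorem bindForests (hF : Covers F) (hG : Covers G) : Covers (bindForests F G) := by
  obtain ⟨L, h1, h2⟩ := hF
  obtain ⟨L', h3, h4⟩ := hG
  refine ⟨fun k => (L' k).flatMap L, fun x k => ?_, ?_⟩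
  · rw [bindForests, BTree.leaves_bind, h3]
    simp only [h1]
  · rw [← rowWord_flatMap, h4, rowWord_flatMap, ← h2]
    simp

theorem compose_eq (hF : Covers F) (hG : Covers G) : (forestReal R C F).compose (forestReal R C G) =
      forestReal R C (bindForests F G) := by
  have hFG := hF.bindForests hG
  have hobj : ∀ (x : V' × V) (X : Row R C p) k, treeObj R (forestObj (F x.2) X) (G x.1 k) =
      treeObj R X (bindForests F G x k) := fun x X k => treeObj_bind X (F x.2) _
  refine Realization.ext_heq hobj (fun x X Y f k => ?_) (fun x y X k => ?_) (fun x X => ?_)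
    fun x X => ?_
  · exact HomogHom.heq (hobj x X k) (hobj x Y k) (treeHom_bind_deg f (F x.2) (G x.1 k))
      ((treeHom_bind f (F x.2) (G x.1 k)).heq (.treeHom _ _))
  · have h1 : IsCan R X (bindForests F G x k)
        ((G x.1 k).bind (F y.2)) (treeHom (forestArrow (F x.2) (F y.2) X) (G x.1 k)).hom :=
      treeHom_isCanonical _ _ _ (hF.arrow_isCanonical x.2 y.2 X) _
    have h2 := (hG.arrow_isCanonical x.1 y.1 (forestObj (F y.2) X) k).bind
    refine HomogHom.heq (hobj x X k) (hobj y X k) ?_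
      ((h1.comp h2).heq (hFG.arrow_isCanonical x y X k))
    refine (add_congr ((treeHom_deg_eq (forestArrow (F x.2) (F y.2) X) (G x.1 k)).trans ?_)
      (canonicalHom_deg _ _ _)).trans ((add_zero 0).trans (canonicalHom_deg _ _ _).symm)
    refine List.sum_eq_zero fun n hn => ?_
    obtain ⟨i, -, rfl⟩ := List.mem_map.1 hn
    exact canonicalHom_deg _ _ _
  · have h2 := (hG.toForest_isCanonical x.1 (forestObj (F x.2) X)).bind
    exact ((hF.toForest_isCanonical x.2 X).comp (h2.congr (rowTree_bind _ _ _)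
      (rowTree_bind _ _ _))).heq (hFG.toForest_isCanonical x X)
  · have h2 := (hG.ofForest_isCanonical x.1 (forestObj (F x.2) X)).bind
    exact ((h2.congr (rowTree_bind _ _ _) (rowTree_bind _ _ _)).comp
      (hF.ofForest_isCanonical x.2 X)).heq (hFG.ofForest_isCanonical x X)

end Covers

/-- The forest with the trees `0, …, j - 1, t, j + i + 1, …`, with `p' + 1` trees. -/
def blockF (p p' i j : ℕ) (t : BTree ℕ) : Forest p p' := fun k =>
  if k.1 < j then .leaf (Fin.ofNat (p + 1) k.1)
  else if k.1 = j then t.map fun a => Fin.ofNat (p + 1) (j + a)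
  else .leaf (Fin.ofNat (p + 1) (k.1 + i))

theorem blockF_lt {i j : ℕ} (t : BTree ℕ) {k : Fin (p' + 1)} (h : k.1 < j) :
    blockF p p' i j t k = .leaf (Fin.ofNat (p + 1) k.1) := if_pos h

theorem blockF_eq {i j : ℕ} (t : BTree ℕ) {k : Fin (p' + 1)} (h : k.1 = j) :
    blockF p p' i j t k = t.map fun a => Fin.ofNat (p + 1) (j + a) := by
  rw [blockF, if_neg (by omega), if_pos h]

theorem blockF_gt {i j : ℕ} (t : BTree ℕ) {k : Fin (p' + 1)} (h : j < k.1) :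
    blockF p p' i j t k = .leaf (Fin.ofNat (p + 1) (k.1 + i)) := by
  rw [blockF, if_neg (by omega), if_neg (by omega)]

theorem val_ofNat {n : ℕ} (h : n ≤ p) : (Fin.ofNat (p + 1) n).1 = n := Nat.mod_eq_of_lt (by omega)

theorem rowWord_block_nat (i j m : ℕ) : rowWord m (fun k : Fin (m + 1) => if k.1 < j then [k.1] else
      if k.1 = j then (List.range (i + 1)).map fun a => j + a else [k.1 + i]) =
      if m < j then List.range (m + 1) else List.range (m + i + 1) := by
  induction m with
  | zero =>
    change (if 0 < j then [0] else if 0 = j then _ else _) = _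
    split_ifs with h h'
    · rfl
    · subst h'
      simp
    · omega
  | succ m ih =>
    refine (congrArg (· ++ _) ih).trans ?_
    simp only [Fin.val_last]
    rcases lt_trichotomy (m + 1) j with h | h | h
    · rw [if_pos (show m < j by omega), if_pos h, if_pos h]
      exact (List.range_succ (n := m + 1)).symm
    · rw [if_pos (show m < j by omega), if_neg h.not_lt, if_pos h, if_neg h.not_lt,
        add_assoc (m + 1) i 1, h]
      exact List.range_add.symm
    · rw [if_neg (show ¬ m < j by omega), if_neg h.not_gt, if_neg h.not_gt, if_neg h.ne',
        add_right_comm m 1 i]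
      exact (List.range_succ (n := m + i + 1)).symm

theorem covers_blockF {i j : ℕ} (h : p' + i = p) (hj : j ≤ p') :
    Covers fun t : BTree ℕ => blockF p p' i j (t.retract i) := by
  refine ⟨fun k : Fin (p' + 1) => if k.1 < j then [Fin.ofNat (p + 1) k.1] else
    if k.1 = j then (List.range (i + 1)).map fun a => Fin.ofNat (p + 1) (j + a) else
      [Fin.ofNat (p + 1) (k.1 + i)], fun t k => ?_, ?_⟩
  · dsimp only
    split_ifs with h1 h2
    · rw [blockF_lt _ h1, BTree.leaves_leaf]
    · rw [blockF_eq _ h2, BTree.leaves_map, BTree.leaves_retract]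
    · rw [blockF_gt _ (by omega), BTree.leaves_leaf]
  · refine List.map_injective_iff.2 Fin.val_injective ?_
    rw [rowWord_map, rowWord_map]
    refine Eq.trans ?_ (rowWord_singleton_nat p).symm
    have h1 := rowWord_block_nat i j p'
    rw [if_neg (by omega), h] at h1
    rw [← h1]
    refine congrArg _ (funext fun k => ?_)
    have hk := k.2
    split_ifs with h1 h2
    · rw [List.map_singleton, val_ofNat (by omega)]
    · rw [List.map_map]
      refine List.map_congr_left fun a ha => val_ofNat ?_
      rw [List.mem_range] at ha
      omega
    · rw [List.map_singleton, val_ofNat (by omega)]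

variable (R C) in
/-- The realization by the trees on the rows `j, …, j + i`. -/
noncomputable def blockReal (p p' i j : ℕ) : Realization R C (BTree ℕ) p p' :=
  forestReal R C fun t => blockF p p' i j (t.retract i)

theorem blockReal_lawful {i j : ℕ} (h : p' + i = p) (hj : j ≤ p') :
    (blockReal R C p p' i j).Lawful := (covers_blockF h hj).lawful

theorem bind_blockF_nested {k l j a : ℕ} (h : p' + l = p) (h' : p'' + k = p') (hj : j ≤ p'')
    (ha : a ≤ k) {t : BTree ℕ} (ht : t.leaves = List.range (k + 1)) (u : BTree ℕ) :
    (fun κ => (blockF p' p'' k j t κ).bind (blockF p p' l (j + a) u)) =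
      blockF p p'' (k + l) j (t.graft a l u) := by
  funext κ
  have hκ := κ.2
  rcases lt_trichotomy κ.1 j with h1 | h1 | h1
  · rw [blockF_lt _ h1, blockF_lt _ h1, BTree.bind,
      blockF_lt _ (by rw [val_ofNat (by omega)]; omega), val_ofNat (by omega)]
  · rw [blockF_eq _ h1, blockF_eq _ h1, BTree.map, BTree.map, BTree.graft, BTree.bind_bind,
      BTree.bind_bind]
    refine BTree.bind_congr fun b hb => ?_
    rw [ht, List.mem_range] at hb
    have hb' : (Fin.ofNat (p' + 1) (j + b)).1 = j + b := val_ofNat (by omega)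
    rw [BTree.bind]
    rcases lt_trichotomy b a with h2 | h2 | h2
    · rw [if_pos h2, BTree.bind, blockF_lt _ (by omega), hb']
    · subst h2
      rw [if_neg (lt_irrefl b), if_pos rfl, blockF_eq _ hb', BTree.map, BTree.map, BTree.bind_bind]
      refine BTree.bind_congr fun c _ => ?_
      rw [BTree.bind, add_assoc, add_comm b c]
    · rw [if_neg h2.not_gt, if_neg h2.ne', BTree.bind, blockF_gt _ (by omega), hb', add_assoc]
  · rw [blockF_gt _ h1, blockF_gt _ h1, BTree.bind,
      blockF_gt _ (by rw [val_ofNat (by omega)]; omega), val_ofNat (by omega), add_assoc]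

theorem bind_blockF_disjoint {q k l j j' : ℕ} (h : p' + l = p) (h' : p'' + k = p')
    (h1 : q + k = p) (hj : j < j') (hj' : j' ≤ p'') {t u : BTree ℕ}
    (ht : t.leaves = List.range (k + 1)) (hu : u.leaves = List.range (l + 1)) :
    (fun κ => (blockF p' p'' k j' t κ).bind (blockF p p' l j u)) =
      fun κ => (blockF q p'' l j u κ).bind (blockF p q k (j' + l) t) := by
  funext κ
  have hκ := κ.2
  rcases lt_trichotomy κ.1 j with h2 | h2 | h2
  · rw [blockF_lt _ (h2.trans hj), blockF_lt _ h2, BTree.bind, BTree.bind,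
      blockF_lt _ (by rw [val_ofNat (by omega)]; omega), val_ofNat (by omega),
      blockF_lt _ (by rw [val_ofNat (by omega)]; omega), val_ofNat (by omega)]
  · rw [blockF_lt _ (h2.trans_lt hj), blockF_eq _ h2, BTree.bind,
      blockF_eq _ (by rw [val_ofNat (by omega)]; omega), BTree.map, BTree.map, BTree.bind_bind]
    refine BTree.bind_congr fun b hb => ?_
    rw [hu, List.mem_range] at hb
    rw [BTree.bind, blockF_lt _ (by rw [val_ofNat (by omega)]; omega), val_ofNat (by omega)]
  · rw [blockF_gt _ h2, BTree.bind]
    rcases lt_trichotomy κ.1 j' with h3 | h3 | h3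
    · rw [blockF_lt _ h3, BTree.bind,
        blockF_gt _ (by rw [val_ofNat (by omega)]; omega), val_ofNat (by omega),
        blockF_lt _ (by rw [val_ofNat (by omega)]; omega), val_ofNat (by omega)]
    · rw [blockF_eq _ h3, blockF_eq _ (by rw [val_ofNat (by omega)]; omega), BTree.map, BTree.map,
        BTree.bind_bind]
      refine BTree.bind_congr fun b hb => ?_
      rw [ht, List.mem_range] at hb
      rw [BTree.bind, blockF_gt _ (by rw [val_ofNat (by omega)]; omega), val_ofNat (by omega),
        add_right_comm]
    · rw [blockF_gt _ h3, BTree.bind,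
        blockF_gt _ (by rw [val_ofNat (by omega)]; omega), val_ofNat (by omega),
        blockF_gt _ (by rw [val_ofNat (by omega)]; omega), val_ofNat (by omega), add_right_comm]

theorem blockReal_nested {k l j a : ℕ} (h : p' + l = p) (h' : p'' + k = p') (hj : j ≤ p'')
    (ha : a ≤ k) :
    (blockReal R C p p' l (j + a)).compose (blockReal R C p' p'' k j) =
      (blockReal R C p p'' (k + l) j).pull
        fun x => (x.1.retract k).graft a l (x.2.retract l) := by
  refine ((covers_blockF h (by omega)).compose_eq (covers_blockF h' hj)).trans ?_
  refine congrArg (forestReal R C) (funext fun x => ?_)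
  have h1 := BTree.leaves_graft (x.1.leaves_retract k) ha (x.2.leaves_retract l)
  refine (bind_blockF_nested h h' hj ha (x.1.leaves_retract k) _).trans ?_
  exact congrArg _ (BTree.retract_of_leaves h1).symm

theorem blockReal_disjoint {q k l j j' : ℕ} (h : p' + l = p) (h' : p'' + k = p')
    (h1 : q + k = p) (h2 : p'' + l = q) (hj : j < j') (hj' : j' ≤ p'') :
    (blockReal R C p p' l j).compose (blockReal R C p' p'' k j') =
      ((blockReal R C p q k (j' + l)).compose (blockReal R C q p'' l j)).pull Prod.swap := by
  refine ((covers_blockF h (by omega)).compose_eq (covers_blockF h' hj')).trans ?_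
  refine Eq.trans ?_ (congrArg (Realization.pull Prod.swap)
    ((covers_blockF h1 (by omega)).compose_eq (covers_blockF h2 (by omega)))).symm
  refine congrArg (forestReal R C) (funext fun x => ?_)
  exact bind_blockF_disjoint h h' h1 hj hj' (x.1.leaves_retract k) (x.2.leaves_retract l)

/-! #### Comparison with the sums over lattice paths -/

variable (R C) in
/-- The realization by all forests. -/
noncomputable def allForests (p p' : ℕ) : Realization R C (Forest p p') p p' :=
  forestReal R C fun F => F

theorem signedSum_latticePaths {T : C} (F : Forest p p') (Q : List (Forest p p'))
    {X Y : Row R C p} (γ : Rect X Y) (Ψ : Fam (forestObj F Y) T) :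
    signedSum (latticePaths F Q γ) (fun P => toForest (bottom F Q) X ≫ Ψ _ P) =
      (allForests R C p p').lat F Q γ Ψ := by
  induction Q generalizing F Y with
  | nil =>
    rw [latticePaths, signedSum_cons, signedSum_nil, one_smul, add_zero]
    induction γ with
    | nil => rfl
    | cons γ f ih => exact ih (push (forestHom F f) Ψ)
  | cons F' Q ihQ =>
    rw [latticePaths]
    induction γ with
    | nil =>
      refine Eq.trans ?_ (ihQ F' .nil (push (forestArrow F' F X) Ψ))
      exact signedSum_map_one (latticePaths F' Q .nil) (fun P => P.cons (forestArrow F' F X))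
        (fun P => toForest (bottom F' Q) X ≫ Ψ _ P)
    | cons γ f ih =>
      rename_i Y Z
      refine (signedSum_append _ _ _).trans (add_congr ?_ ?_)
      · refine (signedSum_map (latticePaths F' Q (γ.cons f)) _
          (fun P => P.cons (forestArrow F' F Z)) (fun P => toForest (bottom F' Q) X ≫ Ψ _ P)).trans
          (congrArg ((-1 : ℤˣ) ^ (γ.length + 1) • ·) ?_)
        exact ihQ F' (γ.cons f) (push (forestArrow F' F Z) Ψ)
      · refine (signedSum_map_one (latticeStep F F' (bottom F' Q) (latticePaths F' Q) γ)
          (fun P => P.cons (forestHom F f)) (fun P => toForest (bottom F' Q) X ≫ Ψ _ P)).trans ?_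
        exact ih (push (forestHom F f) Ψ)

/-- The sum over the admissible paths in an associahedron, placed on the rows `j, …, j + i`. -/
noncomputable def blockOp (p p' i j : ℕ) : Cochain R C p' →ₗ[R] Cochain R C p where
  toFun Φ := signedSum (admissiblePaths (i - 1)) fun S => (blockReal R C p p' i j).eval S Φ
  map_add' Φ Ψ := by simp only [map_add, signedSum_add]
  map_smul' c Φ := by simp only [map_smul, signedSum_smul, RingHom.id_apply]

theorem blockOp_apply (p p' i j : ℕ) (Φ : Cochain R C p') :
    blockOp p p' i j Φ = signedSum (admissiblePaths (i - 1)) fun S =>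
      (blockReal R C p p' i j).eval S Φ := rfl

theorem signedSum_apply_row {A : Type*} (l : List (ℤˣ × A)) (ψ : A → Cochain R C p)
    {X Y : Row R C p} (γ : Rect X Y) :
    signedSum l ψ X Y γ = signedSum l fun a => ψ a X Y γ := by
  induction l with
  | nil => rfl
  | cons x l ih =>
    rw [signedSum_cons, signedSum_cons, ← ih]
    rfl

theorem blockSum_eq (i : ℕ) (hi : 1 ≤ i) (Φ : TotalCochain R C) {X Y : Row R C p} (γ : Rect X Y) :
    blockSum i Φ p X Y γ = ∑ j ∈ Finset.range (p - i + 1),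
      (-1 : ℤˣ) ^ (i * (j + p) + γ.length + (i - 1).choose 2) •
        blockOp p (p - i) i j (Φ (p - i)) X Y γ := by
  refine sum_congr rfl fun j _ => congrArg (_ • ·) ?_
  rw [blockOp_apply, signedSum_apply_row]
  refine signedSum_congr fun x hx => ?_
  have h1 := map_retract_of_mem_admissiblePaths hx
  rw [Nat.sub_add_cancel hi] at h1
  obtain ⟨s, S⟩ := x
  have h2 : (blockReal R C p (p - i) i j).eval S (Φ (p - i)) X Y γ =
      (allForests R C p (p - i)).eval (S.map (blockForest p i j)) (Φ (p - i)) X Y γ := by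
    have h3 := Realization.eval_pull (fun t => blockForest p i j (t.retract i))
      (allForests R C p (p - i)) S (Φ (p - i))
    have h4 : S.map (fun t => blockForest p i j (t.retract i)) = S.map (blockForest p i j) := by
      conv_rhs => rw [show S = S.map (BTree.retract i) from h1.symm]
      rw [List.map_map]
      rfl
    rw [h4] at h3
    exact congrFun (congrFun (congrFun h3 X) Y) γ
  rw [h2]
  cases S.map (blockForest p i j) with
  | nil => rfl
  | cons F Q =>
    exact signedSum_latticePaths F Q γ (post (ofForest F Y) (fam (forestObj F Y) (Φ (p - i))))

end Blocks

/-! ### Shuffles of chains -/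

section Shuffles

variable {A B D A' B' : Type} {M : Type*} [AddCommGroup M]

theorem bdry_congr {A : Type*} {ψ χ : List A → M} {Q : List A}
    (h : ∀ S : List A, S.length + 1 = Q.length → ψ S = χ S) : bdry ψ Q = bdry χ Q := by
  induction Q generalizing ψ χ with
  | nil => rfl
  | cons v Q ih =>
    rw [bdry_cons, bdry_cons, h Q rfl]
    exact congrArg _ (ih fun S hS => h (v :: S) (by simp [hS]))

theorem bdry_signedSum {A B : Type*} (l : List (ℤˣ × B)) (ψ : B → List A → M) (Q : List A) :
    bdry (fun S => signedSum l fun b => ψ b S) Q = signedSum l fun b => bdry (ψ b) Q := by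
  induction Q generalizing ψ with
  | nil => simp
  | cons v Q ih => rw [bdry_cons, ih fun b S => ψ b (v :: S), ← signedSum_sub]; rfl

theorem shufflePaths_nil_left (Q : List B) : shufflePaths ([] : List A) Q = [] := by
  rw [shufflePaths]

theorem shufflePaths_nil_right (P : List A) : shufflePaths P ([] : List B) = [] := by
  cases P <;> rw [shufflePaths]

/-- The signed sum of the values on the shuffles of two lists. -/
def shSum (ψ : List (A × B) → M) (P : List A) (Q : List B) : M :=
  signedSum (shufflePaths P Q) ψ

@[simp] theorem shSum_nil_left (ψ : List (A × B) → M) (Q : List B) : shSum ψ [] Q = 0 := by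
  rw [shSum, shufflePaths_nil_left, signedSum_nil]

@[simp] theorem shSum_nil_right (ψ : List (A × B) → M) (P : List A) : shSum ψ P [] = 0 := by
  rw [shSum, shufflePaths_nil_right, signedSum_nil]

theorem shSum_singleton (ψ : List (A × B) → M) (a : A) (b : B) : shSum ψ [a] [b] = ψ [(a, b)] := by
  rw [shSum, shufflePaths]; simp

theorem shSum_cons_cons (ψ : List (A × B) → M) (a : A) (P : List A) (b : B) (Q : List B)
    (h : P ≠ [] ∨ Q ≠ []) : shSum ψ (a :: P) (b :: Q) =
      (-1 : ℤˣ) ^ Q.length • shSum (fun S => ψ ((a, b) :: S)) P (b :: Q) +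
        shSum (fun S => ψ ((a, b) :: S)) (a :: P) Q := by
  match P, Q with
  | [], [] => simp at h
  | a' :: P, [] =>
    rw [shSum, shufflePaths, shSum_nil_right, add_zero, List.length_nil, pow_zero, one_smul]
    exact signedSum_map_one _ _ _
  | [], b' :: Q =>
    rw [shSum, shufflePaths, shSum_nil_left, smul_zero, zero_add]
    exact signedSum_map_one _ _ _
  | a' :: P, b' :: Q =>
    rw [shSum, shufflePaths, signedSum_append]
    exact congrArg₂ _ (signedSum_map _ _ _ _) (signedSum_map_one _ _ _)

theorem shSum_add (ψ χ : List (A × B) → M) (P : List A) (Q : List B) :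
    shSum (fun S => ψ S + χ S) P Q = shSum ψ P Q + shSum χ P Q :=
  signedSum_add _ _ _

theorem shSum_sub (ψ χ : List (A × B) → M) (P : List A) (Q : List B) :
    shSum (fun S => ψ S - χ S) P Q = shSum ψ P Q - shSum χ P Q :=
  signedSum_sub _ _ _

theorem shSum_units_smul (s : ℤˣ) (ψ : List (A × B) → M) (P : List A) (Q : List B) :
    shSum (fun S => s • ψ S) P Q = s • shSum ψ P Q :=
  signedSum_units_smul _ _ _

theorem length_of_mem_shufflePaths : ∀ {P : List A} {Q : List B} {x : ℤˣ × List (A × B)},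
    x ∈ shufflePaths P Q → x.2.length + 1 = P.length + Q.length
  | [], _, _, h => by simp [shufflePaths] at h
  | _ :: _, [], _, h => by simp [shufflePaths] at h
  | [a], [b], x, h => by
    rw [shufflePaths, List.mem_singleton] at h
    simp [h]
  | a :: a' :: as, [b], x, h => by
    rw [shufflePaths, List.mem_map] at h
    obtain ⟨x, h, rfl⟩ := h
    have := length_of_mem_shufflePaths h
    simp at this ⊢
    omega
  | [a], b :: b' :: bs, x, h => by
    rw [shufflePaths, List.mem_map] at h
    obtain ⟨x, h, rfl⟩ := h
    have := length_of_mem_shufflePaths h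
    simp at this ⊢
    omega
  | a :: a' :: as, b :: b' :: bs, x, h => by
    rw [shufflePaths, List.mem_append, List.mem_map, List.mem_map] at h
    rcases h with ⟨x, h, rfl⟩ | ⟨x, h, rfl⟩ <;>
    · have := length_of_mem_shufflePaths h
      simp at this ⊢
      omega
  termination_by P Q => P.length + Q.length

theorem shSum_congr {ψ χ : List (A × B) → M} {P : List A} {Q : List B}
    (h : ∀ S : List (A × B), S.length + 1 = P.length + Q.length →
      (∀ y ∈ S, y.1 ∈ P ∧ y.2 ∈ Q) → ψ S = χ S) : shSum ψ P Q = shSum χ P Q :=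
  signedSum_congr fun x hx => h x.2 (length_of_mem_shufflePaths hx) (mem_shufflePaths hx)

theorem shSum_map (f : A → A') (g : B → B') (ψ : List (A' × B') → M) (P : List A)
    (Q : List B) : shSum ψ (P.map f) (Q.map g) = shSum (fun S => ψ (S.map (Prod.map f g))) P Q := by
  match P, Q with
  | [], _ => simp
  | _ :: _, [] => simp
  | [a], [b] => simp [shSum_singleton]
  | a :: a' :: P, [b] =>
    have h1 := shSum_map f g (fun S => ψ ((f a, g b) :: S)) (a' :: P) [b]
    rw [shSum_cons_cons (fun S => ψ (S.map (Prod.map f g))) a _ b _ (by simp)]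
    refine (shSum_cons_cons ψ (f a) _ (g b) _ (by simp)).trans ?_
    exact congrArg₂ (fun x y => (-1 : ℤˣ) ^ 0 • x + y) h1 (by simp)
  | [a], b :: b' :: Q =>
    have h2 := shSum_map f g (fun S => ψ ((f a, g b) :: S)) [a] (b' :: Q)
    rw [shSum_cons_cons (fun S => ψ (S.map (Prod.map f g))) a _ b _ (by simp)]
    refine (shSum_cons_cons ψ (f a) _ (g b) _ (by simp)).trans ?_
    exact congrArg₂ (fun x y => x + y) (by simp) h2
  | a :: a' :: P, b :: b' :: Q =>
    have h1 := shSum_map f g (fun S => ψ ((f a, g b) :: S)) (a' :: P) (b :: b' :: Q)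
    have h2 := shSum_map f g (fun S => ψ ((f a, g b) :: S)) (a :: a' :: P) (b' :: Q)
    rw [shSum_cons_cons (fun S => ψ (S.map (Prod.map f g))) a _ b _ (by simp)]
    refine (shSum_cons_cons ψ (f a) _ (g b) _ (by simp)).trans ?_
    rw [List.length_map]
    exact congrArg₂ (fun x y => (-1 : ℤˣ) ^ (Q.length + 1) • x + y) h1 h2
  termination_by P.length + Q.length

theorem shSum_singleton_left (ψ : List (A × B) → M) (a : A) (Q : List B) (h : Q ≠ []) :
    shSum ψ [a] Q = ψ (Q.map fun b => (a, b)) := by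
  match Q with
  | [] => simp at h
  | [b] => exact shSum_singleton _ _ _
  | b :: b' :: Q =>
    rw [shSum_cons_cons _ _ _ _ _ (by simp), shSum_nil_left, smul_zero, zero_add,
      shSum_singleton_left _ _ (b' :: Q) (by simp)]
    rfl

theorem shSum_singleton_right (ψ : List (A × B) → M) (P : List A) (b : B) (h : P ≠ []) :
    shSum ψ P [b] = ψ (P.map fun a => (a, b)) := by
  match P with
  | [] => simp at h
  | [a] => exact shSum_singleton _ _ _
  | a :: a' :: P =>
    rw [shSum_cons_cons _ _ _ _ _ (by simp), shSum_nil_right, List.length_nil, pow_zero,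
      one_smul, add_zero, shSum_singleton_right _ (a' :: P) _ (by simp)]
    rfl

/-- The Leibniz rule for the shuffle product. -/
theorem shSum_bdry (ψ : List (A × B) → M) (a : A) (P : List A) (b : B) (Q : List B)
    (h : P ≠ [] ∨ Q ≠ []) : shSum (bdry ψ) (a :: P) (b :: Q) =
      (-1 : ℤˣ) ^ Q.length • bdry (fun P' => shSum ψ P' (b :: Q)) (a :: P) +
        bdry (fun Q' => shSum ψ (a :: P) Q') (b :: Q) := by
  match P, Q with
  | [], [] => simp at h
  | [], b' :: Q =>
    rw [shSum_singleton_left _ _ _ (by simp), bdry_cons _ a, bdry_nil,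
      shSum_nil_left, sub_zero, smul_zero, zero_add,
      bdry_congr (χ := fun Q' => ψ (Q'.map fun b => (a, b)))
        fun S hS => shSum_singleton_left _ _ _ (by rintro rfl; simp at hS)]
    exact (bdry_map _ _ _).symm
  | a' :: P, [] =>
    rw [shSum_singleton_right _ _ _ (by simp), bdry_cons _ b, bdry_nil,
      shSum_nil_right, sub_zero, List.length_nil, pow_zero, one_smul, add_zero,
      bdry_congr (χ := fun P' => ψ (P'.map fun a => (a, b)))
        fun S hS => shSum_singleton_right _ _ _ (by rintro rfl; simp at hS)]
    exact (bdry_map _ _ _).symm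
  | a' :: P, b' :: Q =>
    have h1 := shSum_bdry (fun S => ψ ((a, b) :: S)) a' P b (b' :: Q) (by simp)
    have h2 := shSum_bdry (fun S => ψ ((a, b) :: S)) a (a' :: P) b' Q (by simp)
    have h3 : bdry (fun P' => shSum ψ (a :: P') (b :: b' :: Q)) (a' :: P) =
        (-1 : ℤˣ) ^ (Q.length + 1) •
            bdry (fun P' => shSum (fun S => ψ ((a, b) :: S)) P' (b :: b' :: Q)) (a' :: P) +
          bdry (fun P' => shSum (fun S => ψ ((a, b) :: S)) (a :: P') (b' :: Q)) (a' :: P) := by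
      rw [← bdry_units_smul, ← bdry_add]
      exact bdry_congr fun S _ => shSum_cons_cons _ _ _ _ _ (by simp)
    have h4 : bdry (fun Q' => shSum ψ (a :: a' :: P) (b :: Q')) (b' :: Q) = (-1 : ℤˣ) ^ Q.length •
            bdry (fun Q' => shSum (fun S => ψ ((a, b) :: S)) (a' :: P) (b :: Q')) (b' :: Q) +
          bdry (fun Q' => shSum (fun S => ψ ((a, b) :: S)) (a :: a' :: P) Q') (b' :: Q) := by
      rw [← bdry_units_smul, ← bdry_add]
      refine bdry_congr fun S hS => ?_
      have hS : S.length = Q.length := by simpa using hS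
      rw [← hS]
      exact shSum_cons_cons _ _ _ _ _ (by simp)
    rw [shSum_cons_cons _ _ _ _ _ h, bdry_cons (fun P' => shSum ψ P' _), h3,
      bdry_cons (fun Q' => shSum ψ _ Q'), h4]
    simp only [bdry_cons ψ]
    rw [shSum_sub, shSum_sub, h1, h2, bdry_cons _ a (a' :: P), bdry_cons _ b (b' :: Q)]
    simp only [List.length_cons, pow_succ]
    rcases Int.units_eq_one_or ((-1 : ℤˣ) ^ Q.length) with hs | hs <;> rw [hs] <;> simp <;> abel
  termination_by P.length + Q.length

theorem shSum_swap (ψ : List (A × B) → M) (P : List A) (Q : List B) :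
    shSum ψ P Q = (-1 : ℤˣ) ^ ((P.length - 1) * (Q.length - 1)) •
      shSum (fun S => ψ (S.map Prod.swap)) Q P := by
  match P, Q with
  | [], _ => simp
  | _ :: _, [] => simp
  | [a], b :: Q =>
    rw [shSum_singleton_left _ _ _ (by simp), shSum_singleton_right _ _ _ (by simp)]
    simp [Function.comp_def]
  | a :: P, [b] =>
    rw [shSum_singleton_left _ _ _ (by simp), shSum_singleton_right _ _ _ (by simp)]
    simp [Function.comp_def]
  | a :: a' :: P, b :: b' :: Q =>
    have h1 := shSum_swap (fun S => ψ ((a, b) :: S)) (a' :: P) (b :: b' :: Q)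
    have h2 := shSum_swap (fun S => ψ ((a, b) :: S)) (a :: a' :: P) (b' :: Q)
    rw [shSum_cons_cons _ _ _ _ _ (by simp), h1, h2,
      shSum_cons_cons _ b _ a _ (by simp)]
    simp only [List.length_cons, Nat.add_sub_cancel, List.map_cons, Prod.swap_prod_mk]
    simp only [add_mul, mul_add, pow_add, one_mul, mul_one, pow_one]
    rcases Int.units_eq_one_or ((-1 : ℤˣ) ^ Q.length) with hs | hs <;>
      rcases Int.units_eq_one_or ((-1 : ℤˣ) ^ P.length) with ht | ht <;>
      rw [hs, ht] <;> simp <;> abel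
  termination_by P.length + Q.length

/-- The signed sum of the values on the shuffles of three lists. -/
def shSum₃ (θ : List (A × B × D) → M) (t : List A) (u : List B) (v : List D) : M :=
  shSum (fun S => shSum θ t S) u v

theorem shSum₃_cons (θ : List (A × B × D) → M) (a : A) (t : List A) (b : B) (u : List B)
    (c : D) (v : List D) (h : t ≠ [] ∨ u ≠ [] ∨ v ≠ []) :
    shSum₃ θ (a :: t) (b :: u) (c :: v) = (-1 : ℤˣ) ^ (u.length + v.length) •
          shSum₃ (fun S => θ ((a, b, c) :: S)) t (b :: u) (c :: v) +
        (-1 : ℤˣ) ^ v.length • shSum₃ (fun S => θ ((a, b, c) :: S)) (a :: t) u (c :: v) +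
        shSum₃ (fun S => θ ((a, b, c) :: S)) (a :: t) (b :: u) v := by
  by_cases h1 : u = [] ∧ v = []
  · obtain ⟨rfl, rfl⟩ := h1
    rw [shSum₃, shSum₃, shSum₃, shSum₃, shSum_singleton,
      shSum_singleton, shSum_nil_left, shSum_nil_right,
      shSum_cons_cons _ _ _ _ _ (by simpa using h)]
    simp
  · have key (u' : List B) (v' : List D) (hn : u'.length + v'.length = u.length + v.length + 1) :
        shSum (fun S => shSum θ (a :: t) ((b, c) :: S)) u' v' = (-1 : ℤˣ) ^ (u.length + v.length) •
            shSum (fun S => shSum (fun S => θ ((a, b, c) :: S)) t ((b, c) :: S)) u' v' +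
          shSum₃ (fun S => θ ((a, b, c) :: S)) (a :: t) u' v' := by
      rw [shSum₃, ← shSum_units_smul, ← shSum_add]
      refine shSum_congr fun S hS _ => ?_
      have hS : S.length = u.length + v.length := by omega
      rw [← hS]
      refine shSum_cons_cons _ _ _ _ _ (Or.inr ?_)
      rintro rfl
      exact h1 ⟨List.length_eq_zero_iff.1 (by simp at hS; omega),
        List.length_eq_zero_iff.1 (by simp at hS; omega)⟩
    have h2 : u ≠ [] ∨ v ≠ [] := by tauto
    rw [shSum₃, shSum_cons_cons _ _ _ _ _ h2, key u (c :: v) (by simp; omega),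
      key (b :: u) v (by simp; omega)]
    nth_rewrite 3 [shSum₃]
    rw [shSum_cons_cons _ b _ c _ h2]
    simp only [smul_add, smul_comm ((-1 : ℤˣ) ^ v.length)]
    abel

theorem shSum_assoc (θ : List ((A × B) × D) → M) (t : List A) (u : List B) (v : List D) :
    shSum (fun S => shSum θ S v) t u =
      shSum₃ (fun S => θ (S.map fun x => ((x.1, x.2.1), x.2.2))) t u v := by
  match t, u, v with
  | [], _, _ =>
    rw [shSum_nil_left, shSum₃]
    simp only [shSum_nil_left]
    exact (signedSum_zero _).symm
  | _ :: _, [], _ => rw [shSum_nil_right, shSum₃, shSum_nil_left]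
  | _ :: _, _ :: _, [] =>
    rw [shSum₃, shSum_nil_right]
    simp only [shSum_nil_right]
    exact signedSum_zero _
  | a :: t, b :: u, c :: v =>
    by_cases h : t = [] ∧ u = []
    · obtain ⟨rfl, rfl⟩ := h
      rw [shSum_singleton, shSum_singleton_left _ _ _ (by simp), shSum₃,
        shSum_singleton_left _ _ _ (by simp), shSum_singleton_left _ _ _ (by simp)]
      simp [Function.comp_def]
    · have key (t' : List A) (u' : List B) (hn : t'.length + u'.length = t.length + u.length + 1) :
          shSum (fun S => shSum θ ((a, b) :: S) (c :: v)) t' u' = (-1 : ℤˣ) ^ v.length •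
              shSum (fun S => shSum (fun S => θ (((a, b), c) :: S)) S (c :: v)) t' u' +
            shSum (fun S => shSum (fun S => θ (((a, b), c) :: S)) ((a, b) :: S) v) t' u' := by
        rw [← shSum_units_smul, ← shSum_add]
        refine shSum_congr fun S hS _ => ?_
        refine shSum_cons_cons _ _ _ _ _ (Or.inl ?_)
        rintro rfl
        exact h ⟨List.length_eq_zero_iff.1 (by simp at hS; omega),
          List.length_eq_zero_iff.1 (by simp at hS; omega)⟩
      have h2 : t ≠ [] ∨ u ≠ [] := by tauto
      have e1 := shSum_assoc (fun S => θ (((a, b), c) :: S)) t (b :: u) (c :: v)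
      have e2 := shSum_assoc (fun S => θ (((a, b), c) :: S)) (a :: t) u (c :: v)
      have e3 := shSum_assoc (fun S => θ (((a, b), c) :: S)) (a :: t) (b :: u) v
      rw [shSum_cons_cons _ _ _ _ _ h2] at e3
      rw [shSum_cons_cons _ _ _ _ _ h2, key t (b :: u) (by simp; omega),
        key (a :: t) u (by simp; omega), shSum₃_cons _ _ _ _ _ _ _ (by tauto)]
      simp only [List.map_cons]
      rw [← e1, ← e2, ← e3]
      simp only [smul_add, pow_add, mul_smul]
      abel
  termination_by t.length + u.length + v.length

end Shuffles

/-! ### The boundary of the fundamental chain of the associahedron -/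

namespace BTree

theorem graft_graft_nested {b c n m : ℕ} (hc : c ≤ n) (t u v : BTree ℕ) :
    (t.graft b n u).graft (b + c) m v = t.graft b (n + m) (u.graft c m v) := by
  rw [graft, graft, graft, bind_bind]
  refine bind_congr fun x _ => ?_
  rcases lt_trichotomy x b with h | rfl | h
  · rw [if_pos h, if_pos h, bind, if_pos (by omega)]
  · rw [if_neg (by omega), if_pos rfl, if_neg (by omega), if_pos rfl]
    simp only [map, graft, bind_bind]
    refine bind_congr fun y _ => ?_
    rw [bind]
    rcases lt_trichotomy y c with h | rfl | h
    · rw [if_pos (by omega), if_pos h, bind]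
    · rw [if_neg (by omega), if_pos (by omega), if_neg (by omega), if_pos rfl, bind_bind]
      refine bind_congr fun z _ => ?_
      rw [bind]
      congr 1
      omega
    · rw [if_neg (by omega), if_neg (by omega), if_neg (by omega), if_neg (by omega), bind]
      congr 1
      omega
  · rw [if_neg (by omega), if_neg (by omega), if_neg (by omega), if_neg (by omega), bind,
      if_neg (by omega), if_neg (by omega), add_assoc]

theorem graft_graft_disjoint {a b n m : ℕ} (h : a < b) (t u : BTree ℕ) {v : BTree ℕ}
    (hv : v.leaves = List.range (m + 1)) :
    (t.graft b n u).graft a m v = (t.graft a m v).graft (b + m) n u := by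
  rw [graft, graft, graft, graft, bind_bind, bind_bind]
  refine bind_congr fun x _ => ?_
  rcases lt_trichotomy x a with hx | rfl | hx
  · rw [if_pos (by omega), if_pos hx, bind, bind, if_pos hx, if_pos (by omega)]
  · rw [if_pos h, if_neg (by omega), if_pos rfl, bind, if_neg (by omega), if_pos rfl, map, bind_bind]
    refine bind_congr fun y hy => ?_
    rw [hv, List.mem_range] at hy
    rw [bind, if_pos (by omega)]
  · rw [if_neg (not_lt.2 hx.le), if_neg hx.ne', bind]
    rcases lt_trichotomy x b with hb | rfl | hb
    · rw [if_pos hb, bind, if_neg (by omega), if_neg (by omega), if_pos (by omega)]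
    · rw [if_neg (by omega), if_pos rfl, if_neg (by omega), if_pos rfl, map, map, bind_bind]
      refine bind_congr fun y _ => ?_
      rw [bind, if_neg (by omega), if_neg (by omega)]
      congr 1
      dsimp only
      omega
    · rw [if_neg (by omega), if_neg (by omega), bind, if_neg (by omega), if_neg (by omega),
        if_neg (by omega), if_neg (by omega)]
      congr 1
      omega

theorem rightComb_map (s r : ℕ) : ∀ k, (rightComb s k).map (· + r) = rightComb (s + r) k
  | 0 => rfl
  | k + 1 => by
    have := rightComb_map (s + 1) r k
    rw [add_right_comm] at this
    exact congrArg (node _) this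

theorem rightComb_graft (m : ℕ) : ∀ s k : ℕ,
    (rightComb s k).graft (s + k) m (rightComb 0 m) = rightComb s (k + m)
  | s, 0 => by
    have := rightComb_map 0 s m
    rw [rightComb, graft, bind, if_neg (by omega), if_pos (by omega)]
    simpa using this
  | s, k + 1 => by
    have := rightComb_graft m (s + 1) k
    rw [add_right_comm s 1 k] at this
    rw [rightComb, add_right_comm k 1 m, rightComb, ← this]
    simp only [graft, bind, add_assoc]
    rw [if_pos (by omega)]

end BTree

section Associahedra

variable {M : Type*} [AddCommGroup M]

open Finset

/-- The signed sum of the values on the paths in the face `A_k × A_l` grafted at `a`. -/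
def graftSum (k l a : ℕ) (ψ : List (BTree ℕ) → M) : M :=
  signedSum (admissiblePaths k) fun P => signedSum (admissiblePaths l) fun Q =>
    shSum (fun S => ψ (S.map fun x => x.1.graft a (l + 1) x.2)) P Q

/-- The sign of the face `A_k × A_l` grafted at `a` in the boundary of `A_{k+l+1}`. -/
def faceSign (l a : ℕ) : ℤˣ := (-1) ^ ((l + 1) * (a + 1) + 1)

theorem graftSum_sub (k l a : ℕ) (ψ χ : List (BTree ℕ) → M) :
    graftSum k l a (fun S => ψ S - χ S) = graftSum k l a ψ - graftSum k l a χ := by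
  simp only [graftSum, shSum_sub, signedSum_sub]

theorem sum_map_signedSum {A : Type*} (l : List (ℤˣ × A)) (s : ℤˣ) (ψ : A → M) :
    (l.map fun x => (s * x.1) • ψ x.2).sum = s • signedSum l ψ := by
  rw [signedSum, List.smul_sum, List.map_map]
  simp only [Function.comp_def, mul_smul]

theorem signedSum_admissiblePaths_succ (N : ℕ) (ψ : List (BTree ℕ) → M) :
    signedSum (admissiblePaths (N + 1)) ψ = ∑ x ∈ antidiagonal N, ∑ a ∈ range (x.1 + 1),
      faceSign x.2 a • graftSum x.1 x.2 a fun S => ψ (BTree.rightComb 0 (N + 2) :: S) := by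
  rw [admissiblePaths, signedSum_flatMap, Finset.Nat.sum_antidiagonal_eq_sum_range_succ_mk,
    ← Fin.sum_univ_eq_sum_range (fun k => ∑ a ∈ range (k + 1), faceSign (N - k) a •
      graftSum k (N - k) a fun S => ψ (BTree.rightComb 0 (N + 2) :: S)), Fin.sum_univ_def]
  refine congrArg List.sum (List.map_congr_left fun k _ => ?_)
  rw [signedSum_flatMap]
  refine Eq.trans ?_ (show ((List.range (k.1 + 1)).map fun a => _).sum = _ from rfl)
  refine congrArg List.sum (List.map_congr_left fun a _ => ?_)
  have hk := k.2
  have hs (l : ℕ) (hl : k.1 + l = N) :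
      (-1 : ℤˣ) ^ ((N + 1) + (N + 1 - k.1) * a + (k.1 + 1)) = faceSign l a := by
    rw [faceSign, show (N + 1) + (N + 1 - k.1) * a + (k.1 + 1) = (l + 1) * (a + 1) + 1 + 2 * k.1 by
        rw [show N + 1 - k.1 = l + 1 by omega]; linear_combination hl.symm, pow_add,
      pow_mul]
    simp
  rw [signedSum_flatMap, graftSum, hs (N - k.1) (by omega), ← sum_map_signedSum]
  refine congrArg List.sum (List.map_congr_left fun P _ => ?_)
  rw [signedSum_flatMap, ← sum_map_signedSum]
  refine congrArg List.sum (List.map_congr_left fun Q _ => ?_)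
  rw [show N + 1 - k.1 = N - k.1 + 1 by omega]
  exact signedSum_map _ _ (fun S : List (BTree ℕ × BTree ℕ) => BTree.rightComb 0 (N + 2) ::
    S.map fun v => v.1.graft a (N - k.1 + 1) v.2) ψ

theorem exists_of_mem_paths {N : ℕ} {x : ℤˣ × List (BTree ℕ)} (hx : x ∈ admissiblePaths N) :
    ∃ P, x.2 = BTree.rightComb 0 (N + 1) :: P ∧ P.length = N := by
  induction N using Nat.strong_induction_on generalizing x with
  | _ N ih =>
    match N, hx with
    | 0, hx =>
      rw [admissiblePaths, List.mem_singleton] at hx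
      exact ⟨[], by rw [hx]; rfl, rfl⟩
    | N + 1, hx =>
      rw [admissiblePaths] at hx
      simp only [List.mem_flatMap, List.mem_map, List.mem_finRange, List.mem_range] at hx
      obtain ⟨k, -, a, ha, P, hP, Q, hQ, S, hS, rfl⟩ := hx
      obtain ⟨P', h1, h1'⟩ := ih k.1 (by omega) hP
      obtain ⟨Q', h2, h2'⟩ := ih (N - k.1) (by omega) hQ
      have := length_of_mem_shufflePaths hS
      rw [h1, h2] at this
      simp only [List.length_cons] at this
      refine ⟨_, rfl, ?_⟩
      rw [List.length_map]
      omega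

/-- The signed sum of the values on the paths in `A_k × A_l × A_m`. -/
def graftSum₃ (k l m : ℕ) (G : BTree ℕ × BTree ℕ × BTree ℕ → BTree ℕ) (χ : List (BTree ℕ) → M) :
    M :=
  signedSum (admissiblePaths k) fun t => signedSum (admissiblePaths l) fun u =>
    signedSum (admissiblePaths m) fun v => shSum₃ (fun S => χ (S.map G)) t u v

theorem graftSum₃_congr {k l m : ℕ} {G G' : BTree ℕ × BTree ℕ × BTree ℕ → BTree ℕ}
    (χ : List (BTree ℕ) → M)
    (h : ∀ t u v : BTree ℕ, t.leaves = List.range (k + 2) → u.leaves = List.range (l + 2) →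
      v.leaves = List.range (m + 2) → G (t, u, v) = G' (t, u, v)) :
    graftSum₃ k l m G χ = graftSum₃ k l m G' χ := by
  refine signedSum_congr fun t ht => signedSum_congr fun u hu => signedSum_congr fun v hv => ?_
  refine shSum_congr fun S _ hS => shSum_congr fun S' _ hS' => ?_
  refine congrArg χ (List.map_congr_left fun x hx => ?_)
  have h1 := hS' x hx
  exact h _ _ _ (leaves_of_mem_admissiblePaths ht _ h1.1)
    (leaves_of_mem_admissiblePaths hu _ (hS _ h1.2).1)
    (leaves_of_mem_admissiblePaths hv _ (hS _ h1.2).2)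

theorem graftSum₃_swap (k l m : ℕ) (G : BTree ℕ × BTree ℕ × BTree ℕ → BTree ℕ)
    (χ : List (BTree ℕ) → M) : graftSum₃ k l m G χ =
      (-1 : ℤˣ) ^ (l * m) • graftSum₃ k m l (fun x => G (x.1, x.2.2, x.2.1)) χ := by
  rw [graftSum₃, graftSum₃, ← signedSum_units_smul]
  refine signedSum_congr fun t _ => ?_
  rw [signedSum_comm, ← signedSum_units_smul]
  refine signedSum_congr fun v hv => ?_
  rw [← signedSum_units_smul]
  refine signedSum_congr fun u hu => ?_
  obtain ⟨P, h1, h1'⟩ := exists_of_mem_paths hv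
  obtain ⟨Q, h2, h2'⟩ := exists_of_mem_paths hu
  rw [shSum₃, shSum_swap, h1, h2, List.length_cons, List.length_cons, h1', h2',
    Nat.add_sub_cancel, Nat.add_sub_cancel, shSum₃]
  congr 1
  refine shSum_congr fun S _ _ => ?_
  have := shSum_map id Prod.swap (fun S => χ (S.map G)) t.2 S
  rw [List.map_id] at this
  refine this.trans (shSum_congr fun S' _ _ => congrArg χ ?_)
  rw [List.map_map]
  rfl

/-- Grafting at `b`, then at `a`. -/
def leftGraft (l m b a : ℕ) (x : BTree ℕ × BTree ℕ × BTree ℕ) : BTree ℕ :=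
  (x.1.graft b (l + 1) x.2.1).graft a (m + 1) x.2.2

/-- Grafting at `a` a tree grafted at `c`. -/
def rightGraft (l m a c : ℕ) (x : BTree ℕ × BTree ℕ × BTree ℕ) : BTree ℕ :=
  x.1.graft a (l + m + 2) (x.2.1.graft c (m + 1) x.2.2)

theorem graftSum_left (k l m b a : ℕ) (χ : List (BTree ℕ) → M) :
    graftSum k l b (fun P => signedSum (admissiblePaths m) fun Q =>
      shSum (fun S => χ (S.map fun x => x.1.graft a (m + 1) x.2)) P Q) =
        graftSum₃ k l m (leftGraft l m b a) χ := by
  refine signedSum_congr fun t _ => signedSum_congr fun u _ => ?_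
  refine (signedSum_comm _ _ _).trans (signedSum_congr fun v _ => ?_)
  have h (S : List (BTree ℕ × BTree ℕ)) := shSum_map (fun x => x.1.graft b (l + 1) x.2) id
    (fun S => χ (S.map fun x => x.1.graft a (m + 1) x.2)) S v.2
  simp only [List.map_id] at h
  refine (shSum_congr fun S _ _ => h S).trans ?_
  rw [shSum_assoc]
  simp only [List.map_map]
  rfl

theorem graftSum_right (k l m a c : ℕ) (χ : List (BTree ℕ) → M) :
    (signedSum (admissiblePaths k) fun P => graftSum l m c fun Q =>
      shSum (fun S => χ (S.map fun x => x.1.graft a (l + m + 2) x.2)) P Q) =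
        graftSum₃ k l m (rightGraft l m a c) χ := by
  refine signedSum_congr fun t _ => signedSum_congr fun u _ => signedSum_congr fun v _ => ?_
  refine shSum_congr fun S _ _ => ?_
  have h := shSum_map id (fun x => x.1.graft c (m + 1) x.2)
    (fun S => χ (S.map fun x => x.1.graft a (l + m + 2) x.2)) t.2 S
  rw [List.map_id] at h
  refine h.trans (shSum_congr fun S _ _ => congrArg χ ?_)
  rw [List.map_map]
  rfl

theorem graftSum₃_leftGraft_nested (k l m b : ℕ) {c : ℕ} (hc : c ≤ l + 1) (χ : List (BTree ℕ) → M) :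
    graftSum₃ k l m (leftGraft l m b (b + c)) χ = graftSum₃ k l m (rightGraft l m b c) χ := by
  refine graftSum₃_congr χ fun t u v _ _ _ => ?_
  rw [leftGraft, rightGraft, BTree.graft_graft_nested hc]
  congr 1
  omega

theorem graftSum₃_leftGraft_disjoint (k l m : ℕ) {a b : ℕ} (h : a < b) (χ : List (BTree ℕ) → M) :
    graftSum₃ k l m (leftGraft l m b a) χ =
      (-1 : ℤˣ) ^ (l * m) • graftSum₃ k m l (leftGraft m l a (b + m + 1)) χ := by
  rw [graftSum₃_swap]
  congr 1
  refine graftSum₃_congr χ fun t v u _ hv _ => ?_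
  exact BTree.graft_graft_disjoint h _ _ hv

theorem graftSum_bdry (k l a : ℕ) (h : k + l ≠ 0) (χ : List (BTree ℕ) → M) :
    graftSum k l a (bdry χ) = (-1 : ℤˣ) ^ l • signedSum (admissiblePaths k) (bdry fun P =>
          signedSum (admissiblePaths l) fun Q =>
            shSum (fun S => χ (S.map fun x => x.1.graft a (l + 1) x.2)) P Q) +
        signedSum (admissiblePaths k) fun P => signedSum (admissiblePaths l) (bdry fun Q =>
            shSum (fun S => χ (S.map fun x => x.1.graft a (l + 1) x.2)) P Q) := by
  rw [graftSum, ← signedSum_units_smul, ← signedSum_add]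
  refine signedSum_congr fun P hP => ?_
  rw [bdry_signedSum, ← signedSum_units_smul, ← signedSum_add]
  refine signedSum_congr fun Q hQ => ?_
  obtain ⟨P', h1, h1'⟩ := exists_of_mem_paths hP
  obtain ⟨Q', h2, h2'⟩ := exists_of_mem_paths hQ
  simp only [← bdry_map]
  rw [h1, h2]
  refine (shSum_bdry _ _ _ _ _ ?_).trans (by rw [h2'])
  by_contra! hc
  rw [hc.1] at h1'
  rw [hc.2] at h2'
  exact h (by simp at h1' h2'; omega)

theorem graftSum_terminal (k l : ℕ) (h : k + l ≠ 0) (ψ : List (BTree ℕ) → M) :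
    graftSum k l (k + 1) ψ = (-1 : ℤˣ) ^ l • signedSum (admissiblePaths k) (fun P =>
          signedSum (admissiblePaths l) fun Q => shSum (fun S =>
            ψ (BTree.rightComb 0 (k + l + 2) :: S.map fun x => x.1.graft (k + 1) (l + 1) x.2))
              P.tail Q) +
        signedSum (admissiblePaths k) fun P => signedSum (admissiblePaths l) fun Q =>
          shSum (fun S =>
            ψ (BTree.rightComb 0 (k + l + 2) :: S.map fun x => x.1.graft (k + 1) (l + 1) x.2))
              P Q.tail := by
  rw [graftSum, ← signedSum_units_smul, ← signedSum_add]
  refine signedSum_congr fun P hP => ?_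
  rw [← signedSum_units_smul, ← signedSum_add]
  refine signedSum_congr fun Q hQ => ?_
  obtain ⟨P', h1, h1'⟩ := exists_of_mem_paths hP
  obtain ⟨Q', h2, h2'⟩ := exists_of_mem_paths hQ
  have h3 := BTree.rightComb_graft (l + 1) 0 (k + 1)
  rw [zero_add] at h3
  rw [h1, h2, shSum_cons_cons]
  · simp only [List.map_cons, List.tail_cons, h3, h2', show k + 1 + (l + 1) = k + l + 2 by omega]
  · by_contra! hc
    rw [hc.1] at h1'
    rw [hc.2] at h2'
    exact h (by simp at h1' h2'; omega)

theorem sum_antidiagonal_antidiagonal (n : ℕ) (f : ℕ → ℕ → ℕ → M) :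
    ∑ x ∈ antidiagonal n, ∑ y ∈ antidiagonal x.1, f y.1 y.2 x.2 =
      ∑ x ∈ antidiagonal n, ∑ y ∈ antidiagonal x.2, f x.1 y.1 y.2 := by
  rw [sum_sigma', sum_sigma']
  refine Finset.sum_bij' (fun x _ => ⟨(x.2.1, x.2.2 + x.1.2), (x.2.2, x.1.2)⟩)
    (fun x _ => ⟨(x.1.1 + x.2.1, x.2.2), (x.1.1, x.2.1)⟩) ?_ ?_ ?_ ?_ ?_ <;>
  · rintro ⟨⟨a, b⟩, ⟨c, d⟩⟩ h
    simp only [mem_sigma, mem_ad] at h ⊢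
    try obtain ⟨rfl, rfl⟩ := h
    all_goals first | rfl | exact ⟨by omega, trivial⟩

theorem sum_antidiagonal_succ_of_zero (n : ℕ) (f g : ℕ → ℕ → M) (hf : ∀ m, f 0 m = 0)
    (hg : ∀ m, g m 0 = 0) : ∑ x ∈ antidiagonal (n + 1), (f x.1 x.2 + g x.1 x.2) =
      ∑ x ∈ antidiagonal n, f (x.1 + 1) x.2 + ∑ x ∈ antidiagonal n, g x.1 (x.2 + 1) := by
  rw [sum_add_distrib, Finset.Nat.sum_antidiagonal_succ, hf, zero_add,
    Finset.Nat.sum_antidiagonal_succ' (f := fun x => g x.1 x.2), hg, zero_add]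

theorem sum_triangle (n : ℕ) (g : ℕ → ℕ → M) : ∑ b ∈ range n, ∑ j ∈ range (n - b), g (b + 1 + j) b =
      ∑ b ∈ range (n + 1), ∑ a ∈ range b, g b a := by
  rw [sum_sigma', sum_sigma']
  refine Finset.sum_bij' (fun x _ => ⟨x.1 + 1 + x.2, x.1⟩)
    (fun x _ => ⟨x.2, x.1 - x.2 - 1⟩) ?_ ?_ ?_ ?_ ?_
  · rintro ⟨a, b⟩ h
    simp only [mem_sigma, mem_range] at h ⊢
    omega
  · rintro ⟨a, b⟩ h
    simp only [mem_sigma, mem_range] at h ⊢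
    omega
  · rintro ⟨a, b⟩ h
    simp only [mem_sigma, mem_range] at h ⊢
    congr 1
    omega
  · rintro ⟨a, b⟩ h
    simp only [mem_sigma, mem_range] at h ⊢
    congr 1
    omega
  · rintro ⟨a, b⟩ h
    rfl

theorem sum_split (k l : ℕ) (f : ℕ → ℕ → M) :
    (∑ a ∈ range (k + l + 2), ∑ b ∈ range (k + 2), f b a) + ∑ b ∈ range (k + 1), f b (k + l + 2) =
      (∑ b ∈ range (k + 1), ∑ c ∈ range (l + 2), f b (b + c)) +
        (∑ c ∈ range (l + 1), f (k + 1) (k + 1 + c)) +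
        (∑ b ∈ range (k + 2), ∑ a ∈ range b, f b a) +
        ∑ b ∈ range (k + 1), ∑ j ∈ range (k + 1 - b), f b (b + 1 + j + l + 1) := by
  have h1 : ∀ b ∈ range (k + 1), (∑ a ∈ range (k + l + 2), f b a) + f b (k + l + 2) =
      (∑ a ∈ range b, f b a) + (∑ c ∈ range (l + 2), f b (b + c)) +
        ∑ j ∈ range (k + 1 - b), f b (b + 1 + j + l + 1) := by
    intro b hb
    have hb := mem_range.1 hb
    rw [← sum_range_succ, show k + l + 2 + 1 = b + (l + 2) + (k + 1 - b) by omega,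
      sum_range_add, sum_range_add]
    congr 1
    refine sum_congr rfl fun j _ => ?_
    congr 1
    omega
  rw [Finset.sum_comm, sum_range_succ, sum_range_succ _ (k + 1),
    show k + l + 2 = k + 1 + (l + 1) by omega, sum_range_add _ (k + 1) (l + 1), add_right_comm,
    ← sum_add_distrib, show k + 1 + (l + 1) = k + l + 2 by omega,
    sum_congr rfl h1, sum_add_distrib, sum_add_distrib]
  abel

theorem neg_one_pow_congr {m n : ℕ} (h : Even (m + n)) : (-1 : ℤˣ) ^ m = (-1) ^ n := by
  rcases Nat.even_or_odd n with hn | hn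
  · rw [hn.neg_one_pow, (Nat.even_add.1 h |>.2 hn).neg_one_pow]
  · have hm : Odd m := by
      rw [← Nat.not_even_iff_odd] at hn ⊢
      exact fun h' => hn (Nat.even_add.1 h |>.1 h')
    rw [hn.neg_one_pow, hm.neg_one_pow]

theorem neg_neg_one_pow (n : ℕ) : -(-1 : ℤˣ) ^ n = (-1) ^ (n + 1) := by
  rw [pow_succ, mul_neg_one]

theorem faceSign_nested (l m b c : ℕ) :
    faceSign m (b + c) * ((-1) ^ m * faceSign l b) = -(faceSign (l + m + 1) b * faceSign m c) := by
  simp only [faceSign, ← pow_add, neg_neg_one_pow]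
  exact neg_one_pow_congr ⟨(b + 1) * (l + m + 2) + (m + 1) * c + m + 3, by ring⟩

theorem faceSign_disjoint (l m b a : ℕ) : faceSign m a * ((-1) ^ m * faceSign l b) =
      -(faceSign l (b + m + 1) * ((-1) ^ l * faceSign m a) * (-1) ^ (l * m)) := by
  simp only [faceSign, ← pow_add, neg_neg_one_pow]
  exact neg_one_pow_congr ⟨(m + 1) * (a + 1) + (l + 1) * (b + 1) + l * m + l + m + 3, by ring⟩

theorem sum_faces_cancel (n : ℕ) (χ : List (BTree ℕ) → M) :
    ∑ x ∈ antidiagonal n, ∑ y ∈ antidiagonal x.2,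
      ((∑ a ∈ range (x.1 + y.1 + 2), ∑ b ∈ range (x.1 + 2),
          (faceSign y.2 a * ((-1) ^ y.2 * faceSign y.1 b)) •
            graftSum₃ x.1 y.1 y.2 (leftGraft y.1 y.2 b a) χ) +
        (∑ b ∈ range (x.1 + 1), (faceSign y.2 (x.1 + y.1 + 2) * ((-1) ^ y.2 * faceSign y.1 b)) •
            graftSum₃ x.1 y.1 y.2 (leftGraft y.1 y.2 b (x.1 + y.1 + 2)) χ) +
        (∑ a ∈ range (x.1 + 1), ∑ c ∈ range (y.1 + 2),
          (faceSign (y.1 + y.2 + 1) a * faceSign y.2 c) •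
            graftSum₃ x.1 y.1 y.2 (rightGraft y.1 y.2 a c) χ) +
        ∑ c ∈ range (y.1 + 1), (faceSign (y.1 + y.2 + 1) (x.1 + 1) * faceSign y.2 c) •
            graftSum₃ x.1 y.1 y.2 (rightGraft y.1 y.2 (x.1 + 1) c) χ) = 0 := by
  refine sum_eq_zero fun x _ => ?_
  obtain ⟨k, n⟩ := x
  let f (l m b a : ℕ) : M := (faceSign m a * ((-1) ^ m * faceSign l b)) •
    graftSum₃ k l m (leftGraft l m b a) χ
  have h1 (l m b c : ℕ) (hc : c ≤ l + 1) : f l m b (b + c) =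
      -((faceSign (l + m + 1) b * faceSign m c) • graftSum₃ k l m (rightGraft l m b c) χ) := by
    rw [← graftSum₃_leftGraft_nested _ _ _ _ hc, ← Units.neg_smul, ← faceSign_nested]
  have h2 (l m b a : ℕ) (h : a < b) : f l m b a = -f m l a (b + m + 1) := by
    change _ • _ = -(_ • _)
    rw [graftSum₃_leftGraft_disjoint _ _ _ h, smul_smul, ← Units.neg_smul, faceSign_disjoint,
      mul_assoc, neg_mul, mul_assoc, mul_assoc, ← pow_add, ← two_mul]
    simp
  have h3 (l m : ℕ) : ∑ b ∈ range (k + 2), ∑ a ∈ range b, f l m b a =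
      -∑ b ∈ range (k + 1), ∑ j ∈ range (k + 1 - b), f m l b (b + 1 + j + m + 1) := by
    rw [← sum_triangle]
    simp only [← Finset.sum_neg_distrib]
    exact sum_congr rfl fun b _ => sum_congr rfl fun j _ => h2 _ _ _ _ (by omega)
  have h4 (l m : ℕ) := sum_split k l (f l m)
  simp only [h3] at h4
  have h5 (l m : ℕ) : ∑ b ∈ range (k + 1), ∑ c ∈ range (l + 2), f l m b (b + c) =
      -∑ a ∈ range (k + 1), ∑ c ∈ range (l + 2), (faceSign (l + m + 1) a * faceSign m c) •
            graftSum₃ k l m (rightGraft l m a c) χ := by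
    simp only [← Finset.sum_neg_distrib]
    exact sum_congr rfl fun b _ => sum_congr rfl fun c hc =>
      h1 _ _ _ _ (by have := mem_range.1 hc; omega)
  have h6 (l m : ℕ) : ∑ c ∈ range (l + 1), f l m (k + 1) (k + 1 + c) =
      -∑ c ∈ range (l + 1), (faceSign (l + m + 1) (k + 1) * faceSign m c) •
            graftSum₃ k l m (rightGraft l m (k + 1) c) χ := by
    simp only [← Finset.sum_neg_distrib]
    exact sum_congr rfl fun c hc => h1 _ _ _ _ (by have := mem_range.1 hc; omega)
  let W (l m : ℕ) : M := ∑ b ∈ range (k + 1), ∑ j ∈ range (k + 1 - b), f l m b (b + 1 + j + l + 1)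
  refine Eq.trans (b := ∑ y ∈ antidiagonal n, (W y.1 y.2 - W y.2 y.1))
    (sum_congr rfl fun y _ => ?_) ?_
  · refine (congrArg (· + _ + _) (h4 y.1 y.2)).trans ?_
    rw [h5, h6]
    dsimp only [W]
    abel
  · rw [Finset.sum_sub_distrib, ← Finset.Nat.sum_antidiagonal_swap (f := fun y => W y.2 y.1)]
    exact sub_self _

theorem signedSum_admissiblePaths_tail (k : ℕ) (θ : List (BTree ℕ) → M) :
    signedSum (admissiblePaths (k + 1)) (fun P => θ P.tail) =
      ∑ x ∈ antidiagonal k, ∑ a ∈ range (x.1 + 1), faceSign x.2 a • graftSum x.1 x.2 a θ :=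
  signedSum_admissiblePaths_succ k fun P => θ P.tail

/-- The boundary of the fundamental chain of an associahedron is the sum of its faces. -/
theorem signedSum_admissiblePaths_bdry (N : ℕ) (ψ : List (BTree ℕ) → M) :
    signedSum (admissiblePaths (N + 1)) (bdry ψ) = ∑ x ∈ antidiagonal N, ∑ a ∈ range (x.1 + 2),
      faceSign x.2 a • graftSum x.1 x.2 a ψ := by
  induction N using Nat.strong_induction_on generalizing ψ with
  | _ N ih =>
    set χ : List (BTree ℕ) → M := fun S => ψ (BTree.rightComb 0 (N + 2) :: S) with hχ
    rw [signedSum_admissiblePaths_succ]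
    simp only [bdry_cons, graftSum_sub, sum_range_succ _ (_ + 1), smul_sub,
      Finset.sum_sub_distrib, sum_add_distrib]
    rw [sub_eq_iff_eq_add, add_assoc, left_eq_add]
    rcases N with _ | n
    · simp only [Finset.Nat.antidiagonal_zero, Finset.sum_singleton, zero_add, Finset.sum_range_one,
        graftSum, admissiblePaths, signedSum_cons, signedSum_nil, shSum_singleton, one_smul,
        add_zero, faceSign, List.map_cons, List.map_nil, bdry_cons, bdry_nil, sub_zero]
      have : (BTree.node (.leaf 0) (.leaf 1)).graft 1 1 (BTree.node (.leaf 0) (.leaf 1)) =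
        BTree.rightComb 0 2 := rfl
      rw [this]
      simp [show (-1 : ℤˣ) ^ 3 = -1 from rfl]
    · let H (m a : ℕ) (P Q : List (BTree ℕ)) : M :=
        shSum (fun S => χ (S.map fun x => x.1.graft a (m + 1) x.2)) P Q
      let f (x m : ℕ) : M := (∑ a ∈ range (x + 1), (faceSign m a * (-1) ^ m) •
            signedSum (admissiblePaths x)
              (bdry fun P => signedSum (admissiblePaths m) fun Q => H m a P Q)) +
          (faceSign m (x + 1) * (-1) ^ m) • signedSum (admissiblePaths x) fun P =>
            signedSum (admissiblePaths m) fun Q => H m (x + 1) P.tail Q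
      let g (x m : ℕ) : M := (∑ a ∈ range (x + 1), faceSign m a •
            signedSum (admissiblePaths x) fun P =>
              signedSum (admissiblePaths m) (bdry fun Q => H m a P Q)) +
          faceSign m (x + 1) • signedSum (admissiblePaths x) fun P =>
            signedSum (admissiblePaths m) fun Q => H m (x + 1) P Q.tail
      have hf0 (m : ℕ) : f 0 m = 0 := by
        simp [f, H, admissiblePaths, bdry_cons]
      have hg0 (m : ℕ) : g m 0 = 0 := by
        simp [g, H, admissiblePaths, bdry_cons]
      have hf (x m : ℕ) (hx : x ≤ n) : f (x + 1) m = ∑ y ∈ antidiagonal x,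
          ((∑ a ∈ range (y.1 + y.2 + 2), ∑ b ∈ range (y.1 + 2),
            (faceSign m a * ((-1) ^ m * faceSign y.2 b)) •
              graftSum₃ y.1 y.2 m (leftGraft y.2 m b a) χ) +
          (∑ b ∈ range (y.1 + 1), (faceSign m (y.1 + y.2 + 2) * ((-1) ^ m * faceSign y.2 b)) •
              graftSum₃ y.1 y.2 m (leftGraft y.2 m b (y.1 + y.2 + 2)) χ)) := by
        have h1 (a : ℕ) := ih x (by omega) fun P => signedSum (admissiblePaths m) fun Q => H m a P Q
        have h2 (a : ℕ) := signedSum_admissiblePaths_tail x fun P =>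
          signedSum (admissiblePaths m) fun Q => H m a P Q
        dsimp only [f]
        simp only [h1, h2]
        simp only [H, graftSum_left, smul_sum, smul_smul, mul_assoc]
        rw [Finset.sum_comm, ← sum_add_distrib]
        refine sum_congr rfl fun y hy => ?_
        rw [mem_ad.1 hy]
      have hg (x m : ℕ) (hm : m ≤ n) : g x (m + 1) = ∑ y ∈ antidiagonal m,
          ((∑ a ∈ range (x + 1), ∑ c ∈ range (y.1 + 2),
            (faceSign (y.1 + y.2 + 1) a * faceSign y.2 c) •
              graftSum₃ x y.1 y.2 (rightGraft y.1 y.2 a c) χ) +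
          ∑ c ∈ range (y.1 + 1), (faceSign (y.1 + y.2 + 1) (x + 1) * faceSign y.2 c) •
              graftSum₃ x y.1 y.2 (rightGraft y.1 y.2 (x + 1) c) χ) := by
        have h1 (a : ℕ) (P : List (BTree ℕ)) := ih m (by omega) fun Q => H (m + 1) a P Q
        have h2 (a : ℕ) (P : List (BTree ℕ)) :=
          signedSum_admissiblePaths_tail m fun Q => H (m + 1) a P Q
        dsimp only [g]
        simp only [h1, h2]
        simp only [H, signedSum_sum, signedSum_units_smul, smul_sum, smul_smul]
        rw [Finset.sum_comm, ← sum_add_distrib]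
        refine sum_congr rfl fun y hy => ?_
        rw [← mem_ad.1 hy]
        simp only [← graftSum_right]
      refine Eq.trans (b := ∑ x ∈ antidiagonal (n + 1), (f x.1 x.2 + g x.1 x.2)) ?_ ?_
      · rw [← sum_add_distrib]
        refine sum_congr rfl fun x hx => ?_
        have hx := mem_ad.1 hx
        rw [graftSum_terminal _ _ (by omega), hx]
        have h1 (a : ℕ) := graftSum_bdry x.1 x.2 a (by omega) χ
        refine (congrArg (_ + ·) (sum_congr rfl fun a _ => congrArg _ (h1 a))).trans ?_
        simp only [smul_add, sum_add_distrib, smul_smul]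
        dsimp only [f, g, H]
        abel
      · have hle {x : ℕ × ℕ} (hx : x ∈ antidiagonal n) : x.1 ≤ n ∧ x.2 ≤ n := by
          have := mem_ad.1 hx
          omega
        rw [sum_antidiagonal_succ_of_zero n f g hf0 hg0]
        refine (add_congr (sum_congr rfl fun x hx => hf x.1 x.2 (hle hx).1)
          (sum_congr rfl fun x hx => hg x.1 x.2 (hle hx).2)).trans ?_
        refine (congrArg (· + _) (sum_antidiagonal_antidiagonal n fun k l m =>
          ((∑ a ∈ range (k + l + 2), ∑ b ∈ range (k + 2),
            (faceSign m a * ((-1) ^ m * faceSign l b)) • graftSum₃ k l m (leftGraft l m b a) χ) +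
          (∑ b ∈ range (k + 1), (faceSign m (k + l + 2) * ((-1) ^ m * faceSign l b)) •
              graftSum₃ k l m (leftGraft l m b (k + l + 2)) χ)))).trans ?_
        rw [← sum_add_distrib, ← sum_faces_cancel n χ]
        refine sum_congr rfl fun x _ => ?_
        rw [← sum_add_distrib]
        refine sum_congr rfl fun y _ => ?_
        abel

end Associahedra

/-! ### Relations between the block operators -/

section Blocks

variable {p p' p'' : ℕ} {Φ : Cochain R C p'} {r : ℤ} {X Y : Row R C p}

theorem signedSum_induction {A M : Type*} [AddCommGroup M] {P : M → Prop} (h0 : P 0)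
    (h1 : ∀ x y, P x → P y → P (x + y)) (h2 : ∀ (s : ℤˣ) x, P x → P (s • x)) (ψ : A → M)
    (hψ : ∀ a, P (ψ a)) (l : List (ℤˣ × A)) : P (signedSum l ψ) := by
  induction l with
  | nil => exact h0
  | cons x l ih => exact h1 _ _ (h2 _ _ (hψ _)) ih

theorem MlCochain.zero : MlCochain (0 : Cochain R C p) := fun _ => Ml.zero

theorem MlCochain.add {Φ Ψ : Cochain R C p} (h : MlCochain Φ) (h' : MlCochain Ψ) :
    MlCochain (Φ + Ψ) := fun Z => (h Z).add (h' Z)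

theorem MlCochain.units_smul {Φ : Cochain R C p} (s : ℤˣ) (h : MlCochain Φ) :
    MlCochain (s • Φ) := fun Z => (h Z).units_smul s

theorem RedCochain.zero : RedCochain (0 : Cochain R C p) := fun _ => Red.zero

theorem RedCochain.add {Φ Ψ : Cochain R C p} (h : RedCochain Φ) (h' : RedCochain Ψ) :
    RedCochain (Φ + Ψ) := fun Z => (h Z).add (h' Z)

theorem RedCochain.units_smul {Φ : Cochain R C p} (s : ℤˣ) (h : RedCochain Φ) :
    RedCochain (s • Φ) := fun Z => (h Z).units_smul s

theorem HgCochain.zero : HgCochain r (0 : Cochain R C p) := fun _ => Hg.zero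

theorem HgCochain.add {Φ Ψ : Cochain R C p} (h : HgCochain r Φ) (h' : HgCochain r Ψ) :
    HgCochain r (Φ + Ψ) := fun Z => (h Z).add (h' Z)

theorem HgCochain.units_smul {Φ : Cochain R C p} (s : ℤˣ) (h : HgCochain r Φ) :
    HgCochain r (s • Φ) := fun Z => (h Z).units_smul s

variable {i j : ℕ} (h : p' + i = p) (hj : j ≤ p')
include h hj

theorem blockOp_mlCochain (hΦ : MlCochain Φ) : MlCochain (blockOp p p' i j Φ) :=
  signedSum_induction MlCochain.zero (fun _ _ => MlCochain.add) (fun _ _ => MlCochain.units_smul _)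
    _ (fun S => (blockReal_lawful h hj).eval_mlCochain hΦ S) _

theorem blockOp_redCochain (hΦ : RedCochain Φ) : RedCochain (blockOp p p' i j Φ) :=
  signedSum_induction RedCochain.zero (fun _ _ => RedCochain.add)
    (fun _ _ => RedCochain.units_smul _) _ (fun S => (blockReal_lawful h hj).eval_redCochain hΦ S) _

theorem blockOp_hgCochain (hΦ : HgCochain r Φ) : HgCochain r (blockOp p p' i j Φ) :=
  signedSum_induction HgCochain.zero (fun _ _ => HgCochain.add)
    (fun _ _ => HgCochain.units_smul _) _ (fun S => (blockReal_lawful h hj).eval_hgCochain hΦ S) _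

theorem blockOp_intern (hΦ : MlCochain Φ) :
    blockOp p p' i j (intern r Φ) = intern r (blockOp p p' i j Φ) := by
  rw [blockOp_apply, blockOp_apply, signedSum_hom]
  exact signedSum_congr fun S _ => (blockReal_lawful h hj).eval_intern r hΦ S.2

theorem blockOp_hoch (hΦ : MlCochain Φ) (γ : Rect X Y) :
    blockOp p p' i j (hoch r Φ) X Y γ = hoch r (blockOp p p' i j Φ) X Y γ +
      (-1 : ℤˣ) ^ γ.length • signedSum (admissiblePaths (i - 1)) (bdry fun S =>
        (blockReal R C p p' i j).eval S Φ X Y γ) := by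
  rw [blockOp_apply, blockOp_apply, signedSum_hom, signedSum_apply_row, signedSum_apply_row,
    ← signedSum_units_smul, ← signedSum_add]
  exact signedSum_congr fun S _ => (blockReal_lawful h hj).eval_hoch r hΦ S.2 γ

omit h hj

theorem blockOp_eq_zero_of_length {q : ℕ} (hi : 1 ≤ i)
    (hΦ : ∀ X Y (γ : Rect X Y), γ.length ≠ q → Φ X Y γ = 0)
    (γ : Rect X Y) (hq : γ.length + i ≠ q + 1) :
    blockOp p p' i j Φ X Y γ = 0 := by
  rw [blockOp_apply, signedSum_apply_row]
  refine (signedSum_congr fun S hS => ?_).trans (signedSum_zero _)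
  refine Realization.eval_eq_zero_of_length _ hΦ _ γ ?_
  obtain ⟨P, h1, h2⟩ := exists_of_mem_paths hS
  rw [h1, List.length_cons, h2]
  omega

theorem blockOp_blockOp {k l j j' : ℕ} (h : p' + (l + 1) = p) (h' : p'' + (k + 1) = p')
    (hj : j ≤ p') (hj' : j' ≤ p'') (Φ : Cochain R C p'')
    (γ : Rect X Y) :
    blockOp p p' (l + 1) j (blockOp p' p'' (k + 1) j' Φ) X Y γ =
      signedSum (admissiblePaths k) fun P => signedSum (admissiblePaths l) fun Q =>
        shSum (fun S => ((blockReal R C p p' (l + 1) j).compose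
          (blockReal R C p' p'' (k + 1) j')).eval S Φ X Y γ) P Q := by
  rw [blockOp_apply, blockOp_apply, signedSum_apply_row, signedSum_comm]
  refine signedSum_congr fun Q hQ => ?_
  rw [signedSum_hom, signedSum_apply_row]
  refine signedSum_congr fun P hP => ?_
  obtain ⟨P', h1, -⟩ := exists_of_mem_paths hP
  obtain ⟨Q', h2, -⟩ := exists_of_mem_paths hQ
  rw [h1, h2, Realization.eval_eval (blockReal_lawful h hj) (blockReal_lawful h' hj')]
  exact (signedSum_shufflePaths _ _ _ _ fun S => ((blockReal R C p p' (l + 1) j).compose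
    (blockReal R C p' p'' (k + 1) j')).eval S Φ X Y γ).symm

theorem blockOp_nested {k l j a : ℕ} (h : p' + (l + 1) = p) (h' : p'' + (k + 1) = p')
    (hj : j ≤ p'') (ha : a ≤ k + 1) (Φ : Cochain R C p'')
    (γ : Rect X Y) :
    blockOp p p' (l + 1) (j + a) (blockOp p' p'' (k + 1) j Φ) X Y γ =
      graftSum k l a fun S => (blockReal R C p p'' (k + l + 2) j).eval S Φ X Y γ := by
  rw [blockOp_blockOp h h' (by omega) hj, blockReal_nested h h' hj ha]
  refine signedSum_congr fun P hP => signedSum_congr fun Q hQ => shSum_congr fun S _ hS => ?_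
  rw [Realization.eval_pull, show k + 1 + (l + 1) = k + l + 2 by omega]
  refine congrArg (fun S => (blockReal R C p p'' (k + l + 2) j).eval S Φ X Y γ)
    (List.map_congr_left fun x hx => ?_)
  rw [BTree.retract_of_leaves (leaves_of_mem_admissiblePaths hP _ (hS x hx).1),
    BTree.retract_of_leaves (leaves_of_mem_admissiblePaths hQ _ (hS x hx).2)]

theorem blockOp_disjoint {q k l j j' : ℕ} (h : p' + (l + 1) = p) (h' : p'' + (k + 1) = p')
    (h1 : q + (k + 1) = p) (h2 : p'' + (l + 1) = q) (hj : j < j') (hj' : j' ≤ p'')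
    (Φ : Cochain R C p'') (γ : Rect X Y) :
    blockOp p p' (l + 1) j (blockOp p' p'' (k + 1) j' Φ) X Y γ = (-1 : ℤˣ) ^ (k * l) •
        blockOp p q (k + 1) (j' + (l + 1)) (blockOp q p'' (l + 1) j Φ) X Y γ := by
  rw [blockOp_blockOp h h' (by omega) hj', blockReal_disjoint h h' h1 h2 hj hj',
    blockOp_blockOp h1 h2 (by omega) (by omega), signedSum_comm, ← signedSum_units_smul]
  refine signedSum_congr fun P hP => ?_
  rw [← signedSum_units_smul]
  refine signedSum_congr fun Q hQ => ?_
  obtain ⟨P', h3, h3'⟩ := exists_of_mem_paths hP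
  obtain ⟨Q', h4, h4'⟩ := exists_of_mem_paths hQ
  rw [shSum_swap, h3, h4, List.length_cons, List.length_cons, h3', h4']
  refine congrArg (_ • ·) (shSum_congr fun S _ _ => ?_)
  rw [Realization.eval_pull, List.map_map]
  simp

open Finset in
/-- The commutator of a block operator and the Hochschild differential. -/
theorem blockOp_hoch_add_two {N j : ℕ} (h : p' + (N + 2) = p) (hj : j ≤ p') (hΦ : MlCochain Φ)
    (γ : Rect X Y) :
    blockOp p p' (N + 2) j (hoch r Φ) X Y γ = hoch r (blockOp p p' (N + 2) j Φ) X Y γ +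
      (-1 : ℤˣ) ^ γ.length • ∑ x ∈ antidiagonal N, ∑ a ∈ range (x.1 + 2), faceSign x.2 a •
        blockOp p (p' + (x.1 + 1)) (x.2 + 1) (j + a)
          (blockOp (p' + (x.1 + 1)) p' (x.1 + 1) j Φ) X Y γ := by
  rw [blockOp_hoch h hj hΦ]
  refine congrArg (_ + _ • ·) ((signedSum_admissiblePaths_bdry N _).trans ?_)
  refine sum_congr rfl fun x hx => sum_congr rfl fun a ha => ?_
  have hx := mem_ad.1 hx
  have ha := mem_range.1 ha
  rw [blockOp_nested (by omega) rfl hj (by omega), hx]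

theorem blockOp_hoch_one {j : ℕ} (h : p' + 1 = p) (hj : j ≤ p') (hΦ : MlCochain Φ) :
    blockOp p p' 1 j (hoch r Φ) = hoch r (blockOp p p' 1 j Φ) := by
  funext X Y γ
  rw [blockOp_hoch h hj hΦ]
  refine (congrArg (_ + _ • ·) ?_).trans ((congrArg _ (smul_zero _)).trans (add_zero _))
  simp [admissiblePaths, bdry_cons]

end Blocks

/-! ### Cutting a rectangle horizontally into two rectangles -/

section Restrict

variable {a b p : ℕ} {X Y Z : Row R C p}

/-- The objects in some of the rows. -/
def Row.restrict (e : Fin (a + 1) → Fin (p + 1)) (X : Row R C p) : Row R C a := fun i => X (e i)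

/-- The morphisms in some of the rows. -/
def resCol (e : Fin (a + 1) → Fin (p + 1)) {X Y : Row R C p} (f : X ⟶ Y) :
    X.restrict e ⟶ Y.restrict e := fun i => f (e i)

/-- The rectangle consisting of some of the rows. -/
def resPath (e : Fin (a + 1) → Fin (p + 1)) {X : Row R C p} :
    {Y : Row R C p} → Rect X Y → Rect (X.restrict e) (Y.restrict e)
  | _, .nil => .nil
  | _, .cons γ f => (resPath e γ).cons (resCol e f)

theorem length_resPath (e : Fin (a + 1) → Fin (p + 1))
    (γ : Rect X Y) : (resPath e γ).length = γ.length := by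
  induction γ with
  | nil => rfl
  | cons γ f ih => exact congrArg (· + 1) ih

theorem resCol_update {e : Fin (a + 1) → Fin (p + 1)} (he : Function.Injective e)
    (f : X ⟶ Y) (i : Fin (a + 1)) (x : HomogHom R (X (e i)) (Y (e i))) :
    resCol e (update f (e i) x : X ⟶ Y) = (update (resCol e f) i x : X.restrict e ⟶ Y.restrict e) :=
  Function.update_comp_eq_of_injective' f he i x

theorem resCol_update_of_ne {e : Fin (a + 1) → Fin (p + 1)} {i : Fin (p + 1)}
    (h : ∀ k, e k ≠ i) (f : X ⟶ Y) (x : HomogHom R (X i) (Y i)) :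
    resCol e (update f i x : X ⟶ Y) = resCol e f :=
  funext fun k => update_of_ne (β := fun k => HomogHom R (X k) (Y k)) (h k) x f

theorem resCol_colComp (e : Fin (a + 1) → Fin (p + 1)) (f : X ⟶ Y)
    (g : Y ⟶ Z) : resCol e (colComp f g) = colComp (resCol e f) (resCol e g) := rfl

theorem resCol_idColumn (e : Fin (a + 1) → Fin (p + 1)) (X : Row R C p) :
    resCol e (idColumn X) = idColumn (X.restrict e) := rfl

end Restrict

/-- A decomposition of the rows `0, …, p` into the first `a + 1` and the last `b + 1` rows. -/
structure Cut (a b p : ℕ) where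
  upper : Fin (a + 1) → Fin (p + 1)
  lower : Fin (b + 1) → Fin (p + 1)
  card : a + b + 1 = p
  upper_val : ∀ i, (upper i).1 = i.1
  lower_val : ∀ i, (lower i).1 = a + 1 + i.1

theorem rowWord_singleton {κ : Type} : ∀ {p : ℕ} (g : Fin (p + 1) → κ),
    rowWord p (fun k => [g k]) = List.ofFn g
  | 0, g => rfl
  | p + 1, g => by
    rw [rowWord, rowWord_singleton fun k => g k.castSucc]
    exact (List.concat_eq_append ..).symm.trans (List.ofFn_succ' g).symm

theorem leaves_rowTree {ι : Type} : ∀ {p : ℕ} (F : Fin (p + 1) → BTree ι),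
    (rowTree p F).leaves = rowWord p fun k => (F k).leaves
  | 0, F => rfl
  | p + 1, F => by
    rw [rowTree, rowWord, BTree.leaves_node, leaves_rowTree]

namespace Cut

variable {a b p : ℕ} (c : Cut a b p) {X Y Z : Row R C p}

theorem upper_injective : Function.Injective c.upper := fun i j h =>
  Fin.ext (by rw [← c.upper_val, ← c.upper_val, h])

theorem lower_injective : Function.Injective c.lower := fun i j h => Fin.ext (by
  have h1 := c.lower_val i
  rw [h, c.lower_val j] at h1
  omega)

theorem upper_ne_lower (i : Fin (a + 1)) (j : Fin (b + 1)) : c.upper i ≠ c.lower j := fun h => by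
  have h1 := c.lower_val j
  rw [← h, c.upper_val] at h1
  have := i.2
  omega

theorem upper_lt_upper {i j : Fin (a + 1)} : c.upper i < c.upper j ↔ i < j := by
  rw [Fin.lt_def, Fin.lt_def, c.upper_val, c.upper_val]

theorem lower_lt_lower {i j : Fin (b + 1)} : c.lower i < c.lower j ↔ i < j := by
  rw [Fin.lt_def, Fin.lt_def, c.lower_val, c.lower_val, Nat.add_lt_add_iff_left]

theorem upper_lt_lower (i : Fin (a + 1)) (j : Fin (b + 1)) : c.upper i < c.lower j := by
  rw [Fin.lt_def, c.upper_val, c.lower_val]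
  have := i.2
  omega

theorem eq_upper_or_lower (k : Fin (p + 1)) : (∃ i, k = c.upper i) ∨ ∃ j, k = c.lower j := by
  have h1 := c.card
  have h2 := k.2
  by_cases h : k.1 < a + 1
  · exact .inl ⟨⟨k.1, h⟩, Fin.ext (c.upper_val ⟨k.1, h⟩).symm⟩
  · refine .inr ⟨⟨k.1 - (a + 1), by omega⟩, Fin.ext ?_⟩
    rw [c.lower_val]
    change k.1 = a + 1 + (k.1 - (a + 1))
    omega

theorem ofFn_append {κ : Type*} (g : Fin (p + 1) → κ) :
    List.ofFn g = (List.ofFn fun i => g (c.upper i)) ++ List.ofFn fun j => g (c.lower j) := by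
  have h1 := c.card
  refine List.ext_getElem (by simp; omega) fun n h2 h3 => ?_
  rw [List.length_ofFn] at h2
  rw [List.getElem_ofFn, List.getElem_append]
  split_ifs with h
  · rw [List.getElem_ofFn]
    rw [List.length_ofFn] at h
    exact congrArg g (Fin.ext (c.upper_val ⟨n, h⟩).symm)
  · rw [List.getElem_ofFn]
    refine congrArg g (Fin.ext ?_)
    rw [List.length_ofFn] at h
    rw [c.lower_val]
    simp only [List.length_ofFn]
    omega

theorem sum_eq {M : Type*} [AddCommMonoid M] (g : Fin (p + 1) → M) :
    ∑ k, g k = ∑ i, g (c.upper i) + ∑ j, g (c.lower j) := by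
  rw [← List.sum_ofFn, c.ofFn_append, List.sum_append, List.sum_ofFn, List.sum_ofFn]

/-- The bracketing `(X 0 ⊗ … ⊗ X a) ⊗ (X (a+1) ⊗ … ⊗ X p)`. -/
def tree : BTree (Fin (p + 1)) :=
  .node (rowTree a fun i => .leaf (c.upper i)) (rowTree b fun j => .leaf (c.lower j))

theorem leaves_tree : (rowTree p BTree.leaf : BTree (Fin (p + 1))).leaves = c.tree.leaves := by
  rw [tree, BTree.leaves_node, leaves_rowTree, leaves_rowTree, leaves_rowTree]
  simp only [BTree.leaves_leaf]
  rw [rowWord_singleton, rowWord_singleton, rowWord_singleton]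
  exact c.ofFn_append _

/-- The first row and the others. -/
def first (p : ℕ) : Cut 0 p (p + 1) where
  upper i := ⟨i.1, by omega⟩
  lower := Fin.succ
  card := by omega
  upper_val _ := rfl
  lower_val i := by rw [Fin.val_succ]; omega

/-- The last row and the others. -/
def last (p : ℕ) : Cut p 0 (p + 1) where
  upper := Fin.castSucc
  lower _ := Fin.last (p + 1)
  card := by omega
  upper_val _ := rfl
  lower_val i := by rw [Fin.val_last]; omega

/-- The cut into `a + 1` and `b + 1` rows. -/
def ofEq (h : a + b + 1 = p) : Cut a b p where
  upper i := ⟨i.1, by omega⟩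
  lower j := ⟨a + 1 + j.1, by omega⟩
  card := h
  upper_val _ := rfl
  lower_val _ := rfl

theorem columnDeg_eq (f : X ⟶ Y) :
    columnDeg f = columnDeg (resCol c.upper f) + columnDeg (resCol c.lower f) :=
  c.sum_eq _

theorem totalDeg_eq (γ : Rect X Y) :
    totalDeg γ = totalDeg (resPath c.upper γ) + totalDeg (resPath c.lower γ) := by
  induction γ with
  | nil => rfl
  | cons γ f ih =>
    have h := c.columnDeg_eq f
    simp only [totalDeg, resPath, ih, h]
    ring

theorem mergeExp_eq (e : X ⟶ Y) (f : Y ⟶ Z) :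
    mergeExp e f = mergeExp (resCol c.upper e) (resCol c.upper f) +
      mergeExp (resCol c.lower e) (resCol c.lower f) +
      columnDeg (resCol c.lower f) * columnDeg (resCol c.upper e) := by
  simp only [mergeExp, c.sum_eq, c.upper_lt_upper, c.lower_lt_lower, c.upper_lt_lower,
    (c.upper_lt_lower _ _).not_gt, if_true, if_false, sum_const_zero, add_zero,
    sum_add_distrib, columnDeg, Finset.sum_mul_sum, resCol]
  ring

theorem colSign_upper (f : X ⟶ Y) (i : Fin (a + 1)) :
    colSign f (c.upper i) = colSign (resCol c.upper f) i := by
  simp only [colSign, c.sum_eq, c.upper_lt_upper, (c.upper_lt_lower _ _).not_gt, if_false,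
    sum_const_zero, add_zero, resCol]

theorem colSign_lower (f : X ⟶ Y) (j : Fin (b + 1)) :
    colSign f (c.lower j) = (columnDeg (resCol c.upper f)).negOnePow *
      colSign (resCol c.lower f) j := by
  simp only [colSign, c.sum_eq, c.lower_lt_lower, c.upper_lt_lower, if_true, resCol,
    columnDeg, negOnePow_add]

theorem update_upper (f : X ⟶ Y) (i : Fin (a + 1))
    (x : HomogHom R (X (c.upper i)) (Y (c.upper i))) :
    resCol c.upper (update f (c.upper i) x : X ⟶ Y) =
        (update (resCol c.upper f) i x : X.restrict c.upper ⟶ Y.restrict c.upper) ∧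
      resCol c.lower (update f (c.upper i) x : X ⟶ Y) = resCol c.lower f :=
  ⟨resCol_update c.upper_injective f i x,
    resCol_update_of_ne (fun k h => c.upper_ne_lower i k h.symm) f x⟩

theorem update_lower (f : X ⟶ Y) (j : Fin (b + 1))
    (x : HomogHom R (X (c.lower j)) (Y (c.lower j))) :
    resCol c.upper (update f (c.lower j) x : X ⟶ Y) = resCol c.upper f ∧
      resCol c.lower (update f (c.lower j) x : X ⟶ Y) = (update (resCol c.lower f) j x :
          X.restrict c.lower ⟶ Y.restrict c.lower) :=
  ⟨resCol_update_of_ne (fun k => c.upper_ne_lower k j) f x, resCol_update c.lower_injective f j x⟩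

/-- A function of two columns which is multilinear in each of them. -/
theorem colMl_restrict {M : Type*} [AddCommGroup M] [Module R M]
    {G : (X.restrict c.upper ⟶ Y.restrict c.upper) → (X.restrict c.lower ⟶ Y.restrict c.lower) → M}
    (h1 : ∀ g, ColMl fun f => G f g) (h2 : ∀ f, ColMl (G f)) :
    ColMl fun f : X ⟶ Y => G (resCol c.upper f) (resCol c.lower f) := by
  refine ⟨fun f k x y z hx hy hz => ?_, fun f k r x z hx hz => ?_⟩
  all_goals obtain ⟨i, rfl⟩ | ⟨i, rfl⟩ := c.eq_upper_or_lower k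
  · simp only [(c.update_upper f i _).1, (c.update_upper f i _).2]
    exact (h1 _).map_add _ i x y z hx hy hz
  · simp only [(c.update_lower f i _).1, (c.update_lower f i _).2]
    exact (h2 _).map_add _ i x y z hx hy hz
  · simp only [(c.update_upper f i _).1, (c.update_upper f i _).2]
    exact (h1 _).map_smul _ i r x z hx hz
  · simp only [(c.update_lower f i _).1, (c.update_lower f i _).2]
    exact (h2 _).map_smul _ i r x z hx hz

theorem colD_restrict {M : Type*} [AddCommGroup M] [Module R M]
    (G : (X.restrict c.upper ⟶ Y.restrict c.upper) →
      (X.restrict c.lower ⟶ Y.restrict c.lower) → M) (f : X ⟶ Y) :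
    colD (fun f : X ⟶ Y => G (resCol c.upper f) (resCol c.lower f)) f =
      colD (fun g => G g (resCol c.lower f)) (resCol c.upper f) +
        (columnDeg (resCol c.upper f)).negOnePow •
          colD (G (resCol c.upper f)) (resCol c.lower f) := by
  refine (c.sum_eq _).trans (add_congr ?_ ?_)
  · refine sum_congr rfl fun i _ => ?_
    obtain ⟨h1, h2⟩ := c.update_upper f i (f (c.upper i)).d
    exact congrArg₂ (· • ·) (c.colSign_upper f i) (congrArg₂ G h1 h2)
  · rw [colD, smul_sum]
    refine sum_congr rfl fun j _ => ?_
    obtain ⟨h1, h2⟩ := c.update_lower f j (f (c.lower j)).d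
    exact (congrArg₂ (· • ·) (c.colSign_lower f j) (congrArg₂ G h1 h2)).trans (mul_smul _ _ _)

/-- The exponent of the Koszul sign for moving the first `a + 1` rows to the front. -/
def exponent {X : Row R C p} : {Y : Row R C p} → Rect X Y → ℤ
  | _, .nil => 0
  | _, .cons γ f =>
      exponent γ + columnDeg (resCol c.lower f) * totalDeg (resPath c.upper γ)


theorem exists_iso (X : Row R C p) :
    ∃ e : (X.tensor : C) ≅ tensorObj R (X.restrict c.upper).tensor (X.restrict c.lower).tensor,
      IsCan R X (rowTree p .leaf) c.tree e.hom := by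
  have hA : X.tensor = treeObj R X (rowTree p .leaf) := rowTensor_eq (R := R) X p .leaf
  have hB : tensorObj R (C := C) (X.restrict c.upper).tensor (X.restrict c.lower).tensor =
      treeObj R X c.tree :=
    congrArg₂ (tensorObj R) (rowTensor_eq (R := R) X a fun i => .leaf (c.upper i))
      (rowTensor_eq (R := R) X b fun i => .leaf (c.lower i))
  have h1 := canonicalHom_isCanonical (R := R) X (p := 0) (p' := 0) (F := fun _ => rowTree p .leaf)
    (G := fun _ => c.tree) (forestWord_congr c.leaves_tree)
  have h2 := canonicalHom_isCanonical (R := R) X (p := 0) (p' := 0) (F := fun _ => c.tree)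
    (G := fun _ => rowTree p .leaf) (forestWord_congr c.leaves_tree.symm)
  have h3 := ((IsCan.eqToHom hA hA).comp h1).comp (.eqToHom hB.symm rfl)
  have h4 := ((IsCan.eqToHom hB hB).comp h2).comp (.eqToHom hA.symm rfl)
  exact ⟨⟨_, _, (h3.comp h4).unique (.id hA), (h4.comp h3).unique (.id hB)⟩, h3⟩

/-- The canonical isomorphism from `X 0 ⊗ … ⊗ X p` to
`(X 0 ⊗ … ⊗ X a) ⊗ (X (a+1) ⊗ … ⊗ X p)`. -/
noncomputable def iso (X : Row R C p) :
    X.tensor ≅ tensorObj R (X.restrict c.upper).tensor (X.restrict c.lower).tensor :=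
  (c.exists_iso X).choose

theorem hom_isCanonical (X : Row R C p) :
    IsCan R X (rowTree p .leaf) c.tree (c.iso X).hom := (c.exists_iso X).choose_spec

theorem inv_isCanonical (X : Row R C p) :
    IsCan R X c.tree (rowTree p .leaf) (c.iso X).inv := (c.hom_isCanonical X).inv

theorem hom_natural (f : X ⟶ Y) : columnTensor f ≫ (c.iso Y).hom = (c.iso X).hom ≫
      tHom (columnTensor (resCol c.upper f)) (columnTensor (resCol c.lower f)) :=
  (c.hom_isCanonical X).natural (c.hom_isCanonical Y) (rowTensorHom_isTreeHom f p .leaf)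
    ((rowTensorHom_isTreeHom f a fun i => .leaf (c.upper i)).tensor
      (rowTensorHom_isTreeHom f b fun i => .leaf (c.lower i)))

theorem inv_natural (f : X ⟶ Y) : tHom (columnTensor (resCol c.upper f))
        (columnTensor (resCol c.lower f)) ≫ (c.iso Y).inv =
      (c.iso X).inv ≫ columnTensor f := by
  rw [Iso.comp_inv_eq, assoc, c.hom_natural, Iso.inv_hom_id_assoc]

/-- The product of families of functions of the first `a + 1` and of the last `b + 1` rows, where
the latter are homogeneous of degree `s`. -/
noncomputable def box (s : ℤ) {Z : Row R C p} {T₁ T₂ : C} :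
    Fam (Z.restrict c.upper) T₁ →ₗ[R] Fam (Z.restrict c.lower) T₂ →ₗ[R] Fam Z (tensorObj R T₁ T₂) :=
  LinearMap.mk₂ R (fun Ψ₁ Ψ₂ X γ =>
      (c.exponent γ + s * totalDeg (resPath c.upper γ)).negOnePow • ((c.iso X).hom ≫
        tHom (Ψ₁ _ (resPath c.upper γ)) (Ψ₂ _ (resPath c.lower γ))))
    (fun Ψ₁ Ψ₁' Ψ₂ => by
      funext X γ
      simp only [Pi.add_apply, map_add, LinearMap.add_apply, Preadditive.comp_add, smul_add])
    (fun r Ψ₁ Ψ₂ => by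
      funext X γ
      simp only [Pi.smul_apply, map_smul, LinearMap.smul_apply, Linear.comp_smul, smul_comm r])
    (fun Ψ₁ Ψ₂ Ψ₂' => by
      funext X γ
      simp only [Pi.add_apply, map_add, Preadditive.comp_add, smul_add])
    (fun r Ψ₁ Ψ₂ => by
      funext X γ
      simp only [Pi.smul_apply, map_smul, Linear.comp_smul, smul_comm r])

variable {s : ℤ} {Y Z : Row R C p} {T₁ T₂ T₁' T₂' : C} {Ψ₁ : Fam (Z.restrict c.upper) T₁}
  {Ψ₂ : Fam (Z.restrict c.lower) T₂}

theorem box_apply (s : ℤ) (Ψ₁ : Fam (Z.restrict c.upper) T₁) (Ψ₂ : Fam (Z.restrict c.lower) T₂)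
    (γ : Rect X Z) : c.box s Ψ₁ Ψ₂ X γ =
      (c.exponent γ + s * totalDeg (resPath c.upper γ)).negOnePow • ((c.iso X).hom ≫
        tHom (Ψ₁ _ (resPath c.upper γ)) (Ψ₂ _ (resPath c.lower γ))) :=
  rfl

theorem box_nil (s : ℤ) (Ψ₁ : Fam (Z.restrict c.upper) T₁) (Ψ₂ : Fam (Z.restrict c.lower) T₂) :
    c.box s Ψ₁ Ψ₂ Z .nil = (c.iso Z).hom ≫ tHom (Ψ₁ _ .nil) (Ψ₂ _ .nil) := by
  rw [box_apply]
  simp [exponent, resPath, totalDeg]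

theorem push_box (s : ℤ) (Ψ₁ : Fam (Z.restrict c.upper) T₁) (Ψ₂ : Fam (Z.restrict c.lower) T₂)
    (f : Y ⟶ Z) : push f (c.box s Ψ₁ Ψ₂) = (s * columnDeg (resCol c.upper f)).negOnePow •
        c.box (s + columnDeg (resCol c.lower f)) (push (resCol c.upper f) Ψ₁)
          (push (resCol c.lower f) Ψ₂) := by
  funext X γ
  change c.box s Ψ₁ Ψ₂ X (γ.cons f) = (s * columnDeg (resCol c.upper f)).negOnePow •
    c.box (s + columnDeg (resCol c.lower f)) (push (resCol c.upper f) Ψ₁)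
      (push (resCol c.lower f) Ψ₂) X γ
  rw [box_apply, box_apply, ← mul_smul, ← negOnePow_add]
  refine congrArg (fun n : ℤ => n.negOnePow • _) ?_
  simp only [exponent, resPath, totalDeg]
  ring

theorem act_box (h : Hg s Ψ₂) (Ψ₁ : Fam (Z.restrict c.upper) T₁) (f : Y ⟶ Z) :
    act f (c.box s Ψ₁ Ψ₂) = (s * columnDeg (resCol c.upper f)).negOnePow •
        c.box (s + columnDeg (resCol c.lower f)) (act (resCol c.upper f) Ψ₁)
          (act (resCol c.lower f) Ψ₂) := by
  funext X γ
  change _ = (s * columnDeg (resCol c.upper f)).negOnePow •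
    c.box (s + columnDeg (resCol c.lower f)) (act (resCol c.upper f) Ψ₁)
      (act (resCol c.lower f) Ψ₂) X γ
  cases γ with
  | nil =>
    rw [act_nil, box_nil, box_nil, ← assoc, c.hom_natural, assoc,
      tensorHom_comp _ _ (columnTensor_mem _) h.nil]
    exact comp_units_smul' _ _ _
  | cons γ e =>
    rw [act_cons, box_apply, box_apply]
    have h1 : act (resCol c.upper f) Ψ₁ _ (resPath c.upper (γ.cons e)) =
      mergeSign (resCol c.upper e) (resCol c.upper f) •
        Ψ₁ _ (resPath c.upper (γ.cons (colComp e f))) := rfl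
    have h2 : act (resCol c.lower f) Ψ₂ _ (resPath c.lower (γ.cons e)) =
      mergeSign (resCol c.lower e) (resCol c.lower f) •
        Ψ₂ _ (resPath c.lower (γ.cons (colComp e f))) := rfl
    rw [h1, h2]
    rw [tensorHom_signs, map_usmul, comp_units_smul', comp_units_smul', mergeSign_eq,
      mergeSign_eq, mergeSign_eq, c.mergeExp_eq, ← mul_smul, ← mul_smul, ← mul_smul, ← mul_smul,
      ← negOnePow_add, ← negOnePow_add, ← negOnePow_add, ← negOnePow_add]
    refine congrArg (fun n : ℤ => n.negOnePow • _) ?_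
    simp only [exponent, resPath, totalDeg, resCol_colComp, columnDeg_colComp]
    ring

end Cut

/-! ### Products of cochains -/

section Unit

variable {p : ℕ} {Y Z : Row R C p} {T T' : C}

/-- The composite of the tensor products of the columns of a rectangle. -/
def compTensor {X : Row R C p} : {Y : Row R C p} → Rect X Y → (X.tensor ⟶ Y.tensor)
  | _, .nil => 𝟙 _
  | _, .cons γ f => compTensor γ ≫ columnTensor f

variable (R C p) in
/-- The cochain whose values are the composites of the tensor products of the columns. -/
def unit : Cochain R C p := fun _ _ γ => compTensor γ

theorem post_id (Ψ : Fam Z T) : post (𝟙 T) Ψ = Ψ := by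
  funext X γ
  exact comp_id _

theorem post_post (g : T ⟶ T') {T'' : C} (g' : T' ⟶ T'') (Ψ : Fam Z T) :
    post g' (post g Ψ) = post (g ≫ g') Ψ := by
  funext X γ
  exact assoc _ _ _

theorem push_unit (f : Y ⟶ Z) (g : Z.tensor ⟶ T) : push f (post g (fam Z (unit R C p))) =
      post (columnTensor f ≫ g) (fam Y (unit R C p)) := by
  funext X γ
  exact assoc _ _ _

theorem act_unit (f : Y ⟶ Z) (g : Z.tensor ⟶ T) : act f (post g (fam Z (unit R C p))) =
      post (columnTensor f ≫ g) (fam Y (unit R C p)) := by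
  rw [act_post, ← post_post]
  refine congrArg (post g) ?_
  funext X γ
  cases γ with
  | nil => exact (comp_id _).trans (id_comp _).symm
  | cons γ e =>
    change mergeSign e f • (compTensor γ ≫ columnTensor (colComp e f)) =
      (compTensor γ ≫ columnTensor e) ≫ columnTensor f
    rw [assoc, columnTensor_comp, comp_units_smul']

theorem compTensor_mem {X : Row R C p} (γ : Rect X Y) :
    compTensor γ ∈ gr (R := R) X.tensor Y.tensor (totalDeg γ) := by
  induction γ with
  | nil => exact id_mem _
  | cons γ f ih => exact comp_mem ih (columnTensor_mem f)

theorem unit_hg {s : ℤ} {g : Z.tensor ⟶ T} (hg : g ∈ gr (R := R) _ _ s) :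
    Hg s (post g (fam Z (unit R C p))) := fun _ γ =>
  comp_mem (compTensor_mem γ) hg

theorem unit_hgCochain : HgCochain 0 (unit R C p) := fun Z => by
  rw [← post_id (fam Z _)]
  exact unit_hg (id_mem _)

theorem unit_mlCochain : MlCochain (unit R C p) := fun Z => by
  rw [← post_id (fam Z _)]
  refine Ml.coinduct (fun {Z} Ψ => ∃ g, Ψ = post g (fam Z (unit R C p))) ?_ ?_ ⟨_, rfl⟩
  · rintro Y Z _ ⟨g, rfl⟩
    simp only [push_unit]
    refine colMl_pi fun X γ => ?_
    exact columnTensor_colMl.comp_linear ((precomp (R := R) _ (compTensor γ)).comp (postcomp _ g))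
  · rintro Y Z _ ⟨g, rfl⟩ f
    exact ⟨_, push_unit f g⟩

/-- The internal differential of a family which is homogeneous of degree `s`. -/
def internFam (s : ℤ) : Fam Z T →ₗ[R] Fam Z T where
  toFun Ψ := dVal Ψ - s.negOnePow • diffSum Ψ
  map_add' Ψ Ψ' := by simp only [map_add, smul_add]; abel
  map_smul' c Ψ := by simp only [map_smul, smul_comm _ c, RingHom.id_apply, smul_sub]

theorem internFam_apply (s : ℤ) (Ψ : Fam Z T) :
    internFam s Ψ = dVal Ψ - s.negOnePow • diffSum Ψ := rfl

theorem internFam_nil (s : ℤ) (Ψ : Fam Z T) : internFam s Ψ Z .nil = dC _ _ (Ψ Z .nil) := by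
  change _ - s.negOnePow • (0 : Z.tensor ⟶ T) = _
  rw [smul_zero, sub_zero]
  rfl

theorem push_internFam (s : ℤ) (Ψ : Fam Z T) (f : Y ⟶ Z) :
    push f (internFam s Ψ) = internFam (s + columnDeg f) (push f Ψ) -
      s.negOnePow • colD (fun f => push f Ψ) f := by
  rw [internFam_apply, internFam_apply, map_sub, map_usmul, push_diffSum, smul_add,
    negOnePow_add, mul_smul, sub_add_eq_sub_sub_swap]
  rfl

theorem internFam_post_add {m : ℤ} {g : T ⟶ T'} (hg : g ∈ gr (R := R) _ _ m) (s : ℤ)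
    (Ψ : Fam Z T) : internFam (s + m) (post g Ψ) =
      post (dC _ _ g) Ψ + m.negOnePow • post g (internFam s Ψ) := by
  have h1 : dVal (post g Ψ) = post (dC _ _ g) Ψ + m.negOnePow • post g (dVal Ψ) := by
    funext X γ
    exact d_comp (R := R) (Ψ X γ) hg
  have h2 : diffSum (post g Ψ) = post g (diffSum Ψ) := by
    funext X γ
    exact (signedSum_hom (postcomp (R := R) X.tensor g) (diffs γ) (Ψ X)).symm
  rw [internFam_apply, h1, h2, internFam_apply, map_sub, map_usmul, smul_sub, ← mul_smul,
    add_comm s, negOnePow_add, add_sub_assoc]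

theorem internFam_post {g : T ⟶ T'} (hg : g ∈ gr (R := R) _ _ 0)
    (hd : dC _ _ g = 0) (s : ℤ) (Ψ : Fam Z T) :
    internFam s (post g Ψ) = post g (internFam s Ψ) := by
  have h := internFam_post_add hg s Ψ
  rw [add_zero, hd, Int.negOnePow_zero, one_smul] at h
  rw [h]
  funext X γ
  change Ψ X γ ≫ (0 : T ⟶ T') + post g (internFam s Ψ) X γ = _
  rw [Limits.comp_zero, zero_add]

theorem intern_unit : intern 0 (unit R C p) = 0 := by
  funext X Z γ
  change internFam 0 (fam Z (unit R C p)) X γ = 0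
  induction γ with
  | nil => exact (internFam_nil _ _).trans (d_id _)
  | cons γ f ih =>
    have h1 := push_internFam 0 (fam _ (unit R C p)) f
    have h2 := internFam_post_add (columnTensor_mem f) 0 (fam _ (unit R C p))
    have h3 := congrFun (congrFun (h1.trans (congrArg (· - _) h2)) X) γ
    refine h3.trans ?_
    change compTensor γ ≫ _ + (columnDeg f).negOnePow • (internFam 0 _ X γ ≫ columnTensor f) -
      (0 : ℤ).negOnePow • colD (fun f => push f (fam _ (unit R C p))) f X γ = 0
    have h4 := colD_hom (evalFam γ) (fun f => push f (fam _ (unit R C p))) f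
    have h5 := colD_hom (precomp (R := R) _ (compTensor γ)) columnTensor f
    rw [ih, Limits.zero_comp, smul_zero, add_zero, Int.negOnePow_zero, one_smul, d_columnTensor]
    exact sub_eq_zero_of_eq (h5.trans h4.symm)

theorem columnDeg_update_d (f : Y ⟶ Z) (i : Fin (p + 1)) :
    columnDeg (update f i (f i).d : Y ⟶ Z) = columnDeg f + 1 := by
  rw [columnDeg_update]
  simp [HomogHom.d]

theorem colD_deg {M : Type*} [AddCommGroup M] [Module R M] (H : ℤ → (Y ⟶ Z) → M) (f : Y ⟶ Z) :
    colD (fun g => H (columnDeg g) g) f = colD (H (columnDeg f + 1)) f := by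
  simp only [colD, columnDeg_update_d]

end Unit

namespace Cut

variable {a b p : ℕ} (c : Cut a b p)

variable {s : ℤ} {Y Z : Row R C p} {T₁ T₂ T₁' T₂' : C} {Ψ₁ : Fam (Z.restrict c.upper) T₁}
  {Ψ₂ : Fam (Z.restrict c.lower) T₂}

theorem box_comp_tensorHom {s₁ m : ℤ} (h : Hg s₁ Ψ₁) (g₁ : T₁ ⟶ T₁') {g₂ : T₂ ⟶ T₂'}
    (hg : g₂ ∈ gr (R := R) _ _ m) (Ψ₂ : Fam (Z.restrict c.lower) T₂) :
    post (tHom g₁ g₂) (c.box s Ψ₁ Ψ₂) =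
      (m * s₁).negOnePow • c.box (s + m) (post g₁ Ψ₁) (post g₂ Ψ₂) := by
  funext X γ
  change c.box s Ψ₁ Ψ₂ X γ ≫ _ = (m * s₁).negOnePow • c.box (s + m) (post g₁ Ψ₁) (post g₂ Ψ₂) X γ
  rw [box_apply, box_apply, units_smul_comp', assoc,
    tensorHom_comp _ _ (h _ _) hg, comp_units_smul', ← mul_smul, ← mul_smul,
    ← negOnePow_add, ← negOnePow_add]
  refine congrArg (fun n : ℤ => n.negOnePow • _) ?_
  ring

theorem bar_box_left (h : Hg s Ψ₂) (g : (Z.restrict c.upper).tensor ⟶ T₁) :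
    bar (c.box s (post g (fam _ (unit R C a))) Ψ₂) =
      c.box s (post g (fam _ (unit R C a))) (bar Ψ₂) := by
  funext X γ
  induction γ generalizing s with
  | nil => rw [bar_nil, box_nil, bar_nil, map_zero, Limits.comp_zero]
  | cons γ f ih =>
    have h2 := ih ((add_comm _ s) ▸ h.push (resCol c.lower f)) (columnTensor (resCol c.upper f) ≫ g)
    change push f (bar (c.box s (post g (fam _ (unit R C a))) Ψ₂)) X γ =
      push f (c.box s (post g (fam _ (unit R C a))) (bar Ψ₂)) X γ
    rw [push_bar, c.act_box h, c.push_box, c.push_box, act_unit,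
      push_unit, push_bar, map_sub, map_neg, map_usmul, smul_sub, smul_neg]
    exact congrArg₂ (· - ·) rfl (congrArg ((s * columnDeg (resCol c.upper f)).negOnePow • ·) h2)

theorem bar_box_right {g : (Z.restrict c.lower).tensor ⟶ T₂}
    (hg : g ∈ gr (R := R) _ _ s) (Ψ₁ : Fam (Z.restrict c.upper) T₁) :
    bar (c.box s Ψ₁ (post g (fam _ (unit R C b)))) =
      c.box s (bar Ψ₁) (post g (fam _ (unit R C b))) := by
  funext X γ
  induction γ generalizing s with
  | nil => rw [bar_nil, box_nil, bar_nil, map_zero, LinearMap.zero_apply, Limits.comp_zero]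
  | cons γ f ih =>
    have h2 := ih (add_comm _ s ▸ comp_mem
      (columnTensor_mem (resCol c.lower f)) hg) (push (resCol c.upper f) Ψ₁)
    change push f (bar (c.box s Ψ₁ (post g (fam _ (unit R C b))))) X γ =
      push f (c.box s (bar Ψ₁) (post g (fam _ (unit R C b)))) X γ
    rw [push_bar, c.act_box (unit_hg hg), c.push_box, c.push_box,
      act_unit, push_unit, push_bar, map_sub, map_neg, LinearMap.sub_apply, LinearMap.neg_apply,
      map_usmul, smul_sub, smul_neg]
    exact congrArg₂ (· - ·) rfl (congrArg ((s * columnDeg (resCol c.upper f)).negOnePow • ·) h2)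

theorem internFam_box {s₁ s₂ : ℤ} (h : Hg s₁ Ψ₁) (Ψ₂ : Fam (Z.restrict c.lower) T₂) :
    internFam (s₁ + s₂) (c.box s₂ Ψ₁ Ψ₂) = c.box s₂ (internFam s₁ Ψ₁) Ψ₂ +
      s₁.negOnePow • c.box (s₂ + 1) Ψ₁ (internFam s₂ Ψ₂) := by
  funext X γ
  induction γ generalizing s₁ s₂ with
  | nil =>
    change internFam (s₁ + s₂) (c.box s₂ Ψ₁ Ψ₂) _ .nil = c.box s₂ (internFam s₁ Ψ₁) Ψ₂ _ .nil +
      s₁.negOnePow • c.box (s₂ + 1) Ψ₁ (internFam s₂ Ψ₂) _ .nil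
    rw [internFam_nil, box_nil, box_nil, box_nil, internFam_nil, internFam_nil]
    refine (d_comp_of_closed (c.hom_isCanonical (R := R) _).d_eq_zero _).trans ?_
    rw [d_tensorHom _ h.nil, Preadditive.comp_add, comp_units_smul']
  | cons γ f ih =>
    have h1 := ih (s₂ := s₂ + columnDeg (resCol c.lower f))
      (add_comm _ s₁ ▸ h.push (resCol c.upper f)) (push (resCol c.lower f) Ψ₂)
    have h2 : colD (fun f => push f (c.box s₂ Ψ₁ Ψ₂)) f =
        (s₂ * (columnDeg (resCol c.upper f) + 1)).negOnePow •
          c.box (s₂ + columnDeg (resCol c.lower f)) (colD (fun f => push f Ψ₁) (resCol c.upper f))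
            (push (resCol c.lower f) Ψ₂) +
        (columnDeg (resCol c.upper f)).negOnePow • (s₂ * columnDeg (resCol c.upper f)).negOnePow •
            c.box (s₂ + (columnDeg (resCol c.lower f) + 1)) (push (resCol c.upper f) Ψ₁)
              (colD (fun f => push f Ψ₂) (resCol c.lower f)) := by
      simp only [push_box]
      refine (c.colD_restrict (fun g g' => (s₂ * columnDeg g).negOnePow •
        c.box (s₂ + columnDeg g') (push g Ψ₁) (push g' Ψ₂)) f).trans ?_
      refine congrArg₂ (· + _ • ·) ?_ ?_
      · rw [colD_deg (fun n g => (s₂ * n).negOnePow •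
          c.box (s₂ + columnDeg (resCol c.lower f)) (push g Ψ₁)
            (push (resCol c.lower f) Ψ₂)), colD_units_smul]
        refine congrArg (_ • ·) ?_
        exact (colD_hom ((c.box (s₂ + columnDeg (resCol c.lower f))).flip
          (push (resCol c.lower f) Ψ₂)) _ _).symm
      · rw [colD_units_smul, colD_deg fun n g => c.box (s₂ + n)
          (push (resCol c.upper f) Ψ₁) (push g Ψ₂)]
        exact congrArg (_ • ·) (colD_hom (c.box (s₂ + (columnDeg (resCol c.lower f) + 1))
          (push (resCol c.upper f) Ψ₁)) _ _).symm
    have h3 : s₁ + s₂ + columnDeg f = s₁ + columnDeg (resCol c.upper f) +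
        (s₂ + columnDeg (resCol c.lower f)) := by
      rw [c.columnDeg_eq f]
      ring
    change push f (internFam (s₁ + s₂) (c.box s₂ Ψ₁ Ψ₂)) X γ = push f
      (c.box s₂ (internFam s₁ Ψ₁) Ψ₂ + s₁.negOnePow • c.box (s₂ + 1) Ψ₁ (internFam s₂ Ψ₂)) X γ
    rw [push_internFam, h2, push_box, map_usmul, map_add, map_usmul, push_box, push_box,
      push_internFam, push_internFam, h3]
    simp only [map_sub, LinearMap.sub_apply, map_usmul, smul_sub, smul_add, ← mul_smul, ← negOnePow_add]
    have key : ∀ {M : Type v} [AddCommGroup M] (u t t' v w x y : ℤˣ) (E A B P Q : M),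
        E = A + t • B → x = u * t → v = u * t' → y = w →
        u • E - (v • P + w • Q) = (u • A - u • t' • P) + (x • B - y • Q) := by
      rintro M _ u t t' v w x y E A B P Q rfl rfl rfl rfl
      rw [smul_add, mul_smul, mul_smul]
      abel
    rw [add_right_comm s₂ 1, ← add_assoc s₂ _ 1]
    refine key _ _ _ _ _ _ _ _ _ _ _ _ h1 ?_ ?_ ?_
    · rw [← negOnePow_add]
      exact congrArg _ (by ring)
    · rw [← negOnePow_add]
      exact negOnePow_congr ⟨s₂, by ring⟩
    · exact congrArg _ (by ring)

/-- The product of a cochain of the first `a + 1` and a cochain of the last `b + 1` rows, where the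
latter is homogeneous of degree `s`. -/
noncomputable def prod (s : ℤ) : Cochain R C a →ₗ[R] Cochain R C b →ₗ[R] Cochain R C p :=
  LinearMap.mk₂ R (fun Φ₁ Φ₂ _ Y γ => c.box s (fam _ Φ₁) (fam _ Φ₂) _ γ ≫ (c.iso Y).inv)
    (fun Φ₁ Φ₁' Φ₂ => by
      funext X Y γ
      simp only [map_add, LinearMap.add_apply, Pi.add_apply, Preadditive.add_comp])
    (fun r Φ₁ Φ₂ => by
      funext X Y γ
      simp only [map_smul, LinearMap.smul_apply, Pi.smul_apply, Linear.smul_comp])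
    (fun Φ₁ Φ₂ Φ₂' => by
      funext X Y γ
      simp only [map_add, Pi.add_apply, Preadditive.add_comp])
    (fun r Φ₁ Φ₂ => by
      funext X Y γ
      simp only [map_smul, Pi.smul_apply, Linear.smul_comp])

theorem fam_prod (s : ℤ) (Φ₁ : Cochain R C a) (Φ₂ : Cochain R C b) (Z : Row R C p) :
    fam Z (c.prod s Φ₁ Φ₂) = post (c.iso Z).inv (c.box s (fam _ Φ₁) (fam _ Φ₂)) := rfl

theorem intern_prod {s₁ s₂ : ℤ} {Φ₁ : Cochain R C a} (h : HgCochain s₁ Φ₁)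
    (Φ₂ : Cochain R C b) : intern (s₁ + s₂) (c.prod s₂ Φ₁ Φ₂) =
      c.prod s₂ (intern s₁ Φ₁) Φ₂ + s₁.negOnePow • c.prod (s₂ + 1) Φ₁ (intern s₂ Φ₂) := by
  funext X Y γ
  change internFam (s₁ + s₂) (post _ _) X γ = _
  rw [internFam_post (c.inv_isCanonical Y).mem (c.inv_isCanonical Y).d_eq_zero,
    c.internFam_box (h _)]
  refine (Preadditive.add_comp _ _ _ _ _ _).trans (add_congr rfl ?_)
  exact units_smul_comp' _ _ _

theorem intern_prod_unit_left (s : ℤ) (Φ : Cochain R C b) : intern s (c.prod s (unit R C a) Φ) =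
      c.prod (s + 1) (unit R C a) (intern s Φ) := by
  have h := c.intern_prod (s₂ := s) unit_hgCochain Φ
  rwa [intern_unit, map_zero, LinearMap.zero_apply, zero_add, zero_add, Int.negOnePow_zero,
    one_smul] at h

theorem intern_prod_unit_right {s : ℤ} {Φ : Cochain R C a} (h : HgCochain s Φ) :
    intern s (c.prod 0 Φ (unit R C b)) = c.prod 0 (intern s Φ) (unit R C b) := by
  have h := c.intern_prod (s₂ := 0) h (unit R C b)
  rwa [intern_unit, map_zero, smul_zero, add_zero, add_zero] at h

theorem prod_nil_eq_zero (s : ℤ) (Φ₁ : Cochain R C a) (Φ₂ : Cochain R C b) (X : Row R C p)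
    (h : Φ₁ (X.restrict c.upper) _ .nil = 0 ∨ Φ₂ (X.restrict c.lower) _ .nil = 0) :
    c.prod s Φ₁ Φ₂ X X .nil = 0 := by
  have h1 : c.prod s Φ₁ Φ₂ X X .nil = c.box s (fam _ Φ₁) (fam _ Φ₂) X .nil ≫ (c.iso X).inv := rfl
  have h2 : tHom (fam _ Φ₁ (X.restrict c.upper) .nil) (fam _ Φ₂ (X.restrict c.lower) .nil) = 0 := by
    rcases h with h | h
    · exact (congrArg (fun x => tHom x _) h).trans (LinearMap.map_zero₂ _ _)
    · exact (congrArg (fun x => tHom _ x) h).trans (map_zero _)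
  rw [h1, box_nil, h2, Limits.comp_zero, Limits.zero_comp]

theorem post_columnTensor_fam_prod {r : ℤ} (s : ℤ) {Φ₁ : Cochain R C a} (h : HgCochain r Φ₁)
    (Φ₂ : Cochain R C b) (f : Y ⟶ Z) : post (columnTensor f) (fam Y (c.prod s Φ₁ Φ₂)) =
      (columnDeg (resCol c.lower f) * r).negOnePow • post (c.iso Z).inv
        (c.box (s + columnDeg (resCol c.lower f))
          (post (columnTensor (resCol c.upper f)) (fam _ Φ₁))
          (post (columnTensor (resCol c.lower f)) (fam _ Φ₂))) := by
  rw [fam_prod, post_post, ← c.inv_natural, ← post_post,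
    c.box_comp_tensorHom (h _) _ (columnTensor_mem _), map_usmul]

theorem push_unit' {q : ℕ} {Y Z : Row R C q} (f : Y ⟶ Z) : push f (fam Z (unit R C q)) =
    post (columnTensor f) (fam Y (unit R C q)) := rfl

theorem hoch_prod_unit_left {s : ℤ} {Φ : Cochain R C b} (h : HgCochain s Φ) :
    hoch s (c.prod s (unit R C a) Φ) = c.prod s (unit R C a) (hoch s Φ) := by
  have h1 : ∀ Z, bar (fam Z (c.prod s (unit R C a) Φ)) =
      post (c.iso Z).inv (c.box s (fam _ (unit R C a)) (bar (fam _ Φ))) := fun Z => by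
    have := c.bar_box_left (h _) (𝟙 (Z.restrict c.upper).tensor)
    rw [post_id] at this
    rw [fam_prod, bar_post, this]
  have h2 : outer s (c.prod s (unit R C a) Φ) = c.prod s (unit R C a) (outer s Φ) := by
    funext X Z γ
    cases γ with
    | nil => exact (c.prod_nil_eq_zero s _ _ X (.inr rfl)).symm
    | cons γ f =>
      refine congrFun (congrFun (?_ : push f (fam Z (outer s (c.prod s (unit R C a) Φ))) =
        push f (fam Z (c.prod s (unit R C a) (outer s Φ)))) X) γ
      rw [push_fam_outer, c.post_columnTensor_fam_prod s unit_hgCochain, mul_zero,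
        Int.negOnePow_zero, one_smul, fam_prod, push_post, push_box, push_fam_outer, push_unit',
        map_usmul, map_usmul, map_usmul, ← mul_smul, ← negOnePow_add,
        ← mul_add, ← c.columnDeg_eq]
  funext X Z γ
  refine congrFun (congrFun (?_ : fam Z (hoch s (c.prod s (unit R C a) Φ)) =
    fam Z (c.prod s (unit R C a) (hoch s Φ))) X) γ
  rw [fam_hoch, h1, h2, fam_prod, fam_prod, fam_hoch, map_add, map_add]

theorem hoch_prod_unit_right {s : ℤ} {Φ : Cochain R C a} (h : HgCochain s Φ) :
    hoch s (c.prod 0 Φ (unit R C b)) = c.prod 0 (hoch s Φ) (unit R C b) := by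
  have h1 : ∀ Z, bar (fam Z (c.prod 0 Φ (unit R C b))) =
      post (c.iso Z).inv (c.box 0 (bar (fam _ Φ)) (fam _ (unit R C b))) := fun Z => by
    have := c.bar_box_right (id_mem (Z.restrict c.lower).tensor) (fam _ Φ)
    rw [post_id] at this
    rw [fam_prod, bar_post, this]
  have h2 : outer s (c.prod 0 Φ (unit R C b)) = c.prod 0 (outer s Φ) (unit R C b) := by
    funext X Z γ
    cases γ with
    | nil => exact (c.prod_nil_eq_zero 0 _ _ X (.inl rfl)).symm
    | cons γ f =>
      refine congrFun (congrFun (?_ : push f (fam Z (outer s (c.prod 0 Φ (unit R C b)))) =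
        push f (fam Z (c.prod 0 (outer s Φ) (unit R C b)))) X) γ
      rw [push_fam_outer, c.post_columnTensor_fam_prod 0 h, fam_prod, push_post, push_box,
        push_fam_outer, push_unit', map_usmul (c.box _), zero_mul, Int.negOnePow_zero,
        one_smul, ← mul_smul, ← negOnePow_add]
      refine Eq.trans ?_ (map_usmul (post _) _ _).symm
      refine congrArg (· • _) (negOnePow_congr ⟨s * columnDeg (resCol c.lower f), ?_⟩)
      rw [c.columnDeg_eq f]
      ring
  funext X Z γ
  refine congrFun (congrFun (?_ : fam Z (hoch s (c.prod 0 Φ (unit R C b))) =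
    fam Z (c.prod 0 (hoch s Φ) (unit R C b))) X) γ
  rw [fam_hoch, h1, h2, fam_prod, fam_prod, fam_hoch, map_add, LinearMap.add_apply, map_add]

theorem box_hg {s₁ : ℤ} (h₁ : Hg s₁ Ψ₁) (h₂ : Hg s Ψ₂) : Hg (s₁ + s) (c.box s Ψ₁ Ψ₂) :=
  fun X γ => by
    rw [box_apply, c.totalDeg_eq γ]
    refine units_mem_smul _ _ ?_
    have h := comp_mem (c.hom_isCanonical X).mem (tensorHom_mem (h₁ _ (resPath c.upper γ))
        (h₂ _ (resPath c.lower γ)))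
    rwa [zero_add, add_add_add_comm] at h

theorem prod_hgCochain {s₁ : ℤ} {Φ₁ : Cochain R C a} {Φ₂ : Cochain R C b}
    (h₁ : HgCochain s₁ Φ₁) (h₂ : HgCochain s Φ₂) : HgCochain (s₁ + s) (c.prod s Φ₁ Φ₂) :=
  fun Z X γ => by
    have h := comp_mem (c.box_hg (h₁ _) (h₂ _) X γ) (c.inv_isCanonical Z).mem
    rwa [add_zero] at h

theorem box_add_apply (s n : ℤ) (Ψ₁ : Fam (Z.restrict c.upper) T₁)
    (Ψ₂ : Fam (Z.restrict c.lower) T₂) {X : Row R C p} (γ : Rect X Z) :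
    c.box (s + n) Ψ₁ Ψ₂ X γ = (n * totalDeg (resPath c.upper γ)).negOnePow • c.box s Ψ₁ Ψ₂ X γ := by
  rw [box_apply, box_apply, ← mul_smul, ← negOnePow_add]
  refine congrArg (fun n : ℤ => n.negOnePow • _) ?_
  ring

theorem box_ml (h₁ : Ml Ψ₁) (h₂ : Ml Ψ₂) (s : ℤ) : Ml (c.box s Ψ₁ Ψ₂) := by
  refine Ml.coinduct (fun {Z} Ψ => ∃ (u : ℤˣ) (s : ℤ) (Ψ₁ : Fam (Z.restrict c.upper) T₁)
    (Ψ₂ : Fam (Z.restrict c.lower) T₂), Ml Ψ₁ ∧ Ml Ψ₂ ∧ Ψ = u • c.box s Ψ₁ Ψ₂) ?_ ?_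
    ⟨1, s, Ψ₁, Ψ₂, h₁, h₂, (one_smul _ _).symm⟩
  · rintro Y Z _ ⟨u, s, Ψ₁, Ψ₂, h₁, h₂, rfl⟩
    simp only [map_usmul, push_box]
    refine c.colMl_restrict (G := fun g g' => u • (s * columnDeg g).negOnePow •
      c.box (s + columnDeg g') (push g Ψ₁) (push g' Ψ₂)) (fun g' => ?_) fun g => ?_
    · exact ((h₁.col.comp_linear ((c.box (R := R) (Z := Y) (T₁ := T₁) (T₂ := T₂)
        (s + columnDeg g')).flip (push g' Ψ₂))).columnDeg
        fun n => (s * n).negOnePow).columnDeg fun _ => u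
    · suffices hG : ∀ (X : Row R C p) (γ : Rect X Y), ColMl fun g' => (u •
          (s * columnDeg g).negOnePow • c.box (s + columnDeg g') (push g Ψ₁) (push g' Ψ₂) :
            Fam Y (tensorObj R T₁ T₂)) X γ from
        ⟨fun f i x y z h1 h2 h3 => funext fun V => funext fun γ =>
          (hG V γ).map_add f i x y z h1 h2 h3, fun f i c x z h1 h2 => funext fun V =>
            funext fun γ => (hG V γ).map_smul f i c x z h1 h2⟩
      intro X γ
      have h := ((h₂.col.comp_linear ((evalFam (R := R) (T := tensorObj R T₁ T₂) γ).comp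
        (c.box (R := R) (Z := Y) (T₁ := T₁) (T₂ := T₂) s (push g Ψ₁)))).columnDeg
        fun n => (n * totalDeg (resPath c.upper γ)).negOnePow).columnDeg
        fun _ => u * (s * columnDeg g).negOnePow
      refine cast (congrArg ColMl (funext fun g' => ?_)) h
      exact (mul_smul _ _ _).trans (congrArg (fun x => u • (s * columnDeg g).negOnePow • x)
        (c.box_add_apply s (columnDeg g') _ _ γ).symm)
  · rintro Y Z _ ⟨u, s, Ψ₁, Ψ₂, h₁, h₂, rfl⟩ f
    refine ⟨u * (s * columnDeg (resCol c.upper f)).negOnePow,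
      s + columnDeg (resCol c.lower f), _, _,
      h₁.push (resCol c.upper f), h₂.push (resCol c.lower f), ?_⟩
    rw [map_usmul, push_box, mul_smul]

theorem box_red (h : Red Ψ₁ ∨ Red Ψ₂) (s : ℤ) : Red (c.box s Ψ₁ Ψ₂) := by
  refine Red.coinduct (fun {Z} Ψ => ∃ (u : ℤˣ) (s : ℤ) (Ψ₁ : Fam (Z.restrict c.upper) T₁)
    (Ψ₂ : Fam (Z.restrict c.lower) T₂), (Red Ψ₁ ∨ Red Ψ₂) ∧ Ψ = u • c.box s Ψ₁ Ψ₂) ?_ ?_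
    ⟨1, s, Ψ₁, Ψ₂, h, (one_smul _ _).symm⟩
  · rintro Z _ ⟨u, s, Ψ₁, Ψ₂, h, rfl⟩
    rw [map_usmul, push_box, resCol_idColumn, resCol_idColumn]
    rcases h with h | h
    · rw [h.push_id, map_zero, LinearMap.zero_apply, smul_zero, smul_zero]
    · rw [h.push_id, map_zero, smul_zero, smul_zero]
  · rintro Y Z _ ⟨u, s, Ψ₁, Ψ₂, h, rfl⟩ f
    refine ⟨u * (s * columnDeg (resCol c.upper f)).negOnePow,
      s + columnDeg (resCol c.lower f), _, _,
      h.imp (fun h => h.push (resCol c.upper f)) fun h =>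
        h.push (resCol c.lower f), ?_⟩
    rw [map_usmul, push_box, mul_smul]

theorem prod_mlCochain {Φ₁ : Cochain R C a} {Φ₂ : Cochain R C b}
    (h₁ : MlCochain Φ₁) (h₂ : MlCochain Φ₂) (s : ℤ) : MlCochain (c.prod s Φ₁ Φ₂) :=
  fun _ => (c.box_ml (h₁ _) (h₂ _) s).post _

theorem prod_redCochain {Φ₁ : Cochain R C a} {Φ₂ : Cochain R C b}
    (h : RedCochain Φ₁ ∨ RedCochain Φ₂) (s : ℤ) : RedCochain (c.prod s Φ₁ Φ₂) :=
  fun _ => (c.box_red (h.imp (fun h => h _) fun h => h _) s).post _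

theorem prod_eq_zero_of_length {q : ℤ} {Φ₁ : Cochain R C a} {Φ₂ : Cochain R C b}
    (h : (∀ X Y (γ : Rect X Y), (γ.length : ℤ) ≠ q → Φ₁ X Y γ = 0) ∨
      ∀ X Y (γ : Rect X Y), (γ.length : ℤ) ≠ q → Φ₂ X Y γ = 0) (s : ℤ) {X Y : Row R C p}
    (γ : Rect X Y) (hγ : (γ.length : ℤ) ≠ q) : c.prod s Φ₁ Φ₂ X Y γ = 0 := by
  have h1 : c.prod s Φ₁ Φ₂ X Y γ = c.box s (fam _ Φ₁) (fam _ Φ₂) X γ ≫ (c.iso Y).inv := rfl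
  have h2 : tHom (fam _ Φ₁ _ (resPath c.upper γ)) (fam _ Φ₂ _ (resPath c.lower γ)) = 0 := by
    rcases h with h | h
    · exact (congrArg (fun x => tHom x _)
        (h _ _ _ (by rwa [length_resPath]))).trans (LinearMap.map_zero₂ _ _)
    · exact (congrArg (fun x => tHom _ x) (h _ _ _ (by rwa [length_resPath]))).trans (map_zero _)
  rw [h1, box_apply, h2, Limits.comp_zero, smul_zero, Limits.zero_comp]

end Cut

/-! ### Products of cochains and lattice paths -/

section HEq

variable {p : ℕ} {Y Y' Z Z' : Row R C p} {T : C}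
  {A A' B B' D : C}

theorem push_heq (hY : Y = Y') (hZ : Z = Z') {f : Y ⟶ Z} {f' : Y' ⟶ Z'} (hf : HEq f f')
    {Ψ : Fam Z T} {Ψ' : Fam Z' T} (h : HEq Ψ Ψ') : HEq (push f Ψ) (push f' Ψ') := by
  subst hY hZ hf h
  rfl

theorem columnTensor_comp_heq (hY : Y = Y') (hZ : Z = Z') {f : Y ⟶ Z} {f' : Y' ⟶ Z'}
    (hf : HEq f f') {g : Z.tensor ⟶ T} {g' : Z'.tensor ⟶ T} (h : HEq g g') :
    HEq (columnTensor f ≫ g) (columnTensor f' ≫ g') := by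
  subst hY hZ hf h
  rfl

theorem columnDeg_heq (hY : Y = Y') (hZ : Z = Z') {f : Y ⟶ Z} {f' : Y' ⟶ Z'} (hf : HEq f f') :
    columnDeg f = columnDeg f' := by
  subst hY hZ hf
  rfl

theorem nil_heq (hZ : Z = Z') {Ψ : Fam Z T} {Ψ' : Fam Z' T} (h : HEq Ψ Ψ') :
    HEq (Ψ Z .nil) (Ψ' Z' .nil) := by
  subst hZ h
  rfl

theorem comp_tensorHom_heq {T T' : C} (hA : A = A') (hB : B = B') {u : D ⟶ tensorObj R A B}
    {u' : D ⟶ tensorObj R A' B'} (hu : HEq u u') {g : A ⟶ T} {g' : A' ⟶ T} (hg : HEq g g')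
    {k : B ⟶ T'} {k' : B' ⟶ T'} (hk : HEq k k') :
    u ≫ tHom g k = u' ≫ tHom g' k' := by
  subst hA hB hu hg hk
  rfl

theorem exists_heq_mem (hA : A = A') {g' : A' ⟶ D} {n : ℤ} (h : g' ∈ gr (R := R) A' D n) :
    ∃ g : A ⟶ D, HEq g g' ∧ g ∈ gr (R := R) A D n := by
  subst hA
  exact ⟨g', HEq.rfl, h⟩

theorem tensorHom_comp_heq {T T' : C} (hA : A = A') (hB : B = B') {g : A ⟶ T} {g' : A' ⟶ T}
    (hg : HEq g g') {k : B ⟶ T'} {k' : B' ⟶ T'} (hk : HEq k k') (e : tensorObj R T T' ⟶ D) :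
    HEq (tHom g k ≫ e) (tHom g' k' ≫ e) := by
  subst hA hB hg hk
  rfl

theorem post_fam_heq (hZ : Z = Z') (Φ : Cochain R C p) {g : Z.tensor ⟶ T}
    {g' : Z'.tensor ⟶ T} (hg : HEq g g') : HEq (post g (fam Z Φ)) (post g' (fam Z' Φ)) := by
  subst hZ hg
  rfl

end HEq

section Compatible

variable {V : Type} {a b p a' b' p' : ℕ}

/-- The realization `ρ` is the product of `ρ₁` and `ρ₂`. -/
structure Realization.IsProd (ρ : Realization R C V p p') (c : Cut a b p) (c' : Cut a' b' p')
    (ρ₁ : Realization R C V a a') (ρ₂ : Realization R C V b b') : Prop where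
  obj₁ : ∀ x (X : Row R C p), (ρ.obj x X).restrict c'.upper = ρ₁.obj x (X.restrict c.upper)
  obj₂ : ∀ x (X : Row R C p), (ρ.obj x X).restrict c'.lower = ρ₂.obj x (X.restrict c.lower)
  map₁ : ∀ x {X Y : Row R C p} (f : X ⟶ Y),
    HEq (resCol c'.upper (ρ.map x f)) (ρ₁.map x (resCol c.upper f))
  map₂ : ∀ x {X Y : Row R C p} (f : X ⟶ Y),
    HEq (resCol c'.lower (ρ.map x f)) (ρ₂.map x (resCol c.lower f))
  arr₁ : ∀ x y (X : Row R C p),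
    HEq (resCol c'.upper (ρ.arr x y X)) (ρ₁.arr x y (X.restrict c.upper))
  arr₂ : ∀ x y (X : Row R C p),
    HEq (resCol c'.lower (ρ.arr x y X)) (ρ₂.arr x y (X.restrict c.lower))
  frm : ∀ x (X : Row R C p), HEq (ρ.frm x X ≫ (c'.iso (ρ.obj x X)).hom)
    ((c.iso X).hom ≫ tHom (ρ₁.frm x (X.restrict c.upper)) (ρ₂.frm x (X.restrict c.lower)))
  bck : ∀ x (X : Row R C p), HEq ((c'.iso (ρ.obj x X)).inv ≫ ρ.bck x X)
    (tHom (ρ₁.bck x (X.restrict c.upper)) (ρ₂.bck x (X.restrict c.lower)) ≫ (c.iso X).inv)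

theorem columnDeg_arr {ρ : Realization R C V p p'} (hρ : ρ.Lawful) (x y : V) (X : Row R C p) :
    columnDeg (ρ.arr x y X) = 0 := sum_eq_zero fun i _ => hρ.arr_deg x y X i

namespace Realization.IsProd

variable {c : Cut a b p} {c' : Cut a' b' p'} {ρ : Realization R C V p p'}
  {ρ₁ : Realization R C V a a'} {ρ₂ : Realization R C V b b'} (h : ρ.IsProd c c' ρ₁ ρ₂)
  (h₁ : ρ₁.Lawful) (h₂ : ρ₂.Lawful) {T₁ T₂ : C}

include h h₁ h₂

theorem lat_box_left (x : V) (Q : List V) {X Z : Row R C p} (γ : Rect X Z) (s : ℤ)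
    {g' : ((ρ.obj x Z).restrict c'.upper).tensor ⟶ T₁}
    {g : (ρ₁.obj x (Z.restrict c.upper)).tensor ⟶ T₁} (hg : HEq g' g)
    {Ψ' : Fam ((ρ.obj x Z).restrict c'.lower) T₂}
    {Ψ : Fam (ρ₂.obj x (Z.restrict c.lower)) T₂} (hΨ : HEq Ψ' Ψ) :
    ρ.lat x Q γ (c'.box s (post g' (fam _ (unit R C a'))) Ψ') =
      c.box s (post (ρ₁.frm x _ ≫ g) (fam _ (unit R C a))) (ρ₂.latFam x Q Ψ) X γ := by
  induction Q generalizing x Z s T₁ T₂ with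
  | nil =>
    induction γ generalizing s T₁ T₂ with
    | nil =>
      rw [lat_nil_nil, c'.box_nil, c.box_nil, latFam_apply, lat_nil_nil, ← assoc]
      refine (comp_tensorHom_heq (congrArg _ (h.obj₁ x X)) (congrArg _ (h.obj₂ x X)) (h.frm x X)
        (g' := g) (k' := Ψ _ .nil) ((heq_of_eq (id_comp _)).trans hg)
        (nil_heq (h.obj₂ x X) hΨ)).trans ?_
      rw [assoc, tensorHom_comp_left _ _ _ (h₁.frm_mem _ _)]
      exact congrArg (fun e => (c.iso X).hom ≫ tHom e _) (id_comp _).symm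
    | @cons Y Z γ f ih =>
      have h3 := ih (s + columnDeg (resCol c.lower f))
        (columnTensor_comp_heq (h.obj₁ x Y) (h.obj₁ x Z) (h.map₁ x f) hg)
        (push_heq (h.obj₂ x Y) (h.obj₂ x Z) (h.map₂ x f) hΨ)
      have h4 := columnDeg_heq (h.obj₁ x Y) (h.obj₁ x Z) (h.map₁ x f)
      have h5 := columnDeg_heq (h.obj₂ x Y) (h.obj₂ x Z) (h.map₂ x f)
      rw [h₁.map_deg] at h4
      rw [h₂.map_deg] at h5
      change _ = push f (c.box s (post (ρ₁.frm x _ ≫ g) (fam _ (unit R C a)))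
        (ρ₂.latFam x [] Ψ)) X γ
      rw [lat_nil_cons, c'.push_box, map_usmul, h4, h5, push_unit, h3, c.push_box, push_unit,
        ← assoc, ← assoc, h₁.frm_nat]
      rfl
  | cons y Q ihQ =>
    have h6 : ∀ {Z : Row R C p} (γ : Rect X Z) (s : ℤ) {T₁ T₂ : C}
        {g' : ((ρ.obj x Z).restrict c'.upper).tensor ⟶ T₁}
        {g : (ρ₁.obj x (Z.restrict c.upper)).tensor ⟶ T₁} (hg : HEq g' g)
        {Ψ' : Fam ((ρ.obj x Z).restrict c'.lower) T₂}
        {Ψ : Fam (ρ₂.obj x (Z.restrict c.lower)) T₂} (hΨ : HEq Ψ' Ψ),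
        ρ.lat y Q γ (push (ρ.arr y x Z) (c'.box s (post g' (fam _ (unit R C a'))) Ψ')) =
          c.box s (post (ρ₁.frm x _ ≫ g) (fam _ (unit R C a)))
            (ρ₂.latFam y Q (push (ρ₂.arr y x _) Ψ)) X γ := fun {Z} γ s T₁ T₂ g' g hg Ψ' Ψ hΨ => by
      have h3 := ihQ y γ s (columnTensor_comp_heq (h.obj₁ y Z) (h.obj₁ x Z) (h.arr₁ y x Z) hg)
        (push_heq (h.obj₂ y Z) (h.obj₂ x Z) (h.arr₂ y x Z) hΨ)
      have h4 := columnDeg_heq (h.obj₁ y Z) (h.obj₁ x Z) (h.arr₁ y x Z)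
      have h5 := columnDeg_heq (h.obj₂ y Z) (h.obj₂ x Z) (h.arr₂ y x Z)
      rw [columnDeg_arr h₁] at h4
      rw [columnDeg_arr h₂] at h5
      rw [c'.push_box, h4, h5, mul_zero, add_zero, Int.negOnePow_zero, one_smul, push_unit, h3,
        ← assoc, h₁.frm_arr]
    induction γ generalizing s T₁ T₂ with
    | nil => exact h6 .nil s hg hΨ
    | @cons Y Z γ f ih =>
      have h3 := ih (s + columnDeg (resCol c.lower f))
        (columnTensor_comp_heq (h.obj₁ x Y) (h.obj₁ x Z) (h.map₁ x f) hg)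
        (push_heq (h.obj₂ x Y) (h.obj₂ x Z) (h.map₂ x f) hΨ)
      have h4 := columnDeg_heq (h.obj₁ x Y) (h.obj₁ x Z) (h.map₁ x f)
      have h5 := columnDeg_heq (h.obj₂ x Y) (h.obj₂ x Z) (h.map₂ x f)
      rw [h₁.map_deg] at h4
      rw [h₂.map_deg] at h5
      have h8 : ρ₂.lat x (y :: Q) (resPath c.lower (γ.cons f)) Ψ =
          (-1 : ℤˣ) ^ (γ.length + 1) • ρ₂.latFam y Q (push (ρ₂.arr y x _) Ψ) _
            (resPath c.lower (γ.cons f)) +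
          ρ₂.lat x (y :: Q) (resPath c.lower γ) (push (ρ₂.map x (resCol c.lower f)) Ψ) :=
        (ρ₂.lat_cons_cons x y Q _ _ Ψ).trans (by rw [length_resPath]; rfl)
      rw [lat_cons_cons, h6 (γ.cons f) s hg hΨ, c'.push_box, map_usmul, h4, h5, push_unit,
        h3, c.box_apply _ _ (ρ₂.latFam x (y :: Q) Ψ), latFam_apply, h8, map_add,
        Preadditive.comp_add, smul_add, map_usmul, comp_units_smul', smul_comm, ← c.box_apply]
      refine add_congr rfl ?_
      change _ = (c.exponent (γ.cons f) + s * totalDeg (resPath c.upper (γ.cons f))).negOnePow •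
        (c.iso X).hom ≫ tHom (push (resCol c.upper f) (post (ρ₁.frm x _ ≫ g)
          (fam _ (unit R C a))) _ (resPath c.upper γ)) _
      rw [push_unit, ← assoc (columnTensor _), h₁.frm_nat, assoc, c.box_apply,
        ← mul_smul, ← negOnePow_add]
      refine congrArg (fun n : ℤ => n.negOnePow • _) ?_
      simp only [Cut.exponent, resPath, totalDeg]
      ring

theorem lat_box_right (x : V) (Q : List V) {X Z : Row R C p} (γ : Rect X Z) (s : ℤ)
    {g' : ((ρ.obj x Z).restrict c'.lower).tensor ⟶ T₂}
    {g : (ρ₂.obj x (Z.restrict c.lower)).tensor ⟶ T₂} (hg : HEq g' g)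
    {Ψ' : Fam ((ρ.obj x Z).restrict c'.upper) T₁}
    {Ψ : Fam (ρ₁.obj x (Z.restrict c.upper)) T₁} (hΨ : HEq Ψ' Ψ) :
    ρ.lat x Q γ (c'.box s Ψ' (post g' (fam _ (unit R C b')))) =
      c.box s (ρ₁.latFam x Q Ψ) (post (ρ₂.frm x _ ≫ g) (fam _ (unit R C b))) X γ := by
  induction Q generalizing x Z s T₁ T₂ with
  | nil =>
    induction γ generalizing s T₁ T₂ with
    | nil =>
      rw [lat_nil_nil, c'.box_nil, c.box_nil, latFam_apply, lat_nil_nil, ← assoc]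
      refine (comp_tensorHom_heq (congrArg _ (h.obj₁ x X)) (congrArg _ (h.obj₂ x X)) (h.frm x X)
        (g' := Ψ _ .nil) (k' := g) (nil_heq (h.obj₁ x X) hΨ)
        ((heq_of_eq (id_comp _)).trans hg)).trans ?_
      rw [assoc, tensorHom_comp_left _ _ _ (h₁.frm_mem _ _)]
      exact congrArg (fun e => (c.iso X).hom ≫ tHom _ e) (id_comp _).symm
    | @cons Y Z γ f ih =>
      have h3 := ih (s + columnDeg (resCol c.lower f))
        (columnTensor_comp_heq (h.obj₂ x Y) (h.obj₂ x Z) (h.map₂ x f) hg)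
        (push_heq (h.obj₁ x Y) (h.obj₁ x Z) (h.map₁ x f) hΨ)
      have h4 := columnDeg_heq (h.obj₁ x Y) (h.obj₁ x Z) (h.map₁ x f)
      have h5 := columnDeg_heq (h.obj₂ x Y) (h.obj₂ x Z) (h.map₂ x f)
      rw [h₁.map_deg] at h4
      rw [h₂.map_deg] at h5
      change _ = push f (c.box s (ρ₁.latFam x [] Ψ)
        (post (ρ₂.frm x _ ≫ g) (fam _ (unit R C b)))) X γ
      rw [lat_nil_cons, c'.push_box, map_usmul, h4, h5, push_unit, h3, c.push_box, push_unit,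
        ← assoc, ← assoc, h₂.frm_nat]
      rfl
  | cons y Q ihQ =>
    have h6 : ∀ {Z : Row R C p} (γ : Rect X Z) (s : ℤ) {T₁ T₂ : C}
        {g' : ((ρ.obj x Z).restrict c'.lower).tensor ⟶ T₂}
        {g : (ρ₂.obj x (Z.restrict c.lower)).tensor ⟶ T₂} (hg : HEq g' g)
        {Ψ' : Fam ((ρ.obj x Z).restrict c'.upper) T₁}
        {Ψ : Fam (ρ₁.obj x (Z.restrict c.upper)) T₁} (hΨ : HEq Ψ' Ψ),
        ρ.lat y Q γ (push (ρ.arr y x Z) (c'.box s Ψ' (post g' (fam _ (unit R C b'))))) =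
          c.box s (ρ₁.latFam y Q (push (ρ₁.arr y x _) Ψ))
            (post (ρ₂.frm x _ ≫ g) (fam _ (unit R C b))) X γ :=
        fun {Z} γ s T₁ T₂ g' g hg Ψ' Ψ hΨ => by
      have h3 := ihQ y γ s (columnTensor_comp_heq (h.obj₂ y Z) (h.obj₂ x Z) (h.arr₂ y x Z) hg)
        (push_heq (h.obj₁ y Z) (h.obj₁ x Z) (h.arr₁ y x Z) hΨ)
      have h4 := columnDeg_heq (h.obj₁ y Z) (h.obj₁ x Z) (h.arr₁ y x Z)
      have h5 := columnDeg_heq (h.obj₂ y Z) (h.obj₂ x Z) (h.arr₂ y x Z)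
      rw [columnDeg_arr h₁] at h4
      rw [columnDeg_arr h₂] at h5
      rw [c'.push_box, h4, h5, mul_zero, add_zero, Int.negOnePow_zero, one_smul, push_unit, h3,
        ← assoc, h₂.frm_arr]
    induction γ generalizing s T₁ T₂ with
    | nil => exact h6 .nil s hg hΨ
    | @cons Y Z γ f ih =>
      have h3 := ih (s + columnDeg (resCol c.lower f))
        (columnTensor_comp_heq (h.obj₂ x Y) (h.obj₂ x Z) (h.map₂ x f) hg)
        (push_heq (h.obj₁ x Y) (h.obj₁ x Z) (h.map₁ x f) hΨ)
      have h4 := columnDeg_heq (h.obj₁ x Y) (h.obj₁ x Z) (h.map₁ x f)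
      have h5 := columnDeg_heq (h.obj₂ x Y) (h.obj₂ x Z) (h.map₂ x f)
      rw [h₁.map_deg] at h4
      rw [h₂.map_deg] at h5
      have h8 : ρ₁.lat x (y :: Q) (resPath c.upper (γ.cons f)) Ψ =
          (-1 : ℤˣ) ^ (γ.length + 1) • ρ₁.latFam y Q (push (ρ₁.arr y x _) Ψ) _
            (resPath c.upper (γ.cons f)) +
          ρ₁.lat x (y :: Q) (resPath c.upper γ) (push (ρ₁.map x (resCol c.upper f)) Ψ) :=
        (ρ₁.lat_cons_cons x y Q _ _ Ψ).trans (by rw [length_resPath]; rfl)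
      rw [lat_cons_cons, h6 (γ.cons f) s hg hΨ, c'.push_box, map_usmul, h4, h5, push_unit,
        h3, c.box_apply _ (ρ₁.latFam x (y :: Q) Ψ), latFam_apply, h8, map_add, LinearMap.add_apply,
        Preadditive.comp_add, smul_add, tensorHom_signs, comp_units_smul', smul_comm,
        ← c.box_apply]
      refine add_congr rfl ?_
      change _ = (c.exponent (γ.cons f) + s * totalDeg (resPath c.upper (γ.cons f))).negOnePow •
        (c.iso X).hom ≫ tHom _ (push (resCol c.lower f)
          (post (ρ₂.frm x _ ≫ g) (fam _ (unit R C b))) _ (resPath c.lower γ))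
      rw [push_unit, ← assoc (columnTensor _), h₂.frm_nat, assoc, c.box_apply,
        ← mul_smul, ← negOnePow_add]
      refine congrArg (fun n : ℤ => n.negOnePow • _) ?_
      simp only [Cut.exponent, resPath, totalDeg]
      ring

theorem exists_bck (x : V) (Z : Row R C p) :
    ∃ (g₁ : ((ρ.obj x Z).restrict c'.upper).tensor ⟶ (Z.restrict c.upper).tensor)
      (g₂ : ((ρ.obj x Z).restrict c'.lower).tensor ⟶ (Z.restrict c.lower).tensor),
      HEq g₁ (ρ₁.bck x (Z.restrict c.upper)) ∧ HEq g₂ (ρ₂.bck x (Z.restrict c.lower)) ∧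
      g₂ ∈ gr (R := R) _ _ 0 ∧
      (c'.iso (ρ.obj x Z)).inv ≫ ρ.bck x Z = tHom g₁ g₂ ≫ (c.iso Z).inv := by
  have e₁ : ((ρ.obj x Z).restrict c'.upper).tensor = (ρ₁.obj x (Z.restrict c.upper)).tensor :=
    congrArg _ (h.obj₁ x Z)
  have e₂ : ((ρ.obj x Z).restrict c'.lower).tensor = (ρ₂.obj x (Z.restrict c.lower)).tensor :=
    congrArg _ (h.obj₂ x Z)
  obtain ⟨g₁, hg₁, -⟩ := exists_heq_mem (R := R) e₁ (h₁.bck_mem x (Z.restrict c.upper))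
  obtain ⟨g₂, hg₂, hm⟩ := exists_heq_mem (R := R) e₂ (h₂.bck_mem x (Z.restrict c.lower))
  exact ⟨g₁, g₂, hg₁, hg₂, hm,
    eq_of_heq ((h.bck x Z).trans (tensorHom_comp_heq e₁ e₂ hg₁ hg₂ _).symm)⟩

theorem eval_prod_left (hb : ∀ x X, ρ₁.frm x X ≫ ρ₁.bck x X = 𝟙 _) (s : ℤ)
    (Φ : Cochain R C b') (S : List V) :
    ρ.eval S (c'.prod s (unit R C a') Φ) = c.prod s (unit R C a) (ρ₂.eval S Φ) := by
  cases S with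
  | nil => exact (map_zero _).symm
  | cons x Q =>
    funext X Z γ
    obtain ⟨g₁, g₂, hg₁, hg₂, hm, hg⟩ := h.exists_bck h₁ h₂ x Z
    have h3 := c'.box_comp_tensorHom (s := s) (unit_hgCochain (R := R) (C := C) _) g₁ hm
      (fam ((ρ.obj x Z).restrict c'.lower) Φ)
    have h4 := h.lat_box_left h₁ h₂ x Q γ s hg₁ (post_fam_heq (h.obj₂ x Z) Φ hg₂)
    rw [zero_mul, Int.negOnePow_zero, one_smul, add_zero] at h3
    rw [eval_cons, c'.fam_prod, post_post, hg, ← post_post, h3, lat_post, h4, hb, post_id]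
    rfl

theorem eval_prod_right (hb : ∀ x X, ρ₂.frm x X ≫ ρ₂.bck x X = 𝟙 _) {r : ℤ}
    {Φ : Cochain R C a'} (hΦ : HgCochain r Φ) (S : List V) :
    ρ.eval S (c'.prod 0 Φ (unit R C b')) = c.prod 0 (ρ₁.eval S Φ) (unit R C b) := by
  cases S with
  | nil => exact ((congrArg (c.prod 0 · _) rfl).trans (LinearMap.map_zero₂ _ _)).symm
  | cons x Q =>
    funext X Z γ
    obtain ⟨g₁, g₂, hg₁, hg₂, hm, hg⟩ := h.exists_bck h₁ h₂ x Z
    have h3 := c'.box_comp_tensorHom (s := 0) (hΦ ((ρ.obj x Z).restrict c'.upper)) g₁ hm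
      (fam _ (unit R C b'))
    have h4 := h.lat_box_right h₁ h₂ x Q γ 0 hg₂ (post_fam_heq (h.obj₁ x Z) Φ hg₁)
    rw [zero_mul, Int.negOnePow_zero, one_smul, add_zero] at h3
    rw [eval_cons, c'.fam_prod, post_post, hg, ← post_post, h3, lat_post, h4, hb, post_id]
    rfl

end Realization.IsProd

theorem column_heq {Y Y' Z Z' : Row R C p} (hY : Y = Y') (hZ : Z = Z') {f : Y ⟶ Z}
    {f' : Y' ⟶ Z'} (h : ∀ k, HEq (f k) (f' k)) : HEq f f' := by
  subst hY hZ
  exact heq_of_eq (funext fun k => eq_of_heq (h k))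

namespace Covers

theorem frm_bck {F : V → Forest p p'} (hF : Covers F) (x : V) (X : Row R C p) :
    (forestReal R C F).frm x X ≫ (forestReal R C F).bck x X = 𝟙 _ :=
  ((hF.toForest_isCanonical x X).comp (hF.ofForest_isCanonical x X)).unique
    (.id (rowTensor_eq X p .leaf))

section Restrict

variable {F : V → Forest p p'} {G : V → Forest a a'} (hF : Covers F) (hG : Covers G)
  {e : Fin (a + 1) → Fin (p + 1)} {e' : Fin (a' + 1) → Fin (p' + 1)}
  (h : ∀ x k, F x (e' k) = (G x k).map e)

include h

theorem restrict_obj (x : V) (X : Row R C p) :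
    (forestObj (F x) X).restrict e' = forestObj (G x) (X.restrict e) :=
  funext fun k => (congrArg (treeObj R X) (h x k)).trans
    (treeObj_bind X (fun i => .leaf (e i)) (G x k)).symm

theorem restrict_map (x : V) {X Y : Row R C p} (f : X ⟶ Y) :
    HEq (resCol e' (forestHom (F x) f)) (forestHom (G x) (resCol e f)) := by
  refine column_heq (restrict_obj h x X) (restrict_obj h x Y) fun k =>
    HomogHom.heq (congrFun (restrict_obj h x X) k) (congrFun (restrict_obj h x Y) k) ?_ ?_
  · exact (congrArg (fun t => (treeHom f t).deg) (h x k)).trans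
      (treeHom_bind_deg f (fun i => .leaf (e i)) (G x k)).symm
  · have h1 : IsTreeHom R f ((G x k).map e) (treeHom f (F x (e' k))).hom := by
      rw [← h]
      exact .treeHom _ _
    exact h1.heq (treeHom_bind f (fun i => .leaf (e i)) (G x k))

include hF hG

theorem restrict_arr (x y : V) (X : Row R C p) : HEq (resCol e' (forestArrow (F x) (F y) X))
      (forestArrow (G x) (G y) (X.restrict e)) := by
  refine column_heq (restrict_obj h x X) (restrict_obj h y X) fun k =>
    HomogHom.heq (congrFun (restrict_obj h x X) k) (congrFun (restrict_obj h y X) k)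
      ((canonicalHom_deg _ _ _).trans (canonicalHom_deg _ _ _).symm) ?_
  exact ((hF.arrow_isCanonical x y X (e' k)).congr (h x k) (h y k)).heq
    (IsCan.bind (X := X) (F := fun i => .leaf (e i)) (hG.arrow_isCanonical x y (X.restrict e) k))

end Restrict

theorem isProd {F : V → Forest p p'} {F₁ : V → Forest a a'} {F₂ : V → Forest b b'}
    (hF : Covers F) (h₁ : Covers F₁) (h₂ : Covers F₂) {c : Cut a b p} {c' : Cut a' b' p'}
    (e₁ : ∀ x k, F x (c'.upper k) = (F₁ x k).map c.upper)
    (e₂ : ∀ x k, F x (c'.lower k) = (F₂ x k).map c.lower) :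
    (forestReal R C F).IsProd c c' (forestReal R C F₁) (forestReal R C F₂) := by
  have ht : ∀ x, c'.tree.bind (F x) = .node ((rowTree a' (F₁ x)).bind fun i => .leaf (c.upper i))
      ((rowTree b' (F₂ x)).bind fun i => .leaf (c.lower i)) := fun x => by
    rw [Cut.tree, BTree.bind, rowTree_bind, rowTree_bind, rowTree_bind, rowTree_bind]
    exact congrArg₂ BTree.node (congrArg _ (funext (e₁ x))) (congrArg _ (funext (e₂ x)))
  have ht' : BTree.node ((rowTree a BTree.leaf).bind fun i => .leaf (c.upper i))
      ((rowTree b BTree.leaf).bind fun i => .leaf (c.lower i)) = c.tree := by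
    rw [Cut.tree, rowTree_bind, rowTree_bind]
    rfl
  refine ⟨fun x => restrict_obj e₁ x, fun x => restrict_obj e₂ x, fun x _ _ => restrict_map e₁ x,
    fun x _ _ => restrict_map e₂ x, fun x y => restrict_arr hF h₁ e₁ x y,
    fun x y => restrict_arr hF h₂ e₂ x y, fun x X => ?_, fun x X => ?_⟩
  · have h3 := (hF.toForest_isCanonical x X).comp
      (((c'.hom_isCanonical (forestObj (F x) X)).bind).congr (rowTree_bind _ _ _) (ht x))
    have h4 := (IsCan.bind (X := X) (F := fun i => .leaf (c.upper i))
      (h₁.toForest_isCanonical x (X.restrict c.upper))).tensor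
      (IsCan.bind (X := X) (F := fun i => .leaf (c.lower i))
        (h₂.toForest_isCanonical x (X.restrict c.lower)))
    exact h3.heq ((c.hom_isCanonical X).comp (h4.congr ht' rfl))
  · have h3 := (((c'.inv_isCanonical (forestObj (F x) X)).bind).congr (ht x)
      (rowTree_bind _ _ _)).comp (hF.ofForest_isCanonical x X)
    have h4 := (IsCan.bind (X := X) (F := fun i => .leaf (c.upper i))
      (h₁.ofForest_isCanonical x (X.restrict c.upper))).tensor
      (IsCan.bind (X := X) (F := fun i => .leaf (c.lower i))
        (h₂.ofForest_isCanonical x (X.restrict c.lower)))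
    exact h3.heq ((h4.congr rfl ht').comp (c.inv_isCanonical X))

end Covers

end Compatible

/-! ### Block operations on products -/

section BlockProd

variable {V : Type} {a b p p' : ℕ}

theorem covers_leaf : Covers fun _ : V => (BTree.leaf : Forest p p) :=
  ⟨fun k => [k], fun _ _ => rfl, rfl⟩

theorem eval_leaf_singleton (x : V) (Φ : Cochain R C p) :
    (forestReal R C fun _ : V => (BTree.leaf : Forest p p)).eval [x] Φ = Φ := by
  have h : ∀ {T : C} {X Y : Row R C p} (γ : Rect X Y) (Ψ : Fam Y T),
      (forestReal R C fun _ : V => (BTree.leaf : Forest p p)).lat x [] γ Ψ =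
        toForest BTree.leaf X ≫ Ψ X γ := fun {T X Y} γ => by
    induction γ with
    | nil => exact fun Ψ => rfl
    | cons γ f ih => exact fun Ψ => ih _
  have h1 : ∀ X : Row R C p, toForest BTree.leaf X = 𝟙 X.tensor := fun X =>
    (covers_leaf.toForest_isCanonical x X).unique (.id (rowTensor_eq X p .leaf))
  have h2 : ∀ X : Row R C p, ofForest BTree.leaf X = 𝟙 X.tensor := fun X =>
    (covers_leaf.ofForest_isCanonical x X).unique (.id (rowTensor_eq X p .leaf))
  funext X Y γ
  refine (h γ _).trans ((congrArg₂ (fun e e' => e ≫ Φ X Y γ ≫ e') (h1 X) (h2 Y)).trans ?_)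
  exact (id_comp _).trans (comp_id _)

theorem eval_leaf_eq_zero {Φ : Cochain R C p} (h : RedCochain Φ) (x y : V) (Q : List V) :
    (forestReal R C fun _ : V => (BTree.leaf : Forest p p)).eval (x :: y :: Q) Φ = 0 := by
  have h1 := Realization.eval_pull (fun _ : V => ())
    (forestReal R C fun _ : Unit => (BTree.leaf : Forest p p)) (x :: y :: Q) Φ
  exact h1.trans (covers_leaf.lawful.eval_eq_zero_of_repeat h (by simp))

theorem signedSum_eval_leaf {Φ : Cochain R C p} (h : RedCochain Φ) {M : Type*}
    [AddCommGroup M] [Module R M] (φ : Cochain R C p →ₗ[R] M) (N : ℕ) :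
    (signedSum (admissiblePaths N) fun S => φ
      ((forestReal R C fun _ : BTree ℕ => (BTree.leaf : Forest p p)).eval S Φ)) =
      if N = 0 then φ Φ else 0 := by
  split_ifs with hN
  · subst hN
    rw [admissiblePaths, signedSum_cons, signedSum_nil, add_zero, one_smul, eval_leaf_singleton]
  · refine (signedSum_congr fun x hx => ?_).trans (signedSum_zero (admissiblePaths N))
    obtain ⟨P, hP, hl⟩ := exists_of_mem_paths hx
    rw [hP]
    cases P with
    | nil => exact absurd hl.symm hN
    | cons y Q => rw [eval_leaf_eq_zero h, map_zero]

theorem blockF_map {q q' i j n : ℕ} (h : p' + i = p) (hj : j ≤ p')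
    {e : Fin (p + 1) → Fin (q + 1)} (he : ∀ x, (e x).1 = n + x.1) {k : Fin (p' + 1)}
    {k' : Fin (q' + 1)} (hk : k'.1 = n + k.1) (t : BTree ℕ) :
    blockF q q' i (n + j) (t.retract i) k' = (blockF p p' i j (t.retract i) k).map e := by
  have h1 := k.2
  have h2 := he (Fin.last p)
  have h3 := (e (Fin.last p)).2
  rw [Fin.val_last] at h2
  have h4 : ∀ m ≤ p, Fin.ofNat (q + 1) (n + m) = e (Fin.ofNat (p + 1) m) := fun m hm =>
    Fin.ext (by rw [val_ofNat (by omega), he, val_ofNat hm])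
  rcases lt_trichotomy k.1 j with h5 | h5 | h5
  · rw [blockF_lt _ (by omega), blockF_lt _ h5, hk, h4 _ (by omega)]
    rfl
  · rw [blockF_eq _ (by omega), blockF_eq _ h5, BTree.map, BTree.map, BTree.map, BTree.bind_bind]
    refine BTree.bind_congr fun m hm => ?_
    rw [BTree.leaves_retract, List.mem_range] at hm
    rw [add_assoc, h4 _ (by omega)]
    rfl
  · rw [blockF_gt _ (by omega), blockF_gt _ h5, hk, add_assoc, h4 _ (by omega)]
    rfl

theorem blockF_lt' {i j : ℕ} (t : BTree ℕ) {k : Fin (p' + 1)} (h : k.1 < j) {m : Fin (p + 1)}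
    (hm : m.1 = k.1) : blockF p p' i j t k = .leaf m := by
  rw [blockF_lt _ h]
  exact congrArg BTree.leaf (Fin.ext (by rw [val_ofNat (by omega), hm]))

theorem blockF_gt' {i j : ℕ} (t : BTree ℕ) {k : Fin (p' + 1)} (h : j < k.1) {m : Fin (p + 1)}
    (hm : m.1 = k.1 + i) : blockF p p' i j t k = .leaf m := by
  rw [blockF_gt _ h]
  exact congrArg BTree.leaf (Fin.ext (by rw [val_ofNat (by omega), hm]))

variable {i j : ℕ} {s : ℤ}

theorem blockOp_prod_first (h : p' + i = p) (hj : j ≤ p') (Φ : Cochain R C p') :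
    blockOp (p + 1) (p' + 1) i (j + 1) ((Cut.first p').prod s (unit R C 0) Φ) =
      (Cut.first p).prod s (unit R C 0) (blockOp p p' i j Φ) := by
  have h1 := (covers_blockF (p := p + 1) (p' := p' + 1) (i := i) (j := j + 1) (by omega)
    (by omega)).isProd (R := R) (C := C) (covers_leaf (p := 0)) (covers_blockF h hj)
    (c := Cut.first p) (c' := Cut.first p')
    (fun t k => blockF_lt' _ (by rw [Cut.upper_val]; omega) (by rw [Cut.upper_val, Cut.upper_val]))
    (fun t k => add_comm j 1 ▸ blockF_map h hj (fun x => (Fin.val_succ x).trans (add_comm _ _))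
      ((Fin.val_succ k).trans (add_comm _ _)) t)
  rw [blockOp_apply, blockOp_apply, signedSum_hom]
  refine congrArg _ (funext fun S => ?_)
  exact h1.eval_prod_left covers_leaf.lawful (covers_blockF h hj).lawful covers_leaf.frm_bck s Φ S

theorem blockOp_prod_last (h : p' + i = p) (hj : j ≤ p') {Φ : Cochain R C p'} (hΦ : HgCochain s Φ) :
    blockOp (p + 1) (p' + 1) i j ((Cut.last p').prod 0 Φ (unit R C 0)) =
      (Cut.last p).prod 0 (blockOp p p' i j Φ) (unit R C 0) := by
  have h1 := (covers_blockF (p := p + 1) (p' := p' + 1) (i := i) (j := j) (by omega)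
    (by omega)).isProd (R := R) (C := C) (covers_blockF h hj) (covers_leaf (p := 0))
    (c := Cut.last p) (c' := Cut.last p')
    (fun t k => (congrArg (blockF (p + 1) (p' + 1) i · _ _) (zero_add j).symm).trans
      (blockF_map h hj (fun x => (Cut.upper_val _ x).trans (zero_add _).symm)
        ((Cut.upper_val _ k).trans (zero_add _).symm) t))
    (fun t k => blockF_gt' _ (by rw [Cut.lower_val]; omega)
      (by rw [Cut.lower_val, Cut.lower_val]; omega))
  have h2 := signedSum_hom (((Cut.last p).prod 0).flip (unit R C 0))
    (admissiblePaths (i - 1)) fun S => (blockReal R C p p' i j).eval S Φ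
  refine Eq.trans ?_ h2.symm
  refine (blockOp_apply ..).trans (congrArg (signedSum _) (funext fun S => ?_))
  exact h1.eval_prod_right (covers_blockF h hj).lawful covers_leaf.lawful covers_leaf.frm_bck hΦ S

theorem blockOp_zero_prod_first (h : i + p' + 1 = p) {Φ : Cochain R C p'}
    (hΦ : RedCochain Φ) : blockOp p (p' + 1) i 0 ((Cut.first p').prod s (unit R C 0) Φ) =
      if i - 1 = 0 then (Cut.ofEq h).prod s (unit R C i) Φ else 0 := by
  have h1 := (covers_blockF (p := p) (p' := p' + 1) (i := i) (j := 0) (by omega)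
    (by omega)).isProd (R := R) (C := C) (covers_blockF (p' := 0) (i := i) (zero_add i) le_rfl)
    (covers_leaf (p := p')) (c := Cut.ofEq h) (c' := Cut.first p')
    (fun t k => blockF_map (n := 0) (zero_add i) le_rfl
      (fun x => (Cut.upper_val _ x).trans (zero_add _).symm)
      ((Cut.upper_val _ k).trans (zero_add _).symm) t)
    (fun t k => blockF_gt' _ (by rw [Cut.lower_val]; omega)
      (by rw [Cut.lower_val, Cut.lower_val]; omega))
  refine Eq.trans ?_ (signedSum_eval_leaf hΦ ((Cut.ofEq h).prod s (unit R C i)) (i - 1))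
  refine (blockOp_apply ..).trans (congrArg (signedSum _) (funext fun S => ?_))
  exact h1.eval_prod_left (covers_blockF (zero_add i) le_rfl).lawful covers_leaf.lawful
    (covers_blockF (zero_add i) le_rfl).frm_bck s Φ S

theorem blockOp_last_prod_last (h : p' + i + 1 = p) {Φ : Cochain R C p'}
    (hΦ : RedCochain Φ) (hΦ' : HgCochain s Φ) :
    blockOp p (p' + 1) i (p' + 1) ((Cut.last p').prod 0 Φ (unit R C 0)) =
      if i - 1 = 0 then (Cut.ofEq h).prod 0 Φ (unit R C i) else 0 := by
  have h1 := (covers_blockF (p := p) (p' := p' + 1) (i := i) (j := p' + 1) (by omega)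
    (by omega)).isProd (R := R) (C := C) (covers_leaf (p := p'))
    (covers_blockF (p' := 0) (i := i) (zero_add i) le_rfl) (c := Cut.ofEq h) (c' := Cut.last p')
    (fun t k => blockF_lt' _ (by rw [Cut.upper_val]; omega) (by rw [Cut.upper_val, Cut.upper_val]))
    (fun t k => blockF_map (n := p' + 1) (zero_add i) le_rfl (fun x => Cut.lower_val _ x)
      (by rw [Cut.lower_val]) t)
  refine Eq.trans ?_ (signedSum_eval_leaf hΦ (((Cut.ofEq h).prod 0).flip (unit R C i)) (i - 1))
  refine (blockOp_apply ..).trans (congrArg (signedSum _) (funext fun S => ?_))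
  exact h1.eval_prod_right covers_leaf.lawful (covers_blockF (zero_add i) le_rfl).lawful
    (covers_blockF (zero_add i) le_rfl).frm_bck hΦ' S

end BlockProd

/-! ### Associativity of the products -/

section Assoc

theorem assoc_heq {A₁ A₂ A₃ A₁' A₂' A₃' B₁ B₂ B₃ B₁' B₂' B₃' D E : C} (a₁ : A₁ = A₁')
    (a₂ : A₂ = A₂') (a₃ : A₃ = A₃') (b₁ : B₁ = B₁') (b₂ : B₂ = B₂') (b₃ : B₃ = B₃')
    {f₁ : A₁ ⟶ B₁} {f₂ : A₂ ⟶ B₂} {f₃ : A₃ ⟶ B₃} {f₁' : A₁' ⟶ B₁'} {f₂' : A₂' ⟶ B₂'}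
    {f₃' : A₃' ⟶ B₃'} (h₁ : HEq f₁ f₁') (h₂ : HEq f₂ f₂') (h₃ : HEq f₃ f₃')
    {u : D ⟶ tensorObj R (tensorObj R A₁ A₂) A₃} {u' : D ⟶ tensorObj R A₁' (tensorObj R A₂' A₃')}
    (hu : HEq (u ≫ (αC A₁ A₂ A₃).hom) u')
    {v : tensorObj R (tensorObj R B₁ B₂) B₃ ⟶ E} {v' : tensorObj R B₁' (tensorObj R B₂' B₃') ⟶ E}
    (hv : HEq ((αC B₁ B₂ B₃).inv ≫ v) v') :
    u ≫ tHom (tHom f₁ f₂) f₃ ≫ v = u' ≫ tHom f₁' (tHom f₂' f₃') ≫ v' := by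
  subst a₁ a₂ a₃ b₁ b₂ b₃ h₁ h₂ h₃ hu hv
  rw [← assoc (tHom f₁ _), tensorHom_assoc_inv, assoc, assoc, Iso.hom_inv_id_assoc]

variable {p q : ℕ} {X Y : Row R C p}

theorem resPath_heq {a : ℕ} {e e' : Fin (a + 1) → Fin (p + 1)} (h : e = e')
    (Φ : Cochain R C a) (γ : Rect X Y) :
    HEq (Φ _ _ (resPath e γ)) (Φ _ _ (resPath e' γ)) := by
  subst h
  rfl

theorem resPath_resPath {a m : ℕ} (e : Fin (a + 1) → Fin (m + 1))
    (e' : Fin (m + 1) → Fin (p + 1)) (γ : Rect X Y) :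
    resPath e (resPath e' γ) = resPath (fun i => e' (e i)) γ := by
  induction γ with
  | nil => rfl
  | cons γ f ih => exact congrArg (fun γ => γ.cons (resCol (fun i => e' (e i)) f)) ih

namespace Cut

variable {a b d m n : ℕ}

theorem prod_apply (c : Cut a b p) (s : ℤ) (Φ₁ : Cochain R C a) (Φ₂ : Cochain R C b)
    (γ : Rect X Y) : c.prod s Φ₁ Φ₂ X Y γ =
      (c.exponent γ + s * totalDeg (resPath c.upper γ)).negOnePow • ((c.iso X).hom ≫
        tHom (Φ₁ _ _ (resPath c.upper γ)) (Φ₂ _ _ (resPath c.lower γ)) ≫ (c.iso Y).inv) :=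
  (units_smul_comp' _ _ _).trans (congrArg _ (assoc _ _ _))

theorem comp_comp_tensorHom {A A' A₁ A₁' B B' D E : C} (u : D ⟶ tensorObj R A B) {i : A ⟶ A'}
    (f : A' ⟶ A₁) (j : A₁ ⟶ A₁') (g : B ⟶ B') (v : tensorObj R A₁' B' ⟶ E)
    (hi : i ∈ gr (R := R) _ _ 0) :
    u ≫ tHom (i ≫ f ≫ j) g ≫ v = (u ≫ tHom i (𝟙 B)) ≫ tHom f g ≫ tHom j (𝟙 B') ≫ v := by
  rw [assoc, ← assoc (tHom f g), tensorHom_comp_right _ _ _ (id_mem _), ← assoc (tHom i _),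
    tensorHom_comp_left _ _ _ hi, id_comp, comp_id]

theorem tensorHom_comp_comp {A A' A₁ A₁' B B' D E : C} (u : D ⟶ tensorObj R B A) (i : A ⟶ A')
    (f : A' ⟶ A₁) {j : A₁ ⟶ A₁'} (g : B ⟶ B') (v : tensorObj R B' A₁' ⟶ E)
    (hj : j ∈ gr (R := R) _ _ 0) :
    u ≫ tHom g (i ≫ f ≫ j) ≫ v = (u ≫ tHom (𝟙 B) i) ≫ tHom g f ≫ tHom (𝟙 B') j ≫ v := by
  rw [assoc, ← assoc (tHom g f), tensorHom_comp_right _ _ _ hj, ← assoc (tHom _ i),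
    tensorHom_comp_left _ _ _ (id_mem _), id_comp, comp_id]

theorem bind_tree (c : Cut a b m) (e : Fin (m + 1) → Fin (p + 1)) :
    c.tree.bind (fun i => .leaf (e i)) = .node (rowTree a fun i => .leaf (e (c.upper i)))
      (rowTree b fun i => .leaf (e (c.lower i))) :=
  congrArg₂ BTree.node (rowTree_bind _ _ _) (rowTree_bind _ _ _)

theorem restrict_hom (c : Cut a b m) (e : Fin (m + 1) → Fin (p + 1)) (X : Row R C p) :
    IsCan R X (rowTree m fun i => .leaf (e i)) (.node
      (rowTree a fun i => .leaf (e (c.upper i))) (rowTree b fun i => .leaf (e (c.lower i))))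
      (c.iso (X.restrict e)).hom :=
  (IsCan.bind (X := X) (F := fun i => .leaf (e i)) (c.hom_isCanonical (X.restrict e))).congr
    (rowTree_bind _ _ _) (c.bind_tree e)

theorem restrict_inv (c : Cut a b m) (e : Fin (m + 1) → Fin (p + 1)) (X : Row R C p) :
    IsCan R X (.node (rowTree a fun i => .leaf (e (c.upper i)))
      (rowTree b fun i => .leaf (e (c.lower i)))) (rowTree m fun i => .leaf (e i))
      (c.iso (X.restrict e)).inv := (c.restrict_hom e X).inv

theorem prod_assoc (c : Cut a b m) (c' : Cut m d p) (k : Cut b d n) (k' : Cut a n p) (s s' : ℤ)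
    (Φ₁ : Cochain R C a) (Φ₂ : Cochain R C b) (Φ₃ : Cochain R C d) :
    c'.prod s' (c.prod s Φ₁ Φ₂) Φ₃ = k'.prod (s + s') Φ₁ (k.prod s' Φ₂ Φ₃) := by
  have e₁ : (fun i => c'.upper (c.upper i)) = k'.upper := funext fun i =>
    Fin.ext (by simp only [upper_val])
  have e₂ : (fun i => c'.upper (c.lower i)) = fun i => k'.lower (k.upper i) := funext fun i =>
    Fin.ext (by simp only [upper_val, lower_val])
  have e₃ : c'.lower = fun i => k'.lower (k.lower i) := funext fun i =>
    Fin.ext (by simp only [lower_val, ← c.card]; omega)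
  have t₁ : ∀ {X Y : Row R C p} (γ : Rect X Y), totalDeg (resPath c.upper (resPath c'.upper γ)) =
        totalDeg (resPath k'.upper γ) := fun γ =>
    (congrArg totalDeg (resPath_resPath _ _ γ)).trans
      (congrArg (fun e => totalDeg (resPath e γ)) e₁)
  have t₂ : ∀ {X Y : Row R C p} (γ : Rect X Y), totalDeg (resPath c.lower (resPath c'.upper γ)) =
        totalDeg (resPath k.upper (resPath k'.lower γ)) := fun γ =>
    (congrArg totalDeg (resPath_resPath _ _ γ)).trans
      ((congrArg (fun e => totalDeg (resPath e γ)) e₂).trans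
        (congrArg totalDeg (resPath_resPath _ _ γ)).symm)
  have hexp : ∀ {X Y : Row R C p} (γ : Rect X Y), c'.exponent γ + c.exponent (resPath c'.upper γ) =
        k'.exponent γ + k.exponent (resPath k'.lower γ) := fun {X Y} γ => by
    induction γ with
    | nil => rfl
    | cons γ f ih =>
      have h1 := c.totalDeg_eq (resPath c'.upper γ)
      have h2 := k.columnDeg_eq (resCol k'.lower f)
      have h3 : columnDeg (resCol c.lower (resCol c'.upper f)) =
        columnDeg (resCol k.upper (resCol k'.lower f)) :=
          congrArg (fun e => columnDeg (resCol e f)) e₂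
      have h4 : columnDeg (resCol c'.lower f) = columnDeg (resCol k.lower (resCol k'.lower f)) :=
          congrArg (fun e => columnDeg (resCol e f)) e₃
      rw [t₁, t₂] at h1
      simp only [exponent, resPath]
      rw [t₁, h1, h2, h3, h4]
      linear_combination ih
  have ht : ∀ e : Fin (b + 1) → Fin (p + 1), (fun i => c'.upper (c.lower i)) = e →
      BTree.node (rowTree a fun i => .leaf (c'.upper (c.upper i)))
        (.node (rowTree b fun i => .leaf (c'.upper (c.lower i)))
          (rowTree d fun i => .leaf (c'.lower i))) =
      .node (rowTree a fun i => .leaf (k'.upper i)) (.node (rowTree b fun i => .leaf (e i))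
        (rowTree d fun i => .leaf (k'.lower (k.lower i)))) := by
    rintro e rfl
    rw [← e₁, e₃]
  funext X Y γ
  rw [prod_apply, prod_apply, prod_apply, prod_apply]
  rw [tensorHom_signs, map_usmul, units_smul_comp', comp_units_smul', units_smul_comp',
    comp_units_smul', ← mul_smul, ← mul_smul, ← negOnePow_add, ← negOnePow_add]
  refine congrArg₂ (fun (n : ℤ) x => n.negOnePow • x) ?_ ?_
  · have h1 := c.totalDeg_eq (resPath c'.upper γ)
    rw [t₁, t₂] at h1
    rw [t₁, h1]
    linear_combination hexp γ
  · refine ((comp_comp_tensorHom _ _ _ _ _ (c.hom_isCanonical _).mem).trans ?_).trans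
      (tensorHom_comp_comp _ _ _ _ _ (k.inv_isCanonical _).mem).symm
    have q₁ : ∀ X : Row R C p, ((X.restrict c'.upper).restrict c.upper).tensor =
      (X.restrict k'.upper).tensor := fun X => congrArg (fun e => (X.restrict e).tensor) e₁
    have q₂ : ∀ X : Row R C p, ((X.restrict c'.upper).restrict c.lower).tensor =
      ((X.restrict k'.lower).restrict k.upper).tensor := fun X =>
        congrArg (fun e => (X.restrict e).tensor) e₂
    have q₃ : ∀ X : Row R C p, (X.restrict c'.lower).tensor =
      ((X.restrict k'.lower).restrict k.lower).tensor := fun X =>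
        congrArg (fun e => (X.restrict e).tensor) e₃
    have w : ∀ {b : ℕ} (e : Fin (b + 1) → Fin (p + 1)) (X : Row R C p), (X.restrict e).tensor =
      treeObj R X (rowTree b fun i => .leaf (e i)) := fun e X => rowTensor_eq (R := R) X _ fun i => .leaf (e i)
    refine assoc_heq (q₁ X) (q₂ X) (q₃ X) (q₁ Y) (q₂ Y) (q₃ Y) ?_ ?_ ?_ ?_ ?_
    · rw [resPath_resPath]
      exact resPath_heq e₁ Φ₁ γ
    · rw [resPath_resPath, resPath_resPath]
      exact resPath_heq e₂ Φ₂ γ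
    · rw [resPath_resPath]
      exact resPath_heq e₃ Φ₃ γ
    · exact ((((c'.hom_isCanonical X).comp ((c.restrict_hom c'.upper X).tensor
        (.id (w _ X)))).comp (.assoc (w (fun i => c'.upper (c.upper i)) X)
          (w (fun i => c'.upper (c.lower i)) X) (w _ X))).congr rfl (ht _ e₂)).heq
        ((k'.hom_isCanonical X).comp (IsCan.tensor (.id (w _ X)) (k.restrict_hom k'.lower X)))
    · exact (((IsCan.inv (.assoc (w (fun i => c'.upper (c.upper i)) Y)
          (w (fun i => c'.upper (c.lower i)) Y) (w _ Y))).comp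
            (((c.restrict_inv c'.upper Y).tensor (.id (w _ Y))).comp (c'.inv_isCanonical Y))).congr
              (ht _ e₂) rfl).heq
        ((IsCan.tensor (.id (w _ Y)) (k.restrict_inv k'.lower Y)).comp (k'.inv_isCanonical Y))

theorem prod_unit (c : Cut a b p) : c.prod 0 (unit R C a) (unit R C b) = unit R C p := by
  have h : ∀ {X Y : Row R C p} (γ : Rect X Y), compTensor γ ≫ (c.iso Y).hom =
      (c.exponent γ).negOnePow • ((c.iso X).hom ≫ tHom
        (compTensor (resPath c.upper γ)) (compTensor (resPath c.lower γ))) :=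
    fun {X Y} γ => by
    induction γ with
    | nil =>
      refine (id_comp _).trans (Eq.symm ?_)
      refine (congrArg (_ • _ ≫ ·) (tensorHom_id _ _)).trans ?_
      rw [comp_id]
      exact one_smul _ _
    | cons γ f ih =>
      refine (assoc _ _ _).trans ?_
      rw [c.hom_natural, ← assoc, ih, units_smul_comp', assoc,
        tensorHom_comp _ _ (compTensor_mem _) (columnTensor_mem _),
        comp_units_smul', ← mul_smul, ← negOnePow_add]
      rfl
  funext X Y γ
  rw [prod_apply, zero_mul, add_zero]
  refine (congrArg (_ • ·) (assoc _ _ _).symm).trans ((units_smul_comp' _ _ _).symm.trans ?_)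
  exact (congrArg (· ≫ _) (h γ).symm).trans (by rw [assoc, Iso.hom_inv_id, comp_id]; rfl)

theorem prod_first_first (h : 1 + p + 1 = p + 2) (s : ℤ) (Φ : Cochain R C p) :
    (first (p + 1)).prod s (unit R C 0) ((first p).prod s (unit R C 0) Φ) =
      (ofEq h).prod s (unit R C 1) Φ := by
  rw [← prod_unit (first 0), prod_assoc (first 0) (ofEq h) (first p) (first (p + 1)), zero_add]

theorem prod_last_last (h : p + 1 + 1 = p + 2) (Φ : Cochain R C p) :
    (last (p + 1)).prod 0 ((last p).prod 0 Φ (unit R C 0)) (unit R C 0) =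
      (ofEq h).prod 0 Φ (unit R C 1) := by
  have h1 := prod_assoc (last p) (last (p + 1)) (last 0) (ofEq h) 0 0 Φ (unit R C 0) (unit R C 0)
  rw [prod_unit] at h1
  exact h1

theorem prod_first_last (s : ℤ) (Φ : Cochain R C p) :
    (first (p + 1)).prod s (unit R C 0) ((last p).prod 0 Φ (unit R C 0)) =
      (last (p + 1)).prod 0 ((first p).prod s (unit R C 0) Φ) (unit R C 0) := by
  rw [prod_assoc (first p) (last (p + 1)) (last p) (first (p + 1)), add_zero]

end Cut

theorem columnDeg_zero {X Y : Row R C 0} (f : X ⟶ Y) : columnDeg f = (f 0).deg :=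
  Fin.sum_univ_one _

theorem rowComp_deg_eq {e : Fin 1 → Fin (p + 1)} (γ : Rect X Y) :
    totalDeg (resPath (a := 0) e γ) = (rowComp (e 0) γ).deg := by
  induction γ with
  | nil => rfl
  | cons γ f ih => exact add_congr ih (columnDeg_zero _)

theorem compTensor_eq_rowComp {e : Fin 1 → Fin (p + 1)} (γ : Rect X Y) :
    compTensor (resPath (a := 0) e γ) = (rowComp (e 0) γ).hom := by
  induction γ with
  | nil => rfl
  | cons γ f ih => exact congrArg (· ≫ (f (e 0)).hom) ih

theorem totalDeg_eq_sum (γ : Rect X Y) : totalDeg γ = ∑ i, (rowComp i γ).deg := by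
  induction γ with
  | nil => exact sum_const_zero.symm
  | cons γ f ih => exact (congrArg (· + _) ih).trans sum_add_distrib.symm

theorem rowComp_deg {a : ℕ} {e : Fin (a + 1) → Fin (p + 1)} (i : Fin (a + 1))
    (γ : Rect X Y) : (rowComp i (resPath e γ)).deg = (rowComp (e i) γ).deg := by
  induction γ with
  | nil => rfl
  | cons γ f ih => exact congrArg (· + (f (e i)).deg) ih

theorem first_iso (X : Row R C (p + 1)) : (splitFirst R p X).toIso = (Cut.first p).iso X :=
  Iso.ext ((splitFirst_isCanonical p BTree.leaf fun _ => rfl).unique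
    ((Cut.first p).hom_isCanonical X))

theorem last_iso (X : Row R C (p + 1)) : (Cut.last p).iso X = Iso.refl _ :=
  Iso.ext (((Cut.last p).hom_isCanonical X).unique (.id (rowTensor_eq X (p + 1) .leaf)))

theorem dropFirstRow_eq {X Y : Row R C (p + 1)} (γ : Rect X Y) :
    dropFirstRow γ = resPath Fin.succ γ := by
  induction γ with
  | nil => rfl
  | cons γ f ih => exact congrArg (fun γ => γ.cons (resCol Fin.succ f)) ih

theorem dropLastRow_eq {X Y : Row R C (p + 1)} (γ : Rect X Y) :
    dropLastRow γ = resPath Fin.castSucc γ := by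
  induction γ with
  | nil => rfl
  | cons γ f ih => exact congrArg (fun γ => γ.cons (resCol Fin.castSucc f)) ih

theorem firstRowExponent_eq {X Y : Row R C (p + 1)} (γ : Rect X Y) :
    firstRowExponent γ = (Cut.first p).exponent γ := by
  induction γ with
  | nil => rfl
  | cons γ f ih =>
    refine add_congr ih ((mul_comm _ _).trans (congrArg (_ * ·) ?_))
    exact (rowComp_deg_eq (e := (Cut.first p).upper) γ).symm

theorem lastRowExponent_eq {X Y : Row R C (p + 1)} (γ : Rect X Y) :
    lastRowExponent γ = (Cut.last p).exponent γ := by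
  induction γ with
  | nil => rfl
  | cons γ f ih =>
    refine add_congr ih (congrArg₂ (· * ·) (columnDeg_zero (resCol (Cut.last p).lower f)).symm ?_)
    rw [totalDeg_eq_sum]
    exact sum_congr rfl fun i _ => (rowComp_deg (e := (Cut.last p).upper) i γ).symm

theorem davydovYetterOuter_succ (n : ℤ) (Φ : TotalCochain R C) {X Y : Row R C (p + 1)}
    (γ : Rect X Y) : davydovYetterOuter n Φ (p + 1) X Y γ = (-1 : ℤˣ) ^ (p + γ.length) •
        ((Cut.first p).prod (n - p - γ.length) (unit R C 0) (Φ p) X Y γ +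
          (-1 : ℤˣ) ^ (p + 2) • (Cut.last p).prod 0 (Φ p) (unit R C 0) X Y γ) := by
  have h1 : tensorFirst (rowComp 0 γ).hom (Φ p _ _ (dropFirstRow γ)) =
      ((Cut.first p).iso X).hom ≫ tHom (unit R C 0 _ _ (resPath (Cut.first p).upper γ))
        (Φ p _ _ (resPath (Cut.first p).lower γ)) ≫ ((Cut.first p).iso Y).inv := by
    rw [dropFirstRow_eq]
    exact congrArg₂ (fun e e' => Iso.hom e ≫ tHom (rowComp 0 γ).hom
      (Φ p _ _ (resPath Fin.succ γ)) ≫ Iso.inv e') (first_iso X) (first_iso Y) |>.trans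
      (congrArg (fun g => _ ≫ tHom g _ ≫ _)
        (compTensor_eq_rowComp (e := (Cut.first p).upper) γ).symm)
  have h2 : tensorLast (Φ p _ _ (dropLastRow γ)) (rowComp (Fin.last (p + 1)) γ).hom =
      ((Cut.last p).iso X).hom ≫ tHom (Φ p _ _ (resPath (Cut.last p).upper γ))
        (unit R C 0 _ _ (resPath (Cut.last p).lower γ)) ≫ ((Cut.last p).iso Y).inv := by
    rw [dropLastRow_eq, last_iso, last_iso]
    refine Eq.trans ?_ ((id_comp _).trans (comp_id _)).symm
    exact congrArg (tHom (Φ p _ _ (resPath Fin.castSucc γ)))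
      (compTensor_eq_rowComp (e := (Cut.last p).lower) γ).symm
  refine congrArg (_ • ·) (add_congr ?_ ?_)
  · rw [Cut.prod_apply, firstRowExponent_eq, h1, rowComp_deg_eq]
    refine congrArg (fun m : ℤ => m.negOnePow • _) (add_comm _ _)
  · rw [Cut.prod_apply, lastRowExponent_eq, mul_smul, zero_mul, add_zero, h2]

end Assoc

/-! ### Cochains of a fixed bidegree -/

section Bidegree

variable {p : ℕ} {T : C}

theorem act_eq_zero_of_length {q : ℤ} {Y Z : Row R C p} {Ψ : Fam Z T}
    (h : ∀ X (γ : Rect X Z), (γ.length : ℤ) ≠ q → Ψ X γ = 0) (f : Y ⟶ Z)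
    {X : Row R C p} (γ : Rect X Y) (hγ : (γ.length : ℤ) ≠ q) : act f Ψ X γ = 0 := by
  cases γ with
  | nil => rw [act_nil, h Z .nil hγ, Limits.comp_zero]
  | cons γ e => rw [act_cons, h X (γ.cons (colComp e f)) hγ, smul_zero]

theorem bar_eq_zero_of_length {q : ℤ} {X Z : Row R C p} {Ψ : Fam Z T}
    (h : ∀ X (γ : Rect X Z), (γ.length : ℤ) ≠ q → Ψ X γ = 0)
    (γ : Rect X Z) (hγ : (γ.length : ℤ) ≠ q + 1) : bar Ψ X γ = 0 := by
  induction γ generalizing q with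
  | nil => rfl
  | cons γ f ih =>
    rw [Quiver.Path.length_cons, Nat.cast_succ] at hγ
    rw [bar_cons, act_eq_zero_of_length h f γ (by omega), ih (q := q - 1) (Ψ := push f Ψ)
      (fun X γ hγ => h X _ (by rw [Quiver.Path.length_cons]; omega)) (by omega), neg_zero, sub_zero]

theorem diffSum_eq_zero_of_length {q : ℤ} {X Z : Row R C p} {Ψ : Fam Z T}
    (h : ∀ X (γ : Rect X Z), (γ.length : ℤ) ≠ q → Ψ X γ = 0)
    (γ : Rect X Z) (hγ : (γ.length : ℤ) ≠ q) : diffSum Ψ X γ = 0 := by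
  induction γ generalizing q with
  | nil => rfl
  | cons γ f ih =>
    have h1 : (fun f' => Ψ X (γ.cons f')) = fun _ => 0 := funext fun f' => h X _ hγ
    rw [Quiver.Path.length_cons, Nat.cast_succ] at hγ
    rw [diffSum_cons, h1, ih (q := q - 1) (Ψ := push f Ψ)
      (fun X γ hγ => h X _ (by rw [Quiver.Path.length_cons]; omega)) (by omega), smul_zero,
      add_zero]
    simp [colD]

/-- `Φ` is an element of `(C^{pq})^r`, extended by zero to the rectangles of other sizes. -/
structure Bihom (q r : ℤ) (Φ : Cochain R C p) : Prop where
  ml : MlCochain Φ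
  hg : HgCochain r Φ
  red : RedCochain Φ
  conc : ∀ X Y (γ : Rect X Y), (γ.length : ℤ) ≠ q → Φ X Y γ = 0

namespace Bihom

variable {q r : ℤ} {Φ Ψ : Cochain R C p}

theorem zero : Bihom q r (0 : Cochain R C p) := ⟨.zero, .zero, .zero, fun _ _ _ _ => rfl⟩

theorem add (h : Bihom q r Φ) (h' : Bihom q r Ψ) : Bihom q r (Φ + Ψ) :=
  ⟨h.ml.add h'.ml, h.hg.add h'.hg, h.red.add h'.red, fun X Y γ hγ =>
    (add_congr (h.conc X Y γ hγ) (h'.conc X Y γ hγ)).trans (add_zero _)⟩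

theorem units_smul (s : ℤˣ) (h : Bihom q r Φ) : Bihom q r (s • Φ) :=
  ⟨h.ml.units_smul s, h.hg.units_smul s, h.red.units_smul s, fun X Y γ hγ =>
    (congrArg (s • ·) (h.conc X Y γ hγ)).trans (smul_zero _)⟩

theorem sum {ι : Type*} (s : Finset ι) {Φ : ι → Cochain R C p}
    (h : ∀ i ∈ s, Bihom q r (Φ i)) : Bihom q r (∑ i ∈ s, Φ i) :=
  Finset.sum_induction _ (Bihom q r) (fun _ _ => add) zero h

theorem eq_zero_of_neg (h : Bihom q r Φ) (hq : q < 0) : Φ = 0 := by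
  funext X Y γ
  exact h.conc X Y γ (by omega)

protected theorem hoch (h : Bihom q r Φ) : Bihom (q + 1) r (hoch r Φ) :=
  ⟨hoch_mlCochain h.ml, hoch_hgCochain h.hg, hoch_redCochain h.red, fun X Y γ hγ => by
    refine (add_congr ?_ (bar_eq_zero_of_length (fun X => h.conc X Y) γ hγ)).trans (add_zero _)
    cases γ with
    | nil => rfl
    | cons γ f =>
      rw [Quiver.Path.length_cons, Nat.cast_succ] at hγ
      rw [outer_cons, h.conc _ _ γ (by omega), Limits.zero_comp, smul_zero]⟩

theorem intern_eq_zero_of_length (s : ℤ)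
    (h : ∀ X Y (γ : Rect X Y), (γ.length : ℤ) ≠ q → Φ X Y γ = 0) {X Y : Row R C p}
    (γ : Rect X Y) (hγ : (γ.length : ℤ) ≠ q) : intern s Φ X Y γ = 0 := by
  change dC _ _ (Φ X Y γ) - s.negOnePow • diffSum (fam Y Φ) X γ = 0
  rw [h X Y γ hγ, diffSum_eq_zero_of_length (Ψ := fam Y Φ) (fun X => h X Y) γ hγ, map_zero,
    smul_zero, sub_zero]

protected theorem intern (h : Bihom q r Φ) : Bihom q (r + 1) (intern r Φ) :=
  ⟨intern_mlCochain h.ml, intern_hgCochain h.hg, intern_redCochain h.red h.ml,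
    fun _ _ => intern_eq_zero_of_length r h.conc⟩

variable {p' : ℕ}

protected theorem blockOp {Φ : Cochain R C p'} (h : Bihom q r Φ) {i j : ℕ} (hi : 1 ≤ i)
    (hp : p' + i = p) (hj : j ≤ p') : Bihom (q + 1 - i) r (blockOp p p' i j Φ) :=
  ⟨blockOp_mlCochain hp hj h.ml, blockOp_hgCochain hp hj h.hg, blockOp_redCochain hp hj h.red,
    fun X Y γ hγ => by
      rcases lt_or_ge q 0 with hq | hq
      · rw [h.eq_zero_of_neg hq, map_zero]
        rfl
      · lift q to ℕ using hq
        exact blockOp_eq_zero_of_length (q := q) hi (fun X Y γ hγ => h.conc X Y γ (by omega)) γ (by omega)⟩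

variable {a b : ℕ}

theorem prod_unit_left (c : Cut a p b) (h : Bihom q r Φ) : Bihom q r (c.prod r (unit R C a) Φ) := by
  refine ⟨c.prod_mlCochain unit_mlCochain h.ml r, ?_, c.prod_redCochain (.inr h.red) r,
    fun X Y => c.prod_eq_zero_of_length (.inr h.conc) r⟩
  have h1 := c.prod_hgCochain unit_hgCochain h.hg
  rwa [zero_add] at h1

theorem prod_unit_right (c : Cut p a b) (h : Bihom q r Φ) :
    Bihom q r (c.prod 0 Φ (unit R C a)) := by
  refine ⟨c.prod_mlCochain h.ml unit_mlCochain 0, ?_, c.prod_redCochain (.inl h.red) 0,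
    fun X Y => c.prod_eq_zero_of_length (.inl h.conc) 0⟩
  have h1 := c.prod_hgCochain h.hg unit_hgCochain
  rwa [add_zero] at h1

end Bihom

end Bidegree

/-! ### The components of the differential -/

section Differential

variable {p : ℕ}

/-- A cochain with a fixed number of rows, extended by zero. -/
def emb (p : ℕ) : Cochain R C p →ₗ[R] TotalCochain R C := LinearMap.single R (Cochain R C) p

theorem emb_same (φ : Cochain R C p) : emb p φ p = φ := Pi.single_eq_same _ _

theorem emb_ne {P : ℕ} (h : P ≠ p) (φ : Cochain R C p) : emb p φ P = 0 := Pi.single_eq_of_ne h _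

theorem eq_emb {F : TotalCochain R C} {φ : Cochain R C p} (h0 : ∀ P, P ≠ p → F P = 0)
    (h1 : F p = φ) : F = emb p φ := by
  funext P
  by_cases h : P = p
  · subst h
    rw [h1, emb_same]
  · rw [h0 P h, emb_ne h]

theorem emb_congr (F : ∀ P, Cochain R C P) {P P' : ℕ} (h : P = P') :
    emb P (F P) = emb P' (F P') := by rw [h]

/-- The internal differential on `(C^{pq})^r`, with the sign of the total complex. -/
def internTotal (q r : ℤ) (φ : Cochain R C p) : Cochain R C p :=
  (p + q).negOnePow • intern r φ

/-- Tensor cochains of internal degree `r` with the composite of a new first row. -/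
noncomputable def addFirst (r : ℤ) : Cochain R C p →ₗ[R] Cochain R C (p + 1) :=
  (Cut.first p).prod r (unit R C 0)

/-- Tensor cochains with the composite of a new last row. -/
noncomputable def addLast : Cochain R C p →ₗ[R] Cochain R C (p + 1) :=
  ((Cut.last p).prod 0).flip (unit R C 0)

/-- The outer terms of the Davydov–Yetter differential on `(C^{pq})^r`. -/
noncomputable def outerTotal (q r : ℤ) (φ : Cochain R C p) : Cochain R C (p + 1) :=
  (p + q).negOnePow • (addFirst r φ + (p : ℤ).negOnePow • addLast φ)

/-- The exponent of the sign of the `j`-th term of `d_i` on `C^{pq}`. -/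
def blockExp (p i j : ℕ) (q : ℤ) : ℤ := i * (j + p + i) + (q + 1 - i) + (i - 1).choose 2

/-- The sum of the block operators which occur in `d_i` on `C^{pq}`. -/
noncomputable def blockTotal (P i : ℕ) (q : ℤ) (φ : Cochain R C p) : Cochain R C P :=
  ∑ j ∈ Finset.range (p + 1), (blockExp p i j q).negOnePow • blockOp P p i j φ

variable {q r : ℤ} {φ : Cochain R C p}

theorem Bihom.internTotal (h : Bihom q r φ) : Bihom q (r + 1) (internTotal q r φ) :=
  h.intern.units_smul _

theorem Bihom.outerTotal (h : Bihom q r φ) : Bihom q r (outerTotal q r φ) :=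
  ((h.prod_unit_left _).add ((h.prod_unit_right _).units_smul _)).units_smul _

theorem Bihom.blockTotal (h : Bihom q r φ) {P i : ℕ} (hi : 1 ≤ i) (hP : p + i = P) :
    Bihom (q + 1 - i) r (blockTotal P i q φ) :=
  .sum _ fun _ hj => (h.blockOp hi hP (by have := mem_range.1 hj; omega)).units_smul _

theorem neg_one_pow_eq_negOnePow (m : ℕ) : (-1 : ℤˣ) ^ m = (m : ℤ).negOnePow := by
  rw [Int.negOnePow_def, zpow_natCast]

theorem differential_apply (n : ℤ) (Φ : TotalCochain R C) {P : ℕ} {X Y : Row R C P}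
    (γ : Rect X Y) : differential R C n Φ P X Y γ =
      (-1 : ℤˣ) ^ (P + γ.length) • internalDiff n Φ P X Y γ + hochschildDiff n Φ P X Y γ +
        davydovYetterOuter n Φ P X Y γ + ∑ i ∈ Finset.range P, blockSum (i + 1) Φ P X Y γ := by
  change _ + ∑ i ∈ Finset.range (P + 1), diffComponent n i Φ P X Y γ = _
  rw [sum_range_succ', add_comm (∑ i ∈ _, _), ← add_assoc, add_assoc _ (davydovYetterOuter ..)]
  refine add_congr rfl ?_
  cases P with
  | zero => exact (add_zero _).symm
  | succ P =>
    rw [sum_range_succ', sum_range_succ']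
    have h1 : ∀ i ∈ Finset.range P, diffComponent n (i + 1 + 1) Φ (P + 1) X Y γ =
        blockSum (i + 1 + 1) Φ (P + 1) X Y γ := fun i hi =>
      if_pos (by have := mem_range.1 hi; omega)
    have h2 : diffComponent n (0 + 1) Φ (P + 1) X Y γ = davydovYetterOuter n Φ (P + 1) X Y γ +
        blockSum (0 + 1) Φ (P + 1) X Y γ := 
      congrArg (davydovYetterOuter n Φ (P + 1) X Y γ + ·) (if_pos (by omega))
    rw [sum_congr rfl h1, h2, add_left_comm]

theorem blockSum_emb (h : Bihom q r φ) {i P : ℕ} (hi : i < P) {X Y : Row R C P}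
    (γ : Rect X Y) : blockSum (i + 1) (emb p φ) P X Y γ =
      emb (p + (i + 1)) (blockTotal (p + (i + 1)) (i + 1) q φ) P X Y γ := by
  rw [blockSum_eq _ (by omega)]
  by_cases hP : P = p + (i + 1)
  · subst hP
    rw [emb_same, blockTotal, Finset.sum_apply, Finset.sum_apply, Finset.sum_apply,
      Nat.add_sub_cancel_right]
    refine sum_congr rfl fun j hj => ?_
    have hj := mem_range.1 hj
    rw [emb_same]
    change _ = (blockExp p (i + 1) j q).negOnePow • blockOp (p + (i + 1)) p (i + 1) j φ X Y γ
    by_cases hγ : (γ.length : ℤ) = q + 1 - (i + 1 : ℕ)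
    · rw [neg_one_pow_eq_negOnePow, blockExp, ← hγ]
      refine congrArg (fun n : ℤ => n.negOnePow • _) ?_
      push_cast
      ring
    · rw [(h.blockOp (by omega) rfl (by omega)).conc X Y γ hγ, smul_zero, smul_zero]
  · rw [emb_ne hP]
    refine sum_eq_zero fun j _ => ?_
    rw [emb_ne (by omega), map_zero]
    exact smul_zero _

theorem differential_emb {n : ℤ} (hn : n = p + q + r) (h : Bihom q r φ) {N : ℕ} (hN : q < N) :
    differential R C n (emb p φ) = emb p (internTotal q r φ + hoch r φ) +
      emb (p + 1) (outerTotal q r φ) + ∑ i ∈ Finset.range N,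
        emb (p + (i + 1)) (blockTotal (p + (i + 1)) (i + 1) q φ) := by
  have h1 : (fun P X Y (γ : Rect X Y) =>
      (-1 : ℤˣ) ^ (P + γ.length) • internalDiff n (emb p φ) P X Y γ) =
        emb p (internTotal q r φ) := by
    refine eq_emb (fun P hP => ?_) ?_ <;> funext X Y γ
    · change (-1 : ℤˣ) ^ (P + γ.length) • intern (n - P - γ.length) (emb p φ P) X Y γ = 0
      rw [emb_ne hP, map_zero]
      exact smul_zero _
    · change (-1 : ℤˣ) ^ (p + γ.length) • intern (n - p - γ.length) (emb p φ p) X Y γ =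
        (p + q).negOnePow • intern r φ X Y γ
      rw [emb_same]
      by_cases hγ : (γ.length : ℤ) = q
      · rw [neg_one_pow_eq_negOnePow, Nat.cast_add, hγ, hn]
        refine congrArg (fun s : ℤ => (p + q).negOnePow • intern s φ X Y γ) ?_
        ring
      · rw [Bihom.intern_eq_zero_of_length _ h.conc γ hγ,
          Bihom.intern_eq_zero_of_length _ h.conc γ hγ, smul_zero, smul_zero]
  have h2 : hochschildDiff n (emb p φ) = emb p (hoch r φ) := by
    refine eq_emb (fun P hP => ?_) ?_ <;> funext X Y γ
    · rw [hochschildDiff_eq n _ P γ (r := 0) fun γ' _ => .inr (by rw [emb_ne hP]; rfl), emb_ne hP,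
        map_zero]
    · rw [hochschildDiff_eq n _ p γ (r := r) fun {Z} γ' _ => ?_, emb_same]
      rw [emb_same]
      by_cases hγ : (γ'.length : ℤ) = q
      · exact .inl (by omega)
      · exact .inr (h.conc X Z γ' hγ)
  have h3 : davydovYetterOuter n (emb p φ) = emb (p + 1) (outerTotal q r φ) := by
    refine eq_emb (fun P hP => ?_) ?_ <;> funext X Y γ
    · cases P with
      | zero => rfl
      | succ P =>
        rw [davydovYetterOuter_succ, emb_ne (by omega), map_zero, map_zero, LinearMap.zero_apply]
        exact (congrArg _ ((zero_add _).trans (smul_zero _))).trans (smul_zero _)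
    · rw [davydovYetterOuter_succ, emb_same]
      by_cases hγ : (γ.length : ℤ) = q
      · change _ = (p + q).negOnePow • ((Cut.first p).prod r (unit R C 0) φ X Y γ +
          (p : ℤ).negOnePow • (Cut.last p).prod 0 φ (unit R C 0) X Y γ)
        rw [neg_one_pow_eq_negOnePow, neg_one_pow_eq_negOnePow, Nat.cast_add, hγ,
          show n - p - q = r by omega, negOnePow_congr (a := ((p + 2 : ℕ) : ℤ)) (b := p) ⟨1, by
            push_cast
            ring⟩]
      · rw [h.outerTotal.conc X Y γ hγ, (h.prod_unit_right _).conc X Y γ hγ,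
          Cut.prod_eq_zero_of_length _ (.inr h.conc) _ γ hγ, smul_zero, add_zero, smul_zero]
  funext P X Y γ
  rw [differential_apply]
  refine add_congr (add_congr ((add_congr (congrFun (congrFun (congrFun
    (congrFun h1 P) X) Y) γ) (congrFun (congrFun (congrFun (congrFun h2 P) X) Y) γ)).trans ?_)
      (congrFun (congrFun (congrFun (congrFun h3 P) X) Y) γ)) ?_
  · rw [map_add]
    rfl
  rw [Finset.sum_apply, Finset.sum_apply, Finset.sum_apply, Finset.sum_apply]
  have h4 : ∀ i, ¬ i < P → emb (p + (i + 1)) (blockTotal (p + (i + 1)) (i + 1) q φ) P X Y γ = 0 :=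
    fun i hi => by
      rw [emb_ne (by omega)]
      rfl
  have h5 : ∀ i, ¬ i < N → emb (p + (i + 1)) (blockTotal (p + (i + 1)) (i + 1) q φ) P X Y γ = 0 :=
    fun i hi => by
      rw [(h.blockTotal (by omega) rfl).eq_zero_of_neg (by omega), map_zero]
      rfl
  rw [sum_congr rfl fun i hi => blockSum_emb h (mem_range.1 hi) γ]
  exact Finset.sum_congr_of_eq_on_inter (fun i _ hi => h5 i fun hi' => hi (mem_range.2 hi'))
    (fun i _ hi => h4 i fun hi' => hi (mem_range.2 hi')) fun _ _ _ => rfl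

end Differential

/-! ### The square of the differential -/

section Square

variable {p : ℕ} {q r : ℤ} {φ : Cochain R C p}

theorem internTotal_internTotal (h : Bihom q r φ) :
    internTotal q (r + 1) (internTotal q r φ) = 0 := by
  rw [internTotal, internTotal, map_usmul, intern_intern h.ml, smul_zero, smul_zero]

theorem internTotal_hoch (h : Bihom q r φ) :
    internTotal (q + 1) r (hoch r φ) + hoch (r + 1) (internTotal q r φ) = 0 := by
  rw [internTotal, internTotal, map_usmul, intern_hoch h.ml h.hg, ← add_assoc,
    negOnePow_succ, Units.neg_smul, neg_add_cancel]

theorem internTotal_outerTotal (h : Bihom q r φ) :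
    internTotal q r (outerTotal q r φ) + outerTotal q (r + 1) (internTotal q r φ) = 0 := by
  have h1 : intern r (addFirst r φ) = addFirst (r + 1) (intern r φ) :=
    (Cut.first p).intern_prod_unit_left r φ
  have h2 : intern r (addLast φ) = addLast (intern r φ) :=
    (Cut.last p).intern_prod_unit_right h.hg
  rw [internTotal, outerTotal, outerTotal, internTotal, map_usmul, map_usmul,
    map_usmul, map_add, map_usmul, h1, h2, smul_comm _ (p + q).negOnePow (addLast _),
    ← smul_add, Nat.cast_succ, add_right_comm, negOnePow_succ, Units.neg_smul, neg_add_cancel]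

theorem hoch_outerTotal (h : Bihom q r φ) :
    hoch r (outerTotal q r φ) + outerTotal (q + 1) r (hoch r φ) = 0 := by
  have h1 : hoch r (addFirst r φ) = addFirst r (hoch r φ) :=
    (Cut.first p).hoch_prod_unit_left h.hg
  have h2 : hoch r (addLast φ) = addLast (hoch r φ) := (Cut.last p).hoch_prod_unit_right h.hg
  rw [outerTotal, outerTotal, map_usmul, map_add, map_usmul, h1, h2, ← add_assoc,
    negOnePow_succ, Units.neg_smul, add_neg_cancel]

theorem internTotal_blockTotal (h : Bihom q r φ) {P i : ℕ} (hP : p + i = P) :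
    internTotal (q + 1 - i) r (blockTotal P i q φ) + blockTotal P i q (internTotal q r φ) = 0 := by
  have h1 : ∀ j ∈ Finset.range (p + 1), (blockExp p i j q).negOnePow •
      blockOp P p i j ((p + q).negOnePow • intern r φ) =
        (p + q).negOnePow • (blockExp p i j q).negOnePow • intern r (blockOp P p i j φ) :=
    fun j hj => by
      rw [map_usmul, blockOp_intern hP (by have := mem_range.1 hj; omega) h.ml,
        smul_comm]
  rw [internTotal, internTotal, blockTotal, blockTotal, sum_congr rfl h1, ← smul_sum,
    map_sum, sum_congr rfl fun j _ => map_usmul _ _ _,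
    show (P : ℤ) + (q + 1 - i) = p + q + 1 by omega, negOnePow_succ, Units.neg_smul,
    neg_add_cancel]

theorem outerTotal_outerTotal (q r : ℤ) (φ : Cochain R C p) :
    outerTotal q r (outerTotal q r φ) = addLast (addLast φ) - addFirst r (addFirst r φ) := by
  have h1 : addFirst r (addLast φ) = addLast (addFirst r φ) := Cut.prod_first_last r φ
  simp only [outerTotal, map_add, map_usmul, h1, Nat.cast_succ, add_right_comm _ (1 : ℤ) q,
    negOnePow_succ]
  generalize (p + q).negOnePow = s
  generalize (p : ℤ).negOnePow = t
  rw [smul_comm (-t), ← smul_add, ← mul_smul, neg_mul, Int.units_mul_self, Units.neg_smul,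
    one_smul, smul_add, ← mul_smul, neg_mul, Int.units_mul_self, Units.neg_smul, Units.neg_smul,
    one_smul]
  abel

theorem outerTotal_blockTotal (h : Bihom q r φ) {P i : ℕ} (hP : p + i = P) :
    outerTotal (q + 1 - i) r (blockTotal P i q φ) + blockTotal (P + 1) i q (outerTotal q r φ) =
      (p + q).negOnePow • ((blockExp (p + 1) i 0 q).negOnePow •
          blockOp (P + 1) (p + 1) i 0 (addFirst r φ) +
        (p : ℤ).negOnePow • (blockExp (p + 1) i (p + 1) q).negOnePow •
          blockOp (P + 1) (p + 1) i (p + 1) (addLast φ)) := by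
  have h1 : blockTotal (P + 1) i q (addFirst r φ) = addFirst r (blockTotal P i q φ) +
      (blockExp (p + 1) i 0 q).negOnePow • blockOp (P + 1) (p + 1) i 0 (addFirst r φ) := by
    rw [blockTotal, sum_range_succ', blockTotal, map_sum]
    refine add_congr (sum_congr rfl fun j hj => ?_) rfl
    have h2 : blockOp (P + 1) (p + 1) i (j + 1) (addFirst r φ) = addFirst r (blockOp P p i j φ) :=
      blockOp_prod_first hP (by have := mem_range.1 hj; omega) φ
    rw [h2, map_usmul]
    refine congrArg (· • _) (negOnePow_congr ⟨i, ?_⟩)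
    simp only [blockExp, Nat.cast_succ]
    ring
  have h2 : blockTotal (P + 1) i q (addLast φ) = (i : ℤ).negOnePow • addLast (blockTotal P i q φ) +
      (blockExp (p + 1) i (p + 1) q).negOnePow • blockOp (P + 1) (p + 1) i (p + 1) (addLast φ) := by
    rw [blockTotal, sum_range_succ, blockTotal, map_sum, smul_sum]
    refine add_congr (sum_congr rfl fun j hj => ?_) rfl
    have h2 : blockOp (P + 1) (p + 1) i j (addLast φ) = addLast (blockOp P p i j φ) :=
      blockOp_prod_last hP (by have := mem_range.1 hj; omega) h.hg
    rw [h2, map_usmul, ← mul_smul, ← negOnePow_add]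
    refine congrArg (fun n : ℤ => n.negOnePow • _) ?_
    simp only [blockExp, Nat.cast_succ]
    ring
  have h3 : blockTotal (P + 1) i q (outerTotal q r φ) = (p + q).negOnePow •
      (blockTotal (P + 1) i q (addFirst r φ) +
        (p : ℤ).negOnePow • blockTotal (P + 1) i q (addLast φ)) := by
    simp only [blockTotal, outerTotal, map_usmul, map_add, smul_sum, smul_add,
      sum_add_distrib, smul_comm (Int.negOnePow (blockExp _ _ _ _))]
  rw [h3, h1, h2, outerTotal, show (P : ℤ) + (q + 1 - i) = p + q + 1 by omega, negOnePow_succ,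
    ← hP, Nat.cast_add, negOnePow_add p i, mul_smul, Units.neg_smul]
  simp only [smul_add]
  abel

theorem outerTotal_blockTotal_one (h : Bihom q r φ) :
    outerTotal q r (blockTotal (p + 1) 1 q φ) + blockTotal (p + 1 + 1) 1 q (outerTotal q r φ) =
      addFirst r (addFirst r φ) - addLast (addLast φ) := by
  have h0 := outerTotal_blockTotal h (i := 1) rfl
  have h1 : blockOp (p + 1 + 1) (p + 1) 1 0 (addFirst r φ) = addFirst r (addFirst r φ) :=
    (blockOp_zero_prod_first (by omega) h.red).trans (Cut.prod_first_first (by omega) r φ).symm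
  have h2 : blockOp (p + 1 + 1) (p + 1) 1 (p + 1) (addLast φ) = addLast (addLast φ) :=
    (blockOp_last_prod_last (by omega) h.red h.hg).trans (Cut.prod_last_last (by omega) φ).symm
  rw [h1, h2, Nat.cast_one, add_sub_cancel_right] at h0
  rw [h0, smul_add, ← mul_smul, ← mul_smul, ← mul_smul, ← negOnePow_add, ← negOnePow_add,
    ← negOnePow_add, sub_eq_add_neg]
  refine add_congr ?_ ?_
  · rw [Int.negOnePow_even _ ⟨p + q + 1, ?_⟩, one_smul]
    simp [blockExp]
    ring
  · rw [Int.negOnePow_odd _ ⟨2 * p + q + 1, ?_⟩, Units.neg_smul, one_smul]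
    simp [blockExp]
    ring

theorem outerTotal_blockTotal_add_two (h : Bihom q r φ) (N : ℕ) {P : ℕ} (hP : p + (N + 2) = P) :
    outerTotal (q + 1 - (N + 2 : ℕ)) r (blockTotal P (N + 2) q φ) +
      blockTotal (P + 1) (N + 2) q (outerTotal q r φ) = 0 := by
  rw [outerTotal_blockTotal h hP]
  have h1 : blockOp (P + 1) (p + 1) (N + 2) 0 (addFirst r φ) = 0 :=
    (blockOp_zero_prod_first (by omega) h.red).trans (if_neg (by omega))
  have h2 : blockOp (P + 1) (p + 1) (N + 2) (p + 1) (addLast φ) = 0 :=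
    (blockOp_last_prod_last (by omega) h.red h.hg).trans (if_neg (by omega))
  rw [h1, h2, smul_zero, smul_zero, smul_zero, add_zero, smul_zero]

theorem hoch_blockTotal_one (h : Bihom q r φ) :
    hoch r (blockTotal (p + 1) 1 q φ) + blockTotal (p + 1) 1 (q + 1) (hoch r φ) = 0 := by
  rw [blockTotal, blockTotal, map_sum, ← sum_add_distrib]
  refine sum_eq_zero fun j hj => ?_
  rw [map_usmul, blockOp_hoch_one rfl (by have := mem_range.1 hj; omega) h.ml,
    show blockExp p 1 j (q + 1) = blockExp p 1 j q + 1 by rw [blockExp, blockExp]; ring,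
    negOnePow_succ, Units.neg_smul, add_neg_cancel]

end Square

section BlockSquare

theorem choose_two_add (k : ℕ) : ∀ l : ℕ,
    (k + l + 1).choose 2 = k.choose 2 + l.choose 2 + k * l + k + l
  | 0 => by rw [Nat.choose_succ_succ' _ 1, Nat.choose_one_right]; simp; ring
  | l + 1 => by
    rw [← add_assoc, Nat.choose_succ_succ' _ 1, choose_two_add k l, Nat.choose_succ_succ' l 1,
      Nat.choose_one_right, Nat.choose_one_right]
    ring

open Finset in
theorem sum_rectangle {M : Type*} [AddCommGroup M] (p k : ℕ) (f : ℕ → ℕ → M) :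
    ∑ i ∈ range (p + (k + 1) + 1), ∑ j ∈ range (p + 1), f i j =
      ∑ j ∈ range (p + 1), ∑ a ∈ range (k + 2), f (j + a) j +
        (∑ j ∈ range p, ∑ c ∈ range (p - j), f j (j + 1 + c) +
          ∑ j ∈ range p, ∑ c ∈ range (p - j), f (j + 1 + c + (k + 1)) j) := by
  have h1 : ∀ j ∈ range (p + 1), ∑ i ∈ range (p + (k + 1) + 1), f i j =
      ∑ a ∈ range (k + 2), f (j + a) j + (∑ a ∈ range j, f a j +
        ∑ c ∈ range (p - j), f (j + 1 + c + (k + 1)) j) := fun j hj => by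
    have hj := mem_range.1 hj
    rw [show p + (k + 1) + 1 = j + (k + 2) + (p - j) by omega, sum_range_add,
      sum_range_add, add_comm (∑ i ∈ range j, _), add_assoc]
    refine add_congr rfl (add_congr rfl (sum_congr rfl fun c _ => ?_))
    rw [show j + (k + 2) + c = j + 1 + c + (k + 1) by omega]
  rw [Finset.sum_comm, sum_congr rfl h1, sum_add_distrib, sum_add_distrib,
    sum_triangle p fun b a => f a b, sum_range_succ (fun j => ∑ c ∈ range (p - j), _) p,
    Nat.sub_self, Finset.sum_range_zero, add_zero]

variable {p : ℕ} {q r : ℤ} {φ : Cochain R C p}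

open Finset in
theorem Bihom.blockOp_hoch (h : Bihom q r φ) {N P j : ℕ} (hP : p + (N + 2) = P) (hj : j ≤ p) :
    blockOp P p (N + 2) j (hoch r φ) = hoch r (blockOp P p (N + 2) j φ) + (q - N).negOnePow •
        ∑ x ∈ antidiagonal N, ∑ a ∈ range (x.1 + 2), faceSign x.2 a •
          blockOp P (p + (x.1 + 1)) (x.2 + 1) (j + a)
            (blockOp (p + (x.1 + 1)) p (x.1 + 1) j φ) := by
  let D (x : ℕ × ℕ) (a : ℕ) : Cochain R C P := faceSign x.2 a •
    blockOp P (p + (x.1 + 1)) (x.2 + 1) (j + a) (blockOp (p + (x.1 + 1)) p (x.1 + 1) j φ)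
  have h1 : Bihom (q - N) r (∑ x ∈ antidiagonal N, ∑ a ∈ range (x.1 + 2), D x a) :=
    .sum _ fun x hx => .sum _ fun a ha => by
      have hx := mem_ad.1 hx
      have ha := mem_range.1 ha
      have h2 := (h.blockOp (i := x.1 + 1) (by omega) rfl hj).blockOp (p := P) (i := x.2 + 1)
        (j := j + a) (by omega) (by omega) (by omega)
      rw [show q + 1 - (x.1 + 1 : ℕ) + 1 - (x.2 + 1 : ℕ) = q - N by omega] at h2
      exact h2.units_smul _
  funext X Y γ
  rw [blockOp_hoch_add_two hP hj h.ml]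
  refine add_congr rfl ?_
  have h2 : ∑ x ∈ antidiagonal N, ∑ a ∈ range (x.1 + 2), D x a X Y γ =
      (∑ x ∈ antidiagonal N, ∑ a ∈ range (x.1 + 2), D x a) X Y γ := by
    simp only [Finset.sum_apply]
  refine (congrArg (_ • ·) h2).trans ?_
  by_cases hγ : (γ.length : ℤ) = q - N
  · rw [neg_one_pow_eq_negOnePow, hγ]
    rfl
  · have h3 := h1.conc X Y γ hγ
    exact (congrArg ((-1 : ℤˣ) ^ γ.length • ·) h3).trans ((smul_zero _).trans
      ((congrArg ((q - N).negOnePow • ·) h3).trans (smul_zero _)).symm)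

theorem blockExp_succ (p k j : ℕ) (q : ℤ) :
    blockExp p (k + 1) j q = (k + 1) * (j + p + k + 1) + (q - k) + k.choose 2 := by
  rw [blockExp, Nat.add_sub_cancel]
  push_cast
  ring

open Finset in
theorem hoch_blockTotal_add_two (h : Bihom q r φ) (N : ℕ) {P : ℕ} (hP : p + (N + 2) = P) :
    hoch r (blockTotal P (N + 2) q φ) + blockTotal P (N + 2) (q + 1) (hoch r φ) +
      ∑ x ∈ antidiagonal N, blockTotal P (x.2 + 1) (q + 1 - (x.1 + 1 : ℕ))
        (blockTotal (p + (x.1 + 1)) (x.1 + 1) q φ) = 0 := by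
  let f (k l i j : ℕ) : Cochain R C P := (blockExp (p + (k + 1)) (l + 1) i (q + 1 - (k + 1 : ℕ)) +
    blockExp p (k + 1) j q).negOnePow •
      blockOp P (p + (k + 1)) (l + 1) i (blockOp (p + (k + 1)) p (k + 1) j φ)
  have h1 : ∀ x ∈ antidiagonal N, blockTotal P (x.2 + 1) (q + 1 - (x.1 + 1 : ℕ))
      (blockTotal (p + (x.1 + 1)) (x.1 + 1) q φ) =
        ∑ j ∈ range (p + 1), ∑ a ∈ range (x.1 + 2), f x.1 x.2 (j + a) j +
          (∑ j ∈ range p, ∑ c ∈ range (p - j), f x.1 x.2 j (j + 1 + c) +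
            ∑ j ∈ range p, ∑ c ∈ range (p - j), f x.1 x.2 (j + 1 + c + (x.1 + 1)) j) :=
    fun x _ => by
      rw [← sum_rectangle p x.1 (f x.1 x.2)]
      refine sum_congr rfl fun i _ => ?_
      rw [blockTotal, map_sum, smul_sum]
      refine sum_congr rfl fun j _ => ?_
      rw [map_usmul, ← mul_smul, ← negOnePow_add]
  have h2 : ∑ x ∈ antidiagonal N, (∑ j ∈ range p, ∑ c ∈ range (p - j), f x.1 x.2 j (j + 1 + c) +
      ∑ j ∈ range p, ∑ c ∈ range (p - j), f x.1 x.2 (j + 1 + c + (x.1 + 1)) j) = 0 := by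
    rw [sum_add_distrib, ← Finset.Nat.sum_antidiagonal_swap (f := fun x => ∑ j ∈ range p,
      ∑ c ∈ range (p - j), f x.1 x.2 (j + 1 + c + (x.1 + 1)) j), ← sum_add_distrib]
    refine sum_eq_zero fun x hx => ?_
    have hx := mem_ad.1 hx
    rw [← sum_add_distrib]
    refine sum_eq_zero fun j hj => ?_
    rw [← sum_add_distrib]
    refine sum_eq_zero fun c hc => ?_
    have hj := mem_range.1 hj
    have hc := mem_range.1 hc
    have h3 : blockOp P (p + (x.1 + 1)) (x.2 + 1) j
        (blockOp (p + (x.1 + 1)) p (x.1 + 1) (j + 1 + c) φ) = (-1 : ℤˣ) ^ (x.1 * x.2) •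
          blockOp P (p + (x.2 + 1)) (x.1 + 1) (j + 1 + c + (x.2 + 1))
            (blockOp (p + (x.2 + 1)) p (x.2 + 1) j φ) := by
      funext X Y γ
      exact blockOp_disjoint (by omega) rfl (by omega) rfl (by omega) (by omega) φ γ
    simp only [f, Prod.fst_swap, Prod.snd_swap]
    have h4 : (blockExp (p + (x.1 + 1)) (x.2 + 1) j (q + 1 - (x.1 + 1 : ℕ)) +
        blockExp p (x.1 + 1) (j + 1 + c) q + (x.1 * x.2 : ℕ)).negOnePow =
          -(blockExp (p + (x.2 + 1)) (x.1 + 1) (j + 1 + c + (x.2 + 1)) (q + 1 - (x.2 + 1 : ℕ)) +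
            blockExp p (x.2 + 1) j q).negOnePow := by
      rw [← negOnePow_succ]
      refine negOnePow_congr ⟨-x.1 - 1, ?_⟩
      rw [blockExp_succ, blockExp_succ p x.1, blockExp_succ, blockExp_succ p x.2]
      push_cast
      ring
    rw [h3, neg_one_pow_eq_negOnePow, ← mul_smul, ← negOnePow_add, h4, Units.neg_smul,
      neg_add_cancel]
  have h3 : ∀ j ∈ range (p + 1), (blockExp p (N + 2) j q).negOnePow •
      hoch r (blockOp P p (N + 2) j φ) + (blockExp p (N + 2) j (q + 1)).negOnePow •
        blockOp P p (N + 2) j (hoch r φ) +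
          ∑ x ∈ antidiagonal N, ∑ a ∈ range (x.1 + 2), f x.1 x.2 (j + a) j = 0 := fun j hj => by
    rw [h.blockOp_hoch hP (by have := mem_range.1 hj; omega),
      show blockExp p (N + 2) j (q + 1) = blockExp p (N + 2) j q + 1 by rw [blockExp, blockExp]; ring,
      negOnePow_succ, smul_add, Units.neg_smul, Units.neg_smul, add_neg_cancel_left,
      smul_sum, smul_sum, neg_add_eq_zero]
    refine sum_congr rfl fun x hx => ?_
    have hx := mem_ad.1 hx
    rw [smul_sum, smul_sum]
    refine sum_congr rfl fun a _ => ?_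
    rw [faceSign, neg_one_pow_eq_negOnePow, ← mul_smul, ← mul_smul, ← negOnePow_add,
      ← negOnePow_add]
    refine congrArg (· • _) (negOnePow_congr ⟨x.1 * x.2 + x.1 + x.2 + 1, ?_⟩)
    rw [blockExp_succ p (N + 1), blockExp_succ _ x.2, blockExp_succ p x.1, ← hx, choose_two_add]
    push_cast
    ring
  rw [sum_congr rfl h1, sum_add_distrib, h2, add_zero, Finset.sum_comm, blockTotal,
    blockTotal, map_sum, sum_congr rfl fun j _ => map_usmul _ _ _,
    ← sum_add_distrib, ← sum_add_distrib]
  exact sum_eq_zero h3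

end BlockSquare

section Total

variable {p : ℕ} {q r : ℤ} {φ : Cochain R C p}

open Finset in
theorem differential_differential_emb {n : ℤ} (hn : n = p + q + r) (h : Bihom q r φ) :
    differential R C (n + 1) (differential R C n (emb p φ)) = 0 := by
  obtain ⟨N, hN⟩ : ∃ N : ℕ, q + 1 < N := ⟨(q + 2).toNat, by omega⟩
  let B (i : ℕ) : Cochain R C (p + (i + 1)) := blockTotal (p + (i + 1)) (i + 1) q φ
  let D (i j : ℕ) := emb (p + (i + 1) + (j + 1))
    (blockTotal (p + (i + 1) + (j + 1)) (j + 1) (q + 1 - (i + 1 : ℕ)) (B i))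
  have h1 : differential R C (n + 1) (∑ i ∈ range (N + 1), emb (p + (i + 1)) (B i)) =
      ∑ i ∈ range (N + 1), (emb (p + (i + 1)) (internTotal (q + 1 - (i + 1 : ℕ)) r (B i)) +
          emb (p + (i + 1)) (hoch r (B i)) +
          emb (p + (i + 1) + 1) (outerTotal (q + 1 - (i + 1 : ℕ)) r (B i)) +
          ∑ j ∈ range (N - i), D i j) := by
    rw [map_sum]
    refine sum_congr rfl fun i hi => ?_
    have hi := mem_range.1 hi
    rw [← map_add]
    exact differential_emb (by push_cast; omega) (h.blockTotal (by omega) rfl) (by omega)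
  have h2 : ∑ i ∈ range (N + 1),
      emb (p + (i + 1)) (internTotal (q + 1 - (i + 1 : ℕ)) r (B i)) + ∑ i ∈ range (N + 1),
        emb (p + (i + 1)) (blockTotal (p + (i + 1)) (i + 1) q (internTotal q r φ)) = 0 := by
    rw [← sum_add_distrib]
    exact sum_eq_zero fun i _ => by rw [← map_add, internTotal_blockTotal h rfl, map_zero]
  have h3 : ∑ i ∈ range (N + 1), emb (p + (i + 1)) (hoch r (B i)) + ∑ i ∈ range (N + 1),
        emb (p + (i + 1)) (blockTotal (p + (i + 1)) (i + 1) (q + 1) (hoch r φ)) +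
      ∑ i ∈ range (N + 1), ∑ j ∈ range (N - i), D i j = 0 := by
    rw [← sum_add_distrib, sum_range_succ', ← map_add, hoch_blockTotal_one h, map_zero,
      add_zero, sum_range_succ (fun i => ∑ j ∈ range (N - i), _), Nat.sub_self,
      Finset.sum_range_zero, add_zero, ← Finset.sum_range_diag_flip N D, ← sum_add_distrib]
    refine sum_eq_zero fun m _ => ?_
    rw [← Finset.Nat.sum_antidiagonal_eq_sum_range_succ D, ← map_add]
    refine Eq.trans ?_ ((congrArg (emb (p + (m + 1 + 1)))
      (hoch_blockTotal_add_two h m rfl)).trans (map_zero _))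
    rw [map_add _ (_ + _), map_sum]
    refine add_congr rfl (sum_congr rfl fun x hx => ?_)
    have hx := mem_ad.1 hx
    exact emb_congr (fun P => blockTotal P (x.2 + 1) (q + 1 - (x.1 + 1 : ℕ)) (B x.1)) (by omega)
  have h4 : emb (p + 1 + 1) (outerTotal q r (outerTotal q r φ)) + ∑ i ∈ range (N + 1),
      emb (p + (i + 1) + 1) (outerTotal (q + 1 - (i + 1 : ℕ)) r (B i)) +
      ∑ i ∈ range (N + 1), emb (p + 1 + (i + 1))
        (blockTotal (p + 1 + (i + 1)) (i + 1) q (outerTotal q r φ)) = 0 := by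
    have h5 : ∀ i ∈ range (N + 1), emb (p + 1 + (i + 1))
        (blockTotal (p + 1 + (i + 1)) (i + 1) q (outerTotal q r φ)) = emb (p + (i + 1) + 1)
          (blockTotal (p + (i + 1) + 1) (i + 1) q (outerTotal q r φ)) := fun i _ =>
      emb_congr (fun P => blockTotal P (i + 1) q (outerTotal q r φ)) (by omega)
    rw [sum_congr rfl h5, add_assoc, ← sum_add_distrib, sum_range_succ', sum_eq_zero fun i _ => by
        rw [← map_add]
        exact (congrArg _ (outerTotal_blockTotal_add_two h i rfl)).trans (map_zero _), zero_add]
    have h6 : outerTotal (q + 1 - (0 + 1 : ℕ)) r (B 0) +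
        blockTotal (p + 1 + 1) 1 q (outerTotal q r φ) =
          addFirst r (addFirst r φ) - addLast (addLast φ) := by
      rw [show q + 1 - (0 + 1 : ℕ) = q by simp]
      exact outerTotal_blockTotal_one h
    refine (add_congr rfl ((map_add _ _ _).symm.trans (congrArg (emb (p + 1 + 1)) h6))).trans ?_
    rw [outerTotal_outerTotal, ← map_add, sub_add_sub_cancel, sub_self, map_zero]
  have h7 := congrArg (emb p) (internTotal_hoch h)
  have h8 := congrArg (emb (p + 1)) (internTotal_outerTotal h)
  have h9 := congrArg (emb (p + 1)) (hoch_outerTotal h)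
  rw [map_add, map_zero] at h7 h8 h9
  rw [differential_emb hn h (N := N + 1) (by push_cast; omega), map_add, map_add, map_add (emb p),
    map_add, h1, differential_emb (by omega) h.internTotal (N := N + 1) (by push_cast; omega),
    differential_emb (by omega) h.hoch (N := N + 1) (by push_cast; omega),
    differential_emb (by push_cast; omega) h.outerTotal (N := N + 1) (by push_cast; omega),
    internTotal_internTotal h, hoch_hoch]
  simp only [map_add, sum_add_distrib, zero_add, add_zero]
  refine Eq.trans ?_ ((add_congr h7 (add_congr h8 (add_congr h9
    (add_congr h2 (add_congr h3 h4))))).trans (by simp))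
  abel

end Total

section Membership

variable {p : ℕ}

theorem component_mem_cochains {Φ : TotalCochain R C} {r : ℤ} (h1 : MlCochain (Φ p))
    (h2 : HgCochain r (Φ p)) (h3 : RedCochain (Φ p)) (q : ℕ) :
    component R C p q Φ ∈ cochains R C p q r :=
  ⟨fun X _ _ Y α f β i m _ =>
    ⟨fun x y => congrFun (congrFun (((h1 Y).ml β).map_add f i ⟨m, x.1, x.2⟩ ⟨m, y.1, y.2⟩
      ⟨m, (x + y).1, (x + y).2⟩ rfl rfl rfl) X) α,
    fun c x => congrFun (congrFun (((h1 Y).ml β).map_smul f i c ⟨m, x.1, x.2⟩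
      ⟨m, (c • x).1, (c • x).2⟩ rfl rfl) X) α⟩,
    fun X Y γ => h2 Y X γ.1, fun _ _ Y α β _ => (h3 Y).vanish α β⟩

/-- Extend a cochain by zero to the rectangles of other sizes. -/
def extend {q : ℕ} (ψ : RawCochain R C p q) : Cochain R C p := fun X Y γ =>
  if h : γ.length = q then ψ X Y ⟨γ, h⟩ else 0

theorem extend_bihom {q : ℕ} {r : ℤ} {ψ : RawCochain R C p q} (h : ψ ∈ cochains R C p q r) :
    Bihom q r (extend ψ) := by
  obtain ⟨h1, h2, h3⟩ := h
  have h4 : ∀ {X X' Y' Y : Row R C p} (α : Rect X X') (f f' : X' ⟶ Y')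
      (β : Rect Y' Y), ((α.cons f).comp β).length = ((α.cons f').comp β).length :=
    fun α f f' β => by
      rw [Quiver.Path.length_comp, Quiver.Path.length_comp]
      rfl
  refine ⟨fun Y => ⟨fun {Y₁ Y₂} β => ⟨fun f i x y z hx hy hz => ?_, fun f i c x z hx hz => ?_⟩⟩,
    fun Y X γ => ?_, fun Y => ⟨fun {X Z} α β => ?_⟩, fun X Y γ hγ => dif_neg fun h => hγ (by rw [h])⟩
  · obtain ⟨m, z, hz'⟩ := z
    obtain ⟨_, x, hx'⟩ := x
    obtain ⟨_, y, hy'⟩ := y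
    subst hx hy hz
    funext X α
    by_cases h : ((α.cons f).comp β).length = q
    · have h5 : ∀ f', extend ψ X Y ((α.cons f').comp β) = ψ X Y ⟨_, (h4 α f' f β).trans h⟩ :=
        fun f' => dif_pos _
      exact (h5 _).trans (((h1 X Y₁ Y₂ Y α f β i _ fun _ => (h4 ..).trans h).map_add
        ⟨x, hx'⟩ ⟨y, hy'⟩).trans (add_congr (h5 _) (h5 _)).symm)
    · have h5 : ∀ f', extend ψ X Y ((α.cons f').comp β) = 0 := fun f' =>
        dif_neg fun h' => h ((h4 ..).trans h')
      exact (h5 _).trans ((add_congr (h5 _) (h5 _)).trans (add_zero _)).symm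
  · obtain ⟨m, z, hz'⟩ := z
    obtain ⟨_, x, hx'⟩ := x
    subst hx hz
    funext X α
    by_cases h : ((α.cons f).comp β).length = q
    · have h5 : ∀ f', extend ψ X Y ((α.cons f').comp β) = ψ X Y ⟨_, (h4 α f' f β).trans h⟩ :=
        fun f' => dif_pos _
      exact (h5 _).trans (((h1 X Y₁ Y₂ Y α f β i _ fun _ => (h4 ..).trans h).map_smul
        c ⟨x, hx'⟩).trans (congrArg (c • ·) (h5 _)).symm)
    · have h5 : ∀ f', extend ψ X Y ((α.cons f').comp β) = 0 := fun f' =>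
        dif_neg fun h' => h ((h4 ..).trans h')
      exact (h5 _).trans ((congrArg (c • ·) (h5 _)).trans (smul_zero _)).symm
  · change (if h : γ.length = q then ψ X Y ⟨γ, h⟩ else 0) ∈ _
    split_ifs with h
    · exact h2 X Y ⟨γ, h⟩
    · exact Submodule.zero_mem _
  · change (if h : _ = q then ψ X Y ⟨_, h⟩ else 0) = 0
    split_ifs with h
    · exact h3 X Z Y α β h
    · rfl

theorem emb_mem_TC {q r n : ℤ} {φ : Cochain R C p} (hn : n = p + q + r) (h : Bihom q r φ) :
    emb p φ ∈ TC R C n := by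
  have h1 : ∀ P Q : ℕ, (P ≠ p ∨ (Q : ℤ) ≠ q) → component R C P Q (emb p φ) = 0 := fun P Q hPQ => by
    funext X Y γ
    change emb p φ P X Y γ.1 = 0
    by_cases hP : P = p
    · subst hP
      rw [emb_same]
      exact h.conc X Y _ (by rw [γ.2]; exact hPQ.resolve_left (not_not.2 rfl))
    · rw [emb_ne hP]
      rfl
  refine ⟨fun P Q => ?_, (Set.finite_singleton (p, q.toNat)).subset fun x hx => ?_⟩
  · by_cases hPQ : P = p ∧ (Q : ℤ) = q
    · obtain ⟨rfl, rfl⟩ := hPQ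
      obtain rfl : n - P - Q = r := by omega
      exact component_mem_cochains ((emb_same φ).symm ▸ h.ml) ((emb_same φ).symm ▸ h.hg)
        ((emb_same φ).symm ▸ h.red) Q
    · rw [h1 P Q (by tauto)]
      exact Submodule.zero_mem _
  · by_contra hx'
    refine hx (h1 x.1 x.2 ?_)
    by_contra! hc
    exact hx' (Prod.ext hc.1 (by simp only; omega))

theorem eq_sum_emb {n : ℤ} {Φ : TotalCochain R C} (h : Φ ∈ TC R C n) :
    Φ = ∑ x ∈ h.2.toFinset, emb x.1 (extend (component R C x.1 x.2 Φ)) := by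
  funext P X Y γ
  have h1 : ∀ x : ℕ × ℕ, emb x.1 (extend (component R C x.1 x.2 Φ)) P X Y γ =
      if (P, γ.length) = x then Φ P X Y γ else 0 := fun x => by
    obtain ⟨p, q⟩ := x
    by_cases hP : P = p
    · subst hP
      rw [emb_same]
      by_cases hq : γ.length = q
      · exact (dif_pos hq).trans (if_pos (by rw [hq])).symm
      · exact (dif_neg hq).trans (if_neg fun h => hq (congrArg Prod.snd h)).symm
    · rw [emb_ne hP, if_neg fun h => hP (congrArg Prod.fst h)]
      rfl
  simp only [Finset.sum_apply, h1, Finset.sum_ite_eq]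
  split_ifs with h2
  · rfl
  · rw [Set.Finite.mem_toFinset, Set.mem_ofPred_eq, not_not] at h2
    exact congrFun (congrFun (congrFun h2 X) Y) ⟨γ, rfl⟩

theorem differential_emb_mem {q r n : ℤ} {φ : Cochain R C p} (hn : n = p + q + r)
    (h : Bihom q r φ) : differential R C n (emb p φ) ∈ TC R C (n + 1) := by
  rw [differential_emb hn h (N := (q + 1).toNat) (by omega), map_add]
  refine Submodule.add_mem _ (Submodule.add_mem _ (Submodule.add_mem _
    (emb_mem_TC ?_ h.internTotal) (emb_mem_TC ?_ h.hoch)) (emb_mem_TC ?_ h.outerTotal))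
    (Submodule.sum_mem _ fun i _ => emb_mem_TC ?_ (h.blockTotal (Nat.succ_pos i) rfl))
  all_goals push_cast; omega

end Membership

end TensorHochschild

theorem mainTheorem1 {R : Type w} [CommRing R] {C : Type u} [Category.{v} C] [Preadditive C]
    [Linear R C] [TensorHochschild.DGCategory R C] [TensorHochschild.MonoidalDGCategory R C]
    (n : ℤ) :
    (∀ Φ ∈ TensorHochschild.TC R C n,
      TensorHochschild.differential R C n Φ ∈ TensorHochschild.TC R C (n + 1)) ∧
    (∀ Φ ∈ TensorHochschild.TC R C n,
      TensorHochschild.differential R C (n + 1) (TensorHochschild.differential R C n Φ) = 0) := by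
  refine ⟨fun Φ h => ?_, fun Φ h => ?_⟩ <;>
    rw [TensorHochschild.eq_sum_emb h, map_sum]
  · exact Submodule.sum_mem _ fun x _ => TensorHochschild.differential_emb_mem (by ring)
      (TensorHochschild.extend_bihom (h.1 x.1 x.2))
  · rw [map_sum]
    exact Finset.sum_eq_zero fun x _ => TensorHochschild.differential_differential_emb (by ring)
      (TensorHochschild.extend_bihom (h.1 x.1 x.2))
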